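/- Let $p\ge 1$ be odd, let $q\in\mathbb C$ be a primitive $p$-th root of unity, let $q^{1/2}$ be the square root of $q$ with $(q^{1/2})^p=-1$, and let $\sigma\in\{1,-1\}$. Put $[n]=\frac{q^n-q^{-n}}{q-q^{-1}}$, $[n]!=[n][n-1]\cdots[1]$, $[0]!=1$. **The algebra $U_F$.** Let $U_F$ be the unital complex algebra generated by $P_\pm,H,p_\pm,\kappa$ with relations $$[P_+,P_-]=0,\quad [P_\pm,H]=\pm\sigma i P_\pm,\quad p_\pm^p=P_\pm,\quad [p_+,p_-]=0,\quad \kappa p_\pm=q^{\pm1}p_\pm\kappa,\quad \kappa^p=1,\quad [\kappa,H]=0,\quad [p_\pm,H]=\pm\sigma\tfrac ip\,p_\pm .$$ The elements $\phi^{nmkrsl}=p_+^np_-^m\kappa^kP_+^rP_-^sH^l$ ($0\le n,m,k\le p-1$; $r,s,l\ge0$) form a basis of $U_F$. There is a Hopf $*$-algebra structure on $U_F$ in which $P_\pm,H,p_\pm,\kappa$ are self-adjoint and $$\Delta(P_\pm)=P_\pm\otimes1+1\otimes P_\pm,\quad \Delta(H)=H\otimes1+1\otimes H,\quad \Delta(p_\pm)=p_\pm\otimes\kappa+\kappa^{-1}\otimes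 p_\pm,\quad \Delta(\kappa)=\kappa\otimes\kappa,$$ $$\varepsilon(P_\pm)=\varepsilon(H)=\varepsilon(p_\pm)=0,\quad \varepsilon(\kappa^{\pm1})=1,\qquad S(P_\pm)=-P_\pm,\quad S(H)=-H,\quad S(p_\pm)=-q^{\pm1}p_\pm,\quad S(\kappa^{\pm1})=\kappa^{\mp1}.$$ **The algebra $A_F$.** Let $E(1,1)$ be the group of real matrices $\begin{pmatrix}e^\lambda&0&z_+\\0&e^{-\lambda}&z_-\\0&0&1\end{pmatrix}$, with unit element $e$ and global coordinates $(z_+,z_-,\lambda)$, and let $A(E(1,1))$ be the $*$-algebra of its complex-valued infinitely differentiable functions. Let $A(E_q(1,1))$ be the algebra generated by $\eta_\pm,\delta$ with $\eta_-\eta_+=q^2\eta_+\eta_-$, $\eta_\pm\delta=q^2\delta\eta_\pm$, $\eta_\pm^p=0$, $\delta^p=1$. Then $A(E_q(1,1))$ is a $*$-algebra with $\eta_\pm^*=\eta_\pm$, $\delta^*=\delta$. Put $A_F=A(E(1,1))\otimes A(E_q(1,1))$; its completed tensor square consists of the smooth functions on $E(1,1)\times E(1,1)$ with values in $A(E_q(1,1))\otimes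 A(E_q(1,1))$. With respect to this completed tensor product, $A_F$ is a Hopf $*$-algebra with $$\Delta(\eta_\pm)=\eta_\pm\otimes1+\delta^{\pm1}e^{\pm\lambda/p}\otimes\eta_\pm,\quad \Delta(\delta)=\delta\otimes\delta,\quad \Delta(\lambda)=\lambda\otimes1+1\otimes\lambda,$$ $$\Delta(z_\pm)=z_\pm\otimes1+e^{\pm\lambda}\otimes z_\pm+N_\pm,\qquad N_\pm=(-1)^{\frac{p+1}2}\sum_{n=1}^{p-1}\frac{q^{\pm n^2}}{[p-n]!\,[n]!}\,\eta_\pm^{p-n}\delta^{\pm n}e^{\pm\lambda n/p}\otimes\eta_\pm^n,$$ $$\varepsilon(\eta_\pm)=\varepsilon(\lambda)=\varepsilon(z_\pm)=0,\quad\varepsilon(\delta^{\pm1})=1,$$ $$S(\eta_\pm)=-\delta^{\mp1}e^{\mp\lambda/p}\eta_\pm,\quad S(\delta^{\pm1})=\delta^{\mp1},\quad S(\lambda)=-\lambda,\quad S(z_\pm)=-e^{\mp\lambda}z_\pm .$$ On a smooth function $f$ these are $\Delta(f)=f(\Delta(z_+),\Delta(z_-),\Delta(\lambda))=\sum_{j,k<p}\frac1{j!\,k!}\,(\partial_+^j\partial_-^kf)(gh)\,N_+^jN_-^k$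 as a function of $(g,h)$, $\varepsilon(f)=f(e)$ and $S(f)(g)=f(g^{-1})$, where $\partial_\pm=\partial/\partial z_\pm$. With $\zeta(k,\delta)=\frac1p\sum_{n=0}^{p-1}q^{-nk}\delta^n$, the elements $a^{nmktsl}=\eta_+^n\eta_-^m\zeta(k,\delta)z_+^tz_-^s\lambda^l$ ($0\le n,m,k\le p-1$; $t,s,l\ge0$) form a local basis of $A_F$: every element of $A_F$ has a unique formal expansion in them that agrees with it to all orders at $e$. **Duality.** There is a bilinear pairing $\langle\cdot,\cdot\rangle:U_F\times A_F\to\mathbb C$ with $$\langle\phi^{nmktsl},a^{n'm'k't's'l'}\rangle=i^{n+m+t+s+l}(-\sigma)^l\,q^{\frac{n-m}2-nm}\,l!\,t!\,s!\,[n]!\,[m]!\;\delta_{nn'}\delta_{mm'}\delta_{tt'}\delta_{ss'}\delta_{ll'}\delta_{k+n+m,\,k'},$$ where the last Kronecker symbol is read modulo $p$; for general smooth $f$, $\langle\phi^{nmktsl},\eta_+^{n'}\eta_-^{m'}\zeta(k',\delta)f\rangle=i^{n+m+t+s+l}(-\sigma)^lq^{\frac{n-m}2-nm}[n]!\,[m]!\,\delta_{nn'}\delta_{mm'}\delta_{k+n+m,\,k'}\,(\partial_+^t\partial_-^s\partial_\lambda^lf)(e)$.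 It is a pairing of Hopf $*$-algebras: for $\phi,\psi\in U_F$ and $x,y\in A_F$, $$\langle\phi\psi,x\rangle=\langle\phi\otimes\psi,\Delta(x)\rangle,\quad\langle\phi,xy\rangle=\langle\Delta(\phi),x\otimes y\rangle,\quad\langle1,x\rangle=\varepsilon(x),\quad\langle\phi,1\rangle=\varepsilon(\phi),$$ $$\langle S(\phi),x\rangle=\langle\phi,S(x)\rangle,\quad\langle\phi^*,x\rangle=\overline{\langle\phi,S(x)^*\rangle}.$$ It is nondegenerate on $U_F$, and an element of $A_F$ is orthogonal to $U_F$ if and only if its Taylor expansion at $e$ vanishes. -/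

import Mathlib

open scoped TensorProduct ContDiff

noncomputable section

namespace FracSusy

/-! Signs `±` are elements `s : ℤˣ`; `P_±` is `P s` with `s = 1` or `s = -1`. -/

/-- A sign as a complex number. -/
def sgn (s : ℤˣ) : ℂ := ((s : ℤ) : ℂ)

/-- The symmetric `q`-number `[n] = (q^n - q^{-n}) / (q - q^{-1})`. -/
def qNum (q : ℂ) (n : ℕ) : ℂ := (q ^ n - q⁻¹ ^ n) / (q - q⁻¹)

/-- The `q`-factorial `[n]! = [n][n-1]⋯[1]`, with `[0]! = 1`. -/
def qFact (q : ℂ) (n : ℕ) : ℂ := ∏ i ∈ Finset.range n, qNum q (i + 1)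

/-! ### The fractional supersymmetry algebra `U_F` -/

/-- The generators `P_±`, `H`, `p_±`, `κ`. -/
inductive UGen : Type
  | bigP (s : ℤˣ)
  | ham
  | smallP (s : ℤˣ)
  | kap

open UGen in
/-- The defining relations of `U_F`. The sign `σ` is the orientation of `H`:
`[P_±, H] = ±σ i P_±` and `[p_±, H] = ±σ (i/p) p_±`. -/
inductive URel (p : ℕ) (q : ℂ) (σ : ℤˣ) : FreeAlgebra ℂ UGen → FreeAlgebra ℂ UGen → Prop
  | bigP_comm : URel p q σ
      (FreeAlgebra.ι ℂ (bigP 1) * FreeAlgebra.ι ℂ (bigP (-1)))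
      (FreeAlgebra.ι ℂ (bigP (-1)) * FreeAlgebra.ι ℂ (bigP 1))
  | bigP_ham (s : ℤˣ) : URel p q σ
      (FreeAlgebra.ι ℂ (bigP s) * FreeAlgebra.ι ℂ ham
        - FreeAlgebra.ι ℂ ham * FreeAlgebra.ι ℂ (bigP s))
      ((sgn s * sgn σ * Complex.I) • FreeAlgebra.ι ℂ (bigP s))
  | smallP_pow (s : ℤˣ) : URel p q σ
      (FreeAlgebra.ι ℂ (smallP s) ^ p) (FreeAlgebra.ι ℂ (bigP s))
  | smallP_comm : URel p q σ
      (FreeAlgebra.ι ℂ (smallP 1) * FreeAlgebra.ι ℂ (smallP (-1)))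
      (FreeAlgebra.ι ℂ (smallP (-1)) * FreeAlgebra.ι ℂ (smallP 1))
  | kap_smallP (s : ℤˣ) : URel p q σ
      (FreeAlgebra.ι ℂ kap * FreeAlgebra.ι ℂ (smallP s))
      (q ^ (s : ℤ) • (FreeAlgebra.ι ℂ (smallP s) * FreeAlgebra.ι ℂ kap))
  | kap_pow : URel p q σ (FreeAlgebra.ι ℂ kap ^ p) 1
  | kap_ham : URel p q σ
      (FreeAlgebra.ι ℂ kap * FreeAlgebra.ι ℂ ham) (FreeAlgebra.ι ℂ ham * FreeAlgebra.ι ℂ kap)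
  | smallP_ham (s : ℤˣ) : URel p q σ
      (FreeAlgebra.ι ℂ (smallP s) * FreeAlgebra.ι ℂ ham
        - FreeAlgebra.ι ℂ ham * FreeAlgebra.ι ℂ (smallP s))
      ((sgn s * sgn σ * (Complex.I / p)) • FreeAlgebra.ι ℂ (smallP s))

/-- The algebra `U_F`, by generators and relations. -/
abbrev UF (p : ℕ) (q : ℂ) (σ : ℤˣ) : Type := RingQuot (URel p q σ)

namespace UF

variable (p : ℕ) (q : ℂ) (σ : ℤˣ)

def gen (x : UGen) : UF p q σ := RingQuot.mkAlgHom ℂ (URel p q σ) (FreeAlgebra.ι ℂ x)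

/-- `P_±` -/
def P (s : ℤˣ) : UF p q σ := gen p q σ (.bigP s)

/-- `H` -/
def H : UF p q σ := gen p q σ .ham

/-- `p_±` -/
def sp (s : ℤˣ) : UF p q σ := gen p q σ (.smallP s)

/-- Integer powers `κ^k`; exponents are read modulo `p`, since `κ^p = 1`. -/
def kappa (k : ℤ) : UF p q σ := gen p q σ .kap ^ (k % (p : ℤ)).toNat

/-- `φ^{nmkrsl} = p_+^n p_-^m κ^k P_+^r P_-^s H^l` -/
def phi (n m k r s l : ℕ) : UF p q σ :=
  sp p q σ 1 ^ n * sp p q σ (-1) ^ m * kappa p q σ k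
    * P p q σ 1 ^ r * P p q σ (-1) ^ s * H p q σ ^ l

end UF

/-- Compatibility of a coalgebra structure, a linear map `S` and an involution with an algebra
structure: a Hopf `*`-algebra with antipode `S`. -/
structure IsHopfStar (A : Type) [Ring A] [Algebra ℂ A] [StarRing A] [StarModule ℂ A]
    [Coalgebra ℂ A] (S : A →ₗ[ℂ] A) : Prop where
  comul_one : Coalgebra.comul (R := ℂ) (1 : A) = 1
  comul_mul : ∀ x y : A, Coalgebra.comul (R := ℂ) (x * y)
    = Coalgebra.comul (R := ℂ) x * Coalgebra.comul (R := ℂ) y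
  counit_one : Coalgebra.counit (R := ℂ) (1 : A) = 1
  counit_mul : ∀ x y : A, Coalgebra.counit (R := ℂ) (x * y)
    = Coalgebra.counit (R := ℂ) x * Coalgebra.counit (R := ℂ) y
  antipode_left : ∀ x : A, LinearMap.mul' ℂ A (S.rTensor A (Coalgebra.comul (R := ℂ) x))
    = algebraMap ℂ A (Coalgebra.counit (R := ℂ) x)
  antipode_right : ∀ x : A, LinearMap.mul' ℂ A (S.lTensor A (Coalgebra.comul (R := ℂ) x))
    = algebraMap ℂ A (Coalgebra.counit (R := ℂ) x)
  comul_star : ∀ x : A, Coalgebra.comul (R := ℂ) (star x) = star (Coalgebra.comul (R := ℂ) x)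
  counit_star : ∀ x : A, Coalgebra.counit (R := ℂ) (star x) = star (Coalgebra.counit (R := ℂ) x)

/-- The values of the involution, coproduct, counit and antipode of `U_F` on the generators. -/
structure UFFormulas (p : ℕ) (q : ℂ) (σ : ℤˣ) [StarRing (UF p q σ)] [Coalgebra ℂ (UF p q σ)]
    (S : UF p q σ →ₗ[ℂ] UF p q σ) : Prop where
  star_P : ∀ s, star (UF.P p q σ s) = UF.P p q σ s
  star_H : star (UF.H p q σ) = UF.H p q σ
  star_sp : ∀ s, star (UF.sp p q σ s) = UF.sp p q σ s
  star_kappa : star (UF.kappa p q σ 1) = UF.kappa p q σ 1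
  comul_P : ∀ s, Coalgebra.comul (R := ℂ) (UF.P p q σ s)
    = UF.P p q σ s ⊗ₜ[ℂ] 1 + 1 ⊗ₜ[ℂ] UF.P p q σ s
  comul_H : Coalgebra.comul (R := ℂ) (UF.H p q σ)
    = UF.H p q σ ⊗ₜ[ℂ] 1 + 1 ⊗ₜ[ℂ] UF.H p q σ
  comul_sp : ∀ s, Coalgebra.comul (R := ℂ) (UF.sp p q σ s)
    = UF.sp p q σ s ⊗ₜ[ℂ] UF.kappa p q σ 1 + UF.kappa p q σ (-1) ⊗ₜ[ℂ] UF.sp p q σ s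
  comul_kappa : Coalgebra.comul (R := ℂ) (UF.kappa p q σ 1)
    = UF.kappa p q σ 1 ⊗ₜ[ℂ] UF.kappa p q σ 1
  counit_P : ∀ s, Coalgebra.counit (R := ℂ) (UF.P p q σ s) = 0
  counit_H : Coalgebra.counit (R := ℂ) (UF.H p q σ) = 0
  counit_sp : ∀ s, Coalgebra.counit (R := ℂ) (UF.sp p q σ s) = 0
  counit_kappa : ∀ s : ℤˣ, Coalgebra.counit (R := ℂ) (UF.kappa p q σ s) = 1
  antipode_P : ∀ s, S (UF.P p q σ s) = -UF.P p q σ s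
  antipode_H : S (UF.H p q σ) = -UF.H p q σ
  antipode_sp : ∀ s : ℤˣ, S (UF.sp p q σ s) = -(q ^ (s : ℤ) • UF.sp p q σ s)
  antipode_kappa : ∀ s : ℤˣ, S (UF.kappa p q σ s) = UF.kappa p q σ (-(s : ℤ))

/-! ### Smooth functions and the Poincaré group `E(1,1)` -/

/-- The `*`-algebra of complex-valued infinitely differentiable functions on `V`. -/
def smoothSub (V : Type) [NormedAddCommGroup V] [NormedSpace ℝ V] : StarSubalgebra ℂ (V → ℂ) where
  carrier := {f | ContDiff ℝ ∞ f}
  mul_mem' {f g} hf hg := ContDiff.mul (f := f) (g := g) (show ContDiff ℝ ∞ f from hf) hg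
  add_mem' {f g} hf hg := ContDiff.add (f := f) (g := g) (show ContDiff ℝ ∞ f from hf) hg
  algebraMap_mem' c := show ContDiff ℝ ∞ (fun _ : V => c) from contDiff_const
  star_mem' {f} hf := Complex.conjCLE.contDiff.comp (show ContDiff ℝ ∞ f from hf)

abbrev Smooth (V : Type) [NormedAddCommGroup V] [NormedSpace ℝ V] : Type := smoothSub V

section Smooth

variable {V W : Type} [NormedAddCommGroup V] [NormedSpace ℝ V]
  [NormedAddCommGroup W] [NormedSpace ℝ W]

theorem Smooth.contDiff (f : Smooth V) : ContDiff ℝ ∞ f.1 := f.2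

/-- Pull-back of functions along a smooth map. -/
def pullback (φ : V → W) (hφ : ContDiff ℝ ∞ φ) : Smooth W →ₐ[ℂ] Smooth V where
  toFun f := ⟨fun x => f.1 (φ x), (Smooth.contDiff f).comp hφ⟩
  map_one' := rfl
  map_mul' _ _ := rfl
  map_zero' := rfl
  map_add' _ _ := rfl
  commutes' _ := rfl

/-- Derivative in the direction `v`. -/
def dirDeriv (v : V) : Smooth V →ₗ[ℂ] Smooth V where
  toFun f := ⟨fun x => fderiv ℝ f.1 x v,
    ((Smooth.contDiff f).fderiv_right (m := ∞) (by simp)).clm_apply contDiff_const⟩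
  map_add' f g := by
    ext x
    have hf : DifferentiableAt ℝ f.1 x := (Smooth.contDiff f).differentiable (by simp) x
    have hg : DifferentiableAt ℝ g.1 x := (Smooth.contDiff g).differentiable (by simp) x
    change fderiv ℝ (f.1 + g.1) x v = fderiv ℝ f.1 x v + fderiv ℝ g.1 x v
    rw [fderiv_add hf hg]
    rfl
  map_smul' c f := by
    ext x
    have hf : DifferentiableAt ℝ f.1 x := (Smooth.contDiff f).differentiable (by simp) x
    change fderiv ℝ (c • f.1) x v = c • fderiv ℝ f.1 x v
    rw [fderiv_const_smul hf c]
    rfl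

/-- Evaluation at a point. -/
def evalPt (x : V) : Smooth V →ₗ[ℂ] ℂ where
  toFun f := f.1 x
  map_add' _ _ := rfl
  map_smul' _ _ := rfl

/-- Evaluation at a point of a smooth function with values in `M`. -/
def evalAt {M : Type} [AddCommMonoid M] [Module ℂ M] (x : V) : Smooth V ⊗[ℂ] M →ₗ[ℂ] M :=
  (TensorProduct.lid ℂ M).toLinearMap ∘ₗ (evalPt x).rTensor M

end Smooth

/-- The group `E(1,1)` in the global coordinates `(z_+, z_-, λ)`: `g.1 s` is `z_±`, `g.2` is `λ`. -/
abbrev E11 : Type := (ℤˣ → ℝ) × ℝ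

namespace E11

/-- The matrix of a group element. -/
def toMatrix (g : E11) : Matrix (Fin 3) (Fin 3) ℝ :=
  !![Real.exp g.2, 0, g.1 1; 0, Real.exp (-g.2), g.1 (-1); 0, 0, 1]

/-- The group multiplication in coordinates. -/
def mul (g h : E11) : E11 :=
  (fun s => g.1 s + Real.exp (((s : ℤ) : ℝ) * g.2) * h.1 s, g.2 + h.2)

/-- The group inverse in coordinates. -/
def inv (g : E11) : E11 := (fun s => -(Real.exp (-(((s : ℤ) : ℝ) * g.2)) * g.1 s), -g.2)

theorem toMatrix_mul (g h : E11) : toMatrix (mul g h) = toMatrix g * toMatrix h := by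
  ext i j
  fin_cases i <;> fin_cases j <;>
    simp [toMatrix, mul, Matrix.mul_apply, Fin.sum_univ_three, Real.exp_add, add_comm, mul_comm]

theorem mul_inv (g : E11) : mul g (inv g) = 0 := by
  ext s
  · simp only [mul, inv, mul_neg, ← mul_assoc, ← Real.exp_add]
    simp
  · simp [mul, inv]

theorem contDiff_mul : ContDiff ℝ ∞ (fun x : E11 × E11 => mul x.1 x.2) := by
  unfold mul
  refine ContDiff.prodMk (contDiff_pi.2 fun s => ?_) (by fun_prop)
  fun_prop

theorem contDiff_inv : ContDiff ℝ ∞ inv := by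
  unfold inv
  refine ContDiff.prodMk (contDiff_pi.2 fun s => ?_) (by fun_prop)
  fun_prop

/-- The coordinate function `z_±`. -/
def z (s : ℤˣ) : Smooth E11 := ⟨fun g => (g.1 s : ℂ), by
  exact Complex.ofRealCLM.contDiff.comp (by fun_prop : ContDiff ℝ ∞ fun g : E11 => g.1 s)⟩

/-- The coordinate function `λ`. -/
def lam : Smooth E11 := ⟨fun g => (g.2 : ℂ), by
  exact Complex.ofRealCLM.contDiff.comp (by fun_prop : ContDiff ℝ ∞ fun g : E11 => g.2)⟩

/-- The function `e^{cλ}`. -/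
def expLam (c : ℝ) : Smooth E11 := ⟨fun g => (Real.exp (c * g.2) : ℂ), by
  exact Complex.ofRealCLM.contDiff.comp
    (by fun_prop : ContDiff ℝ ∞ fun g : E11 => Real.exp (c * g.2))⟩

/-- `∂/∂z_±` -/
def dz (s : ℤˣ) : Smooth E11 →ₗ[ℂ] Smooth E11 := dirDeriv (Pi.single s 1, 0)

/-- `∂/∂λ` -/
def dlam : Smooth E11 →ₗ[ℂ] Smooth E11 := dirDeriv (0, 1)

/-- `f ↦ (∂_+^t ∂_-^s ∂_λ^l f)(e)`, where `e = 0` in coordinates is the unit element. -/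
def jet (t s l : ℕ) : Smooth E11 →ₗ[ℂ] ℂ :=
  evalPt (0 : E11) ∘ₗ (dz 1 ^ t * dz (-1) ^ s * dlam ^ l : Module.End ℂ (Smooth E11))

/-- `f ↦ f ∘ μ`, where `μ` is the group multiplication. -/
def comulFun : Smooth E11 →ₐ[ℂ] Smooth (E11 × E11) := pullback _ contDiff_mul

/-- `f ↦ f ∘ inv` -/
def invFun : Smooth E11 →ₐ[ℂ] Smooth E11 := pullback _ contDiff_inv

end E11

/-! ### The algebras `A(E_q(1,1))` and `A_F` -/

/-- The generators `η_±`, `δ`. -/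
inductive AGen : Type
  | eta (s : ℤˣ)
  | del

open AGen in
/-- The defining relations of `A(E_q(1,1))`. -/
inductive ARel (p : ℕ) (q : ℂ) : FreeAlgebra ℂ AGen → FreeAlgebra ℂ AGen → Prop
  | eta_eta : ARel p q
      (FreeAlgebra.ι ℂ (eta (-1)) * FreeAlgebra.ι ℂ (eta 1))
      (q ^ 2 • (FreeAlgebra.ι ℂ (eta 1) * FreeAlgebra.ι ℂ (eta (-1))))
  | eta_del (s : ℤˣ) : ARel p q
      (FreeAlgebra.ι ℂ (eta s) * FreeAlgebra.ι ℂ del)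
      (q ^ 2 • (FreeAlgebra.ι ℂ del * FreeAlgebra.ι ℂ (eta s)))
  | eta_pow (s : ℤˣ) : ARel p q (FreeAlgebra.ι ℂ (eta s) ^ p) 0
  | del_pow : ARel p q (FreeAlgebra.ι ℂ del ^ p) 1

/-- The algebra `A(E_q(1,1))`, by generators and relations. -/
abbrev Aq (p : ℕ) (q : ℂ) : Type := RingQuot (ARel p q)

namespace Aq

variable (p : ℕ) (q : ℂ)

def gen (x : AGen) : Aq p q := RingQuot.mkAlgHom ℂ (ARel p q) (FreeAlgebra.ι ℂ x)

/-- `η_±` -/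
def eta (s : ℤˣ) : Aq p q := gen p q (.eta s)

/-- Integer powers `δ^k`; exponents are read modulo `p`, since `δ^p = 1`. -/
def delta (k : ℤ) : Aq p q := gen p q .del ^ (k % (p : ℤ)).toNat

/-- `ζ(k, δ) = (1/p) ∑_{n=0}^{p-1} q^{-nk} δ^n` -/
def zeta (k : ℕ) : Aq p q :=
  (1 / (p : ℂ)) • ∑ n ∈ Finset.range p, q⁻¹ ^ (n * k) • delta p q n

/-- `η_+^n η_-^m ζ(k, δ)` -/
def mono (n m k : ℕ) : Aq p q := eta p q 1 ^ n * eta p q (-1) ^ m * zeta p q k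

end Aq

/-- `A_F = A(E(1,1)) ⊗ A(E_q(1,1))`. -/
abbrev AF (p : ℕ) (q : ℂ) : Type := Smooth E11 ⊗[ℂ] Aq p q

/-- The completed tensor square of `A_F`: smooth functions on `E(1,1) × E(1,1)` with values in
`A(E_q(1,1)) ⊗ A(E_q(1,1))` (the algebra `A(E_q(1,1))` is finite dimensional). -/
abbrev AF2 (p : ℕ) (q : ℂ) : Type := Smooth (E11 × E11) ⊗[ℂ] (Aq p q ⊗[ℂ] Aq p q)

namespace AF

variable (p : ℕ) (q : ℂ)

/-- A function on `E(1,1)` as an element of `A_F`. -/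
def fn (f : Smooth E11) : AF p q := f ⊗ₜ[ℂ] 1

def z (s : ℤˣ) : AF p q := fn p q (E11.z s)

def lam : AF p q := fn p q E11.lam

/-- `e^{cλ}` -/
def expLam (c : ℝ) : AF p q := fn p q (E11.expLam c)

def eta (s : ℤˣ) : AF p q := 1 ⊗ₜ[ℂ] Aq.eta p q s

def delta (k : ℤ) : AF p q := 1 ⊗ₜ[ℂ] Aq.delta p q k

def zeta (k : ℕ) : AF p q := 1 ⊗ₜ[ℂ] Aq.zeta p q k

/-- `a^{nmktsl} = η_+^n η_-^m ζ(k, δ) z_+^t z_-^s λ^l` -/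
def a (n m k t s l : ℕ) : AF p q :=
  eta p q 1 ^ n * eta p q (-1) ^ m * zeta p q k * z p q 1 ^ t * z p q (-1) ^ s * lam p q ^ l

/-- The Taylor coefficient `(∂_+^t ∂_-^s ∂_λ^l F)(e)` of `F ∈ A_F` at the unit element. -/
def taylor (t s l : ℕ) : AF p q →ₗ[ℂ] Aq p q :=
  (TensorProduct.lid ℂ (Aq p q)).toLinearMap ∘ₗ (E11.jet t s l).rTensor (Aq p q)

/-- The function `(g, h) ↦ f(g) f'(h)`, as an algebra homomorphism on the tensor product. -/
def extFun : Smooth E11 ⊗[ℂ] Smooth E11 →ₐ[ℂ] Smooth (E11 × E11) :=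
  Algebra.TensorProduct.lift (pullback Prod.fst contDiff_fst) (pullback Prod.snd contDiff_snd)
    (fun f f' => by
      change _ * _ = _ * _
      ext x
      exact mul_comm _ _)

/-- The canonical map of the algebraic tensor square of `A_F` to the completed one. -/
def ext : AF p q ⊗[ℂ] AF p q →ₐ[ℂ] AF2 p q :=
  (Algebra.TensorProduct.map extFun (AlgHom.id ℂ (Aq p q ⊗[ℂ] Aq p q))).comp
    (Algebra.TensorProduct.tensorTensorTensorComm ℂ ℂ ℂ ℂ
      (Smooth E11) (Aq p q) (Smooth E11) (Aq p q)).toAlgHom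

/-- The sum over `n = 1, …, p-1` in the coproduct of `z_±`, including its sign. -/
def nilp (s : ℤˣ) : AF2 p q :=
  (-1 : ℂ) ^ ((p + 1) / 2) • ∑ n ∈ Finset.Icc 1 (p - 1),
    (q ^ ((s : ℤ) * (n : ℤ) ^ 2) / (qFact q (p - n) * qFact q n)) •
      ext p q ((eta p q s ^ (p - n) * delta p q (s * n) * expLam p q (((s : ℤ) : ℝ) * n / p))
        ⊗ₜ[ℂ] (eta p q s ^ n))

variable {p q}

/-- `F(·, h)` for `F` in the completed tensor square. -/
def sliceL (h : E11) : AF2 p q →ₗ[ℂ] AF p q ⊗[ℂ] Aq p q :=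
  (TensorProduct.assoc ℂ (Smooth E11) (Aq p q) (Aq p q)).symm.toLinearMap ∘ₗ
    (pullback (fun g : E11 => (g, h)) (by fun_prop)).toLinearMap.rTensor (Aq p q ⊗[ℂ] Aq p q)

/-- `F(g, ·)` for `F` in the completed tensor square. -/
def sliceR (g : E11) : AF2 p q →ₗ[ℂ] Aq p q ⊗[ℂ] AF p q :=
  (TensorProduct.leftComm ℂ (Smooth E11) (Aq p q) (Aq p q)).toLinearMap ∘ₗ
    (pullback (fun h : E11 => (g, h)) (by fun_prop)).toLinearMap.rTensor (Aq p q ⊗[ℂ] Aq p q)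

end AF

/-- The Hopf `*`-algebra axioms for `A_F` with respect to the completed tensor product. For a linear
map `T` on `A_F`, the map `T ⊗ id` on the completed tensor square is computed pointwise in the
second group variable: it applies `T` to `F(·, h)`; similarly for `id ⊗ T`. -/
structure IsCompletedHopfStar (p : ℕ) (q : ℂ) [StarRing (Aq p q)] [StarModule ℂ (Aq p q)]
    (Δ : AF p q →ₐ[ℂ] AF2 p q) (ε : AF p q →ₐ[ℂ] ℂ) (S : AF p q →ₗ[ℂ] AF p q) : Prop where
  /-- `(Δ ⊗ id) Δ = (id ⊗ Δ) Δ`, evaluated at `(g₁, g₂, g₃)` -/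
  coassoc : ∀ (x : AF p q) (g₁ g₂ g₃ : E11),
    TensorProduct.assoc ℂ (Aq p q) (Aq p q) (Aq p q)
      ((evalAt (g₁, g₂) ∘ₗ Δ.toLinearMap).rTensor (Aq p q) (AF.sliceL g₃ (Δ x)))
    = (evalAt (g₂, g₃) ∘ₗ Δ.toLinearMap).lTensor (Aq p q) (AF.sliceR g₁ (Δ x))
  /-- `(ε ⊗ id) Δ = id` -/
  counit_left : ∀ (x : AF p q) (g : E11),
    TensorProduct.lid ℂ (Aq p q) (ε.toLinearMap.rTensor (Aq p q) (AF.sliceL g (Δ x)))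
    = evalAt g x
  /-- `(id ⊗ ε) Δ = id` -/
  counit_right : ∀ (x : AF p q) (g : E11),
    TensorProduct.rid ℂ (Aq p q) (ε.toLinearMap.lTensor (Aq p q) (AF.sliceR g (Δ x)))
    = evalAt g x
  /-- `m (S ⊗ id) Δ = ε 1`; the product `m` restricts functions to the diagonal -/
  antipode_left : ∀ (x : AF p q) (g : E11),
    LinearMap.mul' ℂ (Aq p q) ((evalAt g ∘ₗ S).rTensor (Aq p q) (AF.sliceL g (Δ x)))
    = algebraMap ℂ (Aq p q) (ε x)
  /-- `m (id ⊗ S) Δ = ε 1` -/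
  antipode_right : ∀ (x : AF p q) (g : E11),
    LinearMap.mul' ℂ (Aq p q) ((evalAt g ∘ₗ S).lTensor (Aq p q) (AF.sliceR g (Δ x)))
    = algebraMap ℂ (Aq p q) (ε x)
  antipode_one : S 1 = 1
  antipode_mul : ∀ x y : AF p q, S (x * y) = S y * S x
  comul_star : ∀ x : AF p q, Δ (star x) = star (Δ x)
  counit_star : ∀ x : AF p q, ε (star x) = star (ε x)

/-- The values of the structure maps of `A_F` on the generators `η_±`, `δ`, `z_±`, `λ` and on
arbitrary smooth functions `f(z_+, z_-, λ)`. -/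
structure AFFormulas (p : ℕ) (q : ℂ) [StarRing (Aq p q)] [StarModule ℂ (Aq p q)]
    (Δ : AF p q →ₐ[ℂ] AF2 p q) (ε : AF p q →ₐ[ℂ] ℂ) (S : AF p q →ₗ[ℂ] AF p q) : Prop where
  star_eta : ∀ s, star (AF.eta p q s) = AF.eta p q s
  star_delta : star (AF.delta p q 1) = AF.delta p q 1
  star_z : ∀ s, star (AF.z p q s) = AF.z p q s
  star_lam : star (AF.lam p q) = AF.lam p q
  comul_eta : ∀ s : ℤˣ, Δ (AF.eta p q s) = AF.ext p q
    (AF.eta p q s ⊗ₜ[ℂ] 1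
      + (AF.delta p q s * AF.expLam p q (((s : ℤ) : ℝ) / p)) ⊗ₜ[ℂ] AF.eta p q s)
  comul_delta : Δ (AF.delta p q 1) = AF.ext p q (AF.delta p q 1 ⊗ₜ[ℂ] AF.delta p q 1)
  comul_lam : Δ (AF.lam p q) = AF.ext p q (AF.lam p q ⊗ₜ[ℂ] 1 + 1 ⊗ₜ[ℂ] AF.lam p q)
  comul_z : ∀ s : ℤˣ, Δ (AF.z p q s) = AF.ext p q
    (AF.z p q s ⊗ₜ[ℂ] 1 + AF.expLam p q ((s : ℤ) : ℝ) ⊗ₜ[ℂ] AF.z p q s) + AF.nilp p q s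
  /-- `Δ(f) = f(Δ(z_+), Δ(z_-), Δ(λ))`: the Taylor expansion in the nilpotent parts of `Δ(z_±)`
  around the group law. It is finite since `η_±^p = 0`. -/
  comul_fn : ∀ f : Smooth E11, Δ (AF.fn p q f)
    = ∑ j ∈ Finset.range p, ∑ k ∈ Finset.range p,
      (1 / ((j.factorial : ℂ) * (k.factorial : ℂ))) •
        (((E11.comulFun ((E11.dz 1 ^ j * E11.dz (-1) ^ k : Module.End ℂ (Smooth E11)) f))
          ⊗ₜ[ℂ] (1 : Aq p q ⊗[ℂ] Aq p q)) * AF.nilp p q 1 ^ j * AF.nilp p q (-1) ^ k)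
  counit_eta : ∀ s, ε (AF.eta p q s) = 0
  counit_delta : ∀ s : ℤˣ, ε (AF.delta p q s) = 1
  counit_lam : ε (AF.lam p q) = 0
  counit_z : ∀ s, ε (AF.z p q s) = 0
  counit_fn : ∀ f : Smooth E11, ε (AF.fn p q f) = f.1 0
  antipode_eta : ∀ s : ℤˣ, S (AF.eta p q s)
    = -(AF.delta p q (-(s : ℤ)) * AF.expLam p q (-((s : ℤ) : ℝ) / p) * AF.eta p q s)
  antipode_delta : ∀ s : ℤˣ, S (AF.delta p q s) = AF.delta p q (-(s : ℤ))
  antipode_lam : S (AF.lam p q) = -AF.lam p q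
  antipode_z : ∀ s : ℤˣ, S (AF.z p q s)
    = -(AF.expLam p q (-((s : ℤ) : ℝ)) * AF.z p q s)
  antipode_fn : ∀ f : Smooth E11, S (AF.fn p q f) = AF.fn p q (E11.invFun f)

/-! ### Bases and duality -/

/-- Indices `(n, m, k, t, s, l)` with `n, m, k ∈ {0, …, p-1}`. -/
abbrev Idx (p : ℕ) : Type := Fin p × Fin p × Fin p × ℕ × ℕ × ℕ

/-- The family `φ^{nmktsl}`. -/
def phiFam (p : ℕ) (q : ℂ) (σ : ℤˣ) (i : Idx p) : UF p q σ :=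
  UF.phi p q σ i.1 i.2.1 i.2.2.1 i.2.2.2.1 i.2.2.2.2.1 i.2.2.2.2.2

/-- The `a^{nmktsl}` form a local basis of `A_F`: each `F ∈ A_F` has a unique formal expansion
`∑ c_{nmktsl} a^{nmktsl}` that agrees with `F` to every order at the unit element. -/
def IsLocalBasis (p : ℕ) (q : ℂ) : Prop :=
  ∀ F : AF p q, ∃! c : Idx p → ℂ, ∀ N t s l : ℕ, t ≤ N → s ≤ N → l ≤ N →
    AF.taylor p q t s l (F - ∑ n : Fin p, ∑ m : Fin p, ∑ k : Fin p,
      ∑ t' ∈ Finset.range (N + 1), ∑ s' ∈ Finset.range (N + 1), ∑ l' ∈ Finset.range (N + 1),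
        c (n, m, k, t', s', l') • AF.a p q n m k t' s' l') = 0

/-- The constant `i^{n+m+t+s} (-σ i)^l q^{(n-m)/2 - nm} [n]! [m]!`, with `r = q^{1/2}`. -/
def dualConst (q r : ℂ) (σ : ℤˣ) (n m t s l : ℕ) : ℂ :=
  Complex.I ^ (n + m + t + s + l) * (-sgn σ) ^ l
    * (r ^ ((n : ℤ) - (m : ℤ)) * q ^ (-((n : ℤ) * (m : ℤ)))) * (qFact q n * qFact q m)

/-- The explicit duality relations, on the bases and, through Taylor coefficients at the unit
element, on all of `A_F`. The indices `k`, `k'` of `κ` and `ζ` only matter modulo `p`. -/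
structure DualityRelations (p : ℕ) (q r : ℂ) (σ : ℤˣ)
    (B : UF p q σ →ₗ[ℂ] AF p q →ₗ[ℂ] ℂ) : Prop where
  basis : ∀ (n m k n' m' k' : Fin p) (t s l t' s' l' : ℕ),
    B (UF.phi p q σ n m k t s l) (AF.a p q n' m' k' t' s' l')
      = if n = n' ∧ m = m' ∧ t = t' ∧ s = s' ∧ l = l' ∧ (k + n + m : ℕ) ≡ k' [MOD p]
        then dualConst q r σ n m t s l
          * ((l.factorial : ℂ) * (t.factorial : ℂ) * (s.factorial : ℂ))
        else 0
  smooth : ∀ (n m k n' m' k' : Fin p) (t s l : ℕ) (f : Smooth E11),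
    B (UF.phi p q σ n m k t s l) (f ⊗ₜ[ℂ] Aq.mono p q n' m' k')
      = if n = n' ∧ m = m' ∧ (k + n + m : ℕ) ≡ k' [MOD p]
        then dualConst q r σ n m t s l * E11.jet t s l f
        else 0

/-- `B` is a pairing of Hopf `*`-algebras between `U_F` and `A_F`, nondegenerate on `U_F`, and on
`A_F` up to elements with vanishing Taylor expansion at the unit element. -/
structure IsHopfPairing (p : ℕ) (q : ℂ) (σ : ℤˣ)
    [StarRing (UF p q σ)] [Coalgebra ℂ (UF p q σ)] [StarRing (Aq p q)] [StarModule ℂ (Aq p q)]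
    (SU : UF p q σ →ₗ[ℂ] UF p q σ)
    (Δ : AF p q →ₐ[ℂ] AF2 p q) (ε : AF p q →ₐ[ℂ] ℂ) (S : AF p q →ₗ[ℂ] AF p q)
    (B : UF p q σ →ₗ[ℂ] AF p q →ₗ[ℂ] ℂ) : Prop where
  /-- `⟨φψ, x⟩ = ⟨φ ⊗ ψ, Δ(x)⟩`. The right side is `⟨ψ, y⟩`, where `y = (⟨φ, ·⟩ ⊗ id) Δ(x)`
  is the element of `A_F` computed pointwise. -/
  mul_left : ∀ (φ : UF p q σ) (x : AF p q), ∃ y : AF p q,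
    (∀ h : E11, evalAt h y
      = TensorProduct.lid ℂ (Aq p q) ((B φ).rTensor (Aq p q) (AF.sliceL h (Δ x)))) ∧
    ∀ ψ : UF p q σ, B (φ * ψ) x = B ψ y
  /-- `⟨φ, xy⟩ = ⟨Δ(φ), x ⊗ y⟩` -/
  mul_right : ∀ (φ : UF p q σ) (x y : AF p q),
    B φ (x * y) = LinearMap.mul' ℂ ℂ
      (TensorProduct.map (B.flip x) (B.flip y) (Coalgebra.comul (R := ℂ) φ))
  one_left : ∀ x : AF p q, B 1 x = ε x
  one_right : ∀ φ : UF p q σ, B φ 1 = Coalgebra.counit (R := ℂ) φ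
  antipode : ∀ (φ : UF p q σ) (x : AF p q), B (SU φ) x = B φ (S x)
  star_pairing : ∀ (φ : UF p q σ) (x : AF p q), B (star φ) x = star (B φ (star (S x)))
  nondeg_left : ∀ φ : UF p q σ, (∀ x : AF p q, B φ x = 0) → φ = 0
  nondeg_right : ∀ x : AF p q, (∀ φ : UF p q σ, B φ x = 0) ↔ ∀ t s l : ℕ, AF.taylor p q t s l x = 0

end FracSusy

end

open scoped TensorProduct ContDiff

noncomputable section

namespace FracSusy
/-! ### `q`-calculus at an odd root of unity -/

/-- `p` is odd and `q` is a primitive `p`-th root of unity. -/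
class RootData (p : ℕ) (q : ℂ) : Prop where
  odd : Odd p
  prim : IsPrimitiveRoot q p

section Numbers

variable (p : ℕ) (q : ℂ)

theorem root_pos [hpq : RootData p q] : 0 < p := hpq.odd.pos

theorem root_ne_zero [hpq : RootData p q] : q ≠ 0 := hpq.prim.ne_zero (root_pos p q).ne'

theorem root_pow [hpq : RootData p q] : q ^ p = 1 := hpq.prim.pow_eq_one

theorem root_star [hpq : RootData p q] : star q = q⁻¹ := by
  have h : ‖q‖ = 1 := hpq.prim.norm'_eq_one (root_pos p q).ne'
  rw [Complex.inv_def, Complex.normSq_eq_norm_sq, h]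
  simp

instance RootData.zpow [hpq : RootData p q] (s : ℤˣ) : RootData p (q ^ (s : ℤ)) where
  odd := hpq.odd
  prim := by
    rcases Int.units_eq_one_or s with rfl | rfl
    · simpa using hpq.prim
    · simpa using hpq.prim.inv

theorem qNum_inv (q : ℂ) (n : ℕ) : qNum q⁻¹ n = qNum q n := by
  unfold qNum
  rw [inv_inv, ← neg_sub (q ^ n), ← neg_sub q, neg_div_neg_eq]

theorem qNum_zpow (q : ℂ) (s : ℤˣ) (n : ℕ) : qNum (q ^ (s : ℤ)) n = qNum q n := by
  rcases Int.units_eq_one_or s with rfl | rfl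
  · simp
  · simpa using qNum_inv q n

theorem qFact_zpow (q : ℂ) (s : ℤˣ) (n : ℕ) : qFact (q ^ (s : ℤ)) n = qFact q n := by
  simp [qFact, qNum_zpow]

@[simp] theorem qFact_zero (q : ℂ) : qFact q 0 = 1 := by simp [qFact]

theorem qFact_succ (q : ℂ) (n : ℕ) : qFact q (n + 1) = qFact q n * qNum q (n + 1) := by
  simp [qFact, Finset.prod_range_succ]

theorem qNum_root [hpq : RootData p q] : qNum q p = 0 := by
  simp [qNum, root_pow p q, inv_pow]

theorem qNum_ne_zero [hpq : RootData p q] {j : ℕ} (h0 : 0 < j) (hj : j < p) : qNum q j ≠ 0 := by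
  have hq := root_ne_zero p q
  have key : ∀ i, 0 < i → i < p → q ^ i - q⁻¹ ^ i ≠ 0 := by
    intro i h0 hi h
    have h1 : q ^ (2 * i) = 1 := by
      rw [two_mul, pow_add]
      have : q ^ i = q⁻¹ ^ i := sub_eq_zero.1 h
      nth_rewrite 1 [this]
      rw [inv_pow, inv_mul_cancel₀ (pow_ne_zero _ hq)]
    have h2 := (hpq.prim.pow_eq_one_iff_dvd _).1 h1
    have h3 : p ∣ i := (Nat.Coprime.dvd_mul_left (Nat.coprime_two_right.2 hpq.odd)).1 h2
    exact absurd (Nat.le_of_dvd h0 h3) (by omega)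
  refine div_ne_zero (key j h0 hj) ?_
  simpa using key 1 one_pos (by omega)

theorem qFact_ne_zero [hpq : RootData p q] {j : ℕ} (hj : j < p) : qFact q j ≠ 0 :=
  Finset.prod_ne_zero_iff.2 fun i hi =>
    qNum_ne_zero p q (Nat.succ_pos i) (by have := Finset.mem_range.1 hi; omega)

theorem qFact_root [hpq : RootData p q] : qFact q p = 0 := by
  obtain ⟨m, hm⟩ := Nat.exists_eq_succ_of_ne_zero (root_pos p q).ne'
  have := qNum_root p q
  rw [hm] at this ⊢
  rw [qFact_succ, this, mul_zero]

theorem qNum_add {q : ℂ} (hq : q ≠ 0) (i j : ℕ) :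
    q⁻¹ ^ j * qNum q i + q ^ i * qNum q j = qNum q (i + j) := by
  unfold qNum
  rw [mul_div_assoc', mul_div_assoc', ← add_div]
  congr 1
  have h : q ^ j * q⁻¹ ^ j = 1 := by rw [← mul_pow, mul_inv_cancel₀ hq, one_pow]
  rw [pow_add, pow_add]
  linear_combination 0 * h

theorem star_qNum [hpq : RootData p q] (n : ℕ) : star (qNum q n) = qNum q n := by
  conv_rhs => rw [← qNum_inv q n]
  simp only [qNum, star_div₀, star_sub, star_pow, star_inv₀, root_star p q]

theorem star_qFact [hpq : RootData p q] (n : ℕ) : star (qFact q n) = qFact q n := by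
  simp only [qFact]
  rw [star_prod]
  exact Finset.prod_congr rfl fun i _ => star_qNum p q _

/-- `q^{-m} = q^n` if `p` divides `m + n`. -/
theorem root_inv_pow_eq [hpq : RootData p q] {m n : ℕ} (h : p ∣ m + n) : q⁻¹ ^ m = q ^ n := by
  have hq := root_ne_zero p q
  rw [inv_pow]
  refine inv_eq_of_mul_eq_one_right ?_
  rw [← pow_add]
  exact (hpq.prim.pow_eq_one_iff_dvd _).2 h

end Numbers

/-! ### The `q`-binomial theorem -/

/-- Coefficient of `a^i b^j` in `(a + b)^{i+j}` if `a b = q^2 b a`. -/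
def qCoef (q : ℂ) : ℕ → ℕ → ℂ
  | 0, _ => 1
  | _ + 1, 0 => 1
  | i + 1, j + 1 => q⁻¹ ^ (2 * (j + 1)) * qCoef q i (j + 1) + qCoef q (i + 1) j

theorem qCoef_zero_right (q : ℂ) (i : ℕ) : qCoef q i 0 = 1 := by cases i <;> simp [qCoef]

theorem qCoef_mul {q : ℂ} (hq : q ≠ 0) : ∀ i j,
    qCoef q i j * (qFact q i * qFact q j) = q⁻¹ ^ (i * j) * qFact q (i + j)
  | 0, j => by simp [qCoef]
  | i + 1, 0 => by simp [qCoef]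
  | i + 1, j + 1 => by
    have h1 := qCoef_mul hq i (j + 1)
    have h2 := qCoef_mul hq (i + 1) j
    have h3 := qNum_add hq (i + 1) (j + 1)
    have e1 : qFact q (i + 1 + (j + 1)) = qFact q (i + j + 1) * qNum q (i + 1 + (j + 1)) := by
      rw [show i + 1 + (j + 1) = (i + j + 1) + 1 by ring, qFact_succ]
    rw [show i + (j + 1) = i + j + 1 by ring] at h1
    rw [show i + 1 + j = i + j + 1 by ring] at h2
    have hu : q⁻¹ ^ (i + 1) * q ^ (i + 1) = 1 := by rw [← mul_pow, inv_mul_cancel₀ hq, one_pow]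
    rw [e1, ← h3, qCoef]
    have e2 : q⁻¹ ^ ((i + 1) * (j + 1)) = q⁻¹ ^ (i * (j + 1)) * q⁻¹ ^ (j + 1) := by
      rw [← pow_add]; ring_nf
    have e3 : q⁻¹ ^ ((i + 1) * (j + 1)) = q⁻¹ ^ ((i + 1) * j) * q⁻¹ ^ (i + 1) := by
      rw [← pow_add]; ring_nf
    have e4 : q⁻¹ ^ (2 * (j + 1)) = q⁻¹ ^ (j + 1) * q⁻¹ ^ (j + 1) := by
      rw [← pow_add]; ring_nf
    rw [e4, qFact_succ q i, qFact_succ q j]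
    rw [qFact_succ q j] at h1
    rw [qFact_succ q i] at h2
    generalize q⁻¹ ^ ((i + 1) * (j + 1)) = E at *
    generalize q⁻¹ ^ (i * (j + 1)) = E₁ at *
    generalize q⁻¹ ^ ((i + 1) * j) = E₂ at *
    generalize q⁻¹ ^ (j + 1) = u at *
    generalize q⁻¹ ^ (i + 1) = w at *
    generalize q ^ (i + 1) = v at *
    generalize qFact q (i + j + 1) = F at *
    linear_combination u ^ 2 * qNum q (i + 1) * h1 + qNum q (j + 1) * h2
      - F * u * qNum q (i + 1) * e2 - F * v * qNum q (j + 1) * e3 - E₂ * F * qNum q (j + 1) * hu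

section Algebra

variable {A : Type*} [Ring A] [Algebra ℂ A]

theorem mul_pow_of_qcomm {c : ℂ} {a b : A} (h : a * b = c • (b * a)) (n : ℕ) :
    a * b ^ n = c ^ n • (b ^ n * a) := by
  induction n with
  | zero => simp
  | succ n ih =>
    rw [pow_succ, ← mul_assoc, ih, smul_mul_assoc, mul_assoc, h, mul_smul_comm, smul_smul,
      mul_assoc, pow_succ]

theorem pow_mul_of_qcomm {c : ℂ} {a b : A} (h : a * b = c • (b * a)) (n : ℕ) :
    a ^ n * b = c ^ n • (b * a ^ n) := by
  induction n with
  | zero => simp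
  | succ n ih =>
    rw [pow_succ', mul_assoc, ih, mul_smul_comm, ← mul_assoc, h, smul_mul_assoc, smul_smul,
      ← pow_succ, ← mul_assoc]

theorem pow_mul_pow_of_qcomm {c : ℂ} {a b : A} (h : a * b = c • (b * a)) (m n : ℕ) :
    a ^ m * b ^ n = c ^ (m * n) • (b ^ n * a ^ m) := by
  rw [mul_pow_of_qcomm (pow_mul_of_qcomm h m), ← pow_mul]

theorem qcomm_symm {c : ℂ} (hc : c ≠ 0) {a b : A} (h : a * b = c • (b * a)) :
    b * a = c⁻¹ • (a * b) := by
  rw [h, smul_smul, inv_mul_cancel₀ hc, one_smul]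

theorem add_pow_of_qcomm {q : ℂ} (hq : q ≠ 0) {a b : A} (h : a * b = q ^ 2 • (b * a)) (m : ℕ) :
    (a + b) ^ m = ∑ ij ∈ Finset.HasAntidiagonal.antidiagonal m, qCoef q ij.1 ij.2 • (a ^ ij.1 * b ^ ij.2) := by
  have hba : ∀ j, b ^ j * a = q⁻¹ ^ (2 * j) • (a * b ^ j) := fun j => by
    rw [pow_mul_of_qcomm (qcomm_symm (pow_ne_zero 2 hq) h), ← inv_pow, ← pow_mul]
  induction m with
  | zero => simp [qCoef]
  | succ m ih =>
    let u : ℕ × ℕ → ℂ := fun x =>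
      match x with
      | (0, _) => 0
      | (i + 1, j) => q⁻¹ ^ (2 * j) * qCoef q i j
    let v : ℕ × ℕ → ℂ := fun x =>
      match x with
      | (_, 0) => 0
      | (i, j + 1) => qCoef q i j
    have huv : ∀ x ∈ Finset.HasAntidiagonal.antidiagonal (m + 1), qCoef q x.1 x.2 • (a ^ x.1 * b ^ x.2)
        = u x • (a ^ x.1 * b ^ x.2) + v x • (a ^ x.1 * b ^ x.2) := by
      rintro ⟨i, j⟩ hij
      rw [← add_smul]
      congr 1
      rcases i with _ | i <;> rcases j with _ | j
      · simp at hij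
      · simp [u, v, qCoef]
      · simp [u, v, qCoef_zero_right]
      · simp [u, v, qCoef]
    rw [Finset.sum_congr rfl huv, Finset.sum_add_distrib, Finset.Nat.sum_antidiagonal_succ,
      Finset.Nat.sum_antidiagonal_succ' (f := fun x => v x • (a ^ x.1 * b ^ x.2))]
    simp only [u, v, zero_smul, zero_add]
    rw [pow_succ, ih, mul_add, Finset.sum_mul, Finset.sum_mul]
    congr 1
    · refine Finset.sum_congr rfl fun x _ => ?_
      rw [smul_mul_assoc, mul_assoc, hba, mul_smul_comm, smul_smul, mul_comm, pow_succ, mul_assoc]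
    · refine Finset.sum_congr rfl fun x _ => ?_
      rw [smul_mul_assoc, mul_assoc, pow_succ]

end Algebra

section RootAlgebra

variable (p : ℕ) (q : ℂ) {A : Type*} [Ring A] [Algebra ℂ A]

theorem qCoef_eq [hpq : RootData p q] {i j : ℕ} (h : i + j < p) :
    qCoef q i j = q⁻¹ ^ (i * j) * qFact q (i + j) * ((qFact q i)⁻¹ * (qFact q j)⁻¹) := by
  rw [← qCoef_mul (root_ne_zero p q)]
  have h1 := qFact_ne_zero p q (j := i) (by omega)
  have h2 := qFact_ne_zero p q (j := j) (by omega)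
  field_simp

theorem add_pow_root [hpq : RootData p q] {a b : A} (h : a * b = q ^ 2 • (b * a)) : (a + b) ^ p = a ^ p + b ^ p := by
  rw [add_pow_of_qcomm (root_ne_zero p q) h]
  obtain ⟨m, hm⟩ := Nat.exists_eq_succ_of_ne_zero (root_pos p q).ne'
  have key : ∀ i j, i + j = p → i ≠ 0 → j ≠ 0 → qCoef q i j = 0 := by
    intro i j hij hi hj
    have := qCoef_mul (root_ne_zero p q) i j
    rw [hij, qFact_root p q, mul_zero] at this
    have h1 := qFact_ne_zero p q (j := i) (by omega)
    have h2 := qFact_ne_zero p q (j := j) (by omega)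
    simpa [h1, h2] using this
  rw [← Finset.sum_subset (s₁ := {(p, 0), (0, p)})]
  · rw [Finset.sum_pair (by simp [hm])]
    simp [qCoef, qCoef_zero_right]
  · intro x hx
    simp only [Finset.mem_insert, Finset.mem_singleton] at hx
    rcases hx with rfl | rfl <;> simp
  · rintro ⟨i, j⟩ hij hx
    simp only [Finset.mem_insert, Finset.mem_singleton, Prod.mk.injEq, not_or,
      Finset.HasAntidiagonal.mem_antidiagonal] at hij hx
    rw [key i j hij (by omega) (by omega), zero_smul]

/-- The nilpotent expression `(-1)^{(p+1)/2} ∑_{n=1}^{p-1} q^{n²} / ([p-n]! [n]!) a^{p-n} b^n`. The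
terms `n = 0` and `n = p` of the sum below vanish since `[p]! = 0`. -/
def nil (a b : A) : A :=
  (-1 : ℂ) ^ ((p + 1) / 2) • ∑ ij ∈ Finset.HasAntidiagonal.antidiagonal p,
    (q ^ (ij.2 ^ 2) * ((qFact q ij.1)⁻¹ * (qFact q ij.2)⁻¹)) • (a ^ ij.1 * b ^ ij.2)

theorem nil_eq_sum_Icc [hpq : RootData p q] (a b : A) : nil p q a b = (-1 : ℂ) ^ ((p + 1) / 2) •
    ∑ n ∈ Finset.Icc 1 (p - 1), (q ^ (n ^ 2) / (qFact q (p - n) * qFact q n)) •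
      (a ^ (p - n) * b ^ n) := by
  unfold nil
  congr 1
  have h0 := root_pos p q
  rw [← Finset.Nat.sum_antidiagonal_swap, Finset.Nat.sum_antidiagonal_eq_sum_range_succ_mk,
    Finset.sum_range_succ,
    Finset.range_eq_Ico, Finset.sum_eq_sum_Ico_succ_bot h0]
  simp only [Prod.fst_swap, Prod.snd_swap, tsub_zero, tsub_self, qFact_root p q, inv_zero, zero_mul, mul_zero, zero_smul,
    zero_add, add_zero]
  refine Finset.sum_congr ?_ fun n _ => ?_
  · ext n
    simp only [Finset.mem_Ico, Finset.mem_Icc]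
    omega
  · congr 1
    rw [div_eq_mul_inv, mul_inv]

theorem map_nil {B : Type*} [Ring B] [Algebra ℂ B] (f : A →ₐ[ℂ] B) (a b : A) :
    f (nil p q a b) = nil p q (f a) (f b) := by
  simp [nil]

theorem nil_zero_left [hpq : RootData p q] (b : A) : nil p q 0 b = 0 := by
  unfold nil
  rw [Finset.sum_eq_zero, smul_zero]
  rintro ⟨i, j⟩ hij
  rcases i with _ | i
  · have : j = p := by simpa using hij
    simp [this, qFact_root p q]
  · simp

theorem nil_zero_right [hpq : RootData p q] (a : A) : nil p q a 0 = 0 := by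
  unfold nil
  rw [Finset.sum_eq_zero, smul_zero]
  rintro ⟨i, j⟩ hij
  rcases j with _ | j
  · have : i = p := by simpa using hij
    simp [this, qFact_root p q]
  · simp

theorem nil_smul (c : ℂ) (a b : A) : nil p q (c • a) (c • b) = c ^ p • nil p q a b := by
  unfold nil
  rw [smul_comm]
  congr 1
  rw [Finset.smul_sum]
  refine Finset.sum_congr rfl fun x hx => ?_
  rw [smul_pow, smul_pow, smul_mul_smul_comm, ← pow_add, Finset.HasAntidiagonal.mem_antidiagonal.1 hx, smul_comm]

theorem linearMap_nil [hpq : RootData p q] {M : Type*} [AddCommGroup M] [Module ℂ M] (T : A →ₗ[ℂ] M) {a b : A}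
    (h : ∀ i j, 0 < i → 0 < j → i + j = p → T (a ^ i * b ^ j) = 0) :
    T (nil p q a b) = 0 := by
  rw [nil_eq_sum_Icc, map_smul, map_sum, Finset.sum_eq_zero, smul_zero]
  intro n hn
  have := Finset.mem_Icc.1 hn
  rw [map_smul, h _ _ (by omega) (by omega) (by omega), smul_zero]

theorem mul_nil_of_qcomm {u : ℂ} (hu : u ^ p = 1) {a b c : A} (ha : c * a = u • (a * c))
    (hb : c * b = u • (b * c)) : Commute c (nil p q a b) := by
  unfold nil
  refine Commute.smul_right (Commute.sum_right _ _ _ fun x hx => Commute.smul_right ?_ _) _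
  have h := Finset.HasAntidiagonal.mem_antidiagonal.1 hx
  change c * _ = _ * c
  rw [← mul_assoc, mul_pow_of_qcomm ha, smul_mul_assoc, mul_assoc, mul_pow_of_qcomm hb,
    mul_smul_comm, smul_smul, ← pow_add, h, hu, one_smul, mul_assoc]

theorem add_commute_nil [hpq : RootData p q] {a b : A} (h : a * b = q ^ 2 • (b * a)) (ha : a ^ p = 0) (hb : b ^ p = 0) :
    Commute (a + b) (nil p q a b) := by
  have hq := root_ne_zero p q
  have h0 := root_pos p q
  unfold nil
  refine Commute.smul_right ?_ _
  change _ * _ = _ * _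
  rw [← sub_eq_zero, add_mul, mul_add]
  set X := ∑ ij ∈ Finset.HasAntidiagonal.antidiagonal p,
    (q ^ (ij.2 ^ 2) * ((qFact q ij.1)⁻¹ * (qFact q ij.2)⁻¹)) • (a ^ ij.1 * b ^ ij.2) with hX
  have hba : ∀ j, b ^ j * a = q⁻¹ ^ (2 * j) • (a * b ^ j) := fun j => by
    rw [pow_mul_of_qcomm (qcomm_symm (pow_ne_zero 2 hq) h), ← inv_pow, ← pow_mul]
  have hba' : ∀ j, b * a ^ j = q⁻¹ ^ (2 * j) • (a ^ j * b) := fun j => by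
    rw [mul_pow_of_qcomm (qcomm_symm (pow_ne_zero 2 hq) h), ← inv_pow, ← pow_mul]
  let u : ℕ × ℕ → ℂ := fun x => q ^ (x.2 ^ 2) * ((qFact q x.1)⁻¹ * (qFact q x.2)⁻¹)
  have e1 : a * X - X * a = ∑ x ∈ Finset.HasAntidiagonal.antidiagonal p,
      (u x * (1 - q⁻¹ ^ (2 * x.2))) • (a ^ (x.1 + 1) * b ^ x.2) := by
    rw [hX, Finset.mul_sum, Finset.sum_mul, ← Finset.sum_sub_distrib]
    refine Finset.sum_congr rfl fun x _ => ?_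
    rw [mul_smul_comm, smul_mul_assoc, mul_assoc (a ^ x.1), hba, mul_smul_comm, ← mul_assoc a,
      ← mul_assoc (a ^ x.1) a, ← pow_succ, ← pow_succ', smul_smul, ← sub_smul]
    congr 1
    simp only [u]; ring
  have e2 : b * X - X * b = ∑ x ∈ Finset.HasAntidiagonal.antidiagonal p,
      (u x * (q⁻¹ ^ (2 * x.1) - 1)) • (a ^ x.1 * b ^ (x.2 + 1)) := by
    rw [hX, Finset.mul_sum, Finset.sum_mul, ← Finset.sum_sub_distrib]
    refine Finset.sum_congr rfl fun x _ => ?_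
    rw [mul_smul_comm, smul_mul_assoc, ← mul_assoc b, hba', smul_mul_assoc, mul_assoc (a ^ x.1),
      mul_assoc (a ^ x.1), ← pow_succ, ← pow_succ', smul_smul, ← sub_smul]
    congr 1
    simp only [u]; ring
  have e3 : a * X + b * X - (X * a + X * b) = (a * X - X * a) + (b * X - X * b) := by abel
  obtain ⟨m, hm⟩ := Nat.exists_eq_succ_of_ne_zero h0.ne'
  rw [e3, e1, e2, hm, Finset.Nat.sum_antidiagonal_succ', Finset.Nat.sum_antidiagonal_succ]
  simp only [mul_zero, pow_zero, sub_self, zero_smul, zero_add]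
  rw [← Finset.sum_add_distrib]
  refine Finset.sum_eq_zero ?_
  rintro ⟨i, j⟩ hij
  have hij' : i + j = m := by simpa using hij
  simp only
  rw [← add_smul]
  rcases Nat.eq_zero_or_pos j with rfl | hj
  · have : a ^ (i + 1) = 0 := by rw [show i + 1 = p by omega]; exact ha
    simp [this]
  rcases Nat.eq_zero_or_pos i with rfl | hi
  · have : b ^ (j + 1) = 0 := by rw [show j + 1 = p by omega]; exact hb
    simp [this]
  convert zero_smul ℂ _
  simp only [u]
  have n1 := qFact_ne_zero p q (j := i) (by omega)
  have n2 := qFact_ne_zero p q (j := j) (by omega)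
  have n3 := qNum_ne_zero p q (j := i + 1) (by omega) (by omega)
  have n4 := qNum_ne_zero p q (j := j + 1) (by omega) (by omega)
  have n5 := qNum_ne_zero p q (j := 1) (by omega) (by omega)
  have n6 : q - q⁻¹ ≠ 0 := by
    intro h; apply n5; simp [qNum, h]
  -- all powers in terms of `q ^ j`
  have hi' : q ^ (i + 1) = q⁻¹ ^ j := (root_inv_pow_eq p q (by rw [hm]; exact ⟨1, by omega⟩)).symm
  have hi'' : q⁻¹ ^ (i + 1) = q ^ j := root_inv_pow_eq p q (by rw [hm]; exact ⟨1, by omega⟩)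
  rw [qFact_succ q i, qFact_succ q j]
  have e5 : q⁻¹ ^ (2 * (i + 1)) = q ^ j * q ^ j := by rw [two_mul, pow_add, hi'']
  have e6 : qNum q (i + 1) * (q - q⁻¹) = q⁻¹ ^ j - q ^ j := by
    rw [qNum, hi', hi'', div_mul_cancel₀ _ n6]
  have e7 : qNum q (j + 1) * (q - q⁻¹) = q ^ (j + 1) - q⁻¹ ^ (j + 1) := by
    rw [qNum, div_mul_cancel₀ _ n6]
  have e8 : q ^ ((j + 1) ^ 2) = q ^ (j ^ 2) * (q ^ j * q ^ (j + 1)) := by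
    rw [← pow_add, ← pow_add]; ring_nf
  have e9 : q⁻¹ ^ (2 * (j + 1)) = q⁻¹ ^ (j + 1) * q⁻¹ ^ (j + 1) := by
    rw [two_mul, pow_add]
  have e10 : q ^ (j + 1) * q⁻¹ ^ (j + 1) = 1 := by rw [← mul_pow, mul_inv_cancel₀ hq, one_pow]
  have e11 : q ^ j * q⁻¹ ^ j = 1 := by rw [← mul_pow, mul_inv_cancel₀ hq, one_pow]
  rw [e5, e8, e9]
  have key : q ^ j * q ^ (j + 1) * (1 - q⁻¹ ^ (j + 1) * q⁻¹ ^ (j + 1)) * qNum q (i + 1)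
      + (q ^ j * q ^ j - 1) * qNum q (j + 1) = 0 := by
    apply mul_right_cancel₀ n6
    rw [add_mul, mul_assoc, e6, mul_assoc (_ - _), e7, zero_mul]
    linear_combination (- q ^ j * q⁻¹ ^ (j + 1) * (q⁻¹ ^ j - q ^ j)) * e10
      + (q ^ (j + 1) - q⁻¹ ^ (j + 1)) * e11
  generalize q ^ j * q ^ (j + 1) = E at *
  generalize q⁻¹ ^ (j + 1) * q⁻¹ ^ (j + 1) = E' at *
  field_simp
  linear_combination q ^ j ^ 2 * key

theorem nil_mul_nil [hpq : RootData p q] {a b : A} (h : a * b = q ^ 2 • (b * a)) (ha : a ^ p = 0) (hb : b ^ p = 0) :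
    nil p q a b * nil p q a b = 0 := by
  have hq := root_ne_zero p q
  unfold nil
  rw [smul_mul_smul_comm, Finset.sum_mul_sum, Finset.sum_eq_zero, smul_zero]
  intro x hx
  refine Finset.sum_eq_zero fun y hy => ?_
  have hx' := Finset.HasAntidiagonal.mem_antidiagonal.1 hx
  have hy' := Finset.HasAntidiagonal.mem_antidiagonal.1 hy
  rw [smul_mul_smul_comm, show a ^ x.1 * b ^ x.2 * (a ^ y.1 * b ^ y.2)
    = a ^ x.1 * (b ^ x.2 * a ^ y.1) * b ^ y.2 by simp only [mul_assoc],
    pow_mul_pow_of_qcomm (qcomm_symm (pow_ne_zero 2 hq) h)]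
  rw [mul_smul_comm, smul_mul_assoc, show a ^ x.1 * (a ^ y.1 * b ^ x.2) * b ^ y.2
    = a ^ (x.1 + y.1) * b ^ (x.2 + y.2) by simp only [mul_assoc, pow_add]]
  rcases le_total p (x.1 + y.1) with h1 | h1
  · rw [pow_eq_zero_of_le h1 ha, zero_mul, smul_zero, smul_zero]
  · rw [pow_eq_zero_of_le (n := x.2 + y.2) (by omega) hb, mul_zero, smul_zero, smul_zero]

theorem pow_mul_nil [hpq : RootData p q] {a b : A} (h : a * b = q ^ 2 • (b * a)) (ha : a ^ p = 0) (hb : b ^ p = 0)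
    {i j : ℕ} (hij : p - 1 ≤ i + j) : a ^ i * b ^ j * nil p q a b = 0 := by
  have hq := root_ne_zero p q
  rw [nil_eq_sum_Icc, mul_smul_comm, Finset.mul_sum, Finset.sum_eq_zero, smul_zero]
  intro n hn
  have hn' := Finset.mem_Icc.1 hn
  rw [mul_smul_comm, show a ^ i * b ^ j * (a ^ (p - n) * b ^ n)
    = a ^ i * (b ^ j * a ^ (p - n)) * b ^ n by simp only [mul_assoc],
    pow_mul_pow_of_qcomm (qcomm_symm (pow_ne_zero 2 hq) h)]
  rw [mul_smul_comm, smul_mul_assoc, show a ^ i * (a ^ (p - n) * b ^ j) * b ^ n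
    = a ^ (i + (p - n)) * b ^ (j + n) by simp only [mul_assoc, pow_add]]
  rcases le_or_gt p (i + (p - n)) with h1 | h1
  · rw [pow_eq_zero_of_le h1 ha, zero_mul, smul_zero, smul_zero]
  · rw [pow_eq_zero_of_le (n := j + n) (by omega) hb, mul_zero, smul_zero, smul_zero]

theorem star_nil [hpq : RootData p q] [StarRing A] [StarModule ℂ A] {a b : A} (h : a * b = q ^ 2 • (b * a))
    (ha : star a = a) (hb : star b = b) : star (nil p q a b) = nil p q a b := by
  have hq := root_ne_zero p q
  unfold nil
  rw [star_smul, star_sum]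
  congr 1
  · simp
  refine Finset.sum_congr rfl fun x hx => ?_
  have hx' := Finset.HasAntidiagonal.mem_antidiagonal.1 hx
  rw [star_smul, star_mul (a ^ _), star_pow a, star_pow b, ha, hb,
    pow_mul_pow_of_qcomm (qcomm_symm (pow_ne_zero 2 hq) h), smul_smul]
  congr 1
  rw [star_mul', star_mul', star_inv₀, star_inv₀, star_pow, star_qFact p q, star_qFact p q,
    root_star p q]
  rw [mul_right_comm, ← inv_pow, ← pow_mul, ← pow_add]
  congr 1
  refine root_inv_pow_eq p q ⟨2 * x.2, ?_⟩
  rw [← hx']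
  ring

theorem sum_antidiagonal_assoc {M : Type*} [AddCommMonoid M] (n : ℕ) (f : ℕ → ℕ → ℕ → M) :
    ∑ x ∈ Finset.HasAntidiagonal.antidiagonal n, ∑ y ∈ Finset.HasAntidiagonal.antidiagonal x.1, f y.1 y.2 x.2
      = ∑ x ∈ Finset.HasAntidiagonal.antidiagonal n, ∑ y ∈ Finset.HasAntidiagonal.antidiagonal x.2, f x.1 y.1 y.2 := by
  rw [Finset.sum_sigma', Finset.sum_sigma']
  refine Finset.sum_nbij' (fun x => ⟨(x.2.1, x.2.2 + x.1.2), (x.2.2, x.1.2)⟩)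
    (fun x => ⟨(x.1.1 + x.2.1, x.2.2), (x.1.1, x.2.1)⟩) ?_ ?_ ?_ ?_ ?_
  · rintro ⟨⟨a, b⟩, ⟨c, d⟩⟩ h
    simp only [Finset.mem_sigma, Finset.HasAntidiagonal.mem_antidiagonal, and_true] at h ⊢
    omega
  · rintro ⟨⟨a, b⟩, ⟨c, d⟩⟩ h
    simp only [Finset.mem_sigma, Finset.HasAntidiagonal.mem_antidiagonal, and_true] at h ⊢
    omega
  · rintro ⟨⟨a, b⟩, ⟨c, d⟩⟩ h
    simp only [Finset.mem_sigma, Finset.HasAntidiagonal.mem_antidiagonal] at h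
    simp [h.2]
  · rintro ⟨⟨a, b⟩, ⟨c, d⟩⟩ h
    simp only [Finset.mem_sigma, Finset.HasAntidiagonal.mem_antidiagonal] at h
    simp [h.2]
  · rintro ⟨⟨a, b⟩, ⟨c, d⟩⟩ h
    rfl

/-- The cocycle identity behind coassociativity. -/
theorem nil_cocycle [hpq : RootData p q] {a b c : A} (hab : a * b = q ^ 2 • (b * a)) (hbc : b * c = q ^ 2 • (c * b)) :
    nil p q (a + b) c + nil p q a b = nil p q a (b + c) + nil p q b c := by
  have hq := root_ne_zero p q
  have h0 := root_pos p q
  let W : ℕ → ℕ → ℕ → A := fun i j k =>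
    (q ^ (k ^ 2) * q⁻¹ ^ (i * j) * ((qFact q i)⁻¹ * (qFact q j)⁻¹ * (qFact q k)⁻¹)) •
      (a ^ i * b ^ j * c ^ k)
  have hL : ∑ x ∈ Finset.HasAntidiagonal.antidiagonal p, ((q ^ (x.2 ^ 2) * ((qFact q x.1)⁻¹ * (qFact q x.2)⁻¹)) •
        ((a + b) ^ x.1 * c ^ x.2)) +
      ∑ x ∈ Finset.HasAntidiagonal.antidiagonal p, ((q ^ (x.2 ^ 2) * ((qFact q x.1)⁻¹ * (qFact q x.2)⁻¹)) •
        (a ^ x.1 * b ^ x.2))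
      = ∑ x ∈ Finset.HasAntidiagonal.antidiagonal p, ∑ y ∈ Finset.HasAntidiagonal.antidiagonal x.1, W y.1 y.2 x.2 := by
    obtain ⟨m, hm⟩ := Nat.exists_eq_succ_of_ne_zero h0.ne'
    conv_lhs => arg 1; rw [hm, Finset.Nat.sum_antidiagonal_succ']
    conv_rhs => rw [hm, Finset.Nat.sum_antidiagonal_succ']
    simp only
    rw [← Nat.succ_eq_add_one, ← hm, qFact_root p q, inv_zero, zero_mul, mul_zero, zero_smul,
      zero_add, add_comm]
    congr 1
    · refine Finset.sum_congr rfl ?_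
      rintro ⟨i, j⟩ hij
      have hij' : i + j = p := by simpa using hij
      simp only [W, pow_zero, mul_one, qFact_zero, inv_one, one_mul]
      congr 2
      have e : q⁻¹ ^ (i * j) = q ^ (j ^ 2) :=
        root_inv_pow_eq p q ⟨j, by rw [← hij']; ring⟩
      rw [e]; simp
    · refine Finset.sum_congr rfl ?_
      rintro ⟨i, k⟩ hik
      have hik' : i + k = m := by simpa using hik
      simp only
      rw [add_pow_of_qcomm hq hab, Finset.sum_mul, Finset.smul_sum]
      refine Finset.sum_congr rfl ?_
      rintro ⟨x, y⟩ hxy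
      have hxy' : x + y = i := by simpa using hxy
      simp only [W]
      rw [smul_mul_assoc, smul_smul, qCoef_eq p q (by omega), hxy']
      congr 1
      have := qFact_ne_zero p q (j := i) (by omega)
      field_simp
  have hR : ∑ x ∈ Finset.HasAntidiagonal.antidiagonal p, ((q ^ (x.2 ^ 2) * ((qFact q x.1)⁻¹ * (qFact q x.2)⁻¹)) •
        (a ^ x.1 * (b + c) ^ x.2)) +
      ∑ x ∈ Finset.HasAntidiagonal.antidiagonal p, ((q ^ (x.2 ^ 2) * ((qFact q x.1)⁻¹ * (qFact q x.2)⁻¹)) •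
        (b ^ x.1 * c ^ x.2))
      = ∑ x ∈ Finset.HasAntidiagonal.antidiagonal p, ∑ y ∈ Finset.HasAntidiagonal.antidiagonal x.2, W x.1 y.1 y.2 := by
    obtain ⟨m, hm⟩ := Nat.exists_eq_succ_of_ne_zero h0.ne'
    rw [add_comm]
    conv_lhs => arg 2; rw [hm, Finset.Nat.sum_antidiagonal_succ]
    conv_rhs => rw [hm, Finset.Nat.sum_antidiagonal_succ]
    simp only
    rw [← Nat.succ_eq_add_one, ← hm, qFact_root p q, inv_zero, mul_zero, mul_zero, zero_smul,
      zero_add]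
    congr 1
    · refine Finset.sum_congr rfl ?_
      rintro ⟨i, j⟩ hij
      simp only [W, pow_zero, mul_one, qFact_zero, inv_one, one_mul, zero_mul]
    · refine Finset.sum_congr rfl ?_
      rintro ⟨i, k⟩ hik
      have hik' : i + k = m := by simpa using hik
      simp only
      rw [add_pow_of_qcomm hq hbc, Finset.mul_sum, Finset.smul_sum]
      refine Finset.sum_congr rfl ?_
      rintro ⟨x, y⟩ hxy
      have hxy' : x + y = k := by simpa using hxy
      simp only [W]
      rw [mul_smul_comm, smul_smul, qCoef_eq p q (by omega), hxy', mul_assoc (a ^ _)]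
      congr 1
      have := qFact_ne_zero p q (j := k) (by omega)
      have e1 : q⁻¹ ^ ((i + 1) * x) = q ^ (x ^ 2 + x * y) :=
        root_inv_pow_eq p q ⟨x, by rw [hm, ← hik', ← hxy', Nat.succ_eq_add_one]; ring⟩
      have e2 : q ^ (k ^ 2) * q⁻¹ ^ (x * y) = q ^ (y ^ 2) * q⁻¹ ^ ((i + 1) * x) := by
        have e3 : q ^ (x * y) * q⁻¹ ^ (x * y) = 1 := by
          rw [← mul_pow, mul_inv_cancel₀ hq, one_pow]
        rw [e1, ← pow_add, ← hxy', show (x + y) ^ 2 = (y ^ 2 + (x ^ 2 + x * y)) + x * y by ring,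
          pow_add _ _ (x * y), mul_assoc, e3, mul_one]
      rw [← e2]
      field_simp
  unfold nil
  rw [← smul_add, ← smul_add, hL, hR, sum_antidiagonal_assoc]

end RootAlgebra

/-! ### Smooth functions: derivations, translations and jets -/

/-- The algebra of smooth functions as a type of its own, so that all its instances come from
one commutative ring structure. -/
def Sm (V : Type) [NormedAddCommGroup V] [NormedSpace ℝ V] : Type := Smooth V

namespace Sm

section Structure

variable (V : Type) [NormedAddCommGroup V] [NormedSpace ℝ V]

def commRingStr : CommRing (Sm V) := inferInstanceAs (CommRing (Smooth V))

instance : CommRing (Sm V) := commRingStr V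

def algebraStr : Algebra ℂ (Sm V) := inferInstanceAs (Algebra ℂ (Smooth V))

instance : Algebra ℂ (Sm V) := algebraStr V

def starRingStr : StarRing (Sm V) := inferInstanceAs (StarRing (Smooth V))

instance : StarRing (Sm V) := starRingStr V

instance : StarModule ℂ (Sm V) := inferInstanceAs (StarModule ℂ (Smooth V))

end Structure

section Calculus

variable {V W : Type} [NormedAddCommGroup V] [NormedSpace ℝ V]
  [NormedAddCommGroup W] [NormedSpace ℝ W]

/-- Pull-back of functions along a smooth map. -/
def pullback (φ : V → W) (hφ : ContDiff ℝ ∞ φ) : Sm W →ₐ[ℂ] Sm V := FracSusy.pullback φ hφ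

/-- Derivative in the direction `v`. -/
def dirDeriv (v : V) : Sm V →ₗ[ℂ] Sm V := FracSusy.dirDeriv v

theorem ext' {f g : Sm V} (h : ∀ x, f.1 x = g.1 x) : f = g := Subtype.ext (funext h)

theorem differentiableAt (f : Sm V) (x : V) : DifferentiableAt ℝ f.1 x :=
  (Smooth.contDiff f).differentiable (by simp) x

theorem dirDeriv_apply (v : V) (f : Sm V) (x : V) :
    (dirDeriv v f).1 x = fderiv ℝ f.1 x v := rfl

theorem dirDeriv_mul (v : V) (f g : Sm V) :
    dirDeriv v (f * g) = f * dirDeriv v g + dirDeriv v f * g := by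
  refine ext' fun x => ?_
  change fderiv ℝ (f.1 * g.1) x v = f.1 x * fderiv ℝ g.1 x v + fderiv ℝ f.1 x v * g.1 x
  rw [fderiv_mul (f.differentiableAt x) (g.differentiableAt x)]
  simp [mul_comm]

theorem dirDeriv_one (v : V) : dirDeriv v (1 : Sm V) = 0 := by
  have h := dirDeriv_mul v (1 : Sm V) 1
  simpa using h

theorem dirDeriv_comm (v w : V) (f : Sm V) :
    dirDeriv v (dirDeriv w f) = dirDeriv w (dirDeriv v f) := by
  refine ext' fun x => ?_
  have hd : DifferentiableAt ℝ (fderiv ℝ f.1) x :=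
    ((Smooth.contDiff f).fderiv_right (m := ∞) (by simp)).differentiable (by simp) x
  have key : ∀ a b : V, (dirDeriv a (dirDeriv b f)).1 x = fderiv ℝ (fderiv ℝ f.1) x a b := by
    intro a b
    change fderiv ℝ (fun y => fderiv ℝ f.1 y b) x a = _
    rw [fderiv_clm_apply hd (differentiableAt_const b)]
    simp
  rw [key, key]
  exact ((Smooth.contDiff f).contDiffAt.isSymmSndFDerivAt
    (by simp only [minSmoothness_of_isRCLikeNormedField]; exact WithTop.coe_le_coe.2 le_top)) v w

theorem dirDeriv_star (v : V) (f : Sm V) : dirDeriv v (star f) = star (dirDeriv v f) := by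
  refine ext' fun x => ?_
  change fderiv ℝ (fun y => Complex.conjCLE (f.1 y)) x v = Complex.conjCLE (fderiv ℝ f.1 x v)
  have := (Complex.conjCLE.toContinuousLinearMap.hasFDerivAt.comp x
    (f.differentiableAt x).hasFDerivAt).fderiv
  exact congrArg (fun L => L v) this

theorem dirDeriv_pullback (φ : V → W) (hφ : ContDiff ℝ ∞ φ) (v : V) (f : Sm W) (x : V) :
    (dirDeriv v (pullback φ hφ f)).1 x = fderiv ℝ f.1 (φ x) (fderiv ℝ φ x v) := by
  have h := fderiv_comp x (f.differentiableAt (φ x)) (hφ.differentiable (by simp) x)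
  exact congrArg (fun L => L v) h

theorem dirDeriv_clm (v : V) (L : V →L[ℝ] ℝ) (f : Sm V) (hf : ∀ x, f.1 x = (L x : ℂ)) :
    dirDeriv v f = algebraMap ℂ (Sm V) (L v) := by
  refine ext' fun x => ?_
  have : f.1 = fun x => (Complex.ofRealCLM.comp L) x := funext fun x => by simp [hf]
  rw [dirDeriv_apply, this, ContinuousLinearMap.fderiv]
  rfl

end Calculus

open E11 (mul inv)

/-- The coordinate function `z_±`. -/
def z (s : ℤˣ) : Sm E11 := E11.z s

/-- The coordinate function `λ`. -/
def lam : Sm E11 := E11.lam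

/-- The function `e^{cλ}`. -/
def expLam (c : ℝ) : Sm E11 := E11.expLam c

/-- `∂/∂z_±` -/
def dz (s : ℤˣ) : Sm E11 →ₗ[ℂ] Sm E11 := dirDeriv (Pi.single s 1, 0)

/-- `∂/∂λ` -/
def dlam : Sm E11 →ₗ[ℂ] Sm E11 := dirDeriv (0, 1)

/-- `f ↦ (∂_+^t ∂_-^s ∂_λ^l f)(e)` -/
def jet (t s l : ℕ) : Sm E11 →ₗ[ℂ] ℂ := E11.jet t s l

/-- `f ↦ f ∘ μ`, where `μ` is the group multiplication. -/
def comulFun : Sm E11 →ₐ[ℂ] Sm (E11 × E11) := pullback _ E11.contDiff_mul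

/-- `f ↦ f ∘ inv` -/
def invFun : Sm E11 →ₐ[ℂ] Sm E11 := pullback _ E11.contDiff_inv

theorem sum_units {M : Type*} [AddCommMonoid M] (f : ℤˣ → M) : ∑ s, f s = f 1 + f (-1) := by
  rw [show (Finset.univ : Finset ℤˣ) = {1, -1} from rfl, Finset.sum_pair (by decide)]

theorem fderiv_eq (f : Sm E11) (g w : E11) :
    fderiv ℝ f.1 g w = ∑ s, (w.1 s : ℂ) * (dz s f).1 g + (w.2 : ℂ) * (dlam f).1 g := by
  have hw : w = ∑ s : ℤˣ, w.1 s • ((Pi.single s 1, 0) : E11) + w.2 • ((0, 1) : E11) := by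
    rw [sum_units]
    ext s
    · rcases Int.units_eq_one_or s with rfl | rfl <;> simp
    · simp
  conv_lhs => rw [hw]
  rw [map_add, map_sum]
  simp only [map_smul, Complex.real_smul]
  rfl

/-- The right invariant vector field `∂_λ + z_+ ∂_+ - z_- ∂_-`. -/
def boost : Sm E11 →ₗ[ℂ] Sm E11 :=
  dlam + ∑ s, sgn s • (LinearMap.mulLeft ℂ (z s) ∘ₗ dz s)

/-- The left invariant vector field `e^{±λ} ∂_±`. -/
def ldz (s : ℤˣ) : Sm E11 →ₗ[ℂ] Sm E11 :=
  LinearMap.mulLeft ℂ (expLam ((s : ℤ) : ℝ)) ∘ₗ dz s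

theorem boost_eq (f : Sm E11) : boost f = dlam f + ∑ s, sgn s • (z s * dz s f) := by
  simp [boost]

theorem boost_apply (f : Sm E11) (g : E11) :
    (boost f).1 g = fderiv ℝ f.1 g (fun s => ((s : ℤ) : ℝ) * g.1 s, 1) := by
  rw [fderiv_eq, boost_eq, sum_units, sum_units]
  change (dlam f).1 g + (sgn 1 * ((g.1 1 : ℂ) * (dz 1 f).1 g)
    + sgn (-1) * ((g.1 (-1) : ℂ) * (dz (-1) f).1 g)) = _
  simp [sgn]
  ring

theorem ldz_eq (s : ℤˣ) (f : Sm E11) : ldz s f = expLam ((s : ℤ) : ℝ) * dz s f := rfl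

theorem dz_mul (s : ℤˣ) (f g : Sm E11) : dz s (f * g) = f * dz s g + dz s f * g :=
  dirDeriv_mul _ f g

theorem dlam_mul (f g : Sm E11) : dlam (f * g) = f * dlam g + dlam f * g :=
  dirDeriv_mul _ f g

theorem boost_mul (f g : Sm E11) : boost (f * g) = f * boost g + boost f * g := by
  simp only [boost_eq, sum_units, dz_mul, dlam_mul, mul_add, add_mul, smul_add, mul_smul_comm,
    smul_mul_assoc]
  simp only [mul_left_comm, mul_assoc]
  abel

theorem dz_comm (s t : ℤˣ) (f : Sm E11) : dz s (dz t f) = dz t (dz s f) := dirDeriv_comm _ _ f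

theorem dlam_dz (s : ℤˣ) (f : Sm E11) : dlam (dz s f) = dz s (dlam f) := dirDeriv_comm _ _ f

theorem dz_star (s : ℤˣ) (f : Sm E11) : dz s (star f) = star (dz s f) := dirDeriv_star _ f

theorem dlam_star (f : Sm E11) : dlam (star f) = star (dlam f) := dirDeriv_star _ f

theorem star_z (s : ℤˣ) : star (z s) = z s :=
  ext' fun g => Complex.conj_ofReal (g.1 s)

theorem star_lam : star lam = lam := ext' fun g => Complex.conj_ofReal g.2

theorem star_sgn (s : ℤˣ) : star (sgn s) = sgn s := by simp [sgn]

theorem boost_star (f : Sm E11) : boost (star f) = star (boost f) := by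
  rw [boost_eq, boost_eq, star_add, star_sum, dlam_star]
  congr 1
  refine Finset.sum_congr rfl fun s _ => ?_
  rw [star_smul, star_mul, star_z, dz_star, star_sgn, mul_comm]

theorem dz_z (s t : ℤˣ) : dz s (z t) = if t = s then 1 else 0 := by
  have := dirDeriv_clm (V := E11) (Pi.single s 1, 0)
    ((ContinuousLinearMap.proj t).comp (ContinuousLinearMap.fst ℝ (ℤˣ → ℝ) ℝ)) (z t) (fun _ => rfl)
  rw [dz, this]
  by_cases h : t = s
  · subst h; simp
  · simp [h]

theorem dlam_z (t : ℤˣ) : dlam (z t) = 0 := by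
  have := dirDeriv_clm (V := E11) (0, 1)
    ((ContinuousLinearMap.proj t).comp (ContinuousLinearMap.fst ℝ (ℤˣ → ℝ) ℝ)) (z t) (fun _ => rfl)
  rw [dlam, this]
  simp

theorem dz_lam (s : ℤˣ) : dz s lam = 0 := by
  have := dirDeriv_clm (V := E11) (Pi.single s 1, 0)
    (ContinuousLinearMap.snd ℝ (ℤˣ → ℝ) ℝ) lam (fun _ => rfl)
  rw [dz, this]
  simp

theorem dlam_lam : dlam lam = 1 := by
  have := dirDeriv_clm (V := E11) (0, 1)
    (ContinuousLinearMap.snd ℝ (ℤˣ → ℝ) ℝ) lam (fun _ => rfl)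
  rw [dlam, this]
  simp

theorem dirDeriv_expLam (c : ℝ) (v : E11) :
    dirDeriv v (expLam c) = ((c * v.2 : ℝ) : ℂ) • expLam c := by
  refine ext' fun g => ?_
  rw [dirDeriv_apply]
  have h1 : HasFDerivAt (fun g : E11 => Real.exp (c * g.2))
      (Real.exp (c * g.2) • (c • ContinuousLinearMap.snd ℝ (ℤˣ → ℝ) ℝ)) g :=
    ((ContinuousLinearMap.snd ℝ (ℤˣ → ℝ) ℝ).hasFDerivAt.const_mul c).exp
  have h2 := (Complex.ofRealCLM.hasFDerivAt.comp g h1).fderiv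
  change fderiv ℝ (fun g : E11 => ((Real.exp (c * g.2) : ℝ) : ℂ)) g v
    = ((c * v.2 : ℝ) : ℂ) * ((Real.exp (c * g.2) : ℝ) : ℂ)
  refine (congrArg (fun L => L v) h2).trans ?_
  simp
  ring

theorem dz_expLam (s : ℤˣ) (c : ℝ) : dz s (expLam c) = 0 := by
  rw [dz, dirDeriv_expLam]; simp

theorem dlam_expLam (c : ℝ) : dlam (expLam c) = (c : ℂ) • expLam c := by
  rw [dlam, dirDeriv_expLam]; simp

theorem boost_expLam (c : ℝ) : boost (expLam c) = (c : ℂ) • expLam c := by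
  simp [boost_eq, dz_expLam, dlam_expLam]

theorem expLam_mul (c d : ℝ) : expLam c * expLam d = expLam (c + d) := by
  refine ext' fun g => ?_
  change ((Real.exp (c * g.2) : ℝ) : ℂ) * ((Real.exp (d * g.2) : ℝ) : ℂ)
    = ((Real.exp ((c + d) * g.2) : ℝ) : ℂ)
  rw [← Complex.ofReal_mul, ← Real.exp_add, add_mul]

theorem expLam_zero : expLam 0 = 1 := by
  refine ext' fun g => ?_
  change ((Real.exp (0 * g.2) : ℝ) : ℂ) = 1
  simp

theorem expLam_pow (c : ℝ) (n : ℕ) : expLam c ^ n = expLam (n * c) := by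
  induction n with
  | zero => simp [expLam_zero]
  | succ n ih => rw [pow_succ, ih, expLam_mul]; push_cast; ring_nf

theorem dz_boost (s : ℤˣ) (f : Sm E11) : dz s (boost f) = boost (dz s f) + sgn s • dz s f := by
  rw [boost_eq, boost_eq, map_add, map_sum, dlam_dz, add_assoc]
  congr 1
  simp only [map_smul, dz_mul, dz_z, smul_add, Finset.sum_add_distrib]
  congr 1
  · exact Finset.sum_congr rfl fun t _ => by rw [dz_comm]
  · rw [Finset.sum_eq_single s]
    · simp
    · intro t _ h; simp [h]
    · intro h; exact absurd (Finset.mem_univ s) h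

theorem dz_ldz (s t : ℤˣ) (f : Sm E11) : dz s (ldz t f) = ldz t (dz s f) := by
  rw [ldz_eq, ldz_eq, dz_mul, dz_expLam, zero_mul, add_zero, dz_comm]

theorem dlam_boost (f : Sm E11) : dlam (boost f) = boost (dlam f) := by
  rw [boost_eq, boost_eq, map_add, map_sum]
  congr 1
  refine Finset.sum_congr rfl fun t _ => ?_
  rw [map_smul, dlam_mul, dlam_z, zero_mul, add_zero, dlam_dz]

theorem boost_ldz (s : ℤˣ) (f : Sm E11) : boost (ldz s f) = ldz s (boost f) := by
  rw [ldz_eq, ldz_eq, boost_mul, boost_expLam, dz_boost, mul_add, smul_mul_assoc, mul_smul_comm]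
  simp [sgn]

/-- Right translation `f ↦ f(· h)`. -/
def rtrans (h : E11) : Sm E11 →ₐ[ℂ] Sm E11 :=
  pullback (fun g => mul g h) (E11.contDiff_mul.comp (contDiff_id.prodMk contDiff_const))

/-- Left translation `f ↦ f(g ·)`. -/
def ltrans (g : E11) : Sm E11 →ₐ[ℂ] Sm E11 :=
  pullback (fun h => mul g h) (E11.contDiff_mul.comp (contDiff_const.prodMk contDiff_id))

theorem rtrans_apply (h : E11) (f : Sm E11) (g : E11) : (rtrans h f).1 g = f.1 (mul g h) := rfl

theorem ltrans_apply (g : E11) (f : Sm E11) (h : E11) : (ltrans g f).1 h = f.1 (mul g h) := rfl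

theorem invFun_apply (f : Sm E11) (g : E11) : (invFun f).1 g = f.1 (inv g) := rfl

/-- The derivative of the function `t ↦ c e^{at}` composed with `λ`, times a linear coordinate. -/
theorem hasFDerivAt_exp (a b : ℝ) (g : E11) :
    HasFDerivAt (fun g : E11 => Real.exp (a * g.2) * b)
      (((a * Real.exp (a * g.2)) * b) • ContinuousLinearMap.snd ℝ (ℤˣ → ℝ) ℝ) g := by
  have h1 : HasFDerivAt (fun g : E11 => Real.exp (a * g.2))
      (Real.exp (a * g.2) • (a • ContinuousLinearMap.snd ℝ (ℤˣ → ℝ) ℝ)) g :=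
    ((ContinuousLinearMap.snd ℝ (ℤˣ → ℝ) ℝ).hasFDerivAt.const_mul a).exp
  convert! h1.mul_const b using 1
  ext
  · simp
  · simp; ring

theorem fderiv_mul_right (g h v : E11) : fderiv ℝ (fun g => mul g h) g v
    = (fun s => v.1 s + ((s : ℤ) : ℝ) * Real.exp (((s : ℤ) : ℝ) * g.2) * h.1 s * v.2, v.2) := by
  have h1 : HasFDerivAt (fun g : E11 => fun s => g.1 s + Real.exp (((s : ℤ) : ℝ) * g.2) * h.1 s)
      (ContinuousLinearMap.pi fun s : ℤˣ =>
        (ContinuousLinearMap.proj s).comp (ContinuousLinearMap.fst ℝ (ℤˣ → ℝ) ℝ)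
        + ((((s : ℤ) : ℝ) * Real.exp (((s : ℤ) : ℝ) * g.2)) * h.1 s) •
          ContinuousLinearMap.snd ℝ (ℤˣ → ℝ) ℝ) g :=
    hasFDerivAt_pi.2 fun s =>
      ((ContinuousLinearMap.proj s).comp
        (ContinuousLinearMap.fst ℝ (ℤˣ → ℝ) ℝ)).hasFDerivAt.add (hasFDerivAt_exp _ _ _)
  have h2 : HasFDerivAt (fun g : E11 => g.2 + h.2) (ContinuousLinearMap.snd ℝ (ℤˣ → ℝ) ℝ) g :=
    (ContinuousLinearMap.snd ℝ (ℤˣ → ℝ) ℝ).hasFDerivAt.add_const _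
  have h3 := (h1.prodMk h2).fderiv
  refine (congrArg (fun L => L v) h3).trans ?_
  ext s <;> simp

theorem fderiv_mul_left (g h v : E11) : fderiv ℝ (fun h => mul g h) h v
    = (fun s : ℤˣ => Real.exp (((s : ℤ) : ℝ) * g.2) * v.1 s, v.2) := by
  have h1 : HasFDerivAt (fun h : E11 => fun s => g.1 s + Real.exp (((s : ℤ) : ℝ) * g.2) * h.1 s)
      (ContinuousLinearMap.pi fun s : ℤˣ => Real.exp (((s : ℤ) : ℝ) * g.2) •
        (ContinuousLinearMap.proj s).comp (ContinuousLinearMap.fst ℝ (ℤˣ → ℝ) ℝ)) h :=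
    hasFDerivAt_pi.2 fun s => ((((ContinuousLinearMap.proj s).comp
        (ContinuousLinearMap.fst ℝ (ℤˣ → ℝ) ℝ)).hasFDerivAt.const_mul _).const_add _)
  have h2 : HasFDerivAt (fun h : E11 => g.2 + h.2) (ContinuousLinearMap.snd ℝ (ℤˣ → ℝ) ℝ) h :=
    (ContinuousLinearMap.snd ℝ (ℤˣ → ℝ) ℝ).hasFDerivAt.const_add _
  have h3 := (h1.prodMk h2).fderiv
  refine (congrArg (fun L => L v) h3).trans ?_
  ext s <;> simp

theorem fderiv_inv (g v : E11) : fderiv ℝ inv g v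
    = (fun s : ℤˣ => ((s : ℤ) : ℝ) * Real.exp (-(((s : ℤ) : ℝ) * g.2)) * g.1 s * v.2
        - Real.exp (-(((s : ℤ) : ℝ) * g.2)) * v.1 s, -v.2) := by
  have h0 : ∀ s : ℤˣ, HasFDerivAt (fun g : E11 => Real.exp (-(((s : ℤ) : ℝ) * g.2)))
      (Real.exp (-(((s : ℤ) : ℝ) * g.2)) • (-(((s : ℤ) : ℝ) •
        ContinuousLinearMap.snd ℝ (ℤˣ → ℝ) ℝ))) g := fun s =>
    ((ContinuousLinearMap.snd ℝ (ℤˣ → ℝ) ℝ).hasFDerivAt.const_mul _).neg.exp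
  have h1 : HasFDerivAt (fun g : E11 => fun s : ℤˣ => -(Real.exp (-(((s : ℤ) : ℝ) * g.2)) * g.1 s))
      (ContinuousLinearMap.pi fun s : ℤˣ => -(Real.exp (-(((s : ℤ) : ℝ) * g.2)) •
        (ContinuousLinearMap.proj s).comp (ContinuousLinearMap.fst ℝ (ℤˣ → ℝ) ℝ)
        + g.1 s • (Real.exp (-(((s : ℤ) : ℝ) * g.2)) • (-(((s : ℤ) : ℝ) •
        ContinuousLinearMap.snd ℝ (ℤˣ → ℝ) ℝ))))) g :=
    hasFDerivAt_pi.2 fun s => ((h0 s).mul ((ContinuousLinearMap.proj s).comp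
        (ContinuousLinearMap.fst ℝ (ℤˣ → ℝ) ℝ)).hasFDerivAt).neg
  have h2 : HasFDerivAt (fun h : E11 => -h.2) (-ContinuousLinearMap.snd ℝ (ℤˣ → ℝ) ℝ) g :=
    (ContinuousLinearMap.snd ℝ (ℤˣ → ℝ) ℝ).hasFDerivAt.neg
  have h3 := (h1.prodMk h2).fderiv
  refine (congrArg (fun L => L v) h3).trans ?_
  ext s <;> simp
  ring

theorem dz_rtrans (s : ℤˣ) (h : E11) (f : Sm E11) : dz s (rtrans h f) = rtrans h (dz s f) := by
  refine ext' fun g => ?_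
  rw [dz, rtrans, dirDeriv_pullback, fderiv_mul_right]
  change _ = fderiv ℝ f.1 (mul g h) (Pi.single s 1, 0)
  simp

theorem boost_rtrans (h : E11) (f : Sm E11) : boost (rtrans h f) = rtrans h (boost f) := by
  refine ext' fun g => ?_
  rw [boost_apply]
  refine (dirDeriv_pullback _ _ _ f g).trans ?_
  rw [fderiv_mul_right, rtrans_apply, boost_apply]
  congr 2
  ext s
  simp [mul]
  ring

theorem dz_ltrans (s : ℤˣ) (g : E11) (f : Sm E11) :
    dz s (ltrans g f) = (Real.exp (((s : ℤ) : ℝ) * g.2) : ℂ) • ltrans g (dz s f) := by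
  refine ext' fun h => ?_
  rw [dz, ltrans, dirDeriv_pullback, fderiv_mul_left]
  change _ = ((Real.exp (((s : ℤ) : ℝ) * g.2) : ℝ) : ℂ) * fderiv ℝ f.1 (mul g h) (Pi.single s 1, 0)
  rw [← Complex.real_smul, ← map_smul]
  congr 1
  ext t
  · simp only [Prod.smul_fst, Pi.smul_apply, smul_eq_mul]
    by_cases h : t = s
    · subst h; simp
    · simp [h]
  · simp

theorem dz_invFun (s : ℤˣ) (f : Sm E11) : dz s (invFun f) = -invFun (ldz s f) := by
  refine ext' fun g => ?_
  rw [dz, invFun, dirDeriv_pullback, fderiv_inv]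
  change _ = -(((Real.exp (((s : ℤ) : ℝ) * (inv g).2) : ℝ) : ℂ)
    * fderiv ℝ f.1 (inv g) (Pi.single s 1, 0))
  rw [← Complex.real_smul, ← map_smul, ← map_neg]
  congr 1
  ext t
  · by_cases h : t = s
    · subst h; simp [inv]
    · simp [h]
  · simp

theorem boost_invFun (f : Sm E11) : boost (invFun f) = -invFun (dlam f) := by
  refine ext' fun g => ?_
  rw [boost_apply]
  refine (dirDeriv_pullback _ _ _ f g).trans ?_
  rw [fderiv_inv]
  change _ = -(fderiv ℝ f.1 (inv g) (0, 1))
  rw [← map_neg]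
  congr 1
  ext t
  · simp; ring
  · simp

theorem mul_assoc' (g h k : E11) : mul (mul g h) k = mul g (mul h k) := by
  ext s
  · simp [mul, mul_add, Real.exp_add]; ring
  · simp [mul, add_assoc]

theorem zero_mul' (g : E11) : mul 0 g = g := by ext s <;> simp [mul]

theorem mul_zero' (g : E11) : mul g 0 = g := by ext s <;> simp [mul]

theorem inv_mul' (g : E11) : mul (inv g) g = 0 := by ext s <;> simp [mul, inv]

theorem inv_zero' : inv 0 = 0 := by ext s <;> simp [inv]

/-! #### Jets -/

theorem evalPt_boost (f : Sm E11) : (boost f).1 0 = (dlam f).1 0 := by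
  rw [boost_apply]
  change _ = fderiv ℝ f.1 0 (0, 1)
  congr 2
  ext s
  simp

theorem boost_pow_dlam (l : ℕ) (f : Sm E11) : (boost ^ l) (dlam f) = dlam ((boost ^ l) f) := by
  induction l generalizing f with
  | zero => rfl
  | succ l ih => rw [pow_succ, Module.End.mul_apply, ← dlam_boost, ih, Module.End.mul_apply]

theorem evalPt_boost_pow (l : ℕ) (f : Sm E11) :
    ((boost ^ l) f).1 0 = ((dlam ^ l) f).1 0 := by
  induction l generalizing f with
  | zero => rfl
  | succ l ih =>
    rw [pow_succ', Module.End.mul_apply, evalPt_boost, ← boost_pow_dlam, ih, pow_succ,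
      Module.End.mul_apply]

theorem jet_eq (t s l : ℕ) (f : Sm E11) :
    jet t s l f = ((boost ^ l) ((dz (-1) ^ s) ((dz 1 ^ t) f))).1 0 := by
  have c1 : Commute (dlam : Module.End ℂ (Sm E11)) (dz 1) := LinearMap.ext fun f => dlam_dz 1 f
  have c2 : Commute (dlam : Module.End ℂ (Sm E11)) (dz (-1)) :=
    LinearMap.ext fun f => dlam_dz (-1) f
  have c3 : Commute (dz 1 : Module.End ℂ (Sm E11)) (dz (-1)) :=
    LinearMap.ext fun f => dz_comm 1 (-1) f
  rw [evalPt_boost_pow, ← Module.End.mul_apply, ← Module.End.mul_apply]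
  change ((dz 1 ^ t * dz (-1) ^ s * dlam ^ l : Module.End ℂ (Sm E11)) f).1 0 = _
  rw [(c3.pow_pow t s).eq, mul_assoc (dlam ^ l), ((c2.pow_pow l s).mul_right (c1.pow_pow l t)).eq]

end Sm

section PowMod

variable {M : Type*} [Monoid M] {x : M} {p : ℕ}

theorem pow_toNat_emod (hp : 0 < p) (h : x ^ p = 1) {k : ℤ} {n : ℕ} (hn : k ≡ n [ZMOD p]) :
    x ^ (k % (p : ℤ)).toNat = x ^ n := by
  rw [pow_eq_pow_mod n h, pow_eq_pow_mod (k % (p : ℤ)).toNat h]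
  congr 1
  have hk : 0 ≤ k % (p : ℤ) := Int.emod_nonneg _ (by omega)
  zify
  rw [Int.toNat_of_nonneg hk, Int.emod_emod]
  exact hn

theorem pow_toNat_emod_add (hp : 0 < p) (h : x ^ p = 1) (a b : ℤ) :
    x ^ ((a + b) % (p : ℤ)).toNat = x ^ (a % (p : ℤ)).toNat * x ^ (b % (p : ℤ)).toNat := by
  have ha : 0 ≤ a % (p : ℤ) := Int.emod_nonneg _ (by omega)
  have hb : 0 ≤ b % (p : ℤ) := Int.emod_nonneg _ (by omega)
  rw [← pow_add]
  refine pow_toNat_emod hp h ?_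
  push_cast
  rw [Int.toNat_of_nonneg ha, Int.toNat_of_nonneg hb]
  exact ((Int.mod_modEq a p).add (Int.mod_modEq b p)).symm

end PowMod

/-- A submodule that contains `1` and is stable under left multiplication by a family of elements
that generates the algebra is everything. -/
theorem span_eq_top_of_mul_mem {A ι : Type*} [Ring A] [Algebra ℂ A] (g : ι → A)
    (ind : ∀ motive : A → Prop, (∀ c, motive (algebraMap ℂ A c)) → (∀ i, motive (g i)) →
      (∀ x y, motive x → motive y → motive (x * y)) →
      (∀ x y, motive x → motive y → motive (x + y)) → ∀ x, motive x)
    (W : Submodule ℂ A) (h1 : 1 ∈ W) (hg : ∀ i, ∀ w ∈ W, g i * w ∈ W) : W = ⊤ := by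
  refine Submodule.eq_top_iff'.2 fun x => ?_
  have := ind (fun x => ∀ w ∈ W, x * w ∈ W) (fun c w hw => by
      rw [← Algebra.smul_def]; exact W.smul_mem c hw) hg
    (fun x y hx hy w hw => by rw [mul_assoc]; exact hx _ (hy _ hw))
    (fun x y hx hy w hw => by rw [add_mul]; exact W.add_mem (hx _ hw) (hy _ hw)) x 1 h1
  simpa using this

/-! ### Generators and relations of `U_F` -/

namespace UAlg

/-- The defining relations of `U_F` for a family of elements of an algebra. -/
structure Rels (p : ℕ) (q : ℂ) (σ : ℤˣ) {B : Type*} [Ring B] [Algebra ℂ B]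
    (P sp : ℤˣ → B) (H kap : B) : Prop where
  P_comm : P 1 * P (-1) = P (-1) * P 1
  P_H : ∀ s, P s * H - H * P s = (sgn s * sgn σ * Complex.I) • P s
  sp_pow : ∀ s, sp s ^ p = P s
  sp_comm : sp 1 * sp (-1) = sp (-1) * sp 1
  kap_sp : ∀ s : ℤˣ, kap * sp s = q ^ (s : ℤ) • (sp s * kap)
  kap_pow : kap ^ p = 1
  kap_H : kap * H = H * kap
  sp_H : ∀ s, sp s * H - H * sp s = (sgn s * sgn σ * (Complex.I / p)) • sp s

end UAlg

/-- `U_F` as a type of its own, so that all its instances come from the ring structure. -/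
def UAlg (p : ℕ) (q : ℂ) (σ : ℤˣ) : Type := UF p q σ

namespace UAlg

def ringStr (p : ℕ) (q : ℂ) (σ : ℤˣ) : Ring (UAlg p q σ) := RingQuot.instRing _

instance (p : ℕ) (q : ℂ) (σ : ℤˣ) : Ring (UAlg p q σ) := ringStr p q σ

def algebraStr (p : ℕ) (q : ℂ) (σ : ℤˣ) : Algebra ℂ (UAlg p q σ) := RingQuot.instAlgebra _

instance (p : ℕ) (q : ℂ) (σ : ℤˣ) : Algebra ℂ (UAlg p q σ) := algebraStr p q σ

section Generators

variable (p : ℕ) (q : ℂ) (σ : ℤˣ)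

/-- The quotient map from the free algebra. -/
def mkHom : FreeAlgebra ℂ UGen →ₐ[ℂ] UAlg p q σ := RingQuot.mkAlgHom ℂ (URel p q σ)

def gen (x : UGen) : UAlg p q σ := mkHom p q σ (FreeAlgebra.ι ℂ x)

/-- `P_±` -/
def P (s : ℤˣ) : UAlg p q σ := gen p q σ (.bigP s)

/-- `H` -/
def H : UAlg p q σ := gen p q σ .ham

/-- `p_±` -/
def sp (s : ℤˣ) : UAlg p q σ := gen p q σ (.smallP s)

/-- `κ^k` -/
def kappa (k : ℤ) : UAlg p q σ := gen p q σ .kap ^ (k % (p : ℤ)).toNat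

/-- `φ^{nmkrsl}` -/
def phi (n m k r s l : ℕ) : UAlg p q σ :=
  sp p q σ 1 ^ n * sp p q σ (-1) ^ m * kappa p q σ k
    * P p q σ 1 ^ r * P p q σ (-1) ^ s * H p q σ ^ l

/-- The family `φ^{nmkrsl}`. -/
def phiFam (i : Idx p) : UAlg p q σ :=
  phi p q σ i.1 i.2.1 i.2.2.1 i.2.2.2.1 i.2.2.2.2.1 i.2.2.2.2.2

theorem mkHom_surjective : Function.Surjective (mkHom p q σ) :=
  RingQuot.mkAlgHom_surjective ℂ (URel p q σ)

theorem mkHom_rel {x y : FreeAlgebra ℂ UGen} (h : URel p q σ x y) :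
    mkHom p q σ x = mkHom p q σ y := RingQuot.mkAlgHom_rel ℂ h

end Generators

variable {p : ℕ} {q : ℂ} {σ : ℤˣ}

/-- The family of images of the generators. -/
def genFun {B : Type*} (P sp : ℤˣ → B) (H kap : B) : UGen → B
  | .bigP s => P s
  | .ham => H
  | .smallP s => sp s
  | .kap => kap

section Lift

variable {B : Type*} [Ring B] [Algebra ℂ B] {P sp : ℤˣ → B} {H kap : B}

/-- The universal property of `U_F`. -/
def lift (h : Rels p q σ P sp H kap) : UAlg p q σ →ₐ[ℂ] B :=
  RingQuot.liftAlgHom (A := FreeAlgebra ℂ UGen) (s := URel p q σ) ℂ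
    ⟨FreeAlgebra.lift ℂ (genFun P sp H kap), by
    intro x y hxy
    induction hxy <;>
      simp only [map_mul, map_sub, map_pow, map_smul, map_one, FreeAlgebra.lift_ι_apply, genFun]
    exacts [h.P_comm, h.P_H _, h.sp_pow _, h.sp_comm, h.kap_sp _, h.kap_pow, h.kap_H, h.sp_H _]⟩

theorem lift_gen (h : Rels p q σ P sp H kap) (x : UGen) :
    lift h (gen p q σ x) = genFun P sp H kap x := by
  exact (RingQuot.liftAlgHom_mkAlgHom_apply ℂ (FreeAlgebra.lift ℂ (genFun P sp H kap)) _
    (FreeAlgebra.ι ℂ x)).trans (FreeAlgebra.lift_ι_apply _ _)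

theorem lift_P (h : Rels p q σ P sp H kap) (s : ℤˣ) : lift h (UAlg.P p q σ s) = P s := lift_gen h _

theorem lift_H (h : Rels p q σ P sp H kap) : lift h (UAlg.H p q σ) = H := lift_gen h _

theorem lift_sp (h : Rels p q σ P sp H kap) (s : ℤˣ) : lift h (UAlg.sp p q σ s) = sp s :=
  lift_gen h _

theorem lift_kap (h : Rels p q σ P sp H kap) : lift h (gen p q σ .kap) = kap := lift_gen h _

end Lift

theorem induction {motive : UAlg p q σ → Prop} (hc : ∀ c, motive (algebraMap ℂ _ c))
    (hg : ∀ x, motive (gen p q σ x))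
    (hmul : ∀ x y, motive x → motive y → motive (x * y))
    (hadd : ∀ x y, motive x → motive y → motive (x + y)) (x : UAlg p q σ) : motive x := by
  obtain ⟨x, rfl⟩ := mkHom_surjective p q σ x
  induction x using FreeAlgebra.induction with
  | grade0 c => rw [AlgHom.commutes]; exact hc c
  | grade1 x => exact hg x
  | mul a b ha hb => rw [map_mul]; exact hmul _ _ ha hb
  | add a b ha hb => rw [map_add]; exact hadd _ _ ha hb

variable (p q σ)

theorem rels : Rels p q σ (P p q σ) (sp p q σ) (H p q σ) (gen p q σ .kap) where
  P_comm := by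
    simpa [P, sp, H, gen] using mkHom_rel p q σ (URel.bigP_comm)
  P_H s := by
    simpa [P, sp, H, gen] using mkHom_rel p q σ (URel.bigP_ham s)
  sp_pow s := by
    simpa [P, sp, H, gen] using mkHom_rel p q σ (URel.smallP_pow s)
  sp_comm := by
    simpa [P, sp, H, gen] using mkHom_rel p q σ (URel.smallP_comm)
  kap_sp s := by
    simpa [P, sp, H, gen] using mkHom_rel p q σ (URel.kap_smallP s)
  kap_pow := by
    simpa [P, sp, H, gen] using mkHom_rel p q σ (URel.kap_pow)
  kap_H := by
    simpa [P, sp, H, gen] using mkHom_rel p q σ (URel.kap_ham)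
  sp_H s := by
    simpa [P, sp, H, gen] using mkHom_rel p q σ (URel.smallP_ham s)

theorem sp_commute (s t : ℤˣ) : Commute (sp p q σ s) (sp p q σ t) := by
  have h : Commute (sp p q σ 1) (sp p q σ (-1)) := (rels p q σ).sp_comm
  rcases Int.units_eq_one_or s with rfl | rfl <;> rcases Int.units_eq_one_or t with rfl | rfl
  exacts [Commute.refl _, h, h.symm, Commute.refl _]

theorem H_mul_sp_pow (s : ℤˣ) (n : ℕ) : H p q σ * sp p q σ s ^ n = sp p q σ s ^ n * H p q σ
    - (n * (sgn s * sgn σ * (Complex.I / p))) • sp p q σ s ^ n := by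
  have h := (rels p q σ).sp_H s
  rw [sub_eq_iff_eq_add] at h
  induction n with
  | zero => simp
  | succ n ih =>
    rw [pow_succ, ← mul_assoc, ih, sub_mul, mul_assoc (sp p q σ s ^ n) (H p q σ), ← mul_assoc]
    rw [mul_assoc (sp p q σ s ^ n), mul_assoc (sp p q σ s ^ n) (sp p q σ s), h, mul_add,
      mul_smul_comm, smul_mul_assoc]
    push_cast
    rw [add_mul, add_smul, one_mul]
    abel

variable [hpq : RootData p q]

theorem kappa_natCast (n : ℕ) : kappa p q σ n = gen p q σ .kap ^ n :=
  pow_toNat_emod (root_pos p q) (rels p q σ).kap_pow (Int.ModEq.refl _)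

theorem kappa_one : kappa p q σ 1 = gen p q σ .kap := by
  simpa using kappa_natCast p q σ 1

theorem kappa_add (a b : ℤ) : kappa p q σ (a + b) = kappa p q σ a * kappa p q σ b :=
  pow_toNat_emod_add (root_pos p q) (rels p q σ).kap_pow a b

theorem kappa_zero : kappa p q σ 0 = 1 := by simpa using kappa_natCast p q σ 0

theorem kappa_mul_neg (a : ℤ) : kappa p q σ a * kappa p q σ (-a) = 1 := by
  rw [← kappa_add, add_neg_cancel, kappa_zero]

theorem kappa_neg_mul (a : ℤ) : kappa p q σ (-a) * kappa p q σ a = 1 := by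
  rw [← kappa_add, neg_add_cancel, kappa_zero]

theorem kap_sp_inv (s : ℤˣ) : kappa p q σ (-1) * sp p q σ s
    = (q ^ (s : ℤ))⁻¹ • (sp p q σ s * kappa p q σ (-1)) := by
  have hq : q ^ (s : ℤ) ≠ 0 := zpow_ne_zero _ (root_ne_zero p q)
  have h := (rels p q σ).kap_sp s
  rw [← kappa_one] at h
  have h2 : sp p q σ s * kappa p q σ (-1) = q ^ (s : ℤ) • (kappa p q σ (-1) * sp p q σ s) := by
    calc sp p q σ s * kappa p q σ (-1)
        = kappa p q σ (-1) * (kappa p q σ 1 * sp p q σ s) * kappa p q σ (-1) := by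
          rw [← mul_assoc, kappa_neg_mul, one_mul]
      _ = _ := by
          rw [h, mul_smul_comm, smul_mul_assoc, mul_assoc, mul_assoc, kappa_mul_neg, mul_one]
  rw [h2, smul_smul, inv_mul_cancel₀ hq, one_smul]

theorem kap_pow_P (s : ℤˣ) (k : ℕ) : Commute (gen p q σ .kap ^ k) (P p q σ s) := by
  have h := pow_mul_pow_of_qcomm ((rels p q σ).kap_sp s) k p
  rw [(rels p q σ).sp_pow] at h
  have : (q ^ (s : ℤ)) ^ (k * p) = 1 := by
    rw [mul_comm, pow_mul, root_pow p (q ^ (s : ℤ)), one_pow]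
  rw [this, one_smul] at h
  exact h

/-- `φ^{nmkrsl}` in terms of the generators `p_±`, `κ`, `H`. -/
theorem phi_eq (n m k r s l : ℕ) : phi p q σ n m k r s l
    = sp p q σ 1 ^ (n + p * r) * sp p q σ (-1) ^ (m + p * s) * gen p q σ .kap ^ k * H p q σ ^ l := by
  rw [phi, kappa_natCast, pow_add, pow_add, pow_mul, pow_mul, (rels p q σ).sp_pow,
    (rels p q σ).sp_pow]
  have c1 := (kap_pow_P p q σ 1 k).pow_right r
  have c2 := (kap_pow_P p q σ (-1) k).pow_right s
  have c3 : Commute (sp p q σ (-1) ^ m) (P p q σ 1 ^ r) := by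
    rw [← (rels p q σ).sp_pow, ← pow_mul]
    exact (sp_commute p q σ (-1) 1).pow_pow _ _
  congr 1
  simp only [mul_assoc]
  rw [← mul_assoc (gen p q σ .kap ^ k), c1.eq, mul_assoc (P p q σ 1 ^ r), c2.eq,
    ← mul_assoc (sp p q σ (-1) ^ m), c3.eq, mul_assoc]

theorem span_phiFam : Submodule.span ℂ (Set.range (phiFam p q σ)) = ⊤ := by
  have hR := rels p q σ
  let e : ℕ → ℕ → ℕ → ℕ → UAlg p q σ := fun a b k l =>
    sp p q σ 1 ^ a * sp p q σ (-1) ^ b * gen p q σ .kap ^ k * H p q σ ^ l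
  have he : ∀ a b k l, e a b k l ∈ Submodule.span ℂ (Set.range (phiFam p q σ)) := by
    intro a b k l
    have h0 := root_pos p q
    refine Submodule.subset_span ⟨(⟨a % p, Nat.mod_lt _ h0⟩, ⟨b % p, Nat.mod_lt _ h0⟩,
      ⟨k % p, Nat.mod_lt _ h0⟩, a / p, b / p, l), ?_⟩
    rw [phiFam, phi_eq, Nat.mod_add_div, Nat.mod_add_div, ← pow_eq_pow_mod k hR.kap_pow]
  refine span_eq_top_of_mul_mem (gen p q σ) (fun motive hc hg hm ha => induction hc hg hm ha) _
    ?_ ?_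
  · simpa [e] using he 0 0 0 0
  have hsp : ∀ s, ∀ w ∈ Submodule.span ℂ (Set.range (phiFam p q σ)),
      sp p q σ s * w ∈ Submodule.span ℂ (Set.range (phiFam p q σ)) := by
    intro s w hw
    induction hw using Submodule.span_induction with
    | zero => simp
    | add x y _ _ hx hy => rw [mul_add]; exact add_mem hx hy
    | smul c x _ hx => rw [mul_smul_comm]; exact Submodule.smul_mem _ _ hx
    | mem x hx =>
      obtain ⟨i, rfl⟩ := hx
      rw [phiFam, phi_eq]
      rcases Int.units_eq_one_or s with rfl | rfl
      · simp only [← mul_assoc, ← pow_succ']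
        exact he _ _ _ _
      · simp only [← mul_assoc]
        rw [((sp_commute p q σ (-1) 1).pow_right _).eq, mul_assoc (sp p q σ 1 ^ _), ← pow_succ']
        exact he _ _ _ _
  intro g w hw
  cases g with
  | smallP s => exact hsp s w hw
  | bigP s =>
    change P p q σ s * w ∈ _
    rw [← hR.sp_pow]
    have : ∀ n, sp p q σ s ^ n * w ∈ Submodule.span ℂ (Set.range (phiFam p q σ)) := by
      intro n
      induction n with
      | zero => simpa using hw
      | succ n ih => rw [pow_succ', mul_assoc]; exact hsp s _ ih
    exact this p
  | kap =>
    induction hw using Submodule.span_induction with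
    | zero => simp
    | add x y _ _ hx hy => rw [mul_add]; exact add_mem hx hy
    | smul c x _ hx => rw [mul_smul_comm]; exact Submodule.smul_mem _ _ hx
    | mem x hx =>
      obtain ⟨i, rfl⟩ := hx
      rw [phiFam, phi_eq]
      simp only [← mul_assoc]
      rw [mul_pow_of_qcomm (hR.kap_sp 1), smul_mul_assoc, mul_assoc (sp p q σ 1 ^ _),
        mul_pow_of_qcomm (hR.kap_sp (-1)), mul_smul_comm, smul_smul, smul_mul_assoc,
        smul_mul_assoc]
      refine Submodule.smul_mem _ _ ?_
      rw [← mul_assoc, mul_assoc _ (gen p q σ .kap), ← pow_succ']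
      exact he _ _ _ _
  | ham =>
    induction hw using Submodule.span_induction with
    | zero => simp
    | add x y _ _ hx hy => rw [mul_add]; exact add_mem hx hy
    | smul c x _ hx => rw [mul_smul_comm]; exact Submodule.smul_mem _ _ hx
    | mem x hx =>
      obtain ⟨i, rfl⟩ := hx
      rw [phiFam, phi_eq]
      change H p q σ * _ ∈ _
      have hk : Commute (H p q σ) (gen p q σ .kap) := hR.kap_H.symm
      simp only [← mul_assoc]
      rw [H_mul_sp_pow, sub_mul, sub_mul, sub_mul, smul_mul_assoc, smul_mul_assoc, smul_mul_assoc]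
      refine sub_mem ?_ (Submodule.smul_mem _ _ (he _ _ _ _))
      rw [mul_assoc (sp p q σ 1 ^ _) (H p q σ), H_mul_sp_pow, mul_sub, sub_mul, sub_mul,
        mul_smul_comm, smul_mul_assoc, smul_mul_assoc]
      refine sub_mem ?_ (Submodule.smul_mem _ _ (he _ _ _ _))
      rw [← mul_assoc, mul_assoc _ (H p q σ), (hk.pow_right _).eq, mul_assoc _ (_ * _),
        mul_assoc _ (H p q σ), ← pow_succ', ← mul_assoc]
      exact he _ _ _ _

end UAlg

/-! ### Involutions -/

/-- The opposite algebra with complex conjugate scalar multiplication. -/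
def ConjOp (A : Type*) : Type _ := Aᵐᵒᵖ

namespace ConjOp

variable {A : Type*}

/-- An element of `A` as an element of `ConjOp A`. -/
def mk (a : A) : ConjOp A := MulOpposite.op a

/-- An element of `ConjOp A` as an element of `A`. -/
def out (a : ConjOp A) : A := MulOpposite.unop a

@[simp] theorem out_mk (a : A) : out (mk a) = a := rfl

variable [Ring A]

instance : Ring (ConjOp A) := inferInstanceAs (Ring Aᵐᵒᵖ)

@[simp] theorem mk_one : mk (1 : A) = 1 := rfl
@[simp] theorem out_one : out (1 : ConjOp A) = 1 := rfl
theorem mk_mul (a b : A) : mk a * mk b = mk (b * a) := rfl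
theorem out_mul (a b : ConjOp A) : out (a * b) = out b * out a := rfl
theorem out_add (a b : ConjOp A) : out (a + b) = out a + out b := rfl
theorem mk_add (a b : A) : mk a + mk b = mk (a + b) := rfl
theorem mk_sub (a b : A) : mk a - mk b = mk (a - b) := rfl
@[simp] theorem mk_zero : mk (0 : A) = 0 := rfl
theorem mk_pow (a : A) (n : ℕ) : mk a ^ n = mk (a ^ n) := rfl

variable [Algebra ℂ A]

instance : Algebra ℂ (ConjOp A) :=
  RingHom.toAlgebra' (R := ℂ) (S := Aᵐᵒᵖ)
    ((algebraMap ℂ Aᵐᵒᵖ).comp (starRingEnd ℂ)) fun c x => Algebra.commutes (starRingEnd ℂ c) x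

theorem smul_mk (c : ℂ) (a : A) : c • mk a = mk (star c • a) := by
  rw [Algebra.smul_def, Algebra.smul_def, Algebra.commutes]
  rfl

theorem out_smul (c : ℂ) (a : ConjOp A) : out (c • a) = star c • out a :=
  congrArg out (smul_mk c (out a))

theorem out_algebraMap (c : ℂ) : out (algebraMap ℂ (ConjOp A) c) = algebraMap ℂ A (star c) := rfl

/-- The involution defined by an antilinear antiautomorphism of order two. -/
@[reducible] def starRing (θ : A →ₐ[ℂ] ConjOp A) (h : ∀ x, (θ (θ x).out).out = x) : StarRing A where
  star x := (θ x).out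
  star_involutive := h
  star_mul x y := by rw [map_mul, out_mul]
  star_add x y := by rw [map_add, out_add]

end ConjOp

/-! ### Antipodes -/

section Antipode

variable {A C : Type*} [Ring A] [Algebra ℂ A] [Ring C] [Algebra ℂ C]

theorem mul_rTensor_mul_of_eq {T : A →ₗ[ℂ] C} (hT : ∀ x y, T (x * y) = T y * T x) {u : A ⊗[ℂ] C}
    {c : ℂ} (hu : LinearMap.mul' ℂ C (T.rTensor C u) = algebraMap ℂ C c) (w : A ⊗[ℂ] C) :
    LinearMap.mul' ℂ C (T.rTensor C (u * w)) = c • LinearMap.mul' ℂ C (T.rTensor C w) := by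
  induction w with
  | zero => simp
  | add x y hx hy => rw [mul_add, map_add, map_add, hx, hy, map_add, map_add, smul_add]
  | tmul a b =>
    have : LinearMap.mul' ℂ C (T.rTensor C (u * a ⊗ₜ b))
        = T a * LinearMap.mul' ℂ C (T.rTensor C u) * b := by
      clear hu
      induction u with
      | zero => simp
      | add x y hx hy => rw [add_mul, map_add, map_add, hx, hy, map_add, map_add, mul_add, add_mul]
      | tmul x y => simp [hT, mul_assoc]
    rw [this, hu, ← Algebra.commutes, mul_assoc, ← Algebra.smul_def]
    simp

theorem mul_lTensor_mul_of_eq {T : A →ₗ[ℂ] C} (hT : ∀ x y, T (x * y) = T y * T x) (u : C ⊗[ℂ] A)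
    {w : C ⊗[ℂ] A} {c : ℂ} (hw : LinearMap.mul' ℂ C (T.lTensor C w) = algebraMap ℂ C c) :
    LinearMap.mul' ℂ C (T.lTensor C (u * w)) = c • LinearMap.mul' ℂ C (T.lTensor C u) := by
  induction u with
  | zero => simp
  | add x y hx hy => rw [add_mul, map_add, map_add, hx, hy, map_add, map_add, smul_add]
  | tmul a b =>
    have : LinearMap.mul' ℂ C (T.lTensor C (a ⊗ₜ b * w))
        = a * LinearMap.mul' ℂ C (T.lTensor C w) * T b := by
      clear hw
      induction w with
      | zero => simp
      | add x y hx hy => rw [mul_add, map_add, map_add, hx, hy, map_add, map_add, mul_add, add_mul]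
      | tmul x y => simp [hT, mul_assoc]
    rw [this, hw, ← Algebra.commutes, mul_assoc, ← Algebra.smul_def]
    simp

end Antipode

/-! ### The Hopf `*`-algebra `U_F` -/

namespace UAlg

theorem algHom_ext {p : ℕ} {q : ℂ} {σ : ℤˣ} {B : Type*} [Semiring B] [Algebra ℂ B]
    {f g : UAlg p q σ →ₐ[ℂ] B} (h : ∀ x, f (gen p q σ x) = g (gen p q σ x)) : f = g :=
  RingQuot.ringQuot_ext' (A := FreeAlgebra ℂ UGen) (s := URel p q σ) ℂ f g
    (FreeAlgebra.hom_ext (funext h))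

variable (p : ℕ) (q : ℂ) (σ : ℤˣ)

theorem kappa_commute_H (k : ℤ) : Commute (kappa p q σ k) (H p q σ) :=
  Commute.pow_left (rels p q σ).kap_H _

theorem kappa_congr {a b : ℤ} (h : a ≡ b [ZMOD p]) : kappa p q σ a = kappa p q σ b := by
  rw [kappa, kappa, h]

variable [hpq : RootData p q]

theorem star_zpow_root (p : ℕ) (q : ℂ) [RootData p q] (s : ℤˣ) : star (q ^ (s : ℤ)) = (q ^ (s : ℤ))⁻¹ := root_star p (q ^ (s : ℤ))

theorem star_rels : Rels p q σ (fun s => ConjOp.mk (P p q σ s)) (fun s => .mk (sp p q σ s))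
    (.mk (H p q σ)) (.mk (gen p q σ .kap)) := by
  have hR := rels p q σ
  have hI : ∀ (s : ℤˣ), star (sgn s * sgn σ * Complex.I) = -(sgn s * sgn σ * Complex.I) := by
    intro s; simp [sgn]
  have hI' : ∀ (s : ℤˣ), star (sgn s * sgn σ * (Complex.I / p))
      = -(sgn s * sgn σ * (Complex.I / p)) := by
    intro s; simp [sgn]; ring
  constructor
  · simp only [ConjOp.mk_mul, hR.P_comm]
  · intro s
    simp only [ConjOp.mk_mul, ConjOp.mk_sub, ConjOp.smul_mk, hI]
    rw [neg_smul, ← hR.P_H, neg_sub]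
  · intro s
    simp only [ConjOp.mk_pow, hR.sp_pow]
  · simp only [ConjOp.mk_mul, hR.sp_comm]
  · intro s
    have hq : q ^ (s : ℤ) ≠ 0 := zpow_ne_zero _ (root_ne_zero p q)
    simp only [ConjOp.mk_mul, ConjOp.smul_mk, hR.kap_sp, smul_smul, star_zpow_root p q s]
    rw [inv_mul_cancel₀ hq, one_smul]
  · simp only [ConjOp.mk_pow, hR.kap_pow, ConjOp.mk_one]
  · simp only [ConjOp.mk_mul, hR.kap_H]
  · intro s
    simp only [ConjOp.mk_mul, ConjOp.mk_sub, ConjOp.smul_mk, hI']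
    rw [neg_smul, ← hR.sp_H, neg_sub]

/-- The involution of `U_F` as a homomorphism to the conjugate opposite algebra. -/
def starHom : UAlg p q σ →ₐ[ℂ] ConjOp (UAlg p q σ) := lift (star_rels p q σ)

theorem starHom_gen (x : UGen) : starHom p q σ (gen p q σ x) = .mk (gen p q σ x) := by
  rw [starHom, lift_gen]
  cases x <;> rfl

instance : StarRing (UAlg p q σ) := ConjOp.starRing (starHom p q σ) fun x => by
  induction x using UAlg.induction with
  | hc c => simp only [AlgHom.commutes, ConjOp.out_algebraMap, star_star]
  | hg x => simp only [starHom_gen, ConjOp.out_mk]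
  | hmul x y hx hy => simp only [map_mul, ConjOp.out_mul, hx, hy]
  | hadd x y hx hy => simp only [map_add, ConjOp.out_add, hx, hy]

theorem star_def (x : UAlg p q σ) : star x = (starHom p q σ x).out := rfl

instance : StarModule ℂ (UAlg p q σ) where
  star_smul c x := by rw [star_def, map_smul, ConjOp.out_smul, star_def]

theorem star_gen (x : UGen) : star (gen p q σ x) = gen p q σ x := by
  rw [star_def, starHom_gen, ConjOp.out_mk]

theorem star_kappa (k : ℤ) : star (kappa p q σ k) = kappa p q σ k := by
  rw [kappa, star_pow, star_gen]

theorem comul_rels : Rels p q σ (fun s => P p q σ s ⊗ₜ[ℂ] (1 : UAlg p q σ) + 1 ⊗ₜ P p q σ s)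
    (fun s => sp p q σ s ⊗ₜ kappa p q σ 1 + kappa p q σ (-1) ⊗ₜ sp p q σ s)
    (H p q σ ⊗ₜ 1 + 1 ⊗ₜ H p q σ) (kappa p q σ 1 ⊗ₜ kappa p q σ 1) := by
  have hR := rels p q σ
  have hk1 : ∀ s, kappa p q σ 1 * sp p q σ s = q ^ (s : ℤ) • (sp p q σ s * kappa p q σ 1) := by
    intro s; rw [kappa_one]; exact hR.kap_sp s
  have hk2 := kap_sp_inv p q σ
  have hkp : ∀ k : ℤ, kappa p q σ k ^ p = 1 := by
    intro k; rw [kappa, ← pow_mul, mul_comm, pow_mul, hR.kap_pow, one_pow]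
  have hq : ∀ s : ℤˣ, q ^ (s : ℤ) ≠ 0 := fun s => zpow_ne_zero _ (root_ne_zero p q)
  have hPH : ∀ s, P p q σ s * H p q σ = (sgn s * sgn σ * Complex.I) • P p q σ s
      + H p q σ * P p q σ s := fun s => sub_eq_iff_eq_add.1 (hR.P_H s)
  have hspH : ∀ s, sp p q σ s * H p q σ = (sgn s * sgn σ * (Complex.I / p)) • sp p q σ s
      + H p q σ * sp p q σ s := fun s => sub_eq_iff_eq_add.1 (hR.sp_H s)
  constructor
  · simp only [mul_add, add_mul, Algebra.TensorProduct.tmul_mul_tmul, one_mul, mul_one, hR.P_comm]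
    abel
  · intro s
    simp only [mul_add, add_mul, Algebra.TensorProduct.tmul_mul_tmul, one_mul, mul_one, hPH,
      TensorProduct.add_tmul, TensorProduct.tmul_add, smul_add, TensorProduct.smul_tmul',
      TensorProduct.tmul_smul]
    abel
  · intro s
    rw [add_pow_root p (q ^ (s : ℤ)), Algebra.TensorProduct.tmul_pow,
      Algebra.TensorProduct.tmul_pow, hkp, hkp, hR.sp_pow]
    simp only [Algebra.TensorProduct.tmul_mul_tmul, hk1, hk2, TensorProduct.tmul_smul,
      TensorProduct.smul_tmul', smul_smul]
    congr 1
    field_simp [hq s]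
  · simp only [mul_add, add_mul, Algebra.TensorProduct.tmul_mul_tmul, hk1, hk2, hR.sp_comm,
      TensorProduct.tmul_smul, TensorProduct.smul_tmul']
    simp
    abel
  · intro s
    simp only [mul_add, add_mul, Algebra.TensorProduct.tmul_mul_tmul, hk1, smul_add,
      TensorProduct.tmul_smul, TensorProduct.smul_tmul', kappa_mul_neg, kappa_neg_mul]
  · rw [Algebra.TensorProduct.tmul_pow, hkp]; rfl
  · simp only [mul_add, add_mul, Algebra.TensorProduct.tmul_mul_tmul, one_mul, mul_one,
      (kappa_commute_H p q σ _).eq]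
  · intro s
    simp only [mul_add, add_mul, Algebra.TensorProduct.tmul_mul_tmul, one_mul, mul_one, hspH,
      TensorProduct.add_tmul, TensorProduct.tmul_add, smul_add, TensorProduct.smul_tmul',
      TensorProduct.tmul_smul, (kappa_commute_H p q σ _).eq]
    abel

/-- The coproduct of `U_F`. -/
def comulHom : UAlg p q σ →ₐ[ℂ] UAlg p q σ ⊗[ℂ] UAlg p q σ := lift (comul_rels p q σ)

theorem comulHom_P (s : ℤˣ) : comulHom p q σ (P p q σ s)
    = P p q σ s ⊗ₜ 1 + 1 ⊗ₜ P p q σ s := lift_P (comul_rels p q σ) s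

theorem comulHom_H : comulHom p q σ (H p q σ) = H p q σ ⊗ₜ 1 + 1 ⊗ₜ H p q σ :=
  lift_H (comul_rels p q σ)

theorem comulHom_sp (s : ℤˣ) : comulHom p q σ (sp p q σ s)
    = sp p q σ s ⊗ₜ kappa p q σ 1 + kappa p q σ (-1) ⊗ₜ sp p q σ s := lift_sp (comul_rels p q σ) s

theorem comulHom_kap : comulHom p q σ (gen p q σ .kap) = kappa p q σ 1 ⊗ₜ kappa p q σ 1 :=
  lift_kap (comul_rels p q σ)

theorem comulHom_kappa (k : ℤ) :
    comulHom p q σ (kappa p q σ k) = kappa p q σ k ⊗ₜ kappa p q σ k := by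
  rw [kappa, map_pow, comulHom_kap, Algebra.TensorProduct.tmul_pow, kappa_one]

theorem counit_rels : Rels p q σ (fun _ => (0 : ℂ)) (fun _ => 0) 0 1 := by
  constructor <;> simp [(root_pos p q).ne']

/-- The counit of `U_F`. -/
def counitHom : UAlg p q σ →ₐ[ℂ] ℂ := lift (counit_rels p q σ)

theorem counitHom_P (s : ℤˣ) : counitHom p q σ (P p q σ s) = 0 := lift_P (counit_rels p q σ) s

theorem counitHom_H : counitHom p q σ (H p q σ) = 0 := lift_H (counit_rels p q σ)

theorem counitHom_sp (s : ℤˣ) : counitHom p q σ (sp p q σ s) = 0 := lift_sp (counit_rels p q σ) s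

theorem counitHom_kap : counitHom p q σ (gen p q σ .kap) = 1 := lift_kap (counit_rels p q σ)

theorem counitHom_kappa (k : ℤ) : counitHom p q σ (kappa p q σ k) = 1 := by
  rw [kappa, map_pow, counitHom_kap, one_pow]

open MulOpposite in
theorem antipode_rels : Rels p q σ (fun s => op (-P p q σ s))
    (fun s => op (-(q ^ (s : ℤ) • sp p q σ s))) (op (-H p q σ)) (op (kappa p q σ (-1))) := by
  have hR := rels p q σ
  have hq : ∀ s : ℤˣ, q ^ (s : ℤ) ≠ 0 := fun s => zpow_ne_zero _ (root_ne_zero p q)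
  have hk2 := kap_sp_inv p q σ
  have hkp : ∀ k : ℤ, kappa p q σ k ^ p = 1 := by
    intro k; rw [kappa, ← pow_mul, mul_comm, pow_mul, hR.kap_pow, one_pow]
  constructor
  · simp only [← op_mul, neg_mul_neg, hR.P_comm]
  · intro s
    rw [← op_mul, ← op_mul, ← op_sub, ← op_smul, neg_mul_neg, neg_mul_neg, smul_neg, ← hR.P_H,
      neg_sub]
  · intro s
    rw [← op_pow, neg_pow, hpq.odd.neg_one_pow, smul_pow, hR.sp_pow, root_pow p (q ^ (s : ℤ)),
      one_smul, neg_one_mul]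
  · rw [← op_mul, ← op_mul, neg_mul_neg, neg_mul_neg, smul_mul_smul_comm, smul_mul_smul_comm,
      hR.sp_comm, mul_comm]
  · intro s
    rw [← op_mul, ← op_mul, ← op_smul, mul_neg, neg_mul, smul_mul_assoc, mul_smul_comm, hk2,
      smul_neg, smul_smul, smul_smul, mul_inv_cancel_right₀ (hq s)]
  · rw [← op_pow, hkp, op_one]
  · rw [← op_mul, ← op_mul, mul_neg, neg_mul, (kappa_commute_H p q σ _).eq]
  · intro s
    rw [← op_mul, ← op_mul, ← op_sub, ← op_smul, neg_mul_neg, neg_mul_neg, smul_neg,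
      smul_comm _ (q ^ (s : ℤ)), ← hR.sp_H, mul_smul_comm, smul_mul_assoc, ← smul_sub, ← smul_neg,
      neg_sub]

/-- The antipode of `U_F` as a homomorphism to the opposite algebra. -/
def antipodeHom : UAlg p q σ →ₐ[ℂ] (UAlg p q σ)ᵐᵒᵖ := lift (antipode_rels p q σ)

/-- The antipode of `U_F`. -/
def antipode : UAlg p q σ →ₗ[ℂ] UAlg p q σ :=
  (MulOpposite.opLinearEquiv ℂ).symm.toLinearMap ∘ₗ (antipodeHom p q σ).toLinearMap

theorem antipode_apply (x : UAlg p q σ) :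
    antipode p q σ x = MulOpposite.unop (antipodeHom p q σ x) := rfl

theorem antipode_mul (x y : UAlg p q σ) :
    antipode p q σ (x * y) = antipode p q σ y * antipode p q σ x := by
  rw [antipode_apply, map_mul]; rfl

theorem antipode_one : antipode p q σ 1 = 1 := by rw [antipode_apply, map_one]; rfl

theorem antipode_P (s : ℤˣ) : antipode p q σ (P p q σ s) = -P p q σ s :=
  congrArg MulOpposite.unop (lift_P (antipode_rels p q σ) s)

theorem antipode_H : antipode p q σ (H p q σ) = -H p q σ :=
  congrArg MulOpposite.unop (lift_H (antipode_rels p q σ))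

theorem antipode_sp (s : ℤˣ) : antipode p q σ (sp p q σ s) = -(q ^ (s : ℤ) • sp p q σ s) :=
  congrArg MulOpposite.unop (lift_sp (antipode_rels p q σ) s)

theorem antipode_kap : antipode p q σ (gen p q σ .kap) = kappa p q σ (-1) :=
  congrArg MulOpposite.unop (lift_kap (antipode_rels p q σ))

theorem antipode_pow (x : UAlg p q σ) (n : ℕ) :
    antipode p q σ (x ^ n) = antipode p q σ x ^ n := by
  rw [antipode_apply, map_pow]; rfl

theorem kappa_pow (k : ℤ) (n : ℕ) : kappa p q σ k ^ n = kappa p q σ (n * k) := by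
  induction n with
  | zero => simp [kappa_zero]
  | succ n ih => rw [pow_succ, ih, ← kappa_add]; push_cast; ring_nf

theorem antipode_kappa (k : ℤ) : antipode p q σ (kappa p q σ k) = kappa p q σ (-k) := by
  have h0 := root_pos p q
  rw [kappa, antipode_pow, antipode_kap, kappa_pow]
  apply kappa_congr
  rw [Int.toNat_of_nonneg (Int.emod_nonneg _ (by omega))]
  simpa using (Int.mod_modEq k p).mul_right (-1)

instance : Coalgebra ℂ (UAlg p q σ) :=
  (Bialgebra.ofAlgHom (comulHom p q σ) (counitHom p q σ)
    (algHom_ext fun x => by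
      cases x with
      | bigP s =>
        change _ = _
        simp only [AlgHom.comp_apply, ← P.eq_1, comulHom_P, map_add, Algebra.TensorProduct.map_tmul,
          AlgHom.id_apply, map_one, Algebra.TensorProduct.one_def, TensorProduct.add_tmul,
          TensorProduct.tmul_add]
        simp [add_assoc]
      | ham =>
        simp only [AlgHom.comp_apply, ← H.eq_1, comulHom_H, map_add, Algebra.TensorProduct.map_tmul,
          AlgHom.id_apply, map_one, Algebra.TensorProduct.one_def, TensorProduct.add_tmul,
          TensorProduct.tmul_add]
        simp [add_assoc]
      | smallP s =>
        simp only [AlgHom.comp_apply, ← sp.eq_1, comulHom_sp, map_add,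
          Algebra.TensorProduct.map_tmul, AlgHom.id_apply, comulHom_kappa, TensorProduct.add_tmul,
          TensorProduct.tmul_add]
        simp [add_assoc]
      | kap =>
        simp only [← kappa_one, AlgHom.comp_apply, comulHom_kappa, Algebra.TensorProduct.map_tmul,
          AlgHom.id_apply]
        simp)
    (algHom_ext fun x => by
      cases x with
      | bigP s => simp [← P.eq_1, comulHom_P, counitHom_P]
      | ham => simp [← H.eq_1, comulHom_H, counitHom_H]
      | smallP s => simp [← sp.eq_1, comulHom_sp, counitHom_sp, counitHom_kappa]
      | kap =>
        rw [← kappa_one]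
        simp [comulHom_kappa, counitHom_kappa])
    (algHom_ext fun x => by
      cases x with
      | bigP s => simp [← P.eq_1, comulHom_P, counitHom_P]
      | ham => simp [← H.eq_1, comulHom_H, counitHom_H]
      | smallP s => simp [← sp.eq_1, comulHom_sp, counitHom_sp, counitHom_kappa]
      | kap =>
        rw [← kappa_one]
        simp [comulHom_kappa, counitHom_kappa])).toCoalgebra

theorem comul_def (x : UAlg p q σ) : Coalgebra.comul (R := ℂ) x = comulHom p q σ x := rfl

theorem counit_def (x : UAlg p q σ) : Coalgebra.counit (R := ℂ) x = counitHom p q σ x := rfl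

theorem antipode_algebraMap (c : ℂ) :
    antipode p q σ (algebraMap ℂ _ c) = algebraMap ℂ _ c := by
  rw [Algebra.algebraMap_eq_smul_one, map_smul, antipode_one]

theorem isHopfStar : IsHopfStar (UAlg p q σ) (antipode p q σ) where
  comul_one := map_one (comulHom p q σ)
  comul_mul := map_mul (comulHom p q σ)
  counit_one := map_one (counitHom p q σ)
  counit_mul := map_mul (counitHom p q σ)
  antipode_left x := by
    have hk := (rels p q σ).kap_sp
    simp only [comul_def, counit_def]
    induction x using UAlg.induction with
    | hc c =>
      simp [Algebra.algebraMap_eq_smul_one, Algebra.TensorProduct.one_def, antipode_one]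
    | hg x =>
      cases x with
      | bigP s => simp [← P.eq_1, comulHom_P, counitHom_P, antipode_P, antipode_one]
      | ham => simp [← H.eq_1, comulHom_H, counitHom_H, antipode_H, antipode_one]
      | smallP s =>
        simp only [← sp.eq_1, comulHom_sp, counitHom_sp, map_add, LinearMap.rTensor_tmul,
          LinearMap.mul'_apply, antipode_sp, antipode_kappa, neg_neg, kappa_one, hk]
        simp
      | kap =>
        rw [← kappa_one]
        simp [comulHom_kappa, counitHom_kappa, antipode_kappa, kappa_neg_mul]
    | hmul x y hx hy =>
      rw [map_mul, mul_rTensor_mul_of_eq (antipode_mul p q σ) hx, hy, map_mul, map_mul,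
        ← Algebra.smul_def]
    | hadd x y hx hy => rw [map_add, map_add, map_add, hx, hy, map_add, map_add]
  antipode_right x := by
    have hk := kap_sp_inv p q σ
    have hq : ∀ s : ℤˣ, q ^ (s : ℤ) ≠ 0 := fun s => zpow_ne_zero _ (root_ne_zero p q)
    simp only [comul_def, counit_def]
    induction x using UAlg.induction with
    | hc c =>
      simp [Algebra.algebraMap_eq_smul_one, Algebra.TensorProduct.one_def, antipode_one]
    | hg x =>
      cases x with
      | bigP s => simp [← P.eq_1, comulHom_P, counitHom_P, antipode_P, antipode_one]
      | ham => simp [← H.eq_1, comulHom_H, counitHom_H, antipode_H, antipode_one]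
      | smallP s =>
        simp only [← sp.eq_1, comulHom_sp, counitHom_sp, map_add, LinearMap.lTensor_tmul,
          LinearMap.mul'_apply, antipode_sp, antipode_kappa, mul_neg, mul_smul_comm, hk,
          smul_smul, mul_inv_cancel₀ (hq s)]
        simp
      | kap =>
        rw [← kappa_one]
        simp [comulHom_kappa, counitHom_kappa, antipode_kappa, kappa_mul_neg]
    | hmul x y hx hy =>
      rw [map_mul, mul_lTensor_mul_of_eq (antipode_mul p q σ) _ hy, hx, map_mul, mul_comm, map_mul,
        ← Algebra.smul_def]
    | hadd x y hx hy => rw [map_add, map_add, map_add, hx, hy, map_add, map_add]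
  comul_star x := by
    simp only [comul_def]
    induction x using UAlg.induction with
    | hc c => simp [Algebra.algebraMap_eq_smul_one]
    | hg x =>
      rw [star_gen]
      cases x with
      | bigP s => rw [← P, comulHom_P]; simp [P, star_gen]
      | ham => rw [← H, comulHom_H]; simp [H, star_gen]
      | smallP s => rw [← sp, comulHom_sp]; simp [sp, star_gen, star_kappa]
      | kap => rw [comulHom_kap]; simp [star_kappa]
    | hmul x y hx hy => rw [star_mul, map_mul, hx, hy, map_mul, star_mul]
    | hadd x y hx hy => rw [star_add, map_add, hx, hy, map_add, star_add]
  counit_star x := by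
    simp only [counit_def]
    induction x using UAlg.induction with
    | hc c => simp [Algebra.algebraMap_eq_smul_one]
    | hg x =>
      rw [star_gen]
      cases x with
      | bigP s => rw [← P, counitHom_P]; simp
      | ham => rw [← H, counitHom_H]; simp
      | smallP s => rw [← sp, counitHom_sp]; simp
      | kap => rw [counitHom_kap]; simp
    | hmul x y hx hy => rw [star_mul, map_mul, hx, hy, map_mul, star_mul]
    | hadd x y hx hy => rw [star_add, map_add, hx, hy, map_add, star_add]

/-- The antipode reverses the coproduct. -/
theorem comul_antipode (x : UAlg p q σ) : comulHom p q σ (antipode p q σ x)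
    = TensorProduct.comm ℂ _ _ (TensorProduct.map (antipode p q σ) (antipode p q σ)
      (comulHom p q σ x)) := by
  have hmul : ∀ u w : UAlg p q σ ⊗[ℂ] UAlg p q σ,
      TensorProduct.comm ℂ _ _ (TensorProduct.map (antipode p q σ) (antipode p q σ) (u * w))
      = TensorProduct.comm ℂ _ _ (TensorProduct.map (antipode p q σ) (antipode p q σ) w)
        * TensorProduct.comm ℂ _ _ (TensorProduct.map (antipode p q σ) (antipode p q σ) u) := by
    intro u w
    induction u with
    | zero => simp
    | add x y hx hy => simp only [add_mul, map_add, hx, hy, mul_add]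
    | tmul a b =>
      induction w with
      | zero => simp
      | add x y hx hy => simp only [add_mul, map_add, hx, hy, mul_add]
      | tmul c d => simp [antipode_mul]
  induction x using UAlg.induction with
  | hc c =>
    simp [Algebra.algebraMap_eq_smul_one, Algebra.TensorProduct.one_def, antipode_one]
  | hg x =>
    cases x with
    | bigP s =>
      rw [← P, antipode_P, map_neg, comulHom_P]
      simp [antipode_P, antipode_one, TensorProduct.neg_tmul, TensorProduct.tmul_neg]
    | ham =>
      rw [← H, antipode_H, map_neg, comulHom_H]
      simp [antipode_H, antipode_one, TensorProduct.neg_tmul, TensorProduct.tmul_neg]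
    | smallP s =>
      rw [← sp, antipode_sp, map_neg, map_smul, comulHom_sp]
      simp [antipode_sp, antipode_kappa, TensorProduct.neg_tmul, TensorProduct.tmul_neg,
        TensorProduct.smul_tmul']
    | kap => rw [← kappa_one, antipode_kappa, comulHom_kappa, comulHom_kappa]; simp [antipode_kappa]
  | hmul x y hx hy => rw [antipode_mul, map_mul, hx, hy, map_mul, hmul]
  | hadd x y hx hy => simp only [map_add, hx, hy]

theorem antipode_star_antipode (x : UAlg p q σ) :
    antipode p q σ (star (antipode p q σ x)) = star x := by
  have hq : ∀ s : ℤˣ, q ^ (s : ℤ) ≠ 0 := fun s => zpow_ne_zero _ (root_ne_zero p q)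
  induction x using UAlg.induction with
  | hc c => simp [Algebra.algebraMap_eq_smul_one, antipode_one]
  | hg x =>
    cases x with
    | bigP s =>
      rw [← P, antipode_P, star_neg, map_neg, P, star_gen, ← P, antipode_P, neg_neg]
    | ham =>
      rw [← H, antipode_H, star_neg, map_neg, H, star_gen, ← H, antipode_H, neg_neg]
    | smallP s =>
      rw [← sp, antipode_sp, star_neg, map_neg, star_smul, map_smul, sp, star_gen, ← sp,
        antipode_sp, smul_neg, neg_neg, smul_smul, star_zpow_root p q s, inv_mul_cancel₀ (hq s),
        one_smul]
    | kap =>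
      rw [← kappa_one, antipode_kappa, star_kappa, antipode_kappa, star_kappa, neg_neg]
  | hmul x y hx hy => rw [antipode_mul, star_mul, antipode_mul, hx, hy, star_mul]
  | hadd x y hx hy => simp only [map_add, star_add, hx, hy]

end UAlg

/-! ### The algebra `A(E_q(1,1))` -/

/-- `A(E_q(1,1))` as a type of its own, so that all its instances come from the ring structure. -/
def AAlg (p : ℕ) (q : ℂ) : Type := Aq p q

namespace AAlg

/-- The defining relations of `A(E_q(1,1))` for a family of elements of an algebra. -/
structure Rels (p : ℕ) (q : ℂ) {B : Type*} [Ring B] [Algebra ℂ B] (e : ℤˣ → B) (d : B) : Prop where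
  eta_eta : e (-1) * e 1 = q ^ 2 • (e 1 * e (-1))
  eta_del : ∀ s, e s * d = q ^ 2 • (d * e s)
  eta_pow : ∀ s, e s ^ p = 0
  del_pow : d ^ p = 1

def ringStr (p : ℕ) (q : ℂ) : Ring (AAlg p q) := RingQuot.instRing _

instance (p : ℕ) (q : ℂ) : Ring (AAlg p q) := ringStr p q

def algebraStr (p : ℕ) (q : ℂ) : Algebra ℂ (AAlg p q) := RingQuot.instAlgebra _

instance (p : ℕ) (q : ℂ) : Algebra ℂ (AAlg p q) := algebraStr p q

section Generators

variable (p : ℕ) (q : ℂ)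

/-- The quotient map from the free algebra. -/
def mkHom : FreeAlgebra ℂ AGen →ₐ[ℂ] AAlg p q := RingQuot.mkAlgHom ℂ (ARel p q)

def gen (x : AGen) : AAlg p q := mkHom p q (FreeAlgebra.ι ℂ x)

/-- `η_±` -/
def eta (s : ℤˣ) : AAlg p q := gen p q (.eta s)

/-- `δ^k` -/
def delta (k : ℤ) : AAlg p q := gen p q .del ^ (k % (p : ℤ)).toNat

/-- `ζ(k, δ)` -/
def zeta (k : ℕ) : AAlg p q :=
  (1 / (p : ℂ)) • ∑ n ∈ Finset.range p, q⁻¹ ^ (n * k) • delta p q n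

/-- `η_+^n η_-^m ζ(k, δ)` -/
def mono (n m k : ℕ) : AAlg p q := eta p q 1 ^ n * eta p q (-1) ^ m * zeta p q k

theorem mkHom_surjective : Function.Surjective (mkHom p q) :=
  RingQuot.mkAlgHom_surjective ℂ (ARel p q)

theorem mkHom_rel {x y : FreeAlgebra ℂ AGen} (h : ARel p q x y) : mkHom p q x = mkHom p q y :=
  RingQuot.mkAlgHom_rel ℂ h

end Generators

variable {p : ℕ} {q : ℂ}

/-- The family of images of the generators. -/
def genFun {B : Type*} (e : ℤˣ → B) (d : B) : AGen → B
  | .eta s => e s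
  | .del => d

section Lift

variable {B : Type*} [Ring B] [Algebra ℂ B] {e : ℤˣ → B} {d : B}

/-- The universal property of `A(E_q(1,1))`. -/
def lift (h : Rels p q e d) : AAlg p q →ₐ[ℂ] B :=
  RingQuot.liftAlgHom (A := FreeAlgebra ℂ AGen) (s := ARel p q) ℂ
    ⟨FreeAlgebra.lift ℂ (genFun e d), by
    intro x y hxy
    induction hxy <;>
      simp only [map_mul, map_pow, map_smul, map_one, map_zero, FreeAlgebra.lift_ι_apply, genFun]
    exacts [h.eta_eta, h.eta_del _, h.eta_pow _, h.del_pow]⟩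

theorem lift_gen (h : Rels p q e d) (x : AGen) : lift h (gen p q x) = genFun e d x := by
  exact (RingQuot.liftAlgHom_mkAlgHom_apply ℂ (FreeAlgebra.lift ℂ (genFun e d)) _
    (FreeAlgebra.ι ℂ x)).trans (FreeAlgebra.lift_ι_apply _ _)

theorem lift_eta (h : Rels p q e d) (s : ℤˣ) : lift h (eta p q s) = e s := lift_gen h _

theorem lift_del (h : Rels p q e d) : lift h (gen p q .del) = d := lift_gen h _

end Lift

theorem induction {motive : AAlg p q → Prop} (hc : ∀ c, motive (algebraMap ℂ _ c))
    (hg : ∀ x, motive (gen p q x))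
    (hmul : ∀ x y, motive x → motive y → motive (x * y))
    (hadd : ∀ x y, motive x → motive y → motive (x + y)) (x : AAlg p q) : motive x := by
  obtain ⟨x, rfl⟩ := mkHom_surjective p q x
  induction x using FreeAlgebra.induction with
  | grade0 c => rw [AlgHom.commutes]; exact hc c
  | grade1 x => exact hg x
  | mul a b ha hb => rw [map_mul]; exact hmul _ _ ha hb
  | add a b ha hb => rw [map_add]; exact hadd _ _ ha hb

theorem algHom_ext {B : Type*} [Semiring B] [Algebra ℂ B] {f g : AAlg p q →ₐ[ℂ] B}
    (he : ∀ s, f (eta p q s) = g (eta p q s)) (hd : f (gen p q .del) = g (gen p q .del)) : f = g :=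
  RingQuot.ringQuot_ext' (A := FreeAlgebra ℂ AGen) (s := ARel p q) ℂ f g
    (FreeAlgebra.hom_ext (funext fun x => by
      cases x with
      | eta s => exact he s
      | del => exact hd))

variable (p q)

theorem rels : Rels p q (eta p q) (gen p q .del) where
  eta_eta := by simpa [eta, gen] using mkHom_rel p q ARel.eta_eta
  eta_del s := by simpa [eta, gen] using mkHom_rel p q (ARel.eta_del s)
  eta_pow s := by simpa [eta, gen] using mkHom_rel p q (ARel.eta_pow s)
  del_pow := by simpa [eta, gen] using mkHom_rel p q ARel.del_pow

theorem eta_pow_eq_zero (s : ℤˣ) {n : ℕ} (h : p ≤ n) : eta p q s ^ n = 0 :=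
  pow_eq_zero_of_le h ((rels p q).eta_pow s)

theorem delta_congr {a b : ℤ} (h : a ≡ b [ZMOD p]) : delta p q a = delta p q b := by
  rw [delta, delta, h]

variable [hpq : RootData p q]

theorem delta_natCast (n : ℕ) : delta p q n = gen p q .del ^ n :=
  pow_toNat_emod (root_pos p q) (rels p q).del_pow (Int.ModEq.refl _)

theorem delta_one : delta p q 1 = gen p q .del := by simpa using delta_natCast p q 1

theorem delta_add (a b : ℤ) : delta p q (a + b) = delta p q a * delta p q b :=
  pow_toNat_emod_add (root_pos p q) (rels p q).del_pow a b

theorem delta_zero : delta p q 0 = 1 := by simpa using delta_natCast p q 0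

theorem delta_mul_neg (a : ℤ) : delta p q a * delta p q (-a) = 1 := by
  rw [← delta_add, add_neg_cancel, delta_zero]

theorem delta_neg_mul (a : ℤ) : delta p q (-a) * delta p q a = 1 := by
  rw [← delta_add, neg_add_cancel, delta_zero]

theorem delta_pow (k : ℤ) (n : ℕ) : delta p q k ^ n = delta p q (n * k) := by
  induction n with
  | zero => simp [delta_zero]
  | succ n ih => rw [pow_succ, ih, ← delta_add]; push_cast; ring_nf

theorem delta_pow_root (k : ℤ) : delta p q k ^ p = 1 := by
  rw [delta, ← pow_mul, mul_comm, pow_mul, (rels p q).del_pow, one_pow]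

theorem eta_neg_mul (s : ℤˣ) :
    eta p q (-s) * eta p q s = (q ^ (s : ℤ)) ^ 2 • (eta p q s * eta p q (-s)) := by
  have h := (rels p q).eta_eta
  rcases Int.units_eq_one_or s with rfl | rfl
  · simpa using h
  · have := qcomm_symm (pow_ne_zero 2 (root_ne_zero p q)) h
    simpa using this

theorem eta_mul_neg (s : ℤˣ) :
    eta p q s * eta p q (-s) = ((q ^ (s : ℤ)) ^ 2)⁻¹ • (eta p q (-s) * eta p q s) :=
  qcomm_symm (pow_ne_zero 2 (root_ne_zero p (q ^ (s : ℤ)))) (eta_neg_mul p q s)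

theorem zpow_root_congr {a b : ℤ} (h : a ≡ b [ZMOD p]) : q ^ a = q ^ b := by
  obtain ⟨c, hc⟩ := h.dvd
  have hb : b = a + p * c := by linarith
  rw [hb, zpow_add₀ (root_ne_zero p q), zpow_mul, zpow_natCast, root_pow p q, one_zpow, mul_one]

theorem eta_mul_delta (s : ℤˣ) (k : ℤ) :
    eta p q s * delta p q k = (q ^ k) ^ 2 • (delta p q k * eta p q s) := by
  have h0 := root_pos p q
  have hk : 0 ≤ k % (p : ℤ) := Int.emod_nonneg _ (by omega)
  rw [delta, mul_pow_of_qcomm ((rels p q).eta_del s)]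
  congr 1
  rw [pow_right_comm, ← zpow_natCast q (k % p).toNat, Int.toNat_of_nonneg hk,
    zpow_root_congr p q (Int.mod_modEq k p)]

theorem delta_mul_eta (s : ℤˣ) (k : ℤ) :
    delta p q k * eta p q s = ((q ^ k) ^ 2)⁻¹ • (eta p q s * delta p q k) :=
  qcomm_symm (pow_ne_zero 2 (zpow_ne_zero _ (root_ne_zero p q))) (eta_mul_delta p q s k)

/-! #### The idempotents `ζ(k, δ)` and spanning -/

/-- `ζ(k, δ)` for an integer `k`. -/
def idem (k : ℤ) : AAlg p q :=
  (1 / (p : ℂ)) • ∑ n ∈ Finset.range p, ((q ^ k)⁻¹ • gen p q .del) ^ n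


theorem zeta_eq (k : ℕ) : zeta p q k = idem p q k := by
  rw [zeta, idem]
  congr 1
  refine Finset.sum_congr rfl fun n _ => ?_
  rw [delta_natCast, smul_pow, mul_comm n k, pow_mul, zpow_natCast, inv_pow]

theorem idem_congr {a b : ℤ} (h : a ≡ b [ZMOD p]) : idem p q a = idem p q b := by
  rw [idem, idem, zpow_root_congr p q h]

theorem del_mul_idem (k : ℤ) : gen p q .del * idem p q k = q ^ k • idem p q k := by
  have hq : q ^ k ≠ 0 := zpow_ne_zero _ (root_ne_zero p q)
  have h1 : ((q ^ k)⁻¹ • gen p q .del) ^ p = 1 := by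
    rw [smul_pow, (rels p q).del_pow, inv_pow, ← zpow_natCast, zpow_comm, zpow_natCast,
      root_pow p q, one_zpow, inv_one, one_smul]
  have h2 := mul_geom_sum ((q ^ k)⁻¹ • gen p q .del) p
  rw [h1, sub_self, sub_mul, one_mul, sub_eq_zero, smul_mul_assoc] at h2
  rw [idem, mul_smul_comm, smul_comm]
  congr 1
  conv_rhs => rw [← h2, smul_smul, mul_inv_cancel₀ hq, one_smul]

theorem sum_idem : ∑ k ∈ Finset.range p, idem p q k = 1 := by
  have h0 := root_pos p q
  have hq := root_ne_zero p q
  simp only [idem]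
  rw [← Finset.smul_sum, Finset.sum_comm]
  have key : ∀ n ∈ Finset.range p, n ≠ 0 →
      ∑ k ∈ Finset.range p, ((q ^ (k : ℤ))⁻¹ • gen p q .del) ^ n = 0 := by
    intro n hn hn0
    have hn' := Finset.mem_range.1 hn
    have h1 : ∑ k ∈ Finset.range p, (q⁻¹ ^ n) ^ k = 0 := by
      have hx := mul_geom_sum (q⁻¹ ^ n) p
      have hx1 : (q⁻¹ ^ n) ^ p = 1 := by
        rw [← pow_mul, mul_comm, pow_mul, inv_pow, root_pow p q, inv_one, one_pow]
      rw [hx1, sub_self] at hx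
      refine (mul_eq_zero.1 hx).resolve_left fun h => ?_
      have h' : q ^ n = 1 := by
        have := sub_eq_zero.1 h
        rwa [inv_pow, inv_eq_one] at this
      exact hpq.prim.pow_ne_one_of_pos_of_lt hn0 hn' h'
    have : ∀ k ∈ Finset.range p, ((q ^ (k : ℤ))⁻¹ • gen p q .del) ^ n
        = (q⁻¹ ^ n) ^ k • gen p q .del ^ n := by
      intro k _
      rw [smul_pow, zpow_natCast, ← inv_pow, pow_right_comm]
    rw [Finset.sum_congr rfl this, ← Finset.sum_smul, h1, zero_smul]
  rw [Finset.sum_eq_single 0 key (fun h => absurd (Finset.mem_range.2 h0) h)]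
  have hp : (p : ℂ) ≠ 0 := by exact_mod_cast h0.ne'
  simp only [pow_zero, Finset.sum_const, Finset.card_range]
  rw [← Nat.cast_smul_eq_nsmul ℂ, smul_smul, one_div, inv_mul_cancel₀ hp, one_smul]

/-- `η_+^n η_-^m ζ(k, δ)` with an integer index `k`. -/
def monoZ (n m : ℕ) (k : ℤ) : AAlg p q := eta p q 1 ^ n * eta p q (-1) ^ m * idem p q k

theorem mono_eq (n m k : ℕ) : mono p q n m k = monoZ p q n m k := by
  rw [mono, zeta_eq, monoZ]

theorem monoZ_congr (n m : ℕ) {a b : ℤ} (h : a ≡ b [ZMOD p]) :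
    monoZ p q n m a = monoZ p q n m b := by
  rw [monoZ, idem_congr p q h, monoZ]

theorem monoZ_eq_zero {n m : ℕ} (h : p ≤ n ∨ p ≤ m) (k : ℤ) : monoZ p q n m k = 0 := by
  rcases h with h | h <;> simp [monoZ, eta_pow_eq_zero p q _ h]

theorem span_monoZ : Submodule.span ℂ
    (Set.range fun i : Fin p × Fin p × Fin p => monoZ p q i.1 i.2.1 (i.2.2 : ℕ)) = ⊤ := by
  have h0 := root_pos p q
  have hR := rels p q
  have he : ∀ n m (k : ℕ), k < p → monoZ p q n m k ∈ Submodule.span ℂ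
      (Set.range fun i : Fin p × Fin p × Fin p => monoZ p q i.1 i.2.1 (i.2.2 : ℕ)) := by
    intro n m k hk
    by_cases h : p ≤ n ∨ p ≤ m
    · rw [monoZ_eq_zero p q h]; exact zero_mem _
    · push Not at h
      exact Submodule.subset_span ⟨(⟨n, h.1⟩, ⟨m, h.2⟩, ⟨k, hk⟩), rfl⟩
  refine span_eq_top_of_mul_mem (gen p q) (fun motive hc hg hm ha => induction hc hg hm ha) _ ?_ ?_
  · rw [← sum_idem p q]
    refine sum_mem fun k hk => ?_
    have := he 0 0 k (Finset.mem_range.1 hk)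
    simpa [monoZ] using this
  intro g w hw
  induction hw using Submodule.span_induction with
  | zero => simp
  | add x y _ _ hx hy => rw [mul_add]; exact add_mem hx hy
  | smul c x _ hx => rw [mul_smul_comm]; exact Submodule.smul_mem _ _ hx
  | mem x hx =>
    obtain ⟨⟨n, m, k⟩, rfl⟩ := hx
    have hd : gen p q .del * eta p q 1 = _ := qcomm_symm (pow_ne_zero 2 (root_ne_zero p q)) (hR.eta_del 1)
    have hd' : gen p q .del * eta p q (-1) = _ :=
      qcomm_symm (pow_ne_zero 2 (root_ne_zero p q)) (hR.eta_del (-1))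
    cases g with
    | eta s =>
      change eta p q s * _ ∈ _
      simp only [monoZ]
      rcases Int.units_eq_one_or s with rfl | rfl
      · rw [← mul_assoc, ← mul_assoc, ← pow_succ']
        exact he _ _ _ k.2
      · rw [← mul_assoc, ← mul_assoc, mul_pow_of_qcomm hR.eta_eta, smul_mul_assoc, smul_mul_assoc,
          mul_assoc (eta p q 1 ^ _), ← pow_succ']
        exact Submodule.smul_mem _ _ (he _ _ _ k.2)
    | del =>
      simp only [monoZ]
      rw [← mul_assoc, ← mul_assoc, mul_pow_of_qcomm hd, smul_mul_assoc, smul_mul_assoc,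
        mul_assoc (eta p q 1 ^ _), mul_pow_of_qcomm hd', mul_smul_comm, smul_mul_assoc, ← mul_assoc,
        mul_assoc _ (gen p q .del), del_mul_idem, mul_smul_comm]
      exact Submodule.smul_mem _ _ (Submodule.smul_mem _ _ (Submodule.smul_mem _ _ (he _ _ _ k.2)))

/-! #### The involution -/

theorem star_rels : Rels p q (fun s => ConjOp.mk (eta p q s)) (.mk (gen p q .del)) := by
  have hR := rels p q
  have hq := pow_ne_zero 2 (root_ne_zero p q)
  have hs : star (q ^ 2) = (q ^ 2)⁻¹ := by rw [star_pow, root_star p q, inv_pow]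
  constructor
  · simp only [ConjOp.mk_mul, ConjOp.smul_mk, hs, hR.eta_eta, smul_smul, inv_mul_cancel₀ hq,
      one_smul]
  · intro s
    simp only [ConjOp.mk_mul, ConjOp.smul_mk, hs, hR.eta_del, smul_smul, inv_mul_cancel₀ hq,
      one_smul]
  · intro s
    simp only [ConjOp.mk_pow, hR.eta_pow, ConjOp.mk_zero]
  · simp only [ConjOp.mk_pow, hR.del_pow, ConjOp.mk_one]

/-- The involution of `A(E_q(1,1))` as a homomorphism to the conjugate opposite algebra. -/
def starHom : AAlg p q →ₐ[ℂ] ConjOp (AAlg p q) := lift (star_rels p q)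

theorem starHom_gen (x : AGen) : starHom p q (gen p q x) = .mk (gen p q x) := by
  rw [starHom, lift_gen]
  cases x <;> rfl

instance : StarRing (AAlg p q) := ConjOp.starRing (starHom p q) fun x => by
  induction x using AAlg.induction with
  | hc c => simp only [AlgHom.commutes, ConjOp.out_algebraMap, star_star]
  | hg x => simp only [starHom_gen, ConjOp.out_mk]
  | hmul x y hx hy => simp only [map_mul, ConjOp.out_mul, hx, hy]
  | hadd x y hx hy => simp only [map_add, ConjOp.out_add, hx, hy]

theorem star_def (x : AAlg p q) : star x = (starHom p q x).out := rfl

instance : StarModule ℂ (AAlg p q) where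
  star_smul c x := by rw [star_def, map_smul, ConjOp.out_smul, star_def]

theorem star_gen (x : AGen) : star (gen p q x) = gen p q x := by
  rw [star_def, starHom_gen, ConjOp.out_mk]

theorem star_eta (s : ℤˣ) : star (eta p q s) = eta p q s := star_gen p q _

theorem star_delta (k : ℤ) : star (delta p q k) = delta p q k := by
  rw [delta, star_pow, star_gen]

end AAlg

/-! ### Evaluation of smooth functions with values in an algebra -/

section Eval

variable {V : Type} [NormedAddCommGroup V] [NormedSpace ℝ V]

/-- Evaluation at a point as an algebra homomorphism. -/
def evHom (x : V) : Sm V →ₐ[ℂ] ℂ where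
  toFun f := f.1 x
  map_one' := rfl
  map_mul' _ _ := rfl
  map_zero' := rfl
  map_add' _ _ := rfl
  commutes' _ := rfl

theorem evHom_apply (x : V) (f : Sm V) : evHom x f = f.1 x := rfl

variable {M : Type} [Ring M] [Algebra ℂ M]

/-- Evaluation at a point of algebra valued functions as an algebra homomorphism. -/
def evalHom (x : V) : Sm V ⊗[ℂ] M →ₐ[ℂ] M :=
  Algebra.TensorProduct.lift ((Algebra.ofId ℂ M).comp (evHom x)) (AlgHom.id ℂ M)
    fun _ _ => Algebra.commute_algebraMap_left _ _

theorem evalHom_tmul (x : V) (f : Sm V) (m : M) : evalHom x (f ⊗ₜ[ℂ] m) = f.1 x • m := by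
  rw [Algebra.smul_def]
  rfl

/-- Evaluation at a point of a smooth function with values in `M`. -/
def evalLin {M : Type} [AddCommMonoid M] [Module ℂ M] (x : V) : Sm V ⊗[ℂ] M →ₗ[ℂ] M :=
  (TensorProduct.lid ℂ M).toLinearMap ∘ₗ (evHom x).toLinearMap.rTensor M

theorem evalLin_eq (x : V) : evalLin x = (evalHom x : Sm V ⊗[ℂ] M →ₐ[ℂ] M).toLinearMap :=
  TensorProduct.ext' fun f m => (evalHom_tmul x f m).symm

end Eval

/-! ### Taylor expansion in nilpotent directions -/

section Taylor

variable {B : Type*} [Ring B] [Algebra ℂ B]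

/-- `f ↦ ρ(f) + ρ(Df) n` -/
def stepMap (ρ : Sm E11 →ₗ[ℂ] B) (D : Sm E11 →ₗ[ℂ] Sm E11) (n : B) :
    Sm E11 →ₗ[ℂ] B :=
  ρ + LinearMap.mulRight ℂ n ∘ₗ ρ ∘ₗ D

theorem stepMap_apply (ρ : Sm E11 →ₗ[ℂ] B) (D : Sm E11 →ₗ[ℂ] Sm E11) (n : B)
    (f : Sm E11) : stepMap ρ D n f = ρ f + ρ (D f) * n := rfl

theorem stepMap_mul {ρ : Sm E11 →ₗ[ℂ] B} (hρ : ∀ f g, ρ (f * g) = ρ f * ρ g)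
    {D : Sm E11 →ₗ[ℂ] Sm E11} (hD : ∀ f g, D (f * g) = f * D g + D f * g) {n : B}
    (hn : n * n = 0) (hc : ∀ f, Commute n (ρ f)) (f g : Sm E11) :
    stepMap ρ D n (f * g) = stepMap ρ D n f * stepMap ρ D n g := by
  have h2 : ρ (D f) * n * (ρ (D g) * n) = 0 := by
    rw [mul_assoc, ← mul_assoc n, (hc _).eq, mul_assoc _ n, hn, mul_zero, mul_zero]
  simp only [stepMap_apply, hD, map_add, hρ, add_mul, mul_add, h2, mul_assoc, (hc _).eq]
  abel

/-- The Taylor expansion of `ρ(f(z_+ + n_+, z_- + n_-, λ))` for `n_±` with square zero. -/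
def tay (ρ : Sm E11 →ₗ[ℂ] B) (n : ℤˣ → B) : Sm E11 →ₗ[ℂ] B :=
  stepMap (stepMap ρ (Sm.dz 1) (n 1)) (Sm.dz (-1)) (n (-1))

theorem tay_apply (ρ : Sm E11 →ₗ[ℂ] B) (n : ℤˣ → B) (f : Sm E11) :
    tay ρ n f = ρ f + ρ (Sm.dz 1 f) * n 1 + ρ (Sm.dz (-1) f) * n (-1)
      + ρ (Sm.dz 1 (Sm.dz (-1) f)) * (n 1 * n (-1)) := by
  simp only [tay, stepMap_apply, add_mul, mul_assoc]
  abel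

theorem tay_mul {ρ : Sm E11 →ₗ[ℂ] B} (hρ : ∀ f g, ρ (f * g) = ρ f * ρ g) {n : ℤˣ → B}
    (hn : ∀ s, n s * n s = 0) (hc : ∀ s f, Commute (n s) (ρ f)) (hnn : Commute (n 1) (n (-1)))
    (f g : Sm E11) : tay ρ n (f * g) = tay ρ n f * tay ρ n g :=
  stepMap_mul (stepMap_mul hρ (Sm.dz_mul 1) (hn 1) (hc 1)) (Sm.dz_mul (-1)) (hn (-1))
    (fun _ => (hc (-1) _).add_right ((hc (-1) _).mul_right hnn.symm)) f g

theorem tay_one (ρ : Sm E11 →ₗ[ℂ] B) (n : ℤˣ → B) : tay ρ n 1 = ρ 1 := by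
  have h : ∀ s, Sm.dz s 1 = 0 := fun s => Sm.dirDeriv_one _
  simp [tay_apply, h]

theorem tay_map {C : Type*} [Ring C] [Algebra ℂ C] (Φ : B →ₐ[ℂ] C) (ρ : Sm E11 →ₗ[ℂ] B)
    (n : ℤˣ → B) (f : Sm E11) :
    Φ (tay ρ n f) = tay (Φ.toLinearMap ∘ₗ ρ) (fun s => Φ (n s)) f := by
  simp [tay_apply]

theorem tay_zero (ρ : Sm E11 →ₗ[ℂ] B) (f : Sm E11) : tay ρ (fun _ => 0) f = ρ f := by
  simp [tay_apply]

theorem tay_tay (ρ : Sm E11 →ₗ[ℂ] B) {a b : ℤˣ → B} (h : Commute (a (-1)) (b 1))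
    (f : Sm E11) : tay (tay ρ a) b f = ρ f + ρ (Sm.dz 1 f) * (a 1 + b 1)
      + ρ (Sm.dz (-1) f) * (a (-1) + b (-1)) + ρ (Sm.dz 1 (Sm.dz 1 f)) * (a 1 * b 1)
      + ρ (Sm.dz (-1) (Sm.dz (-1) f)) * (a (-1) * b (-1))
      + ρ (Sm.dz 1 (Sm.dz (-1) f)) * ((a 1 + b 1) * (a (-1) + b (-1)))
      + ρ (Sm.dz 1 (Sm.dz 1 (Sm.dz (-1) f))) * ((a 1 * b 1) * (a (-1) + b (-1)))
      + ρ (Sm.dz 1 (Sm.dz (-1) (Sm.dz (-1) f))) * ((a 1 + b 1) * (a (-1) * b (-1)))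
      + ρ (Sm.dz 1 (Sm.dz 1 (Sm.dz (-1) (Sm.dz (-1) f)))) * ((a 1 * b 1) * (a (-1) * b (-1)))
      := by
  have e : ∀ g, Sm.dz (-1) (Sm.dz 1 g) = Sm.dz 1 (Sm.dz (-1) g) := fun g => Sm.dz_comm _ _ g
  have h1 : ∀ x, a (-1) * (b 1 * x) = b 1 * (a (-1) * x) := fun x => by
    rw [← mul_assoc, h.eq, mul_assoc]
  simp only [tay_apply, e, mul_add, add_mul, mul_assoc, h1, h.eq]
  abel

/-- Expansions in two commuting steps only depend on the sum of the steps. -/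
theorem tay_tay_congr (ρ : Sm E11 →ₗ[ℂ] B) {a b c d : ℤˣ → B} (h : Commute (a (-1)) (b 1))
    (h' : Commute (c (-1)) (d 1)) (hab : ∀ s, Commute (a s) (b s)) (hcd : ∀ s, Commute (c s) (d s))
    (ha : ∀ s, a s * a s = 0) (hb : ∀ s, b s * b s = 0) (hc : ∀ s, c s * c s = 0)
    (hd : ∀ s, d s * d s = 0) (hs : ∀ s, a s + b s = c s + d s) (f : Sm E11) :
    tay (tay ρ a) b f = tay (tay ρ c) d f := by
  have hsq : ∀ {x y : B}, Commute x y → x * x = 0 → y * y = 0 →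
      (x + y) * (x + y) = (2 : ℂ) • (x * y) := by
    intro x y hxy hx hy
    rw [two_smul]
    simp only [mul_add, add_mul, hx, hy, hxy.eq]
    abel
  have hp : ∀ s, a s * b s = c s * d s := by
    intro s
    have h1 := hsq (hab s) (ha s) (hb s)
    rw [hs, hsq (hcd s) (hc s) (hd s)] at h1
    exact (smul_right_injective B (two_ne_zero (α := ℂ)) h1).symm
  rw [tay_tay ρ h, tay_tay ρ h']
  simp only [hs, hp]

end Taylor

/-! ### The coproduct of `A_F` -/

/-- `A_F = A(E(1,1)) ⊗ A(E_q(1,1))` -/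
abbrev AFAlg (p : ℕ) (q : ℂ) : Type := Sm E11 ⊗[ℂ] AAlg p q

/-- The completed tensor square of `A_F`. -/
abbrev AFAlg2 (p : ℕ) (q : ℂ) : Type := Sm (E11 × E11) ⊗[ℂ] (AAlg p q ⊗[ℂ] AAlg p q)

namespace AFAlg

variable {p : ℕ} {q : ℂ}

/-- `F(·, h)` for `F` in the completed tensor square. -/
def sliceL (h : E11) : AFAlg2 p q →ₗ[ℂ] AFAlg p q ⊗[ℂ] AAlg p q :=
  (TensorProduct.assoc ℂ (Sm E11) (AAlg p q) (AAlg p q)).symm.toLinearMap ∘ₗ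
    (Sm.pullback (fun g : E11 => (g, h)) (by fun_prop)).toLinearMap.rTensor (AAlg p q ⊗[ℂ] AAlg p q)

/-- `F(g, ·)` for `F` in the completed tensor square. -/
def sliceR (g : E11) : AFAlg2 p q →ₗ[ℂ] AAlg p q ⊗[ℂ] AFAlg p q :=
  (TensorProduct.leftComm ℂ (Sm E11) (AAlg p q) (AAlg p q)).toLinearMap ∘ₗ
    (Sm.pullback (fun h : E11 => (g, h)) (by fun_prop)).toLinearMap.rTensor (AAlg p q ⊗[ℂ] AAlg p q)

/-- `sliceL` as an algebra homomorphism. -/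
def sliceLHom (h : E11) : AFAlg2 p q →ₐ[ℂ] AFAlg p q ⊗[ℂ] AAlg p q :=
  (Algebra.TensorProduct.assoc ℂ ℂ ℂ (Sm E11) (AAlg p q) (AAlg p q)).symm.toAlgHom.comp
    (Algebra.TensorProduct.map (Sm.pullback (fun g : E11 => (g, h)) (by fun_prop)) (AlgHom.id ℂ _))

/-- `sliceR` as an algebra homomorphism. -/
def sliceRHom (g : E11) : AFAlg2 p q →ₐ[ℂ] AAlg p q ⊗[ℂ] AFAlg p q :=
  (Algebra.TensorProduct.leftComm ℂ (Sm E11) (AAlg p q) (AAlg p q)).toAlgHom.comp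
    (Algebra.TensorProduct.map (Sm.pullback (fun h : E11 => (g, h)) (by fun_prop)) (AlgHom.id ℂ _))

theorem sliceLHom_tmul (h : E11) (F : Sm (E11 × E11)) (a b : AAlg p q) :
    sliceLHom h (F ⊗ₜ[ℂ] (a ⊗ₜ[ℂ] b))
      = (Sm.pullback (fun g : E11 => (g, h)) (by fun_prop) F ⊗ₜ[ℂ] a) ⊗ₜ[ℂ] b := rfl

theorem sliceRHom_tmul (g : E11) (F : Sm (E11 × E11)) (a b : AAlg p q) :
    sliceRHom g (F ⊗ₜ[ℂ] (a ⊗ₜ[ℂ] b))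
      = a ⊗ₜ[ℂ] (Sm.pullback (fun h : E11 => (g, h)) (by fun_prop) F ⊗ₜ[ℂ] b) := rfl

theorem sliceL_eq (h : E11) (x : AFAlg2 p q) : sliceL h x = sliceLHom h x := by
  refine LinearMap.congr_fun (g := (sliceLHom h).toLinearMap) ?_ x
  ext F a b
  rfl

theorem sliceR_eq (g : E11) (x : AFAlg2 p q) : sliceR g x = sliceRHom g x := by
  refine LinearMap.congr_fun (g := (sliceRHom g).toLinearMap) ?_ x
  ext F a b
  rfl

/-- A function on `E(1,1)` as an element of `A_F`. -/
def fnHom (p : ℕ) (q : ℂ) : Sm E11 →ₐ[ℂ] AFAlg p q := Algebra.TensorProduct.includeLeft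

/-- An element of `A(E_q(1,1))` as an element of `A_F`. -/
def aqHom (p : ℕ) (q : ℂ) : AAlg p q →ₐ[ℂ] AFAlg p q := Algebra.TensorProduct.includeRight

theorem fnHom_apply (f : Sm E11) : fnHom p q f = f ⊗ₜ 1 := rfl

theorem aqHom_apply (a : AAlg p q) : aqHom p q a = 1 ⊗ₜ a := rfl

theorem fnHom_mul_aqHom (f : Sm E11) (a : AAlg p q) : fnHom p q f * aqHom p q a = f ⊗ₜ a := by
  simp [fnHom_apply, aqHom_apply]

theorem induction {motive : AFAlg p q → Prop} (hf : ∀ f, motive (fnHom p q f))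
    (he : ∀ s, motive (aqHom p q (AAlg.eta p q s))) (hd : motive (aqHom p q (AAlg.gen p q .del)))
    (hmul : ∀ x y, motive x → motive y → motive (x * y))
    (hadd : ∀ x y, motive x → motive y → motive (x + y)) (x : AFAlg p q) : motive x := by
  induction x using TensorProduct.induction_on with
  | zero => simpa using hf 0
  | add x y hx hy => exact hadd _ _ hx hy
  | tmul f a =>
    rw [← fnHom_mul_aqHom]
    refine hmul _ _ (hf f) ?_
    induction a using AAlg.induction with
    | hc c =>
      rw [AlgHom.commutes, ← AlgHom.commutes (fnHom p q)]
      exact hf _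
    | hg x =>
      cases x with
      | eta s => exact he s
      | del => exact hd
    | hmul x y hx hy => rw [map_mul]; exact hmul _ _ hx hy
    | hadd x y hx hy => rw [map_add]; exact hadd _ _ hx hy

theorem algHom_ext {B : Type*} [Ring B] [Algebra ℂ B] {Φ Ψ : AFAlg p q →ₐ[ℂ] B}
    (hf : ∀ f, Φ (fnHom p q f) = Ψ (fnHom p q f))
    (he : ∀ s, Φ (aqHom p q (AAlg.eta p q s)) = Ψ (aqHom p q (AAlg.eta p q s)))
    (hd : Φ (aqHom p q (AAlg.gen p q .del)) = Ψ (aqHom p q (AAlg.gen p q .del)))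
    (x : AFAlg p q) : Φ x = Ψ x := by
  induction x using AFAlg.induction with
  | hf f => exact hf f
  | he s => exact he s
  | hd => exact hd
  | hmul x y hx hy => rw [map_mul, map_mul, hx, hy]
  | hadd x y hx hy => rw [map_add, map_add, hx, hy]

section Coproduct

variable (p q)

/-- `η_± ⊗ 1` in the completed tensor square. -/
def cX (s : ℤˣ) : AFAlg2 p q := 1 ⊗ₜ (AAlg.eta p q s ⊗ₜ 1)

/-- The function `e^{±λ/p} ⊗ 1`. -/
def cE (p : ℕ) (s : ℤˣ) : Sm (E11 × E11) :=
  Sm.pullback Prod.fst contDiff_fst (Sm.expLam (((s : ℤ) : ℝ) / p))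

/-- `δ^{±1} e^{±λ/p} ⊗ η_±` in the completed tensor square. -/
def cY (s : ℤˣ) : AFAlg2 p q := cE p s ⊗ₜ (AAlg.delta p q s ⊗ₜ AAlg.eta p q s)

/-- `δ ⊗ δ` in the completed tensor square. -/
def cD : AFAlg2 p q := 1 ⊗ₜ (AAlg.delta p q 1 ⊗ₜ AAlg.delta p q 1)

/-- The nilpotent part `N_±` of the coproduct of `z_±`. -/
def cN (s : ℤˣ) : AFAlg2 p q := nil p (q ^ (s : ℤ)) (cX p q s) (cY p q s)

variable [hpq : RootData p q]

theorem cX_mul_cY (s : ℤˣ) :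
    cX p q s * cY p q s = (q ^ (s : ℤ)) ^ 2 • (cY p q s * cX p q s) := by
  simp only [cX, cY, Algebra.TensorProduct.tmul_mul_tmul, one_mul, mul_one, AAlg.eta_mul_delta,
    ← TensorProduct.smul_tmul', TensorProduct.tmul_smul]

theorem cX_pow (s : ℤˣ) : cX p q s ^ p = 0 := by
  simp [cX, Algebra.TensorProduct.tmul_pow, (AAlg.rels p q).eta_pow]

theorem cY_pow (s : ℤˣ) : cY p q s ^ p = 0 := by
  simp [cY, Algebra.TensorProduct.tmul_pow, (AAlg.rels p q).eta_pow]

theorem cX_neg_mul_cX (s : ℤˣ) :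
    cX p q (-s) * cX p q s = (q ^ (s : ℤ)) ^ 2 • (cX p q s * cX p q (-s)) := by
  simp only [cX, Algebra.TensorProduct.tmul_mul_tmul, one_mul, mul_one, AAlg.eta_neg_mul,
    ← TensorProduct.smul_tmul', TensorProduct.tmul_smul]

theorem cX_neg_mul_cY (s : ℤˣ) :
    cX p q (-s) * cY p q s = (q ^ (s : ℤ)) ^ 2 • (cY p q s * cX p q (-s)) := by
  simp only [cX, cY, Algebra.TensorProduct.tmul_mul_tmul, one_mul, mul_one, AAlg.eta_mul_delta,
    ← TensorProduct.smul_tmul', TensorProduct.tmul_smul]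

theorem cY_neg_mul_cX (s : ℤˣ) :
    cY p q (-s) * cX p q s = (q ^ (s : ℤ)) ^ 2 • (cX p q s * cY p q (-s)) := by
  simp only [cX, cY, Algebra.TensorProduct.tmul_mul_tmul, one_mul, mul_one, AAlg.delta_mul_eta,
    ← TensorProduct.smul_tmul', TensorProduct.tmul_smul]
  simp

theorem cY_neg_mul_cY (s : ℤˣ) :
    cY p q (-s) * cY p q s = (q ^ (s : ℤ)) ^ 2 • (cY p q s * cY p q (-s)) := by
  simp only [cY, Algebra.TensorProduct.tmul_mul_tmul, AAlg.eta_neg_mul, ← AAlg.delta_add,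
    ← TensorProduct.smul_tmul', TensorProduct.tmul_smul, mul_comm (cE p (-s)),
    add_comm (((-s : ℤˣ) : ℤ))]

theorem cX_mul_cD (s : ℤˣ) : cX p q s * cD p q = q ^ 2 • (cD p q * cX p q s) := by
  simp only [cX, cD, Algebra.TensorProduct.tmul_mul_tmul, one_mul, mul_one, AAlg.eta_mul_delta,
    ← TensorProduct.smul_tmul', TensorProduct.tmul_smul, zpow_one]

theorem cY_mul_cD (s : ℤˣ) : cY p q s * cD p q = q ^ 2 • (cD p q * cY p q s) := by
  simp only [cY, cD, Algebra.TensorProduct.tmul_mul_tmul, one_mul, mul_one, AAlg.eta_mul_delta,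
    ← TensorProduct.smul_tmul', TensorProduct.tmul_smul, zpow_one, ← AAlg.delta_add,
    add_comm (1 : ℤ)]

theorem fn_commute (F : Sm (E11 × E11)) (x : AFAlg2 p q) : Commute x (F ⊗ₜ 1) := by
  induction x using TensorProduct.induction_on with
  | zero => exact Commute.zero_left _
  | add x y hx hy => exact hx.add_left hy
  | tmul G a =>
    change _ * _ = _ * _
    simp [mul_comm]

theorem cN_sq (s : ℤˣ) : cN p q s * cN p q s = 0 :=
  nil_mul_nil p _ (cX_mul_cY p q s) (cX_pow p q s) (cY_pow p q s)

theorem cX_neg_commute_cN (s : ℤˣ) : Commute (cX p q (-s)) (cN p q s) :=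
  mul_nil_of_qcomm p _ (u := (q ^ (s : ℤ)) ^ 2)
    (by rw [pow_right_comm, root_pow p (q ^ (s : ℤ)), one_pow])
    (cX_neg_mul_cX p q s) (cX_neg_mul_cY p q s)

theorem cY_neg_commute_cN (s : ℤˣ) : Commute (cY p q (-s)) (cN p q s) :=
  mul_nil_of_qcomm p _ (u := (q ^ (s : ℤ)) ^ 2)
    (by rw [pow_right_comm, root_pow p (q ^ (s : ℤ)), one_pow])
    (cY_neg_mul_cX p q s) (cY_neg_mul_cY p q s)

theorem cN_commute : Commute (cN p q 1) (cN p q (-1)) := by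
  refine mul_nil_of_qcomm p _ (u := 1) (one_pow p) ?_ ?_
  · rw [one_smul]; exact (cX_neg_commute_cN p q 1).eq.symm
  · rw [one_smul]; exact (cY_neg_commute_cN p q 1).eq.symm

theorem cD_commute_cN (s : ℤˣ) : Commute (cD p q) (cN p q s) := by
  have hq := pow_ne_zero 2 (root_ne_zero p q)
  refine mul_nil_of_qcomm p _ (u := (q ^ 2)⁻¹) ?_ (qcomm_symm hq (cX_mul_cD p q s))
    (qcomm_symm hq (cY_mul_cD p q s))
  rw [inv_pow, pow_right_comm, root_pow p q, one_pow, inv_one]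

theorem cXY_commute_cN (s t : ℤˣ) : Commute (cX p q t + cY p q t) (cN p q s) := by
  rcases eq_or_ne t s with rfl | h
  · exact add_commute_nil (A := AFAlg2 p q) p _ (cX_mul_cY p q t) (cX_pow p q t) (cY_pow p q t)
  · have : t = -s := Int.units_ne_iff_eq_neg.1 h
    rw [this]
    exact (cX_neg_commute_cN p q s).add_left (cY_neg_commute_cN p q s)

theorem comul_rels : AAlg.Rels p q (fun s => cX p q s + cY p q s) (cD p q) where
  eta_eta := by
    have h1 := cX_neg_mul_cX p q 1
    have h2 := cX_neg_mul_cY p q 1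
    have h3 := cY_neg_mul_cX p q 1
    have h4 := cY_neg_mul_cY p q 1
    simp only [Units.val_one, zpow_one] at h1 h2 h3 h4
    simp only [mul_add, add_mul, h1, h2, h3, h4, smul_add]
    abel
  eta_del s := by rw [add_mul, mul_add, cX_mul_cD, cY_mul_cD, smul_add]
  eta_pow s := by 
    exact (add_pow_root (A := AFAlg2 p q) p _ (cX_mul_cY p q s)).trans
      (by rw [cX_pow, cY_pow, add_zero])
  del_pow := by
    rw [cD, Algebra.TensorProduct.tmul_pow, Algebra.TensorProduct.tmul_pow, AAlg.delta_pow_root,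
      one_pow]
    rfl

/-- The pull-back of functions along the group law, in the completed tensor square. -/
def comulRho : Sm E11 →ₐ[ℂ] AFAlg2 p q :=
  Algebra.TensorProduct.includeLeft.comp Sm.comulFun

theorem comulRho_apply (f : Sm E11) : comulRho p q f = Sm.comulFun f ⊗ₜ 1 := rfl

/-- The coproduct on functions. -/
def comulFn : Sm E11 →ₐ[ℂ] AFAlg2 p q :=
  AlgHom.ofLinearMap (tay (comulRho p q).toLinearMap (cN p q))
    (by rw [tay_one]; exact map_one (comulRho p q))
    (tay_mul (fun f g => map_mul (comulRho p q) f g) (cN_sq p q) (fun _ _ => fn_commute p q _ _)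
      (cN_commute p q))

theorem comulFn_apply (f : Sm E11) :
    comulFn p q f = tay (comulRho p q).toLinearMap (cN p q) f := rfl

/-- The coproduct of `A_F`. -/
def comul : AFAlg p q →ₐ[ℂ] AFAlg2 p q :=
  Algebra.TensorProduct.lift (comulFn p q) (AAlg.lift (comul_rels p q)) fun f a => by
    have key : ∀ x : AFAlg2 p q, Commute (cN p q 1) x → Commute (cN p q (-1)) x →
        Commute (comulFn p q f) x := by
      intro x h1 h2
      rw [comulFn_apply, tay_apply]
      have h0 : ∀ g, Commute ((comulRho p q).toLinearMap g) x := fun g => (fn_commute p q _ x).symm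
      exact (((h0 _).add_left ((h0 _).mul_left h1)).add_left ((h0 _).mul_left h2)).add_left
        ((h0 _).mul_left (h1.mul_left h2))
    induction a using AAlg.induction with
    | hc c => rw [AlgHom.commutes]; exact (Algebra.commute_algebraMap_left _ _).symm
    | hg x =>
      rw [AAlg.lift_gen]
      cases x with
      | eta s => exact key _ (cXY_commute_cN p q _ s).symm (cXY_commute_cN p q _ s).symm
      | del => exact key _ (cD_commute_cN p q _).symm (cD_commute_cN p q _).symm
    | hmul x y hx hy => rw [map_mul]; exact hx.mul_right hy
    | hadd x y hx hy => rw [map_add]; exact hx.add_right hy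

theorem comul_fn (f : Sm E11) :
    comul p q (fnHom p q f) = tay (comulRho p q).toLinearMap (cN p q) f := by
  rw [comul, fnHom_apply, Algebra.TensorProduct.lift_tmul, map_one, mul_one, comulFn_apply]

theorem comul_eta (s : ℤˣ) :
    comul p q (aqHom p q (AAlg.eta p q s)) = cX p q s + cY p q s := by
  rw [comul, aqHom_apply, Algebra.TensorProduct.lift_tmul, map_one, one_mul, AAlg.lift_eta]

theorem comul_del : comul p q (aqHom p q (AAlg.gen p q .del)) = cD p q := by
  rw [comul, aqHom_apply, Algebra.TensorProduct.lift_tmul, map_one, one_mul, AAlg.lift_del]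

theorem counit_rels : AAlg.Rels p q (fun _ => (0 : ℂ)) 1 := by
  constructor <;> simp [(root_pos p q).ne']

/-- The counit of `A_F`. -/
def counit : AFAlg p q →ₐ[ℂ] ℂ :=
  Algebra.TensorProduct.lift (evHom 0) (AAlg.lift (counit_rels p q)) fun _ _ => Commute.all _ _

theorem counit_fn (f : Sm E11) : counit p q (fnHom p q f) = f.1 0 := by
  rw [counit, fnHom_apply, Algebra.TensorProduct.lift_tmul, map_one, mul_one, evHom_apply]

theorem counit_eta (s : ℤˣ) : counit p q (aqHom p q (AAlg.eta p q s)) = 0 := by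
  rw [counit, aqHom_apply, Algebra.TensorProduct.lift_tmul, map_one, one_mul, AAlg.lift_eta]

theorem counit_del : counit p q (aqHom p q (AAlg.gen p q .del)) = 1 := by
  rw [counit, aqHom_apply, Algebra.TensorProduct.lift_tmul, map_one, one_mul, AAlg.lift_del]

theorem counit_delta (k : ℤ) : counit p q (aqHom p q (AAlg.delta p q k)) = 1 := by
  rw [AAlg.delta, map_pow, map_pow, counit_del, one_pow]

end Coproduct

end AFAlg

section NilpotentPart

variable {A : Type*} [Ring A] [Algebra ℂ A]

theorem nil_mul_left (p : ℕ) (q : ℂ) {w a b : A} (ha : Commute w a) (hb : Commute w b) :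
    nil p q (w * a) (w * b) = w ^ p * nil p q a b := by
  unfold nil
  rw [mul_smul_comm, Finset.mul_sum]
  congr 1
  refine Finset.sum_congr rfl fun x hx => ?_
  rw [mul_smul_comm, ha.mul_pow, hb.mul_pow, ← Finset.HasAntidiagonal.mem_antidiagonal.1 hx,
    pow_add]
  congr 1
  rw [mul_assoc, mul_assoc, ← mul_assoc (a ^ x.1), ((ha.pow_pow x.2 x.1).eq).symm, mul_assoc]

theorem exists_mul_pow_of_qcomm {v : ℂ} {t e : A} (h : e * t = v • (t * e)) (n : ℕ) :
    ∃ c : ℂ, (t * e) ^ n = c • (t ^ n * e ^ n) := by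
  induction n with
  | zero => exact ⟨1, by simp⟩
  | succ n ih =>
    obtain ⟨c, hc⟩ := ih
    refine ⟨c * v ^ n, ?_⟩
    rw [pow_succ, hc, smul_mul_assoc, mul_assoc, ← mul_assoc (e ^ n), pow_mul_of_qcomm h,
      smul_mul_assoc, mul_smul_comm, smul_smul, pow_succ t, pow_succ e]
    simp only [mul_assoc]

end NilpotentPart

section TaylorLemmas

variable {B : Type*} [Ring B] [Algebra ℂ B]

theorem tay_rtrans (ρ : Sm E11 →ₗ[ℂ] B) (n : ℤˣ → B) (h : E11) (f : Sm E11) :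
    tay ρ n (Sm.rtrans h f) = tay (ρ ∘ₗ (Sm.rtrans h).toLinearMap) n f := by
  simp [tay_apply, Sm.dz_rtrans]

theorem tay_ltrans (ρ : Sm E11 →ₗ[ℂ] B) (n : ℤˣ → B) (g : E11) (f : Sm E11) :
    tay ρ n (Sm.ltrans g f) = tay (ρ ∘ₗ (Sm.ltrans g).toLinearMap)
      (fun s => (Real.exp (((s : ℤ) : ℝ) * g.2) : ℂ) • n s) f := by
  simp [tay_apply, Sm.dz_ltrans, smul_smul, mul_comm]

theorem tay_z (ρ : Sm E11 →ₗ[ℂ] B) (hρ : ρ 1 = 1) (n : ℤˣ → B) (s : ℤˣ) :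
    tay ρ n (Sm.z s) = ρ (Sm.z s) + n s := by
  have h1 : ∀ t, Sm.dz t (1 : Sm E11) = 0 := fun t => Sm.dirDeriv_one _
  rcases Int.units_eq_one_or s with rfl | rfl <;> simp [tay_apply, Sm.dz_z, h1, hρ]

theorem tay_expLam (ρ : Sm E11 →ₗ[ℂ] B) (n : ℤˣ → B) (c : ℝ) :
    tay ρ n (Sm.expLam c) = ρ (Sm.expLam c) := by
  simp [tay_apply, Sm.dz_expLam]

end TaylorLemmas

namespace AFAlg

/-- The number `e^{±λ/p}` at a group element. -/
def ex (p : ℕ) (s : ℤˣ) (g : E11) : ℂ := (Real.exp (((s : ℤ) : ℝ) / p * g.2) : ℂ)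

theorem ex_mul (p : ℕ) (s : ℤˣ) (g h : E11) : ex p s (E11.mul g h) = ex p s g * ex p s h := by
  rw [ex, ex, ex, ← Complex.ofReal_mul, ← Real.exp_add, ← mul_add]
  rfl

theorem ex_zero (p : ℕ) (s : ℤˣ) : ex p s 0 = 1 := by simp [ex]

theorem ex_neg_mul (p : ℕ) (s : ℤˣ) (g : E11) : ex p (-s) g * ex p s g = 1 := by
  rw [ex, ex, ← Complex.ofReal_mul, ← Real.exp_add]
  simp [neg_div]

theorem ex_pow {p : ℕ} (hp : 0 < p) (s : ℤˣ) (g : E11) :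
    ex p s g ^ p = (Real.exp (((s : ℤ) : ℝ) * g.2) : ℂ) := by
  have : (p : ℝ) ≠ 0 := by exact_mod_cast hp.ne'
  rw [ex, ← Complex.ofReal_pow, ← Real.exp_nat_mul]
  congr 2
  field_simp

section Hopf

variable (p : ℕ) (q : ℂ) [hpq : RootData p q]

theorem sliceLHom_cX (h : E11) (s : ℤˣ) :
    sliceLHom h (cX p q s) = aqHom p q (AAlg.eta p q s) ⊗ₜ 1 := rfl

theorem sliceLHom_cY (h : E11) (s : ℤˣ) : sliceLHom h (cY p q s)
    = (fnHom p q (Sm.expLam (((s : ℤ) : ℝ) / p)) * aqHom p q (AAlg.delta p q s))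
      ⊗ₜ AAlg.eta p q s := by
  rw [fnHom_mul_aqHom]
  rfl

theorem sliceLHom_cD (h : E11) : sliceLHom h (cD p q)
    = aqHom p q (AAlg.delta p q 1) ⊗ₜ AAlg.delta p q 1 := rfl

theorem sliceLHom_rho (h : E11) (f : Sm E11) :
    sliceLHom h (comulRho p q f) = fnHom p q (Sm.rtrans h f) ⊗ₜ 1 := rfl

theorem sliceRHom_cX (g : E11) (s : ℤˣ) :
    sliceRHom g (cX p q s) = AAlg.eta p q s ⊗ₜ 1 := rfl

theorem sliceRHom_cY (g : E11) (s : ℤˣ) : sliceRHom g (cY p q s)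
    = ex p s g • (AAlg.delta p q s ⊗ₜ aqHom p q (AAlg.eta p q s)) := by
  have h : (Sm.pullback (fun h : E11 => (g, h)) (by fun_prop) (cE p s) : Sm E11) = ex p s g • 1 :=
    Sm.ext' fun _ => (mul_one _).symm
  rw [cY, sliceRHom_tmul, h, ← TensorProduct.smul_tmul', TensorProduct.tmul_smul]
  rfl

theorem sliceRHom_cD (g : E11) : sliceRHom g (cD p q)
    = AAlg.delta p q 1 ⊗ₜ aqHom p q (AAlg.delta p q 1) := rfl

theorem sliceRHom_rho (g : E11) (f : Sm E11) :
    sliceRHom g (comulRho p q f) = 1 ⊗ₜ fnHom p q (Sm.ltrans g f) := rfl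

theorem comul_expLam (c : ℝ) :
    comul p q (fnHom p q (Sm.expLam c)) = comulRho p q (Sm.expLam c) := by
  rw [comul_fn, tay_expLam]
  rfl

theorem comul_delta (k : ℤ) : comul p q (aqHom p q (AAlg.delta p q k))
    = 1 ⊗ₜ (AAlg.delta p q k ⊗ₜ AAlg.delta p q k) := by
  rw [AAlg.delta, map_pow, map_pow, comul_del, cD, Algebra.TensorProduct.tmul_pow,
    Algebra.TensorProduct.tmul_pow, one_pow, AAlg.delta_one]

/-! #### Coassociativity -/

/-- The coproduct at a point. -/
def comulAt (g h : E11) : AFAlg p q →ₐ[ℂ] AAlg p q ⊗[ℂ] AAlg p q :=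
  (evalHom (g, h)).comp (comul p q)

theorem comulAt_fn (g h : E11) (f : Sm E11) : comulAt p q g h (fnHom p q f)
    = tay ((evalHom (g, h)).comp (comulRho p q)).toLinearMap
      (fun s => evalHom (g, h) (cN p q s)) f := by
  rw [comulAt, AlgHom.comp_apply, comul_fn, tay_map]
  rfl

theorem comulAt_rho (g h : E11) (f : Sm E11) :
    evalHom (g, h) (comulRho p q f) = f.1 (E11.mul g h) • 1 := by
  rw [comulRho_apply, evalHom_tmul]
  rfl

theorem comulAt_expLam (g h : E11) (s : ℤˣ) :
    comulAt p q g h (fnHom p q (Sm.expLam (((s : ℤ) : ℝ) / p)))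
      = (ex p s g * ex p s h) • 1 := by
  rw [comulAt, AlgHom.comp_apply, comul_expLam, comulAt_rho, ← ex_mul]
  rfl

theorem evalHom_cX (g h : E11) (s : ℤˣ) : evalHom (g, h) (cX p q s) = AAlg.eta p q s ⊗ₜ 1 := by
  rw [cX, evalHom_tmul]
  exact one_smul _ _

theorem evalHom_cY (g h : E11) (s : ℤˣ) : evalHom (g, h) (cY p q s)
    = ex p s g • (AAlg.delta p q s ⊗ₜ AAlg.eta p q s) := by
  rw [cY, evalHom_tmul]
  rfl

theorem comulAt_eta (g h : E11) (s : ℤˣ) : comulAt p q g h (aqHom p q (AAlg.eta p q s))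
    = AAlg.eta p q s ⊗ₜ 1 + ex p s g • (AAlg.delta p q s ⊗ₜ AAlg.eta p q s) := by
  rw [comulAt, AlgHom.comp_apply, comul_eta, map_add, evalHom_cX, evalHom_cY]

theorem comulAt_delta (g h : E11) (k : ℤ) : comulAt p q g h (aqHom p q (AAlg.delta p q k))
    = AAlg.delta p q k ⊗ₜ AAlg.delta p q k := by
  rw [comulAt, AlgHom.comp_apply, comul_delta, evalHom_tmul]
  exact one_smul _ _

theorem evalHom_cN (g h : E11) (s : ℤˣ) : evalHom (g, h) (cN p q s)
    = nil p (q ^ (s : ℤ)) (AAlg.eta p q s ⊗ₜ 1)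
      (ex p s g • (AAlg.delta p q s ⊗ₜ AAlg.eta p q s)) := by
  rw [cN, map_nil, evalHom_cX, evalHom_cY]

/-- `Δ ⊗ id` at a point. -/
def comulLeft (g h : E11) :
    AFAlg p q ⊗[ℂ] AAlg p q →ₐ[ℂ] AAlg p q ⊗[ℂ] (AAlg p q ⊗[ℂ] AAlg p q) :=
  (Algebra.TensorProduct.assoc ℂ ℂ ℂ (AAlg p q) (AAlg p q) (AAlg p q)).toAlgHom.comp
    (Algebra.TensorProduct.map (comulAt p q g h) (AlgHom.id ℂ _))

/-- `id ⊗ Δ` at a point. -/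
def comulRight (g h : E11) :
    AAlg p q ⊗[ℂ] AFAlg p q →ₐ[ℂ] AAlg p q ⊗[ℂ] (AAlg p q ⊗[ℂ] AAlg p q) :=
  Algebra.TensorProduct.map (AlgHom.id ℂ _) (comulAt p q g h)

/-- `x ⊗ y ↦ x ⊗ (y ⊗ 1)` -/
def inclLeft (p : ℕ) (q : ℂ) :
    AAlg p q ⊗[ℂ] AAlg p q →ₐ[ℂ] AAlg p q ⊗[ℂ] (AAlg p q ⊗[ℂ] AAlg p q) :=
  Algebra.TensorProduct.map (AlgHom.id ℂ _) Algebra.TensorProduct.includeLeft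

/-- `x ⊗ y ↦ 1 ⊗ (x ⊗ y)` -/
def inclRight (p : ℕ) (q : ℂ) :
    AAlg p q ⊗[ℂ] AAlg p q →ₐ[ℂ] AAlg p q ⊗[ℂ] (AAlg p q ⊗[ℂ] AAlg p q) :=
  Algebra.TensorProduct.includeRight

theorem comulLeft_tmul_one (g h : E11) (x : AFAlg p q) :
    comulLeft p q g h (x ⊗ₜ 1) = inclLeft p q (comulAt p q g h x) := by
  change Algebra.TensorProduct.assoc ℂ ℂ ℂ _ _ _ (comulAt p q g h x ⊗ₜ[ℂ] 1) = _
  induction comulAt p q g h x using TensorProduct.induction_on with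
  | zero => simp
  | add x y hx hy => rw [TensorProduct.add_tmul, map_add, hx, hy, map_add]
  | tmul a b => rfl

theorem comulLeft_cX (g₁ g₂ g₃ : E11) (s : ℤˣ) :
    comulLeft p q g₁ g₂ (sliceLHom g₃ (cX p q s)) = AAlg.eta p q s ⊗ₜ (1 ⊗ₜ 1)
      + ex p s g₁ • (AAlg.delta p q s ⊗ₜ (AAlg.eta p q s ⊗ₜ 1)) := by
  rw [sliceLHom_cX, comulLeft_tmul_one, comulAt_eta, map_add, map_smul]
  rfl

theorem comulLeft_cY (g₁ g₂ g₃ : E11) (s : ℤˣ) :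
    comulLeft p q g₁ g₂ (sliceLHom g₃ (cY p q s)) = (ex p s g₁ * ex p s g₂) •
      (AAlg.delta p q s ⊗ₜ (AAlg.delta p q s ⊗ₜ AAlg.eta p q s)) := by
  have : comulLeft p q g₁ g₂ (sliceLHom g₃ (cY p q s))
      = Algebra.TensorProduct.assoc ℂ ℂ ℂ _ _ _ (comulAt p q g₁ g₂
        (fnHom p q (Sm.expLam (((s : ℤ) : ℝ) / p)) * aqHom p q (AAlg.delta p q s))
        ⊗ₜ[ℂ] AAlg.eta p q s) := by
    rw [sliceLHom_cY]; rfl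
  rw [this, map_mul, comulAt_expLam, comulAt_delta, smul_one_mul, ← TensorProduct.smul_tmul',
    map_smul]
  rfl

theorem comulLeft_cD (g₁ g₂ g₃ : E11) :
    comulLeft p q g₁ g₂ (sliceLHom g₃ (cD p q))
      = AAlg.delta p q 1 ⊗ₜ (AAlg.delta p q 1 ⊗ₜ AAlg.delta p q 1) := by
  have : comulLeft p q g₁ g₂ (sliceLHom g₃ (cD p q))
      = Algebra.TensorProduct.assoc ℂ ℂ ℂ _ _ _ (comulAt p q g₁ g₂
        (aqHom p q (AAlg.delta p q 1)) ⊗ₜ[ℂ] AAlg.delta p q 1) := rfl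
  rw [this, comulAt_delta]
  rfl

theorem comulRight_one_tmul (g h : E11) (x : AFAlg p q) :
    comulRight p q g h (1 ⊗ₜ x) = inclRight p q (comulAt p q g h x) := rfl

theorem comulRight_cX (g₁ g₂ g₃ : E11) (s : ℤˣ) :
    comulRight p q g₂ g₃ (sliceRHom g₁ (cX p q s)) = AAlg.eta p q s ⊗ₜ (1 ⊗ₜ 1) := by
  rw [sliceRHom_cX, comulRight, Algebra.TensorProduct.map_tmul, map_one]
  rfl

theorem comulRight_cY (g₁ g₂ g₃ : E11) (s : ℤˣ) :
    comulRight p q g₂ g₃ (sliceRHom g₁ (cY p q s))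
      = ex p s g₁ • (AAlg.delta p q s ⊗ₜ (AAlg.eta p q s ⊗ₜ 1))
      + (ex p s g₁ * ex p s g₂) •
        (AAlg.delta p q s ⊗ₜ (AAlg.delta p q s ⊗ₜ AAlg.eta p q s)) := by
  rw [sliceRHom_cY, map_smul, comulRight, Algebra.TensorProduct.map_tmul, comulAt_eta,
    TensorProduct.tmul_add, TensorProduct.tmul_smul, smul_add, smul_smul]
  rfl

theorem comulRight_cD (g₁ g₂ g₃ : E11) :
    comulRight p q g₂ g₃ (sliceRHom g₁ (cD p q))
      = AAlg.delta p q 1 ⊗ₜ (AAlg.delta p q 1 ⊗ₜ AAlg.delta p q 1) := by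
  rw [sliceRHom_cD, comulRight, Algebra.TensorProduct.map_tmul, comulAt_delta]
  rfl

theorem coassoc_fn (f : Sm E11) (g₁ g₂ g₃ : E11) :
    comulLeft p q g₁ g₂ (sliceLHom g₃ (comul p q (fnHom p q f)))
      = comulRight p q g₂ g₃ (sliceRHom g₁ (comul p q (fnHom p q f))) := by
  let ρ : Sm E11 →ₐ[ℂ] AAlg p q ⊗[ℂ] (AAlg p q ⊗[ℂ] AAlg p q) :=
    (Algebra.ofId ℂ _).comp (evHom (E11.mul (E11.mul g₁ g₂) g₃))
  let m : ℤˣ → AAlg p q ⊗[ℂ] (AAlg p q ⊗[ℂ] AAlg p q) := fun s =>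
    inclLeft p q (evalHom (g₁, g₂) (cN p q s))
  let m' : ℤˣ → AAlg p q ⊗[ℂ] (AAlg p q ⊗[ℂ] AAlg p q) := fun s =>
    comulLeft p q g₁ g₂ (sliceLHom g₃ (cN p q s))
  let n : ℤˣ → AAlg p q ⊗[ℂ] (AAlg p q ⊗[ℂ] AAlg p q) := fun s =>
    (Real.exp (((s : ℤ) : ℝ) * g₁.2) : ℂ) • inclRight p q (evalHom (g₂, g₃) (cN p q s))
  let n' : ℤˣ → AAlg p q ⊗[ℂ] (AAlg p q ⊗[ℂ] AAlg p q) := fun s =>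
    comulRight p q g₂ g₃ (sliceRHom g₁ (cN p q s))
  have hL : comulLeft p q g₁ g₂ (sliceLHom g₃ (comul p q (fnHom p q f)))
      = tay (tay ρ.toLinearMap m) m' f := by
    rw [comul_fn, tay_map, tay_map]
    congr 2
    ext f
    change comulLeft p q g₁ g₂ (sliceLHom g₃ (comulRho p q f)) = _
    rw [sliceLHom_rho, comulLeft_tmul_one, comulAt_fn, tay_map, tay_rtrans]
    congr 2
    ext f
    change inclLeft p q (evalHom (g₁, g₂) (comulRho p q (Sm.rtrans g₃ f))) = _
    rw [comulAt_rho, map_smul, map_one, ← Algebra.algebraMap_eq_smul_one]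
    rfl
  have hR : comulRight p q g₂ g₃ (sliceRHom g₁ (comul p q (fnHom p q f)))
      = tay (tay ρ.toLinearMap n) n' f := by
    rw [comul_fn, tay_map, tay_map]
    congr 2
    ext f
    change comulRight p q g₂ g₃ (sliceRHom g₁ (comulRho p q f)) = _
    rw [sliceRHom_rho, comulRight_one_tmul, comulAt_fn, tay_map, tay_ltrans]
    congr 2
    ext f
    change inclRight p q (evalHom (g₂, g₃) (comulRho p q (Sm.ltrans g₁ f))) = _
    rw [comulAt_rho, map_smul, map_one, ← Algebra.algebraMap_eq_smul_one, Sm.ltrans_apply,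
      ← Sm.mul_assoc']
    rfl
  have hm : ∀ s y, Commute (m s) (comulLeft p q g₁ g₂ (sliceLHom g₃ y)) := by
    intro s y
    have h1 : m s = comulLeft p q g₁ g₂ (fnHom p q (Sm.z s) ⊗ₜ 1)
        - algebraMap ℂ _ ((Sm.z s).1 (E11.mul g₁ g₂)) := by
      rw [comulLeft_tmul_one, comulAt_fn, tay_z]
      · change _ = inclLeft p q (evalHom (g₁, g₂) (comulRho p q (Sm.z s)) + _) - _
        rw [comulAt_rho, map_add, map_smul, map_one, ← Algebra.algebraMap_eq_smul_one,
          add_sub_cancel_left]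
      · exact map_one ((evalHom (g₁, g₂)).comp (comulRho p q))
    rw [h1]
    refine Commute.sub_left ?_ (Algebra.commute_algebraMap_left _ _)
    refine Commute.map ?_ (comulLeft p q g₁ g₂)
    induction sliceLHom g₃ y using TensorProduct.induction_on with
    | zero => exact Commute.zero_right _
    | add x y hx hy => exact hx.add_right hy
    | tmul x b =>
      have : Commute (fnHom p q (Sm.z s)) x := by
        induction x using TensorProduct.induction_on with
        | zero => exact Commute.zero_right _
        | add x y hx hy => exact hx.add_right hy
        | tmul f a =>
          change _ * _ = _ * _
          simp [fnHom_apply, mul_comm]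
      change _ * _ = _ * _
      rw [Algebra.TensorProduct.tmul_mul_tmul, Algebra.TensorProduct.tmul_mul_tmul, this.eq,
        one_mul, mul_one]
  have hn : ∀ s y, Commute (n s) (comulRight p q g₂ g₃ (sliceRHom g₁ y)) := by
    intro s y
    have h1 : inclRight p q (evalHom (g₂, g₃) (cN p q s))
        = comulRight p q g₂ g₃ (1 ⊗ₜ fnHom p q (Sm.z s))
        - algebraMap ℂ _ ((Sm.z s).1 (E11.mul g₂ g₃)) := by
      rw [comulRight_one_tmul, comulAt_fn, tay_z]
      · change _ = inclRight p q (evalHom (g₂, g₃) (comulRho p q (Sm.z s)) + _) - _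
        rw [comulAt_rho, map_add, map_smul, map_one, ← Algebra.algebraMap_eq_smul_one,
          add_sub_cancel_left]
      · exact map_one ((evalHom (g₂, g₃)).comp (comulRho p q))
    refine Commute.smul_left ?_ _
    rw [h1]
    refine Commute.sub_left ?_ (Algebra.commute_algebraMap_left _ _)
    refine Commute.map ?_ (comulRight p q g₂ g₃)
    induction sliceRHom g₁ y using TensorProduct.induction_on with
    | zero => exact Commute.zero_right _
    | add x y hx hy => exact hx.add_right hy
    | tmul b x =>
      have : Commute (fnHom p q (Sm.z s)) x := by
        induction x using TensorProduct.induction_on with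
        | zero => exact Commute.zero_right _
        | add x y hx hy => exact hx.add_right hy
        | tmul f a =>
          change _ * _ = _ * _
          simp [fnHom_apply, mul_comm]
      change _ * _ = _ * _
      rw [Algebra.TensorProduct.tmul_mul_tmul, Algebra.TensorProduct.tmul_mul_tmul, this.eq,
        one_mul, mul_one]
  rw [hL, hR]
  refine tay_tay_congr ρ.toLinearMap (hm _ _) (hn _ _) (fun s => hm s _) (fun s => hn s _)
    ?_ ?_ ?_ ?_ ?_ f
  · intro s
    change inclLeft p q _ * inclLeft p q _ = 0
    rw [← map_mul, ← map_mul, cN_sq, map_zero, map_zero]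
  · intro s
    change comulLeft p q _ _ _ * comulLeft p q _ _ _ = 0
    rw [← map_mul, ← map_mul, cN_sq, map_zero, map_zero]
  · intro s
    change _ • inclRight p q _ * _ • inclRight p q _ = 0
    rw [smul_mul_smul_comm, ← map_mul, ← map_mul, cN_sq, map_zero, map_zero, smul_zero]
  · intro s
    change comulRight p q _ _ _ * comulRight p q _ _ _ = 0
    rw [← map_mul, ← map_mul, cN_sq, map_zero, map_zero]
  · intro s
    let a : AAlg p q ⊗[ℂ] (AAlg p q ⊗[ℂ] AAlg p q) := AAlg.eta p q s ⊗ₜ (1 ⊗ₜ 1)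
    let b : AAlg p q ⊗[ℂ] (AAlg p q ⊗[ℂ] AAlg p q) :=
      ex p s g₁ • (AAlg.delta p q s ⊗ₜ (AAlg.eta p q s ⊗ₜ 1))
    let c : AAlg p q ⊗[ℂ] (AAlg p q ⊗[ℂ] AAlg p q) :=
      (ex p s g₁ * ex p s g₂) • (AAlg.delta p q s ⊗ₜ (AAlg.delta p q s ⊗ₜ AAlg.eta p q s))
    have e1 : m s = nil p (q ^ (s : ℤ)) a b := by
      change inclLeft p q _ = _
      rw [evalHom_cN, map_nil, map_smul]
      rfl
    have e2 : m' s = nil p (q ^ (s : ℤ)) (a + b) c := by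
      change comulLeft p q _ _ _ = _
      rw [cN, map_nil, map_nil, comulLeft_cX, comulLeft_cY]
    have e3 : n' s = nil p (q ^ (s : ℤ)) a (b + c) := by
      change comulRight p q _ _ _ = _
      rw [cN, map_nil, map_nil, comulRight_cX, comulRight_cY]
    have e4 : n s = nil p (q ^ (s : ℤ)) b c := by
      let w : AAlg p q ⊗[ℂ] (AAlg p q ⊗[ℂ] AAlg p q) :=
        ex p s g₁ • (AAlg.delta p q s ⊗ₜ (1 ⊗ₜ 1))
      have hw : ∀ y, Commute w (inclRight p q y) := by
        intro y
        refine Commute.smul_left ?_ _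
        change _ * _ = _ * _
        rw [inclRight, Algebra.TensorProduct.includeRight_apply,
          Algebra.TensorProduct.tmul_mul_tmul, Algebra.TensorProduct.tmul_mul_tmul,
          ← Algebra.TensorProduct.one_def, one_mul, mul_one, one_mul, mul_one]
      have hb : b = w * inclRight p q (AAlg.eta p q s ⊗ₜ 1) := by
        simp only [b, w, inclRight, Algebra.TensorProduct.includeRight_apply, smul_mul_assoc,
          Algebra.TensorProduct.tmul_mul_tmul, one_mul, mul_one]
      have hc : c = w * inclRight p q (ex p s g₂ • (AAlg.delta p q s ⊗ₜ AAlg.eta p q s)) := by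
        simp only [c, w, inclRight, Algebra.TensorProduct.includeRight_apply, smul_mul_assoc,
          mul_smul_comm, smul_smul, TensorProduct.tmul_smul,
          Algebra.TensorProduct.tmul_mul_tmul, one_mul, mul_one, mul_comm (ex p s g₂)]
      have hwp : w ^ p = (Real.exp (((s : ℤ) : ℝ) * g₁.2) : ℂ) • 1 := by
        change (_ • _) ^ p = _
        rw [smul_pow, ex_pow (root_pos p q), Algebra.TensorProduct.tmul_pow,
          Algebra.TensorProduct.tmul_pow, one_pow, AAlg.delta_pow_root]
        rfl
      change _ • inclRight p q _ = _
      rw [hb, hc, nil_mul_left p _ (hw _) (hw _), ← map_nil, ← evalHom_cN p q g₂ g₃, hwp,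
        smul_one_mul]
    change m s + m' s = n s + n' s
    rw [e1, e2, e3, e4, add_comm, add_comm (nil p (q ^ (s : ℤ)) b c)]
    refine nil_cocycle p _ ?_ ?_
    · simp only [a, b, mul_smul_comm, smul_mul_assoc, Algebra.TensorProduct.tmul_mul_tmul, one_mul,
        mul_one, AAlg.eta_mul_delta, ← TensorProduct.smul_tmul']
      rw [smul_comm]
    · simp only [b, c, mul_smul_comm, smul_mul_assoc, Algebra.TensorProduct.tmul_mul_tmul, one_mul,
        mul_one, AAlg.eta_mul_delta, ← TensorProduct.smul_tmul', TensorProduct.tmul_smul, smul_smul]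
      congr 1
      ring

theorem coassoc_hom (x : AFAlg p q) (g₁ g₂ g₃ : E11) :
    comulLeft p q g₁ g₂ (sliceLHom g₃ (comul p q x))
      = comulRight p q g₂ g₃ (sliceRHom g₁ (comul p q x)) := by
  refine algHom_ext (Φ := ((comulLeft p q g₁ g₂).comp (sliceLHom g₃)).comp (comul p q))
    (Ψ := ((comulRight p q g₂ g₃).comp (sliceRHom g₁)).comp (comul p q)) ?_ ?_ ?_ x
  · intro f
    exact coassoc_fn p q f g₁ g₂ g₃
  · intro s
    simp only [AlgHom.comp_apply, comul_eta, map_add, comulLeft_cX, comulLeft_cY, comulRight_cX,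
      comulRight_cY, add_assoc]
  · simp only [AlgHom.comp_apply, comul_del, comulLeft_cD, comulRight_cD]

theorem coassoc (x : AFAlg p q) (g₁ g₂ g₃ : E11) :
    TensorProduct.assoc ℂ (AAlg p q) (AAlg p q) (AAlg p q)
      ((evalLin (g₁, g₂) ∘ₗ (comul p q).toLinearMap).rTensor (AAlg p q)
        (sliceL g₃ (comul p q x)))
    = (evalLin (g₂, g₃) ∘ₗ (comul p q).toLinearMap).lTensor (AAlg p q)
        (sliceR g₁ (comul p q x)) := by
  rw [evalLin_eq, evalLin_eq, sliceL_eq, sliceR_eq]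
  exact coassoc_hom p q x g₁ g₂ g₃

end Hopf

end AFAlg

namespace AFAlg

section Hopf

variable (p : ℕ) (q : ℂ) [hpq : RootData p q]

/-! #### Counit -/

theorem counit_left (x : AFAlg p q) (g : E11) :
    TensorProduct.lid ℂ (AAlg p q) ((counit p q).toLinearMap.rTensor (AAlg p q)
      (sliceL g (comul p q x))) = evalLin g x := by
  let L : AFAlg p q ⊗[ℂ] AAlg p q →ₐ[ℂ] AAlg p q :=
    (Algebra.TensorProduct.lid ℂ (AAlg p q)).toAlgHom.comp
      (Algebra.TensorProduct.map (counit p q) (AlgHom.id ℂ _))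
  have hL : ∀ y b, L (y ⊗ₜ b) = counit p q y • b := fun y b => rfl
  have hX : ∀ s, L (sliceLHom g (cX p q s)) = 0 := by
    intro s
    rw [sliceLHom_cX, hL, counit_eta, zero_smul]
  have hE : ∀ s : ℤˣ, counit p q (fnHom p q (Sm.expLam (((s : ℤ) : ℝ) / p))) = 1 := fun s =>
    (counit_fn p q _).trans (ex_zero p s)
  rw [evalLin_eq, sliceL_eq]
  refine algHom_ext (Φ := (L.comp (sliceLHom g)).comp (comul p q)) (Ψ := evalHom g) ?_ ?_ ?_ x
  · intro f
    rw [AlgHom.comp_apply, AlgHom.comp_apply, comul_fn, tay_map, tay_map]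
    have h0 : (fun s => L (sliceLHom g (cN p q s))) = fun _ => 0 := by
      funext s
      rw [cN, map_nil, map_nil, hX, nil_zero_left]
    rw [h0, tay_zero]
    change L (sliceLHom g (comulRho p q f)) = _
    rw [sliceLHom_rho, hL, counit_fn, Sm.rtrans_apply, Sm.zero_mul', fnHom_apply, evalHom_tmul]
  · intro s
    rw [AlgHom.comp_apply, AlgHom.comp_apply, comul_eta, map_add, map_add, hX, zero_add,
      sliceLHom_cY, hL, map_mul, hE, counit_delta, aqHom_apply, evalHom_tmul, mul_one]
    rfl
  · rw [AlgHom.comp_apply, AlgHom.comp_apply, comul_del, sliceLHom_cD, hL, counit_delta,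
      aqHom_apply, evalHom_tmul, AAlg.delta_one]
    rfl

theorem counit_right (x : AFAlg p q) (g : E11) :
    TensorProduct.rid ℂ (AAlg p q) ((counit p q).toLinearMap.lTensor (AAlg p q)
      (sliceR g (comul p q x))) = evalLin g x := by
  let L : AAlg p q ⊗[ℂ] AFAlg p q →ₐ[ℂ] AAlg p q :=
    (Algebra.TensorProduct.rid ℂ ℂ (AAlg p q)).toAlgHom.comp
      (Algebra.TensorProduct.map (AlgHom.id ℂ _) (counit p q))
  have hL : ∀ y b, L (b ⊗ₜ y) = counit p q y • b := fun y b => rfl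
  have hY : ∀ s, L (sliceRHom g (cY p q s)) = 0 := by
    intro s
    rw [sliceRHom_cY, map_smul, hL, counit_eta, zero_smul, smul_zero]
  rw [evalLin_eq, sliceR_eq]
  refine algHom_ext (Φ := (L.comp (sliceRHom g)).comp (comul p q)) (Ψ := evalHom g) ?_ ?_ ?_ x
  · intro f
    rw [AlgHom.comp_apply, AlgHom.comp_apply, comul_fn, tay_map, tay_map]
    have h0 : (fun s => L (sliceRHom g (cN p q s))) = fun _ => 0 := by
      funext s
      rw [cN, map_nil, map_nil, hY, nil_zero_right]
    rw [h0, tay_zero]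
    change L (sliceRHom g (comulRho p q f)) = _
    rw [sliceRHom_rho, hL, counit_fn, Sm.ltrans_apply, Sm.mul_zero', fnHom_apply, evalHom_tmul]
  · intro s
    rw [AlgHom.comp_apply, AlgHom.comp_apply, comul_eta, map_add, map_add, hY, add_zero,
      sliceRHom_cX, hL, map_one, aqHom_apply, evalHom_tmul]
    rfl
  · rw [AlgHom.comp_apply, AlgHom.comp_apply, comul_del, sliceRHom_cD, hL, counit_delta,
      aqHom_apply, evalHom_tmul, AAlg.delta_one]
    rfl

/-! #### Antipode -/

/-- `S(η_±)` -/
def sEta (s : ℤˣ) : AFAlg p q :=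
  -(Sm.expLam (((-s : ℤˣ) : ℤ) / p : ℝ) ⊗ₜ (AAlg.delta p q (-s : ℤˣ) * AAlg.eta p q s))

theorem delta_mul_eta_pow (s : ℤˣ) (k : ℤ) : (AAlg.delta p q k * AAlg.eta p q s) ^ p = 0 := by
  obtain ⟨c, hc⟩ := exists_mul_pow_of_qcomm (AAlg.eta_mul_delta p q s k) p
  rw [hc, (AAlg.rels p q).eta_pow, mul_zero, smul_zero]

open MulOpposite in
theorem antipode_rels : AAlg.Rels p q (fun s => op (sEta p q s))
    (op (aqHom p q (AAlg.delta p q (-1)))) := by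
  have hq := root_ne_zero p q
  have hqs := fun s : ℤˣ => root_ne_zero p (q ^ (s : ℤ))
  have key : ∀ s : ℤˣ, AAlg.delta p q (-s : ℤˣ) * AAlg.eta p q s
      * (AAlg.delta p q (s : ℤˣ) * AAlg.eta p q (-s))
      = (q ^ (s : ℤ)) ^ 2 • (AAlg.eta p q s * AAlg.eta p q (-s)) := by
    intro s
    rw [mul_assoc, ← mul_assoc (AAlg.eta p q s), AAlg.eta_mul_delta, smul_mul_assoc, mul_smul_comm,
      mul_assoc, ← mul_assoc, Units.val_neg, AAlg.delta_neg_mul, one_mul]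
  have k1 := key 1
  have k2 := key (-1)
  have e1 := AAlg.eta_neg_mul p q 1
  simp only [neg_neg, Units.val_neg, Units.val_one, zpow_one, zpow_neg] at k1 k2 e1
  constructor
  · simp only [← op_mul, ← op_smul, sEta, neg_mul_neg, Algebra.TensorProduct.tmul_mul_tmul, neg_neg,
      Units.val_neg, Units.val_one, k1, k2, e1, TensorProduct.tmul_smul, smul_smul]
    congr 1
    rw [mul_comm (Sm.expLam _)]
    congr 1
    field_simp
  · intro s
    simp only [← op_mul, ← op_smul, sEta, mul_neg, neg_mul, aqHom_apply, one_mul, mul_one,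
      Algebra.TensorProduct.tmul_mul_tmul, smul_neg, ← TensorProduct.tmul_smul]
    congr 3
    rw [mul_assoc, AAlg.eta_mul_delta, mul_smul_comm, smul_smul, ← mul_assoc, ← mul_assoc,
      ← AAlg.delta_add, ← AAlg.delta_add, add_comm]
    have : q ^ 2 * (q ^ (-1 : ℤ)) ^ 2 = 1 := by
      rw [zpow_neg_one]; field_simp
    rw [this, one_smul]
  · intro s
    rw [← op_pow, sEta, neg_pow, Algebra.TensorProduct.tmul_pow, delta_mul_eta_pow,
      TensorProduct.tmul_zero, mul_zero, op_zero]
  · rw [← op_pow, ← map_pow, AAlg.delta_pow_root, map_one, op_one]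

theorem fnHom_commute (f : Sm E11) (x : AFAlg p q) : Commute (fnHom p q f) x := by
  induction x using TensorProduct.induction_on with
  | zero => exact Commute.zero_right _
  | add x y hx hy => exact hx.add_right hy
  | tmul g a =>
    change _ * _ = _ * _
    simp [fnHom_apply, mul_comm]

/-- Functions, as elements of the opposite algebra of `A_F`. -/
def fnOp : Sm E11 →ₐ[ℂ] (AFAlg p q)ᵐᵒᵖ :=
  AlgHom.ofLinearMap ((MulOpposite.opLinearEquiv ℂ).toLinearMap ∘ₗ
    ((fnHom p q).comp Sm.invFun).toLinearMap) (by simp)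
    (fun f g => by
      simp only [LinearMap.comp_apply, AlgHom.toLinearMap_apply, LinearEquiv.coe_coe,
        MulOpposite.coe_opLinearEquiv]
      rw [mul_comm, map_mul, MulOpposite.op_mul])

theorem fnOp_apply (f : Sm E11) : fnOp p q f = MulOpposite.op (fnHom p q (Sm.invFun f)) := rfl

/-- The antipode of `A_F` as a homomorphism to the opposite algebra. -/
def antipodeHom : AFAlg p q →ₐ[ℂ] (AFAlg p q)ᵐᵒᵖ :=
  Algebra.TensorProduct.lift (fnOp p q) (AAlg.lift (antipode_rels p q)) fun f a => by
    rw [fnOp_apply]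
    change _ * _ = _ * _
    rw [← MulOpposite.op_unop (AAlg.lift _ a), ← MulOpposite.op_mul, ← MulOpposite.op_mul,
      (fnHom_commute p q _ _).eq]

/-- The antipode of `A_F`. -/
def antipode : AFAlg p q →ₗ[ℂ] AFAlg p q :=
  (MulOpposite.opLinearEquiv ℂ).symm.toLinearMap ∘ₗ (antipodeHom p q).toLinearMap

theorem antipode_apply (x : AFAlg p q) :
    antipode p q x = MulOpposite.unop (antipodeHom p q x) := rfl

theorem antipode_mul (x y : AFAlg p q) :
    antipode p q (x * y) = antipode p q y * antipode p q x := by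
  rw [antipode_apply, map_mul]; rfl

theorem antipode_one : antipode p q 1 = 1 := by rw [antipode_apply, map_one]; rfl

theorem antipode_pow (x : AFAlg p q) (n : ℕ) : antipode p q (x ^ n) = antipode p q x ^ n := by
  rw [antipode_apply, map_pow]; rfl

theorem antipode_fn (f : Sm E11) :
    antipode p q (fnHom p q f) = fnHom p q (Sm.invFun f) := by
  rw [antipode_apply, antipodeHom, fnHom_apply, Algebra.TensorProduct.lift_tmul, map_one, mul_one]
  rfl

theorem antipode_eta (s : ℤˣ) : antipode p q (aqHom p q (AAlg.eta p q s)) = sEta p q s := by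
  change MulOpposite.unop (antipodeHom p q (1 ⊗ₜ _)) = _
  rw [antipodeHom, Algebra.TensorProduct.lift_tmul, map_one, one_mul, AAlg.lift_eta]
  rfl

theorem antipode_del :
    antipode p q (aqHom p q (AAlg.gen p q .del)) = aqHom p q (AAlg.delta p q (-1)) := by
  change MulOpposite.unop (antipodeHom p q (1 ⊗ₜ _)) = _
  rw [antipodeHom, Algebra.TensorProduct.lift_tmul, map_one, one_mul, AAlg.lift_del]
  rfl

theorem antipode_delta (k : ℤ) :
    antipode p q (aqHom p q (AAlg.delta p q k)) = aqHom p q (AAlg.delta p q (-k)) := by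
  have h0 := root_pos p q
  rw [AAlg.delta, map_pow, antipode_pow, antipode_del, ← map_pow, AAlg.delta_pow]
  congr 1
  apply AAlg.delta_congr
  rw [Int.toNat_of_nonneg (Int.emod_nonneg _ (by omega))]
  simpa using (Int.mod_modEq k p).mul_right (-1)

/-- The antipode at a point. -/
def antipodeAt (g : E11) : AFAlg p q →ₗ[ℂ] AAlg p q := evalLin g ∘ₗ antipode p q

theorem antipodeAt_apply (g : E11) (x : AFAlg p q) :
    antipodeAt p q g x = evalHom g (antipode p q x) := by
  rw [antipodeAt, evalLin_eq]; rfl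

theorem antipodeAt_mul (g : E11) (x y : AFAlg p q) :
    antipodeAt p q g (x * y) = antipodeAt p q g y * antipodeAt p q g x := by
  simp only [antipodeAt_apply, antipode_mul, map_mul]

theorem antipodeAt_one (g : E11) : antipodeAt p q g 1 = 1 := by
  rw [antipodeAt_apply, antipode_one, map_one]

theorem antipodeAt_pow (g : E11) (x : AFAlg p q) (n : ℕ) :
    antipodeAt p q g (x ^ n) = antipodeAt p q g x ^ n := by
  simp only [antipodeAt_apply, antipode_pow, map_pow]

theorem antipodeAt_fn (g : E11) (f : Sm E11) :
    antipodeAt p q g (fnHom p q f) = algebraMap ℂ _ (f.1 (E11.inv g)) := by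
  rw [antipodeAt_apply, antipode_fn, fnHom_apply, evalHom_tmul, Algebra.algebraMap_eq_smul_one]
  rfl

theorem antipodeAt_eta (g : E11) (s : ℤˣ) : antipodeAt p q g (aqHom p q (AAlg.eta p q s))
    = -(ex p (-s) g • (AAlg.delta p q (-s : ℤˣ) * AAlg.eta p q s)) := by
  rw [antipodeAt_apply, antipode_eta, sEta, map_neg, evalHom_tmul]
  rfl

theorem antipodeAt_delta (g : E11) (k : ℤ) :
    antipodeAt p q g (aqHom p q (AAlg.delta p q k)) = AAlg.delta p q (-k) := by
  rw [antipodeAt_apply, antipode_delta, aqHom_apply, evalHom_tmul]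
  exact one_smul _ _

theorem antipodeAt_expLam_mul_delta (g : E11) (s : ℤˣ) :
    antipodeAt p q g (fnHom p q (Sm.expLam (((s : ℤ) : ℝ) / p)) * aqHom p q (AAlg.delta p q s))
      = ex p (-s) g • AAlg.delta p q (-s : ℤˣ) := by
  rw [antipodeAt_mul, antipodeAt_delta, antipodeAt_fn, ← Algebra.commutes, ← Algebra.smul_def,
    Units.val_neg]
  congr 1
  change ((Real.exp (((s : ℤ) : ℝ) / p * -g.2) : ℝ) : ℂ)
    = ((Real.exp ((((-s : ℤˣ) : ℤ) : ℝ) / p * g.2) : ℝ) : ℂ)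
  simp [neg_div]

theorem mul_antipodeAt_sliceL_cN (g : E11) (s : ℤˣ) (w : AFAlg2 p q) :
    LinearMap.mul' ℂ (AAlg p q) ((antipodeAt p q g).rTensor (AAlg p q)
      (sliceLHom g (cN p q s * w))) = 0 := by
  rw [map_mul, mul_rTensor_mul_of_eq (c := 0) (antipodeAt_mul p q g), zero_smul]
  rw [cN, map_nil, map_zero]
  change (LinearMap.mul' ℂ (AAlg p q) ∘ₗ (antipodeAt p q g).rTensor (AAlg p q)) _ = 0
  refine linearMap_nil p _ _ fun i j hi hj hij => ?_
  rw [sliceLHom_cX, sliceLHom_cY, Algebra.TensorProduct.tmul_pow, Algebra.TensorProduct.tmul_pow,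
    Algebra.TensorProduct.tmul_mul_tmul, one_pow, one_mul, LinearMap.comp_apply,
    LinearMap.rTensor_tmul, LinearMap.mul'_apply, antipodeAt_mul, antipodeAt_pow, antipodeAt_pow,
    antipodeAt_expLam_mul_delta, antipodeAt_eta]
  obtain ⟨c, hc⟩ := exists_mul_pow_of_qcomm (AAlg.eta_mul_delta p q s (-s : ℤˣ)) i
  rw [← smul_neg, smul_pow, smul_pow, neg_pow, hc]
  simp only [mul_smul_comm, mul_assoc, smul_mul_assoc, ← pow_add, hij, (AAlg.rels p q).eta_pow,
    mul_zero, smul_zero]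

theorem mul_antipodeAt_sliceR_cN (g : E11) (s : ℤˣ) (w : AFAlg2 p q) :
    LinearMap.mul' ℂ (AAlg p q) ((antipodeAt p q g).lTensor (AAlg p q)
      (sliceRHom g (w * cN p q s))) = 0 := by
  rw [map_mul, mul_lTensor_mul_of_eq (c := 0) (antipodeAt_mul p q g), zero_smul]
  rw [cN, map_nil, map_zero]
  change (LinearMap.mul' ℂ (AAlg p q) ∘ₗ (antipodeAt p q g).lTensor (AAlg p q)) _ = 0
  refine linearMap_nil p _ _ fun i j hi hj hij => ?_
  rw [sliceRHom_cX, sliceRHom_cY, smul_pow, mul_smul_comm, map_smul,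
    Algebra.TensorProduct.tmul_pow, Algebra.TensorProduct.tmul_pow,
    Algebra.TensorProduct.tmul_mul_tmul, one_pow, one_mul, LinearMap.comp_apply,
    LinearMap.lTensor_tmul, LinearMap.mul'_apply, antipodeAt_pow, antipodeAt_eta]
  obtain ⟨c, hc⟩ := exists_mul_pow_of_qcomm (AAlg.eta_mul_delta p q s (-s : ℤˣ)) j
  have h2 := pow_mul_pow_of_qcomm (AAlg.eta_mul_delta p q s s) i j
  have h3 := pow_mul_pow_of_qcomm (AAlg.eta_mul_delta p q s (-s : ℤˣ)) i j
  have h4 : AAlg.eta p q s ^ i * AAlg.delta p q s ^ j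
      * (AAlg.delta p q (-s : ℤˣ) ^ j * AAlg.eta p q s ^ j) = 0 := by
    rw [h2, smul_mul_assoc, mul_assoc, ← mul_assoc (AAlg.eta p q s ^ i), h3, smul_mul_assoc,
      mul_assoc, ← pow_add, hij, (AAlg.rels p q).eta_pow]
    simp
  rw [← smul_neg, smul_pow, neg_pow, hc]
  simp only [mul_smul_comm]
  rw [(Commute.neg_one_left _).pow_left j |>.eq, ← mul_assoc, h4]
  simp

theorem antipode_left (x : AFAlg p q) (g : E11) :
    LinearMap.mul' ℂ (AAlg p q) ((antipodeAt p q g).rTensor (AAlg p q)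
      (sliceLHom g (comul p q x))) = algebraMap ℂ (AAlg p q) (counit p q x) := by
  induction x using AFAlg.induction with
  | hf f =>
    have h0 : ∀ f, LinearMap.mul' ℂ (AAlg p q) ((antipodeAt p q g).rTensor (AAlg p q)
        (sliceLHom g (comulRho p q f))) = algebraMap ℂ (AAlg p q) (f.1 0) := by
      intro f
      rw [sliceLHom_rho, LinearMap.rTensor_tmul, LinearMap.mul'_apply, mul_one, antipodeAt_fn,
        Sm.rtrans_apply, Sm.inv_mul']
    have hN := mul_antipodeAt_sliceL_cN p q g
    have hc : ∀ s f, comulRho p q f * cN p q s = cN p q s * comulRho p q f := fun s f =>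
      (fn_commute p q _ _).eq.symm
    rw [comul_fn, tay_apply]
    simp only [AlgHom.toLinearMap_apply, ← mul_assoc, hc]
    simp only [mul_assoc, map_add (sliceLHom g), map_add (LinearMap.rTensor _ _),
      map_add (LinearMap.mul' ℂ _), h0, hN, add_zero, counit_fn]
  | he s =>
    rw [comul_eta, map_add, map_add, map_add, sliceLHom_cX, sliceLHom_cY, LinearMap.rTensor_tmul,
      LinearMap.rTensor_tmul, LinearMap.mul'_apply, LinearMap.mul'_apply, antipodeAt_eta,
      antipodeAt_expLam_mul_delta, counit_eta, mul_one, smul_mul_assoc, neg_add_cancel, map_zero]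
  | hd =>
    rw [comul_del, sliceLHom_cD, LinearMap.rTensor_tmul, LinearMap.mul'_apply, antipodeAt_delta,
      AAlg.delta_neg_mul, counit_del, map_one]
  | hmul x y hx hy =>
    rw [map_mul, map_mul, mul_rTensor_mul_of_eq (antipodeAt_mul p q g) hx, hy, map_mul, map_mul,
      ← Algebra.smul_def]
  | hadd x y hx hy => simp only [map_add, hx, hy]

theorem antipode_right (x : AFAlg p q) (g : E11) :
    LinearMap.mul' ℂ (AAlg p q) ((antipodeAt p q g).lTensor (AAlg p q)
      (sliceRHom g (comul p q x))) = algebraMap ℂ (AAlg p q) (counit p q x) := by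
  induction x using AFAlg.induction with
  | hf f =>
    have h0 : ∀ f, LinearMap.mul' ℂ (AAlg p q) ((antipodeAt p q g).lTensor (AAlg p q)
        (sliceRHom g (comulRho p q f))) = algebraMap ℂ (AAlg p q) (f.1 0) := by
      intro f
      rw [sliceRHom_rho, LinearMap.lTensor_tmul, LinearMap.mul'_apply, one_mul, antipodeAt_fn,
        Sm.ltrans_apply, E11.mul_inv]
    have hN := mul_antipodeAt_sliceR_cN p q g
    rw [comul_fn, tay_apply]
    simp only [AlgHom.toLinearMap_apply, ← mul_assoc]
    simp only [map_add (sliceRHom g), map_add (LinearMap.lTensor _ _),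
      map_add (LinearMap.mul' ℂ _), h0, hN, add_zero, counit_fn]
  | he s =>
    have h1 : AAlg.delta p q s * (AAlg.delta p q (-s : ℤˣ) * AAlg.eta p q s) = AAlg.eta p q s := by
      rw [← mul_assoc, Units.val_neg, AAlg.delta_mul_neg, one_mul]
    rw [comul_eta, map_add, map_add, map_add, sliceRHom_cX, sliceRHom_cY, map_smul, map_smul,
      LinearMap.lTensor_tmul, LinearMap.lTensor_tmul, LinearMap.mul'_apply, LinearMap.mul'_apply,
      antipodeAt_eta, antipodeAt_one, counit_eta, mul_one, mul_neg, mul_smul_comm, h1, smul_neg,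
      smul_smul, mul_comm, ex_neg_mul, one_smul, add_neg_cancel, map_zero]
  | hd =>
    rw [comul_del, sliceRHom_cD, LinearMap.lTensor_tmul, LinearMap.mul'_apply, antipodeAt_delta,
      AAlg.delta_mul_neg, counit_del, map_one]
  | hmul x y hx hy =>
    rw [map_mul, map_mul, mul_lTensor_mul_of_eq (antipodeAt_mul p q g) _ hy, hx, map_mul, mul_comm,
      map_mul, ← Algebra.smul_def]
  | hadd x y hx hy => simp only [map_add, hx, hy]

/-! #### Involution -/

theorem star_fn (f : Sm E11) : star (fnHom p q f) = fnHom p q (star f) := by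
  rw [fnHom_apply, fnHom_apply, TensorProduct.star_tmul, star_one]

theorem star_aq (a : AAlg p q) : star (aqHom p q a) = aqHom p q (star a) := by
  rw [aqHom_apply, aqHom_apply, TensorProduct.star_tmul, star_one]

theorem star_cX (s : ℤˣ) : star (cX p q s) = cX p q s := by
  simp [cX, AAlg.star_eta]

theorem star_cE (s : ℤˣ) : star (cE p s) = cE p s :=
  Sm.ext' fun _ => Complex.conj_ofReal _

theorem star_cY (s : ℤˣ) : star (cY p q s) = cY p q s := by
  rw [cY, TensorProduct.star_tmul, TensorProduct.star_tmul, star_cE, AAlg.star_eta,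
    AAlg.star_delta]

theorem star_cN (s : ℤˣ) : star (cN p q s) = cN p q s :=
  star_nil (A := AFAlg2 p q) p _ (cX_mul_cY p q s) (star_cX p q s) (star_cY p q s)

theorem star_comulRho (f : Sm E11) : star (comulRho p q f) = comulRho p q (star f) := by
  rw [comulRho_apply, comulRho_apply, TensorProduct.star_tmul, star_one]
  rfl

theorem comul_star (x : AFAlg p q) : comul p q (star x) = star (comul p q x) := by
  induction x using AFAlg.induction with
  | hf f =>
    have hc : ∀ f y, y * comulRho p q f = comulRho p q f * y := fun f y =>
      (fn_commute p q _ _).eq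
    rw [star_fn, comul_fn, comul_fn, tay_apply, tay_apply]
    simp only [AlgHom.toLinearMap_apply, star_add, star_mul, star_cN, star_comulRho, hc,
      Sm.dz_star, (cN_commute p q).eq]
  | he s => rw [star_aq, AAlg.star_eta, comul_eta, star_add, star_cX, star_cY]
  | hd =>
    rw [star_aq, AAlg.star_gen, comul_del, cD, TensorProduct.star_tmul, TensorProduct.star_tmul,
      star_one, AAlg.star_delta]
  | hmul x y hx hy => rw [star_mul, map_mul, hx, hy, map_mul, star_mul]
  | hadd x y hx hy => rw [star_add, map_add, hx, hy, map_add, star_add]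

theorem counit_star (x : AFAlg p q) : counit p q (star x) = star (counit p q x) := by
  induction x using AFAlg.induction with
  | hf f => rw [star_fn, counit_fn, counit_fn]; rfl
  | he s => rw [star_aq, AAlg.star_eta, counit_eta, star_zero]
  | hd => rw [star_aq, AAlg.star_gen, counit_del, star_one]
  | hmul x y hx hy => rw [star_mul, map_mul, hx, hy, map_mul, star_mul]
  | hadd x y hx hy => rw [star_add, map_add, hx, hy, map_add, star_add]

end Hopf

end AFAlg

namespace AFAlg

section Formulas

variable (p : ℕ) (q : ℂ)

/-- The canonical map of the algebraic tensor square of `A_F` to the completed one. -/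
def ext : AFAlg p q ⊗[ℂ] AFAlg p q →ₐ[ℂ] AFAlg2 p q := AF.ext p q

theorem ext_tmul (f g : Sm E11) (a b : AAlg p q) : ext p q ((f ⊗ₜ a) ⊗ₜ (g ⊗ₜ b))
    = (Sm.pullback Prod.fst contDiff_fst f * Sm.pullback Prod.snd contDiff_snd g)
      ⊗ₜ (a ⊗ₜ b) := rfl

variable [hpq : RootData p q]

theorem cX_eq (s : ℤˣ) : cX p q s = ext p q (aqHom p q (AAlg.eta p q s) ⊗ₜ 1) := by
  rw [aqHom_apply, Algebra.TensorProduct.one_def, ext_tmul, map_one, map_one, mul_one]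
  rfl

theorem cY_eq (s : ℤˣ) : cY p q s = ext p q ((aqHom p q (AAlg.delta p q s)
    * fnHom p q (Sm.expLam (((s : ℤ) : ℝ) / p))) ⊗ₜ aqHom p q (AAlg.eta p q s)) := by
  rw [← (fnHom_commute p q _ _).eq, fnHom_mul_aqHom, aqHom_apply, ext_tmul, map_one, mul_one]
  rfl

theorem cD_eq : cD p q = ext p q (aqHom p q (AAlg.delta p q 1) ⊗ₜ aqHom p q (AAlg.delta p q 1)) := by
  rw [aqHom_apply, ext_tmul, map_one, map_one, mul_one]
  rfl

theorem cN_eq (s : ℤˣ) : cN p q s = (-1 : ℂ) ^ ((p + 1) / 2) • ∑ n ∈ Finset.Icc 1 (p - 1),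
    (q ^ ((s : ℤ) * (n : ℤ) ^ 2) / (qFact q (p - n) * qFact q n)) •
      ext p q ((aqHom p q (AAlg.eta p q s) ^ (p - n) * aqHom p q (AAlg.delta p q (s * n))
        * fnHom p q (Sm.expLam (((s : ℤ) : ℝ) * n / p))) ⊗ₜ[ℂ] (aqHom p q (AAlg.eta p q s) ^ n)) := by
  rw [cN, nil_eq_sum_Icc]
  congr 1
  refine Finset.sum_congr rfl fun n _ => ?_
  rw [qFact_zpow, qFact_zpow, zpow_mul, ← zpow_natCast (q ^ (s : ℤ)), cX_eq, cY_eq, ← map_pow,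
    ← map_pow, ← map_mul, Algebra.TensorProduct.tmul_pow, Algebra.TensorProduct.tmul_pow,
    Algebra.TensorProduct.tmul_mul_tmul, one_pow, one_mul, (fnHom_commute p q _ _).symm.mul_pow,
    ← map_pow (aqHom p q) (AAlg.delta p q s), AAlg.delta_pow, ← map_pow (fnHom p q), Sm.expLam_pow,
    ← mul_assoc]
  push_cast
  rw [mul_comm (s : ℤ) (n : ℤ), mul_comm ((s : ℤ) : ℝ) (n : ℝ), mul_div_assoc]

theorem comul_lam : comul p q (fnHom p q Sm.lam)
    = ext p q (fnHom p q Sm.lam ⊗ₜ 1 + 1 ⊗ₜ fnHom p q Sm.lam) := by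
  rw [comul_fn, tay_apply]
  simp only [Sm.dz_lam, map_zero, zero_mul, add_zero, AlgHom.toLinearMap_apply, map_add]
  rw [fnHom_apply, Algebra.TensorProduct.one_def, ext_tmul, ext_tmul, ← TensorProduct.add_tmul,
    map_one, map_one, mul_one, one_mul, comulRho_apply]
  congr 1
  refine Sm.ext' fun x => ?_
  change ((x.1.2 + x.2.2 : ℝ) : ℂ) = (x.1.2 : ℂ) + (x.2.2 : ℂ)
  push_cast
  rfl

theorem comul_z (s : ℤˣ) : comul p q (fnHom p q (Sm.z s))
    = ext p q (fnHom p q (Sm.z s) ⊗ₜ 1 + fnHom p q (Sm.expLam ((s : ℤ) : ℝ)) ⊗ₜ fnHom p q (Sm.z s))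
      + cN p q s := by
  rw [comul_fn, tay_z _ (map_one (comulRho p q)), AlgHom.toLinearMap_apply, map_add]
  congr 1
  rw [fnHom_apply, fnHom_apply, Algebra.TensorProduct.one_def, ext_tmul, ext_tmul,
    ← TensorProduct.add_tmul, map_one, mul_one, comulRho_apply]
  congr 1
  refine Sm.ext' fun x => ?_
  change ((x.1.1 s + Real.exp (((s : ℤ) : ℝ) * x.1.2) * x.2.1 s : ℝ) : ℂ)
    = (x.1.1 s : ℂ) + (Real.exp (((s : ℤ) : ℝ) * x.1.2) : ℂ) * (x.2.1 s : ℂ)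
  push_cast
  rfl

theorem sum_range_eq_of_eq_zero {M : Type*} [AddCommMonoid M] (f : ℕ → M) (hp : Odd p)
    (h2 : ∀ j, 2 ≤ j → f j = 0) (h1 : p = 1 → f 1 = 0) :
    ∑ j ∈ Finset.range p, f j = f 0 + f 1 := by
  have h0 := hp.pos
  rcases Nat.lt_or_ge p 2 with h | h
  · have : p = 1 := by omega
    subst this
    simp [h1 rfl]
  · rw [← Finset.sum_subset (s₁ := Finset.range 2)]
    · simp [Finset.sum_range_succ]
    · intro x hx
      simp only [Finset.mem_range] at *
      omega
    · intro x _ hx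
      simp only [Finset.mem_range] at *
      exact h2 x (by omega)

theorem cN_eq_zero (h : p = 1) (s : ℤˣ) : cN p q s = 0 := by
  have := cX_pow p q s
  rw [show cX p q s ^ p = cX p q s by rw [h, pow_one]] at this
  rw [cN, this, nil_zero_left]

theorem comul_fn_eq_sum (f : Sm E11) : comul p q (fnHom p q f)
    = ∑ j ∈ Finset.range p, ∑ k ∈ Finset.range p,
      (1 / ((j.factorial : ℂ) * (k.factorial : ℂ))) •
        (((Sm.comulFun ((Sm.dz 1 ^ j * Sm.dz (-1) ^ k : Module.End ℂ (Sm E11)) f))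
          ⊗ₜ[ℂ] (1 : AAlg p q ⊗[ℂ] AAlg p q)) * cN p q 1 ^ j * cN p q (-1) ^ k) := by
  have hN : ∀ (s : ℤˣ) (j : ℕ), 2 ≤ j → cN p q s ^ j = 0 := fun s j hj =>
    pow_eq_zero_of_le hj (by rw [sq, cN_sq])
  have hk : ∀ j : ℕ, ∑ k ∈ Finset.range p, (1 / ((j.factorial : ℂ) * (k.factorial : ℂ))) •
        (((Sm.comulFun ((Sm.dz 1 ^ j * Sm.dz (-1) ^ k : Module.End ℂ (Sm E11)) f))
          ⊗ₜ[ℂ] (1 : AAlg p q ⊗[ℂ] AAlg p q)) * cN p q 1 ^ j * cN p q (-1) ^ k)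
      = _ := fun j => sum_range_eq_of_eq_zero p _ hpq.odd
        (fun k hk => by rw [hN _ _ hk, mul_zero, smul_zero])
        (fun h => by rw [cN_eq_zero p q h (-1), pow_one (0 : AFAlg2 p q), mul_zero, smul_zero])
  rw [Finset.sum_congr rfl fun j _ => hk j, sum_range_eq_of_eq_zero p _ hpq.odd]
  · rw [comul_fn, tay_apply]
    simp only [pow_zero, pow_one, Nat.factorial_zero, Nat.factorial_one, Nat.cast_one, mul_one,
      one_mul, div_one, one_smul, Module.End.mul_apply, Module.End.one_apply, mul_assoc]
    simp only [AlgHom.toLinearMap_apply, comulRho_apply]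
    abel
  · intro j hj
    simp only [hN _ _ hj, mul_zero, zero_mul, smul_zero, add_zero]
  · intro h
    simp only [pow_one, cN_eq_zero p q h, mul_zero, zero_mul, smul_zero, add_zero]

theorem sEta_eq (s : ℤˣ) : sEta p q s = -(aqHom p q (AAlg.delta p q (-(s : ℤ)))
    * fnHom p q (Sm.expLam (-((s : ℤ) : ℝ) / p)) * aqHom p q (AAlg.eta p q s)) := by
  rw [← (fnHom_commute p q _ _).eq, mul_assoc, ← map_mul, fnHom_mul_aqHom, sEta]
  simp

theorem antipode_z (s : ℤˣ) : antipode p q (fnHom p q (Sm.z s))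
    = -(fnHom p q (Sm.expLam (-((s : ℤ) : ℝ))) * fnHom p q (Sm.z s)) := by
  rw [antipode_fn, ← map_mul, ← map_neg]
  congr 1
  refine Sm.ext' fun x => ?_
  change ((-(Real.exp (-(((s : ℤ) : ℝ) * x.2)) * x.1 s) : ℝ) : ℂ)
    = -((Real.exp (-((s : ℤ) : ℝ) * x.2) : ℂ) * (x.1 s : ℂ))
  push_cast
  rw [neg_mul]

theorem antipode_lam : antipode p q (fnHom p q Sm.lam) = -fnHom p q Sm.lam := by
  rw [antipode_fn, ← map_neg]
  congr 1
  refine Sm.ext' fun x => ?_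
  change ((-x.2 : ℝ) : ℂ) = -(x.2 : ℂ)
  push_cast
  rfl

end Formulas

end AFAlg

/-! ### Twisted derivations -/

theorem upperTriangular_pow {A : Type*} [Ring A] (a d b : A) (n : ℕ) :
    !![a, d; 0, b] ^ n
      = !![a ^ n, ∑ i ∈ Finset.range n, a ^ i * d * b ^ (n - 1 - i); 0, b ^ n] := by
  induction n with
  | zero =>
    ext i j
    fin_cases i <;> fin_cases j <;> simp
  | succ n ih =>
    rw [pow_succ, ih, Matrix.mul_fin_two]
    have h : a ^ n * d + (∑ i ∈ Finset.range n, a ^ i * d * b ^ (n - 1 - i)) * b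
        = ∑ i ∈ Finset.range (n + 1), a ^ i * d * b ^ (n + 1 - 1 - i) := by
      rw [Finset.sum_range_succ, Finset.sum_mul, add_comm]
      simp only [Nat.add_sub_cancel, Nat.sub_self, pow_zero, mul_one]
      congr 1
      refine Finset.sum_congr rfl fun i hi => ?_
      have := Finset.mem_range.1 hi
      rw [mul_assoc, ← pow_succ]
      congr 2
      omega
    rw [h]
    simp [← pow_succ]

namespace AAlg

variable {p : ℕ} {q : ℂ}

/-- The relations between the values on generators of a derivation twisted by two homomorphisms. -/
structure DerRels (p : ℕ) (q : ℂ) (K₁ K₂ : AAlg p q →ₐ[ℂ] AAlg p q) (d : ℤˣ → AAlg p q) : Prop where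
  eta_eta : K₁ (eta p q (-1)) * d 1 + d (-1) * K₂ (eta p q 1)
    = q ^ 2 • (K₁ (eta p q 1) * d (-1) + d 1 * K₂ (eta p q (-1)))
  eta_del : ∀ s, d s * K₂ (gen p q .del) = q ^ 2 • (K₁ (gen p q .del) * d s)
  eta_pow : ∀ s, ∑ i ∈ Finset.range p, K₁ (eta p q s) ^ i * d s * K₂ (eta p q s) ^ (p - 1 - i) = 0

section TwistedDerivation

variable {K₁ K₂ : AAlg p q →ₐ[ℂ] AAlg p q} {d : ℤˣ → AAlg p q}

theorem DerRels.rels (h : DerRels p q K₁ K₂ d) :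
    Rels p q (fun s => !![K₁ (eta p q s), d s; 0, K₂ (eta p q s)])
      !![K₁ (gen p q .del), 0; 0, K₂ (gen p q .del)] := by
  have hR := AAlg.rels p q
  constructor
  · simp only [Matrix.mul_fin_two, Matrix.smul_of, Matrix.smul_cons, Matrix.smul_empty, mul_zero,
      zero_mul, zero_add, add_zero, ← map_mul, hR.eta_eta, map_smul, h.eta_eta, smul_zero]
  · intro s
    simp only [Matrix.mul_fin_two, Matrix.smul_of, Matrix.smul_cons, Matrix.smul_empty, mul_zero,
      zero_mul, zero_add, add_zero, ← map_mul, hR.eta_del, map_smul, h.eta_del, smul_zero]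
  · intro s
    rw [upperTriangular_pow, h.eta_pow, ← map_pow, ← map_pow, hR.eta_pow, map_zero, map_zero]
    ext i j
    fin_cases i <;> fin_cases j <;> rfl
  · rw [upperTriangular_pow, ← map_pow, ← map_pow, hR.del_pow, map_one, map_one, Matrix.one_fin_two]
    simp

/-- The derivation with given values on the generators `η_±` and value zero at `δ`. -/
def derOf (h : DerRels p q K₁ K₂ d) : AAlg p q →ₗ[ℂ] AAlg p q where
  toFun x := lift h.rels x 0 1
  map_add' x y := by rw [map_add]; rfl
  map_smul' c x := by rw [map_smul]; rfl

theorem derOf_eta (h : DerRels p q K₁ K₂ d) (s : ℤˣ) : derOf h (eta p q s) = d s := by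
  change lift h.rels (eta p q s) 0 1 = d s
  rw [lift_eta]; rfl

theorem derOf_del (h : DerRels p q K₁ K₂ d) : derOf h (gen p q .del) = 0 := by
  change lift h.rels (gen p q .del) 0 1 = 0
  rw [lift_del]; rfl

theorem lift_derRels (h : DerRels p q K₁ K₂ d) (x : AAlg p q) :
    lift h.rels x = !![K₁ x, derOf h x; 0, K₂ x] := by
  have key : lift h.rels x 0 0 = K₁ x ∧ lift h.rels x 1 0 = 0 ∧ lift h.rels x 1 1 = K₂ x := by
    induction x using AAlg.induction with
    | hc c => simp [Matrix.algebraMap_matrix_apply]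
    | hg x =>
      rw [lift_gen]
      cases x with
      | eta s => exact ⟨rfl, rfl, rfl⟩
      | del => exact ⟨rfl, rfl, rfl⟩
    | hmul x y hx hy =>
      obtain ⟨h1, h2, h3⟩ := hx
      obtain ⟨h4, h5, h6⟩ := hy
      simp only [map_mul, Matrix.mul_apply, Fin.sum_univ_two, h1, h2, h3, h4, h5, h6]
      simp
    | hadd x y hx hy =>
      obtain ⟨h1, h2, h3⟩ := hx
      obtain ⟨h4, h5, h6⟩ := hy
      simp only [map_add, Matrix.add_apply, h1, h2, h3, h4, h5, h6]
      simp
  ext i j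
  fin_cases i <;> fin_cases j
  exacts [key.1, rfl, key.2.1, key.2.2]

theorem derOf_mul (h : DerRels p q K₁ K₂ d) (x y : AAlg p q) :
    derOf h (x * y) = K₁ x * derOf h y + derOf h x * K₂ y := by
  change lift h.rels (x * y) 0 1 = _
  rw [map_mul, lift_derRels h, lift_derRels h, Matrix.mul_fin_two]
  rfl

end TwistedDerivation

/-! ### The operators on `A(E_q(1,1))` -/

variable (p q)
variable [hpq : RootData p q]

theorem zpow_pow_root (k : ℤ) : (q ^ k) ^ p = 1 := by
  rw [← zpow_natCast, zpow_comm, zpow_natCast, root_pow p q, one_zpow]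

theorem kapA_rels (k : ℤ) : Rels p q (fun s : ℤˣ => q ^ (k * s) • eta p q s)
    (q ^ k • gen p q .del) where
  eta_eta := by
    rw [smul_mul_smul_comm, smul_mul_smul_comm, (rels p q).eta_eta, smul_comm, mul_comm]
  eta_del s := by
    rw [smul_mul_smul_comm, smul_mul_smul_comm, (rels p q).eta_del, smul_comm, mul_comm]
  eta_pow s := by rw [smul_pow, (rels p q).eta_pow, smul_zero]
  del_pow := by rw [smul_pow, (rels p q).del_pow, zpow_pow_root, one_smul]

/-- The action of `κ^k` on `A(E_q(1,1))`. -/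
def kapA (k : ℤ) : AAlg p q →ₐ[ℂ] AAlg p q := lift (kapA_rels p q k)

theorem kapA_eta (k : ℤ) (s : ℤˣ) : kapA p q k (eta p q s) = q ^ (k * s) • eta p q s :=
  lift_eta (kapA_rels p q k) s

theorem kapA_del (k : ℤ) : kapA p q k (gen p q .del) = q ^ k • gen p q .del :=
  lift_del (kapA_rels p q k)

theorem kapA_delta (k j : ℤ) : kapA p q k (delta p q j) = q ^ (k * j) • delta p q j := by
  have h0 := root_pos p q
  rw [delta, map_pow, kapA_del, smul_pow]
  congr 1
  rw [← zpow_natCast, ← zpow_mul, Int.toNat_of_nonneg (Int.emod_nonneg _ (by omega))]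
  exact zpow_root_congr p q ((Int.mod_modEq j p).mul_left k)

theorem kapA_add (j k : ℤ) (x : AAlg p q) : kapA p q (j + k) x = kapA p q j (kapA p q k x) := by
  have hq := root_ne_zero p q
  have : kapA p q (j + k) = (kapA p q j).comp (kapA p q k) := by
    refine algHom_ext (fun s => ?_) ?_
    · rw [AlgHom.comp_apply, kapA_eta, kapA_eta, map_smul, kapA_eta, smul_smul, add_mul,
        zpow_add₀ hq, mul_comm]
    · rw [AlgHom.comp_apply, kapA_del, kapA_del, map_smul, kapA_del, smul_smul, zpow_add₀ hq,
        mul_comm]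
  rw [this, AlgHom.comp_apply]

theorem kapA_zero (x : AAlg p q) : kapA p q 0 x = x := by
  have : kapA p q 0 = AlgHom.id ℂ _ := by
    refine algHom_ext (fun s => ?_) ?_
    · simp [kapA_eta]
    · simp [kapA_del]
  rw [this, AlgHom.id_apply]

theorem kapA_congr {a b : ℤ} (h : a ≡ b [ZMOD p]) (x : AAlg p q) : kapA p q a x = kapA p q b x := by
  have : kapA p q a = kapA p q b := by
    refine algHom_ext (fun s => ?_) ?_
    · rw [kapA_eta, kapA_eta, zpow_root_congr p q (h.mul_right _)]
    · rw [kapA_del, kapA_del, zpow_root_congr p q h]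
  rw [this]

theorem kapA_idem (j k : ℤ) : kapA p q j (idem p q k) = idem p q (k - j) := by
  have hq := root_ne_zero p q
  rw [idem, idem, map_smul, map_sum]
  congr 1
  refine Finset.sum_congr rfl fun n _ => ?_
  rw [map_pow, map_smul, kapA_del, smul_smul, zpow_sub₀ hq, inv_div, div_eq_inv_mul]

theorem kapA_monoZ (j : ℤ) (n m : ℕ) (k : ℤ) :
    kapA p q j (monoZ p q n m k) = q ^ (j * (n - m)) • monoZ p q n m (k - j) := by
  have hq := root_ne_zero p q
  rw [monoZ, map_mul, map_mul, map_pow, map_pow, kapA_eta, kapA_eta, kapA_idem, smul_pow, smul_pow,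
    smul_mul_smul_comm, smul_mul_assoc, monoZ]
  congr 1
  rw [← zpow_natCast, ← zpow_natCast, ← zpow_mul, ← zpow_mul, ← zpow_add₀ hq]
  congr 1
  push_cast
  ring

theorem degA_rels : DerRels p q (AlgHom.id ℂ _) (AlgHom.id ℂ _) (fun s => sgn s • eta p q s) where
  eta_eta := by
    simp only [AlgHom.id_apply, mul_smul_comm, smul_mul_assoc, (rels p q).eta_eta, smul_add]
    rw [smul_comm (sgn 1), smul_comm (sgn (-1)), add_comm]
  eta_del s := by
    simp only [AlgHom.id_apply, mul_smul_comm, smul_mul_assoc, (rels p q).eta_del]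
    rw [smul_comm]
  eta_pow s := by
    have h0 := root_pos p q
    refine Finset.sum_eq_zero fun i hi => ?_
    have := Finset.mem_range.1 hi
    rw [AlgHom.id_apply, mul_smul_comm, smul_mul_assoc, ← pow_succ, ← pow_add,
      eta_pow_eq_zero p q s (by omega), smul_zero]

/-- The grading derivation with degree `±1` on `η_±`. -/
def degA : AAlg p q →ₗ[ℂ] AAlg p q := derOf (degA_rels p q)

theorem degA_mul (x y : AAlg p q) : degA p q (x * y) = x * degA p q y + degA p q x * y :=
  derOf_mul (degA_rels p q) x y

theorem degA_eta (s : ℤˣ) : degA p q (eta p q s) = sgn s • eta p q s := derOf_eta (degA_rels p q) s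

theorem degA_del : degA p q (gen p q .del) = 0 := derOf_del (degA_rels p q)

theorem sum_root_eq_zero : ∑ i ∈ Finset.range p, q⁻¹ ^ i * (qNum q 1 * q ^ (p - 1 - i)) = 0 := by
  have hq := root_ne_zero p q
  have h0 := root_pos p q
  by_cases h1 : q - q⁻¹ = 0
  · simp [qNum, h1]
  have h2 : (q⁻¹ ^ 2 - 1) * ∑ i ∈ Finset.range p, (q⁻¹ ^ 2) ^ i = 0 := by
    rw [mul_geom_sum, pow_right_comm, inv_pow, root_pow p q]
    simp
  have h3 : q⁻¹ ^ 2 - 1 ≠ 0 := by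
    intro h
    apply h1
    have : q⁻¹ ^ 2 - 1 = -(q⁻¹ * (q - q⁻¹)) := by field_simp; ring
    rw [this, neg_eq_zero] at h
    exact (mul_eq_zero.1 h).resolve_left (inv_ne_zero hq)
  have h4 := (mul_eq_zero.1 h2).resolve_left h3
  have : ∀ i ∈ Finset.range p, q⁻¹ ^ i * (qNum q 1 * q ^ (p - 1 - i))
      = qNum q 1 * q ^ (p - 1) * (q⁻¹ ^ 2) ^ i := by
    intro i hi
    have hi' := Finset.mem_range.1 hi
    rw [show q ^ (p - 1) = q ^ (p - 1 - i) * q ^ i by rw [← pow_add]; congr 1; omega]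
    have : q ^ i * q⁻¹ ^ i = 1 := by rw [← mul_pow, mul_inv_cancel₀ hq, one_pow]
    rw [← pow_mul, mul_comm 2, pow_mul, sq]
    linear_combination (-qNum q 1 * q ^ (p - 1 - i) * q⁻¹ ^ i) * this
  rw [Finset.sum_congr rfl this, ← Finset.mul_sum, h4, mul_zero]

theorem pA_rels (e : ℂ) (s : ℤˣ) : DerRels p q (kapA p q (-1)) (kapA p q 1)
    (fun t => if t = s then (e * qNum q 1) • 1 else 0) where
  eta_eta := by
    have hq := root_ne_zero p q
    rcases Int.units_eq_one_or s with rfl | rfl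
    · rw [if_pos rfl, if_neg (by decide)]
      simp only [kapA_eta, mul_smul_comm, smul_mul_assoc, mul_one, one_mul, mul_zero, zero_mul,
        zero_add, add_zero, smul_smul]
      congr 1
      simp
      field_simp
    · rw [if_pos rfl, if_neg (by decide)]
      simp only [kapA_eta, mul_smul_comm, smul_mul_assoc, mul_one, one_mul, mul_zero, zero_mul,
        zero_add, add_zero, smul_smul, smul_zero]
      congr 1
      simp
      field_simp
  eta_del t := by
    have hq := root_ne_zero p q
    split_ifs
    · simp only [kapA_del, mul_smul_comm, smul_mul_assoc, mul_one, one_mul, smul_smul]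
      congr 1
      simp
      field_simp
    · simp
  eta_pow t := by
    split_ifs with h
    · subst h
      have hs := sum_root_eq_zero p (q ^ (t : ℤ))
      rw [qNum_zpow] at hs
      have : ∀ i ∈ Finset.range p, kapA p q (-1) (eta p q t) ^ i * (e * qNum q 1) • 1
          * kapA p q 1 (eta p q t) ^ (p - 1 - i)
          = ((q ^ (t : ℤ))⁻¹ ^ i * (qNum q 1 * (q ^ (t : ℤ)) ^ (p - 1 - i)))
            • (e • eta p q t ^ (p - 1)) := by
        intro i hi
        have hi' := Finset.mem_range.1 hi
        simp only [kapA_eta, smul_pow, mul_smul_comm, smul_mul_assoc, mul_one, smul_smul,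
          ← pow_add, neg_one_mul, one_mul, zpow_neg]
        rw [show i + (p - 1 - i) = p - 1 by omega]
        congr 1
        ring
      rw [Finset.sum_congr rfl this, ← Finset.sum_smul, hs, zero_smul]
    · simp

/-- The part of the action of `p_±` that acts on `A(E_q(1,1))` only: the twisted derivation with
`η_± ↦ e [1]`. -/
def pA (e : ℂ) (s : ℤˣ) : AAlg p q →ₗ[ℂ] AAlg p q := derOf (pA_rels p q e s)

theorem pA_mul (e : ℂ) (s : ℤˣ) (x y : AAlg p q) : pA p q e s (x * y)
    = kapA p q (-1) x * pA p q e s y + pA p q e s x * kapA p q 1 y := derOf_mul (pA_rels p q e s) x y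

theorem pA_eta (e : ℂ) (s : ℤˣ) : pA p q e s (eta p q s) = (e * qNum q 1) • 1 := by
  rw [pA, derOf_eta, if_pos rfl]

theorem pA_eta_neg (e : ℂ) (s : ℤˣ) : pA p q e s (eta p q (-s)) = 0 := by
  rw [pA, derOf_eta, if_neg]
  rcases Int.units_eq_one_or s with rfl | rfl <;> decide

theorem pA_del (e : ℂ) (s : ℤˣ) : pA p q e s (gen p q .del) = 0 := derOf_del (pA_rels p q e s)

theorem pA_one (e : ℂ) (s : ℤˣ) : pA p q e s 1 = 0 := by
  have h := pA_mul p q e s 1 1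
  rw [map_one (kapA p q (-1)), map_one (kapA p q 1), mul_one, one_mul, mul_one] at h
  exact left_eq_add.1 h

theorem pA_pow_eq_zero (e : ℂ) (s : ℤˣ) {x : AAlg p q} (hx : pA p q e s x = 0) (n : ℕ) :
    pA p q e s (x ^ n) = 0 := by
  induction n with
  | zero => rw [pow_zero, pA_one]
  | succ n ih => rw [pow_succ, pA_mul, hx, ih, mul_zero, zero_mul, add_zero]

theorem pA_delta (e : ℂ) (s : ℤˣ) (k : ℤ) : pA p q e s (delta p q k) = 0 :=
  pA_pow_eq_zero p q e s (pA_del p q e s) _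

theorem pA_idem (e : ℂ) (s : ℤˣ) (k : ℤ) : pA p q e s (idem p q k) = 0 := by
  rw [idem, map_smul, map_sum, Finset.sum_eq_zero, smul_zero]
  intro n _
  rw [smul_pow, map_smul, pA_pow_eq_zero p q e s (pA_del p q e s), smul_zero]

theorem pA_eta_pow (e : ℂ) (s : ℤˣ) (n : ℕ) :
    pA p q e s (eta p q s ^ n) = (e * qNum q n) • eta p q s ^ (n - 1) := by
  induction n with
  | zero => rw [pow_zero, pA_one]; simp [qNum]
  | succ n ih =>
    have h := qNum_add (root_ne_zero p (q ^ (s : ℤ))) 1 n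
    rw [qNum_zpow, qNum_zpow, qNum_zpow, pow_one] at h
    rw [pow_succ, pA_mul, ih, pA_eta, map_pow, kapA_eta, kapA_eta, smul_pow, Nat.add_sub_cancel,
      smul_mul_smul_comm, smul_mul_smul_comm, mul_one]
    have hn : (e * qNum q n * q ^ (1 * (s : ℤ))) • (eta p q s ^ (n - 1) * eta p q s)
        = (e * qNum q n * q ^ (1 * (s : ℤ))) • eta p q s ^ n := by
      rcases n with _ | n
      · simp [qNum]
      · rw [Nat.add_sub_cancel, ← pow_succ]
    rw [hn, ← add_smul]
    congr 1
    rw [add_comm n 1, ← h, neg_one_mul, one_mul, zpow_neg]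
    ring

theorem pA_one_monoZ (e : ℂ) (n m : ℕ) (k : ℤ) :
    pA p q e 1 (monoZ p q n m k) = (e * qNum q n * q⁻¹ ^ m) • monoZ p q (n - 1) m (k - 1) := by
  have h0 : pA p q e 1 (eta p q (-1) ^ m * idem p q k) = 0 := by
    rw [pA_mul, pA_idem, pA_pow_eq_zero p q e 1 (pA_eta_neg p q e 1), mul_zero, zero_mul, add_zero]
  rw [monoZ, mul_assoc, pA_mul, h0, mul_zero, zero_add, pA_eta_pow, map_mul, map_pow, kapA_eta,
    kapA_idem, smul_pow, smul_mul_assoc, smul_mul_assoc, mul_smul_comm, smul_smul, monoZ, mul_assoc]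
  simp [mul_assoc]

theorem pA_neg_one_monoZ (e : ℂ) (n m : ℕ) (k : ℤ) :
    pA p q e (-1) (monoZ p q n m k) = (e * qNum q m * q⁻¹ ^ n) • monoZ p q n (m - 1) (k - 1) := by
  have h1 : pA p q e (-1) (eta p q 1) = 0 := by simpa using pA_eta_neg p q e (-1)
  have h0 : pA p q e (-1) (eta p q 1 ^ n) = 0 := pA_pow_eq_zero p q e (-1) h1 n
  rw [monoZ, pA_mul, pA_mul, h0, zero_mul, add_zero, pA_idem, mul_zero, zero_add, pA_eta_pow,
    map_pow, kapA_eta, kapA_idem, smul_pow, mul_smul_comm, smul_mul_assoc, smul_mul_assoc,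
    smul_mul_assoc, smul_smul, monoZ]
  simp

/-- `a ↦ κ⁻¹(a) η_±^{p-1}` -/
def thA (s : ℤˣ) : AAlg p q →ₗ[ℂ] AAlg p q :=
  LinearMap.mulRight ℂ (eta p q s ^ (p - 1)) ∘ₗ (kapA p q (-1)).toLinearMap

theorem thA_apply (s : ℤˣ) (a : AAlg p q) :
    thA p q s a = kapA p q (-1) a * eta p q s ^ (p - 1) := rfl

theorem eta_mul_pow_sub_one (s : ℤˣ) : eta p q s * eta p q s ^ (p - 1) = 0 := by
  rw [← pow_succ', eta_pow_eq_zero p q s (by omega)]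

theorem pow_sub_one_inv {u : ℂ} (hu : u ^ p = 1) (h0 : 0 < p) : u⁻¹ ^ (p - 1) = u := by
  have hu0 : u ≠ 0 := by
    rintro rfl
    rw [zero_pow h0.ne'] at hu
    exact zero_ne_one hu
  rw [inv_pow]
  refine inv_eq_of_mul_eq_one_right ?_
  rw [← pow_succ, Nat.sub_add_cancel h0, hu]

theorem thA_eq (s : ℤˣ) (a : AAlg p q) : thA p q s a = eta p q s ^ (p - 1) * kapA p q 1 a := by
  have hq := root_ne_zero p q
  have h0 := root_pos p q
  rw [thA_apply]
  induction a using AAlg.induction with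
  | hc c => rw [AlgHom.commutes, AlgHom.commutes, Algebra.commutes]
  | hg x =>
    cases x with
    | eta t =>
      rw [← eta, kapA_eta, kapA_eta, smul_mul_assoc, mul_smul_comm]
      rcases eq_or_ne t s with rfl | h
      · rw [eta_mul_pow_sub_one, ← pow_succ, eta_pow_eq_zero p q t (by omega), smul_zero, smul_zero]
      · have ht : t = -s := Int.units_ne_iff_eq_neg.1 h
        subst ht
        have h1 := pow_mul_of_qcomm (eta_mul_neg p q s) (p - 1)
        rw [h1, ← inv_pow, pow_right_comm,
          pow_sub_one_inv p (zpow_pow_root p q _) h0, smul_smul]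
        congr 1
        rw [← zpow_natCast, ← zpow_mul, ← zpow_add₀ hq]
        congr 1
        push_cast
        ring
    | del =>
      rw [kapA_del, kapA_del, smul_mul_assoc, mul_smul_comm,
        pow_mul_of_qcomm ((rels p q).eta_del s), smul_smul]
      congr 1
      have h1 := pow_sub_one_inv p (zpow_pow_root p q (-1)) h0
      rw [zpow_neg_one, inv_inv] at h1
      rw [pow_right_comm, h1, zpow_neg_one, zpow_one]
      field_simp
  | hmul x y hx hy => rw [map_mul, map_mul, mul_assoc, hy, ← mul_assoc, hx, mul_assoc]
  | hadd x y hx hy => rw [map_add, map_add, add_mul, mul_add, hx, hy]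

theorem thA_one_monoZ_zero (m : ℕ) (k : ℤ) :
    thA p q 1 (monoZ p q 0 m k) = q⁻¹ ^ m • monoZ p q (p - 1) m (k - 1) := by
  rw [thA_eq, kapA_monoZ, mul_smul_comm, monoZ, monoZ, pow_zero, one_mul, mul_assoc]
  simp [mul_assoc]

theorem thA_one_monoZ {n : ℕ} (hn : 0 < n) (m : ℕ) (k : ℤ) : thA p q 1 (monoZ p q n m k) = 0 := by
  rw [thA_eq, kapA_monoZ, mul_smul_comm, monoZ, ← mul_assoc, ← mul_assoc, ← pow_add,
    eta_pow_eq_zero p q 1 (by omega), zero_mul, zero_mul, smul_zero]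

theorem thA_neg_one_monoZ (n m : ℕ) (k : ℤ) :
    thA p q (-1) (monoZ p q n m k)
      = (q⁻¹ ^ n * q⁻¹ ^ m) • monoZ p q n (p - 1 + m) (k - 1) := by
  have hq := root_ne_zero p q
  have h0 := root_pos p q
  have h1 : eta p q (-1) ^ (p - 1) * eta p q 1 ^ n = _ :=
    pow_mul_pow_of_qcomm (rels p q).eta_eta (p - 1) n
  rw [thA_eq, kapA_monoZ, mul_smul_comm, monoZ, ← mul_assoc, ← mul_assoc, h1, smul_mul_assoc,
    smul_mul_assoc, mul_assoc (eta p q 1 ^ n), ← pow_add, ← monoZ, smul_smul]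
  congr 1
  have h2 := pow_sub_one_inv p (zpow_pow_root p q (-1)) h0
  rw [zpow_neg_one, inv_inv] at h2
  rw [show (q ^ 2) ^ ((p - 1) * n) = ((q ^ (p - 1)) ^ 2) ^ n by
    rw [← pow_mul, ← pow_mul, ← pow_mul]; ring_nf, h2, one_mul, zpow_sub₀ hq, zpow_natCast, zpow_natCast]
  have : q⁻¹ ^ n * q ^ n = 1 := by rw [← mul_pow, inv_mul_cancel₀ hq, one_pow]
  rw [← pow_mul, mul_comm 2, pow_mul, div_eq_mul_inv, inv_pow q m]
  linear_combination ((q ^ m)⁻¹ * q⁻¹ ^ n) * this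

theorem degA_one : degA p q 1 = 0 := by
  have h := degA_mul p q 1 1
  rw [mul_one, one_mul, mul_one] at h
  exact left_eq_add.1 h

theorem degA_pow {x : AAlg p q} {c : ℂ} (hx : degA p q x = c • x) (n : ℕ) :
    degA p q (x ^ n) = (n * c) • x ^ n := by
  induction n with
  | zero => simp [degA_one]
  | succ n ih =>
    rw [pow_succ, degA_mul, hx, ih, smul_mul_assoc, mul_smul_comm, ← add_smul]
    push_cast
    ring_nf

theorem degA_idem (k : ℤ) : degA p q (idem p q k) = 0 := by
  rw [idem, map_smul, map_sum, Finset.sum_eq_zero, smul_zero]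
  intro n _
  have h : degA p q (gen p q .del) = (0 : ℂ) • gen p q .del := by rw [degA_del, zero_smul]
  rw [smul_pow, map_smul, degA_pow p q h, mul_zero, zero_smul, smul_zero]

theorem degA_monoZ (n m : ℕ) (k : ℤ) :
    degA p q (monoZ p q n m k) = ((n : ℂ) - m) • monoZ p q n m k := by
  rw [monoZ, degA_mul, degA_mul, degA_idem, degA_pow p q (degA_eta p q 1),
    degA_pow p q (degA_eta p q (-1)), mul_zero, zero_add, mul_smul_comm, smul_mul_assoc, ← add_smul,
    smul_mul_assoc]
  congr 1
  simp [sgn]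
  ring

theorem degA_delta (k : ℤ) : degA p q (delta p q k) = 0 := by
  have h : degA p q (gen p q .del) = (0 : ℂ) • gen p q .del := by rw [degA_del, zero_smul]
  rw [delta, degA_pow p q h, mul_zero, zero_smul]

end AAlg

/-- `r` is the square root of `q` with `r^p = -1`. -/
class SqrtData (p : ℕ) (q r : ℂ) : Prop where
  sq : r ^ 2 = q
  pow : r ^ p = -1

section Constants

variable (p : ℕ) (q r : ℂ)

/-- `i q^{±1/2}` -/
def eps (r : ℂ) (s : ℤˣ) : ℂ := Complex.I * r ^ (s : ℤ)

/-- The coefficient of `η_±^{p-1} ∂_± f` in the action of `p_±` on functions. -/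
def wrap (s : ℤˣ) : ℂ := (-1) ^ ((p + 1) / 2) * eps r s / qFact q (p - 1)

theorem wrap_mul_eps_pow [hpq : RootData p q] [hr : SqrtData p q r] (s : ℤˣ) :
    wrap p q r s * (eps r s ^ (p - 1) * qFact q (p - 1)) = Complex.I := by
  have h0 := root_pos p q
  have hF : qFact q (p - 1) ≠ 0 := qFact_ne_zero p q (by omega)
  have h1 : wrap p q r s * (eps r s ^ (p - 1) * qFact q (p - 1))
      = (-1) ^ ((p + 1) / 2) * eps r s ^ p := by
    obtain ⟨n, hn⟩ : ∃ n, p = n + 1 := ⟨p - 1, by omega⟩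
    rw [wrap, div_mul_eq_mul_div, div_eq_iff hF]
    subst hn
    rw [Nat.add_sub_cancel, pow_succ (eps r s) n]
    ring
  obtain ⟨m, hm⟩ := hpq.odd
  have h2 : (r ^ (s : ℤ)) ^ p = -1 := by
    rw [← zpow_natCast, zpow_comm, zpow_natCast, hr.pow (q := q)]
    rcases Int.units_eq_one_or s with rfl | rfl <;> simp
  have h3 : (p + 1) / 2 = m + 1 := by omega
  rw [h1, eps, mul_pow, h2, h3, hm, pow_succ Complex.I, pow_mul, Complex.I_sq]
  have h4 : ((-1 : ℂ) ^ m) * (-1) ^ m = 1 := by rw [← mul_pow]; simp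
  rw [pow_succ]
  linear_combination Complex.I * h4

end Constants

/-! ### Lowering operators on cyclic families -/

/-- The cyclic predecessor modulo `p`. -/
def cpred (p n : ℕ) : ℕ := if n = 0 then p - 1 else n - 1

section Cyclic

variable {p : ℕ} {q : ℂ} {F V : Type*} [AddCommGroup V] [Module ℂ V]
  {T : Module.End ℂ V} {v : F → ℕ → ℤ → V} {D : F → F} {e c u : ℂ}

theorem pow_apply_of_le (hT : ∀ f n k, 0 < n → T (v f n k) = (e * qNum q n * u) • v f (n - 1) (k - 1))
    (f : F) (n j : ℕ) (k : ℤ) :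
    qFact q j • (T ^ n) (v f (j + n) k) = (e ^ n * u ^ n * qFact q (j + n)) • v f j (k - n) := by
  induction n generalizing k with
  | zero => simp
  | succ n ih =>
    rw [pow_succ, Module.End.mul_apply, hT _ _ _ (by omega), map_smul, smul_comm, ← add_assoc,
      Nat.add_sub_cancel, ih, smul_smul, qFact_succ]
    push_cast
    rw [show k - 1 - (n : ℤ) = k - (n + 1) by ring]
    congr 1
    ring

theorem pow_self_apply (hT : ∀ f n k, 0 < n → T (v f n k) = (e * qNum q n * u) • v f (n - 1) (k - 1))
    (f : F) (n : ℕ) (k : ℤ) :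
    (T ^ n) (v f n k) = (e ^ n * u ^ n * qFact q n) • v f 0 (k - n) := by
  simpa using pow_apply_of_le hT f n 0 k

variable [hpq : RootData p q]

theorem pow_wrap_apply
    (hT : ∀ f n k, 0 < n → T (v f n k) = (e * qNum q n * u) • v f (n - 1) (k - 1))
    (hT0 : ∀ f k, T (v f 0 k) = (c * u) • v (D f) (p - 1) (k - 1))
    (f : F) (n j : ℕ) (hnj : n + j + 1 = p) (k : ℤ) :
    (T ^ p) (v f n k) = (c * (e ^ (p - 1) * qFact q (p - 1)) * u ^ p) • v (D f) n (k - p) := by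
  have hF : qFact q n ≠ 0 := qFact_ne_zero p q (by omega)
  have hp : T ^ p = T ^ j * (T * T ^ n) := by rw [← pow_succ', ← pow_add]; congr 1; omega
  have h1 := pow_apply_of_le hT (D f) j n (k - n - 1)
  rw [show n + j = p - 1 by omega] at h1
  have h2 : (T ^ j) (v (D f) (p - 1) (k - n - 1))
      = (qFact q n)⁻¹ • (e ^ j * u ^ j * qFact q (p - 1)) • v (D f) n (k - n - 1 - j) := by
    rw [← h1, smul_smul, inv_mul_cancel₀ hF, one_smul]
  rw [hp, Module.End.mul_apply, Module.End.mul_apply, pow_self_apply hT, map_smul, hT0, map_smul,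
    map_smul, h2, smul_smul, smul_smul, smul_smul,
    show k - (n : ℤ) - 1 - j = k - p by rw [← hnj]; push_cast; ring]
  congr 1
  rw [show e ^ (p - 1) = e ^ n * e ^ j by rw [← pow_add]; congr 1; omega,
    show u ^ p = u ^ n * u ^ j * u by rw [← pow_add, ← pow_succ]; congr 1; omega]
  field_simp

theorem exists_pow_apply
    (hT : ∀ f n k, 0 < n → T (v f n k) = (e * qNum q n * u) • v f (n - 1) (k - 1))
    (hT0 : ∀ f k, T (v f 0 k) = (c * u) • v (D f) (p - 1) (k - 1))
    (f : F) {n i : ℕ} (hi : i < p) (k : ℤ) (hn : n < p) :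
    ∃ (a : ℂ) (g : F) (j : ℕ), j < p ∧ (n ≠ i → 0 < j) ∧ (T ^ n) (v f i k) = a • v g j (k - n) := by
  have key : ∀ (f : F) (n i : ℕ) (k : ℤ), n ≤ i → i < p →
      ∃ a : ℂ, (T ^ n) (v f i k) = a • v f (i - n) (k - n) := by
    intro f n i k hni hi
    have hF : qFact q (i - n) ≠ 0 := qFact_ne_zero p q (by omega)
    have h := pow_apply_of_le hT f n (i - n) k
    rw [Nat.sub_add_cancel hni] at h
    refine ⟨(qFact q (i - n))⁻¹ * (e ^ n * u ^ n * qFact q i), ?_⟩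
    rw [mul_smul, ← h, smul_smul, inv_mul_cancel₀ hF, one_smul]
  rcases Nat.lt_or_ge i n with h | h
  · obtain ⟨j, rfl⟩ : ∃ j, n = j + (1 + i) := ⟨n - 1 - i, by omega⟩
    obtain ⟨a, ha⟩ := key (D f) j (p - 1) (k - i - 1) (by omega) (by omega)
    refine ⟨e ^ i * u ^ i * qFact q i * (c * u) * a, D f, p - 1 - j, by omega, by omega, ?_⟩
    rw [pow_add, pow_add, pow_one, Module.End.mul_apply, Module.End.mul_apply, pow_self_apply hT,
      map_smul, map_smul, hT0, map_smul, ha, smul_smul, smul_smul, mul_assoc]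
    congr 2
    push_cast
    ring
  · obtain ⟨a, ha⟩ := key f n i k h hi
    exact ⟨a, f, i - n, by omega, by omega, ha⟩

end Cyclic

/-! ### Monomials ordered according to a sign -/

namespace AAlg

variable (p : ℕ) (q : ℂ)

/-- The monomial with exponent `n` of `η_s` and exponent `m` of `η_{-s}`. -/
def monoS [RootData p q] (s : ℤˣ) (n m : ℕ) (k : ℤ) : AAlg p q :=
  if s = 1 then monoZ p q n m k else monoZ p q m n k

variable [hpq : RootData p q]

theorem monoS_one (n m : ℕ) (k : ℤ) : monoS p q 1 n m k = monoZ p q n m k := if_pos rfl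

theorem monoS_neg_one (n m : ℕ) (k : ℤ) : monoS p q (-1) n m k = monoZ p q m n k :=
  if_neg (by decide)

theorem monoS_congr (s : ℤˣ) (n m : ℕ) {a b : ℤ} (h : a ≡ b [ZMOD p]) :
    monoS p q s n m a = monoS p q s n m b := by
  rw [monoS, monoS, monoZ_congr p q n m h, monoZ_congr p q m n h]

theorem kapA_monoS (j : ℤ) (s : ℤˣ) (n m : ℕ) (k : ℤ) :
    kapA p q j (monoS p q s n m k) = q ^ (j * (s * (n - m))) • monoS p q s n m (k - j) := by
  rcases Int.units_eq_one_or s with rfl | rfl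
  · simp [monoS_one, kapA_monoZ]
  · simp [monoS_neg_one, kapA_monoZ]

theorem degA_monoS (s : ℤˣ) (n m : ℕ) (k : ℤ) :
    degA p q (monoS p q s n m k) = (sgn s * (n - m)) • monoS p q s n m k := by
  rcases Int.units_eq_one_or s with rfl | rfl
  · simp [monoS_one, degA_monoZ, sgn]
  · simp [monoS_neg_one, degA_monoZ, sgn]

theorem pA_monoS (e : ℂ) (s : ℤˣ) (n m : ℕ) (k : ℤ) :
    pA p q e s (monoS p q s n m k) = (e * qNum q n * q⁻¹ ^ m) • monoS p q s (n - 1) m (k - 1) := by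
  rcases Int.units_eq_one_or s with rfl | rfl
  · rw [monoS_one, monoS_one, pA_one_monoZ]
  · rw [monoS_neg_one, monoS_neg_one, pA_neg_one_monoZ]

theorem thA_monoS_zero (s : ℤˣ) (m : ℕ) (k : ℤ) :
    thA p q s (monoS p q s 0 m k) = q⁻¹ ^ m • monoS p q s (p - 1) m (k - 1) := by
  rcases Int.units_eq_one_or s with rfl | rfl
  · rw [monoS_one, monoS_one, thA_one_monoZ_zero]
  · rw [monoS_neg_one, monoS_neg_one, thA_neg_one_monoZ, pow_zero, mul_one, add_zero]

theorem thA_monoS (s : ℤˣ) {n : ℕ} (hn : 0 < n) (m : ℕ) (k : ℤ) :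
    thA p q s (monoS p q s n m k) = 0 := by
  rcases Int.units_eq_one_or s with rfl | rfl
  · rw [monoS_one, thA_one_monoZ p q hn]
  · rw [monoS_neg_one, thA_neg_one_monoZ, monoZ_eq_zero p q (Or.inr (by omega)), smul_zero]

end AAlg

namespace AFAlg

/-! ### The action of the generators of `U_F` on `A_F` -/

section Operators

variable (p : ℕ) (q r : ℂ) (σ : ℤˣ) [hpq : RootData p q]

/-- The action of `P_±`. -/
def opP (s : ℤˣ) : Module.End ℂ (AFAlg p q) := Complex.I • (Sm.dz s).rTensor (AAlg p q)

/-- The action of `H`. -/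
def opH : Module.End ℂ (AFAlg p q) := (-(sgn σ * Complex.I)) •
  (Sm.boost.rTensor (AAlg p q) + (1 / (p : ℂ)) • (AAlg.degA p q).lTensor (Sm E11))

/-- The action of `κ^k`. -/
def opK (k : ℤ) : AFAlg p q →ₐ[ℂ] AFAlg p q :=
  Algebra.TensorProduct.map (AlgHom.id ℂ (Sm E11)) (AAlg.kapA p q k)

/-- The action of `p_±`. -/
def opp (s : ℤˣ) : Module.End ℂ (AFAlg p q) :=
  (AAlg.pA p q (eps r s) s).lTensor (Sm E11)
    + wrap p q r s • TensorProduct.map (Sm.dz s) (AAlg.thA p q s)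

theorem opP_tmul (s : ℤˣ) (f : Sm E11) (a : AAlg p q) :
    opP p q s (f ⊗ₜ a) = (Complex.I • Sm.dz s f) ⊗ₜ a := rfl

theorem opH_tmul (f : Sm E11) (a : AAlg p q) : opH p q σ (f ⊗ₜ a)
    = (-(sgn σ * Complex.I)) • (Sm.boost f ⊗ₜ[ℂ] a + (1 / (p : ℂ)) • (f ⊗ₜ[ℂ] AAlg.degA p q a)) := rfl

theorem opK_tmul (k : ℤ) (f : Sm E11) (a : AAlg p q) :
    opK p q k (f ⊗ₜ a) = f ⊗ₜ AAlg.kapA p q k a := rfl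

theorem opp_tmul (s : ℤˣ) (f : Sm E11) (a : AAlg p q) : opp p q r s (f ⊗ₜ a)
    = f ⊗ₜ[ℂ] AAlg.pA p q (eps r s) s a + wrap p q r s • (Sm.dz s f ⊗ₜ[ℂ] AAlg.thA p q s a) := rfl

theorem linearMap_ext {M : Type*} [AddCommGroup M] [Module ℂ M] (s : ℤˣ)
    {Φ Ψ : AFAlg p q →ₗ[ℂ] M} (h : ∀ (f : Sm E11) (n m : ℕ) (k : ℤ), n < p → m < p →
      Φ (f ⊗ₜ AAlg.monoS p q s n m k) = Ψ (f ⊗ₜ AAlg.monoS p q s n m k)) : Φ = Ψ := by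
  refine TensorProduct.ext' fun f a => ?_
  have ha : a ∈ Submodule.span ℂ
    (Set.range fun i : Fin p × Fin p × Fin p => AAlg.monoZ p q i.1 i.2.1 (i.2.2 : ℕ)) := by
    rw [AAlg.span_monoZ]; trivial
  induction ha using Submodule.span_induction with
  | mem x hx =>
    obtain ⟨⟨n, m, k⟩, rfl⟩ := hx
    rcases Int.units_eq_one_or s with rfl | rfl
    · have := h f n m (k : ℕ) n.2 m.2
      rwa [AAlg.monoS_one] at this
    · have := h f m n (k : ℕ) m.2 n.2
      rwa [AAlg.monoS_neg_one] at this
  | zero => rw [TensorProduct.tmul_zero, map_zero, map_zero]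
  | add x y _ _ hx hy => rw [TensorProduct.tmul_add, map_add, map_add, hx, hy]
  | smul c x _ hx => rw [TensorProduct.tmul_smul, map_smul, map_smul, hx]

theorem opp_monoS (s : ℤˣ) (f : Sm E11) (n m : ℕ) (k : ℤ) (hn : 0 < n) :
    opp p q r s (f ⊗ₜ AAlg.monoS p q s n m k)
      = (eps r s * qNum q n * q⁻¹ ^ m) • (f ⊗ₜ AAlg.monoS p q s (n - 1) m (k - 1)) := by
  rw [opp_tmul, AAlg.pA_monoS, AAlg.thA_monoS p q s hn, TensorProduct.tmul_zero, smul_zero, add_zero,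
    TensorProduct.tmul_smul]

theorem opp_monoS_zero (s : ℤˣ) (f : Sm E11) (m : ℕ) (k : ℤ) :
    opp p q r s (f ⊗ₜ AAlg.monoS p q s 0 m k)
      = (wrap p q r s * q⁻¹ ^ m) • (Sm.dz s f ⊗ₜ AAlg.monoS p q s (p - 1) m (k - 1)) := by
  rw [opp_tmul, AAlg.pA_monoS, AAlg.thA_monoS_zero, TensorProduct.tmul_smul, TensorProduct.tmul_smul,
    smul_smul]
  simp [qNum]

theorem opp_pow [hr : SqrtData p q r] (s : ℤˣ) : opp p q r s ^ p = opP p q s := by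
  refine linearMap_ext p q s fun f n m k hn _ => ?_
  rw [pow_wrap_apply (v := fun f n k => f ⊗ₜ AAlg.monoS p q s n m k)
      (fun f n k hn => opp_monoS p q r s f n m k hn) (fun f k => opp_monoS_zero p q r s f m k) f n
      (p - 1 - n) (by omega) k, wrap_mul_eps_pow, pow_right_comm, inv_pow, root_pow p q, inv_one,
      one_pow, mul_one, opP_tmul, AAlg.monoS_congr p q s n m (b := k), TensorProduct.smul_tmul']
  exact Int.modEq_iff_dvd.2 ⟨1, by ring⟩

theorem opp_monoS_cpred (s : ℤˣ) (f : Sm E11) (n m : ℕ) (k : ℤ) :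
    opp p q r s (f ⊗ₜ AAlg.monoS p q s n m k)
      = ((if n = 0 then wrap p q r s else eps r s * qNum q n) * q⁻¹ ^ m) •
        ((if n = 0 then Sm.dz s f else f) ⊗ₜ AAlg.monoS p q s (cpred p n) m (k - 1)) := by
  rw [cpred]
  split_ifs with h
  · rw [h, opp_monoS_zero]
  · rw [opp_monoS p q r s f n m k (by omega)]

theorem inv_pow_cpred (n : ℕ) : q⁻¹ ^ cpred p n = q * q⁻¹ ^ n := by
  have hq := root_ne_zero p q
  have h0 := root_pos p q
  rw [cpred]
  split_ifs with h
  · rw [AAlg.pow_sub_one_inv p (root_pow p q) h0, h, pow_zero, mul_one]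
  · obtain ⟨j, rfl⟩ : ∃ j, n = j + 1 := ⟨n - 1, by omega⟩
    rw [Nat.add_sub_cancel, pow_succ]
    field_simp

theorem opp_comm : opp p q r 1 ∘ₗ opp p q r (-1) = opp p q r (-1) ∘ₗ opp p q r 1 := by
  refine linearMap_ext p q 1 fun f n m k hn hm => ?_
  have h1 := opp_monoS_cpred p q r 1
  have h2 : ∀ (f : Sm E11) (n m : ℕ) (k : ℤ), opp p q r (-1) (f ⊗ₜ AAlg.monoZ p q n m k) = _ :=
    fun f n m k => (AAlg.monoS_neg_one p q m n k) ▸ opp_monoS_cpred p q r (-1) f m n k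
  simp only [AAlg.monoS_one, AAlg.monoS_neg_one] at h1 h2 ⊢
  simp only [LinearMap.comp_apply, h1, h2, map_smul, smul_smul, inv_pow_cpred]
  congr 1
  · ring
  · congr 1
    split_ifs <;> first | rfl | exact Sm.dz_comm _ _ _

theorem opK_opp (s : ℤˣ) (x : AFAlg p q) :
    opp p q r s (opK p q 1 x) = q ^ (s : ℤ) • opK p q 1 (opp p q r s x) := by
  have hq := root_ne_zero p q
  suffices h : opp p q r s ∘ₗ (opK p q 1).toLinearMap
      = q ^ (s : ℤ) • ((opK p q 1).toLinearMap ∘ₗ opp p q r s) from LinearMap.congr_fun h x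
  refine linearMap_ext p q s fun f n m k hn hm => ?_
  simp only [LinearMap.comp_apply, LinearMap.smul_apply, AlgHom.toLinearMap_apply, opK_tmul,
    AAlg.kapA_monoS, TensorProduct.tmul_smul, map_smul, opp_monoS_cpred, smul_smul]
  congr 1
  have : q ^ (1 * ((s : ℤ) * ((n : ℤ) - m)))
      = q ^ (s : ℤ) * q ^ (1 * ((s : ℤ) * ((cpred p n : ℤ) - m))) := by
    rw [← zpow_add₀ hq]
    refine AAlg.zpow_root_congr p q ?_
    have h0 := root_pos p q
    rw [cpred]
    split_ifs with h
    · refine Int.modEq_iff_dvd.2 ⟨s, ?_⟩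
      rw [h]
      push_cast [Nat.cast_sub (show 1 ≤ p by omega)]
      ring
    · push_cast [Nat.cast_sub (show 1 ≤ n by omega)]
      ring_nf
      rfl
  rw [this]
  ring

theorem opH_opp (s : ℤˣ) (x : AFAlg p q) :
    opH p q σ (opp p q r s x) - opp p q r s (opH p q σ x)
      = (sgn s * sgn σ * (Complex.I / p)) • opp p q r s x := by
  have h0 := root_pos p q
  have hp : (p : ℂ) ≠ 0 := by exact_mod_cast h0.ne'
  suffices h : opH p q σ ∘ₗ opp p q r s - opp p q r s ∘ₗ opH p q σ
      = (sgn s * sgn σ * (Complex.I / p)) • opp p q r s from LinearMap.congr_fun h x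
  refine linearMap_ext p q s fun f n m k hn hm => ?_
  simp only [LinearMap.comp_apply, LinearMap.smul_apply, LinearMap.sub_apply, opH_tmul,
    AAlg.degA_monoS, TensorProduct.tmul_smul, map_smul, map_add, opp_monoS_cpred, smul_smul]
  rw [cpred]
  split_ifs with h
  · rw [Sm.dz_boost, TensorProduct.add_tmul, ← TensorProduct.smul_tmul', h]
    push_cast [Nat.cast_sub (show 1 ≤ p by omega)]
    match_scalars
    · ring
    · field_simp
      ring
  · push_cast [Nat.cast_sub (show 1 ≤ n by omega)]
    match_scalars
    · ring
    · field_simp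
      ring

theorem opK_zero (x : AFAlg p q) : opK p q 0 x = x := by
  induction x using TensorProduct.induction_on with
  | zero => rw [map_zero]
  | tmul f a => rw [opK_tmul, AAlg.kapA_zero]
  | add x y hx hy => rw [map_add, hx, hy]

theorem opK_add (j k : ℤ) (x : AFAlg p q) : opK p q (j + k) x = opK p q j (opK p q k x) := by
  induction x using TensorProduct.induction_on with
  | zero => simp only [map_zero]
  | tmul f a => rw [opK_tmul, opK_tmul, opK_tmul, AAlg.kapA_add]
  | add x y hx hy => simp only [map_add, hx, hy]

theorem opK_congr {a b : ℤ} (h : a ≡ b [ZMOD p]) (x : AFAlg p q) : opK p q a x = opK p q b x := by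
  induction x using TensorProduct.induction_on with
  | zero => simp only [map_zero]
  | tmul f a => rw [opK_tmul, opK_tmul, AAlg.kapA_congr p q h]
  | add x y hx hy => simp only [map_add, hx, hy]

theorem opK_pow (n : ℕ) (x : AFAlg p q) :
    ((opK p q 1).toLinearMap ^ n : Module.End ℂ (AFAlg p q)) x = opK p q n x := by
  induction n with
  | zero => simp [opK_zero]
  | succ n ih =>
    rw [pow_succ', Module.End.mul_apply, ih, AlgHom.toLinearMap_apply, ← opK_add]
    push_cast
    rw [add_comm]

open MulOpposite in
theorem act_rels [hr : SqrtData p q r] :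
    UAlg.Rels p q σ (fun s => op (opP p q s)) (fun s => op (opp p q r s)) (op (opH p q σ))
      (op (opK p q 1).toLinearMap) where
  P_comm := by
    rw [← op_mul, ← op_mul]
    congr 1
    refine TensorProduct.ext' fun f a => ?_
    simp only [Module.End.mul_apply, opP_tmul, map_smul, Sm.dz_comm 1 (-1)]
  P_H s := by
    rw [← op_mul, ← op_mul, ← op_sub, ← op_smul]
    congr 1
    refine TensorProduct.ext' fun f a => ?_
    simp only [Module.End.mul_apply, LinearMap.sub_apply, LinearMap.smul_apply, opP_tmul, opH_tmul,
      map_smul, map_add, Sm.dz_boost, TensorProduct.add_tmul, smul_add, ← TensorProduct.smul_tmul']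
    module
  sp_pow s := by rw [← op_pow, opp_pow]
  sp_comm := by
    rw [← op_mul, ← op_mul]
    exact congrArg op (opp_comm p q r).symm
  kap_sp s := by
    rw [← op_mul, ← op_mul, ← op_smul]
    exact congrArg op (LinearMap.ext (opK_opp p q r s))
  kap_pow := by
    rw [← op_pow]
    refine congrArg op (LinearMap.ext fun x => ?_)
    rw [opK_pow, opK_congr p q (b := 0), opK_zero, Module.End.one_apply]
    simp
  kap_H := by
    rw [← op_mul, ← op_mul]
    congr 1
    refine linearMap_ext p q 1 fun f n m k _ _ => ?_
    simp only [Module.End.mul_apply, opH_tmul, AlgHom.toLinearMap_apply, opK_tmul, map_smul, map_add,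
      AAlg.degA_monoS, AAlg.kapA_monoS, TensorProduct.tmul_smul]
    module
  sp_H s := by
    rw [← op_mul, ← op_mul, ← op_sub, ← op_smul]
    exact congrArg op (LinearMap.ext (opH_opp p q r σ s))

end Operators

end AFAlg

namespace AFAlg

section Action

variable (p : ℕ) (q r : ℂ) (σ : ℤˣ) [hpq : RootData p q] [hr : SqrtData p q r]

/-- The right action of `U_F` on `A_F`, as a homomorphism to the opposite endomorphism algebra. -/
def actHom : UAlg p q σ →ₐ[ℂ] (Module.End ℂ (AFAlg p q))ᵐᵒᵖ := UAlg.lift (act_rels p q r σ)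

/-- The right action of `φ ∈ U_F` on `A_F`. -/
def act (φ : UAlg p q σ) : Module.End ℂ (AFAlg p q) := MulOpposite.unop (actHom p q r σ φ)

theorem act_mul (φ ψ : UAlg p q σ) (x : AFAlg p q) :
    act p q r σ (φ * ψ) x = act p q r σ ψ (act p q r σ φ x) := by
  rw [act, map_mul]; rfl

theorem act_add (φ ψ : UAlg p q σ) : act p q r σ (φ + ψ) = act p q r σ φ + act p q r σ ψ := by
  rw [act, map_add]; rfl

theorem act_neg (φ : UAlg p q σ) : act p q r σ (-φ) = -act p q r σ φ := by
  rw [act, map_neg]; rfl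

theorem act_smul (c : ℂ) (φ : UAlg p q σ) : act p q r σ (c • φ) = c • act p q r σ φ := by
  rw [act, map_smul]; rfl

theorem act_one : act p q r σ 1 = 1 := by rw [act, map_one]; rfl

theorem act_algebraMap (c : ℂ) (x : AFAlg p q) :
    act p q r σ (algebraMap ℂ _ c) x = c • x := by
  rw [Algebra.algebraMap_eq_smul_one, act_smul, act_one]; rfl

theorem act_pow (φ : UAlg p q σ) (n : ℕ) : act p q r σ (φ ^ n) = act p q r σ φ ^ n := by
  rw [act, map_pow, MulOpposite.unop_pow]; rfl

theorem act_P (s : ℤˣ) : act p q r σ (UAlg.P p q σ s) = opP p q s := by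
  rw [act, actHom, UAlg.lift_P, MulOpposite.unop_op]

theorem act_H : act p q r σ (UAlg.H p q σ) = opH p q σ := by
  rw [act, actHom, UAlg.lift_H, MulOpposite.unop_op]

theorem act_sp (s : ℤˣ) : act p q r σ (UAlg.sp p q σ s) = opp p q r s := by
  rw [act, actHom, UAlg.lift_sp, MulOpposite.unop_op]

theorem act_kap : act p q r σ (UAlg.gen p q σ .kap) = (opK p q 1).toLinearMap := by
  rw [act, actHom, UAlg.lift_kap, MulOpposite.unop_op]

theorem act_kappa (k : ℤ) (x : AFAlg p q) : act p q r σ (UAlg.kappa p q σ k) x = opK p q k x := by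
  have h0 := root_pos p q
  rw [UAlg.kappa, act_pow, act_kap, opK_pow, Int.toNat_of_nonneg (Int.emod_nonneg _ (by omega))]
  exact opK_congr p q (Int.mod_modEq k p) x

/-- The pairing of `U_F` and `A_F`. -/
def pairing : UAlg p q σ →ₗ[ℂ] AFAlg p q →ₗ[ℂ] ℂ :=
  LinearMap.mk₂ ℂ (fun φ x => counit p q (act p q r σ φ x))
    (fun φ ψ x => by rw [act_add, LinearMap.add_apply, map_add])
    (fun c φ x => by rw [act_smul, LinearMap.smul_apply, map_smul])
    (fun φ x y => by rw [map_add, map_add])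
    (fun c φ x => by rw [map_smul, map_smul])

theorem pairing_apply (φ : UAlg p q σ) (x : AFAlg p q) :
    pairing p q r σ φ x = counit p q (act p q r σ φ x) := rfl

theorem pairing_mul (φ ψ : UAlg p q σ) (x : AFAlg p q) :
    pairing p q r σ (φ * ψ) x = pairing p q r σ ψ (act p q r σ φ x) := by
  rw [pairing_apply, pairing_apply, act_mul]

end Action

/-! ### The duality relations -/

section Duality

variable (p : ℕ) (q r : ℂ) (σ : ℤˣ) [hpq : RootData p q]

theorem opP_pow_tmul (s : ℤˣ) (n : ℕ) (f : Sm E11) (a : AAlg p q) :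
    (opP p q s ^ n) (f ⊗ₜ a) = (Complex.I ^ n • (Sm.dz s ^ n) f) ⊗ₜ a := by
  induction n with
  | zero => simp
  | succ n ih =>
    rw [pow_succ', Module.End.mul_apply, ih, opP_tmul, map_smul, smul_smul, pow_succ' (Sm.dz s),
      Module.End.mul_apply, pow_succ' Complex.I]

theorem exists_opH_pow_monoZ (f : Sm E11) (n m : ℕ) (k : ℤ) (l : ℕ) :
    ∃ g : Sm E11, (opH p q σ ^ l) (f ⊗ₜ AAlg.monoZ p q n m k) = g ⊗ₜ AAlg.monoZ p q n m k := by
  induction l with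
  | zero => exact ⟨f, by simp⟩
  | succ l ih =>
    obtain ⟨g, hg⟩ := ih
    refine ⟨(-(sgn σ * Complex.I)) • (Sm.boost g + ((1 / (p : ℂ)) * ((n : ℂ) - m)) • g), ?_⟩
    rw [pow_succ', Module.End.mul_apply, hg, opH_tmul, AAlg.degA_monoZ, TensorProduct.tmul_smul,
      ← TensorProduct.smul_tmul', TensorProduct.add_tmul, ← TensorProduct.smul_tmul', smul_smul]

theorem opH_pow_idem (f : Sm E11) (k : ℤ) (l : ℕ) :
    (opH p q σ ^ l) (f ⊗ₜ AAlg.idem p q k)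
      = ((-(sgn σ * Complex.I)) ^ l • (Sm.boost ^ l) f) ⊗ₜ AAlg.idem p q k := by
  induction l with
  | zero => simp
  | succ l ih =>
    rw [pow_succ', Module.End.mul_apply, ih, opH_tmul, AAlg.degA_idem, TensorProduct.tmul_zero,
      smul_zero, add_zero, map_smul, TensorProduct.smul_tmul', smul_smul, pow_succ' Sm.boost,
      Module.End.mul_apply, pow_succ' (-(sgn σ * Complex.I))]

theorem monoZ_zero_zero (k : ℤ) : AAlg.monoZ p q 0 0 k = AAlg.idem p q k := by
  rw [AAlg.monoZ, pow_zero, pow_zero, one_mul, one_mul]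

theorem counit_aq_idem (k : ℤ) :
    counit p q (aqHom p q (AAlg.idem p q k)) = if k ≡ 0 [ZMOD p] then 1 else 0 := by
  have h0 := root_pos p q
  have hp : (p : ℂ) ≠ 0 := by exact_mod_cast h0.ne'
  have hk : q ^ k = 1 ↔ k ≡ 0 [ZMOD p] := by
    rw [hpq.prim.zpow_eq_one_iff_dvd, Int.modEq_zero_iff_dvd]
  rw [AAlg.idem, map_smul, map_smul, map_sum, map_sum]
  simp only [map_pow, map_smul, counit_del, smul_eq_mul, mul_one]
  split_ifs with h
  · rw [hk.2 h]
    simp [hp]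
  · have h1 : (q ^ k)⁻¹ - 1 ≠ 0 := fun h2 => h (hk.1 (inv_eq_one.1 (sub_eq_zero.1 h2)))
    have h2 : ((q ^ k)⁻¹ - 1) * ∑ n ∈ Finset.range p, (q ^ k)⁻¹ ^ n = 0 := by
      rw [mul_geom_sum, inv_pow, AAlg.zpow_pow_root, inv_one, sub_self]
    rw [(mul_eq_zero.1 h2).resolve_left h1, mul_zero]

theorem counit_idem (f : Sm E11) (k : ℤ) :
    counit p q (f ⊗ₜ AAlg.idem p q k) = if k ≡ 0 [ZMOD p] then f.1 0 else 0 := by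
  rw [← fnHom_mul_aqHom, map_mul, counit_fn, counit_aq_idem, mul_ite, mul_one, mul_zero]

theorem counit_monoZ (f : Sm E11) {n m : ℕ} (h : 0 < n ∨ 0 < m) (k : ℤ) :
    counit p q (f ⊗ₜ AAlg.monoZ p q n m k) = 0 := by
  rw [← fnHom_mul_aqHom, AAlg.monoZ, map_mul, map_mul, map_mul, map_mul, map_mul, map_pow, map_pow,
    map_pow, map_pow, counit_eta, counit_eta]
  rcases h with h | h <;> rw [zero_pow h.ne'] <;> simp

theorem act_phi [hr : SqrtData p q r] (n m k t s l : ℕ) (x : AFAlg p q) : act p q r σ (UAlg.phi p q σ n m k t s l) x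
    = (opH p q σ ^ l) ((opP p q (-1) ^ s) ((opP p q 1 ^ t)
      (opK p q k ((opp p q r (-1) ^ m) ((opp p q r 1 ^ n) x))))) := by
  rw [UAlg.phi, act_mul, act_mul, act_mul, act_mul, act_mul, act_kappa, act_pow, act_pow, act_pow,
    act_pow, act_pow, act_sp, act_sp, act_P, act_P, act_H]

theorem exists_opH_opP_opK_monoZ (f : Sm E11) (i j : ℕ) (a : ℤ) (k t s l : ℕ) :
    ∃ g : Sm E11, (opH p q σ ^ l) ((opP p q (-1) ^ s) ((opP p q 1 ^ t)
      (opK p q k (f ⊗ₜ AAlg.monoZ p q i j a)))) = g ⊗ₜ AAlg.monoZ p q i j (a - k) := by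
  obtain ⟨g, hg⟩ := exists_opH_pow_monoZ p q σ (Complex.I ^ s • (Sm.dz (-1) ^ s)
    (Complex.I ^ t • (Sm.dz 1 ^ t) f)) i j (a - k) l
  refine ⟨q ^ ((k : ℤ) * ((i : ℤ) - j)) • g, ?_⟩
  rw [opK_tmul, AAlg.kapA_monoZ, TensorProduct.tmul_smul, map_smul, map_smul, map_smul, opP_pow_tmul,
    opP_pow_tmul, hg, TensorProduct.smul_tmul']

theorem opp_one_pow (f : Sm E11) {n i : ℕ} (hi : i < p) (hn : n < p) (m : ℕ) (k : ℤ) :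
    ∃ (a : ℂ) (g : Sm E11) (j : ℕ), j < p ∧ (n ≠ i → 0 < j) ∧
      (opp p q r 1 ^ n) (f ⊗ₜ AAlg.monoZ p q i m k) = a • (g ⊗ₜ AAlg.monoZ p q j m (k - n)) := by
  have h := exists_pow_apply (v := fun f n k => f ⊗ₜ AAlg.monoS p q 1 n m k)
    (fun f n k hn => opp_monoS p q r 1 f n m k hn) (fun f k => opp_monoS_zero p q r 1 f m k) f hi k hn
  simpa only [AAlg.monoS_one] using h

theorem opp_neg_one_pow (f : Sm E11) {m i : ℕ} (hi : i < p) (hm : m < p) (n : ℕ) (k : ℤ) :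
    ∃ (a : ℂ) (g : Sm E11) (j : ℕ), j < p ∧ (m ≠ i → 0 < j) ∧
      (opp p q r (-1) ^ m) (f ⊗ₜ AAlg.monoZ p q n i k) = a • (g ⊗ₜ AAlg.monoZ p q n j (k - m)) := by
  have h := exists_pow_apply (v := fun f m k => f ⊗ₜ AAlg.monoS p q (-1) m n k)
    (fun f m k hm => opp_monoS p q r (-1) f m n k hm)
    (fun f k => opp_monoS_zero p q r (-1) f n k) f hi k hm
  simpa only [AAlg.monoS_neg_one] using h

theorem opp_one_pow_self (f : Sm E11) (n m : ℕ) (k : ℤ) :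
    (opp p q r 1 ^ n) (f ⊗ₜ AAlg.monoZ p q n m k)
      = (eps r 1 ^ n * (q⁻¹ ^ m) ^ n * qFact q n) • (f ⊗ₜ AAlg.monoZ p q 0 m (k - n)) := by
  have h := pow_self_apply (v := fun f n k => f ⊗ₜ AAlg.monoS p q 1 n m k)
    (fun f n k hn => opp_monoS p q r 1 f n m k hn) f n k
  simpa only [AAlg.monoS_one] using h

theorem opp_neg_one_pow_self (f : Sm E11) (n m : ℕ) (k : ℤ) :
    (opp p q r (-1) ^ m) (f ⊗ₜ AAlg.monoZ p q n m k)
      = (eps r (-1) ^ m * (q⁻¹ ^ n) ^ m * qFact q m) • (f ⊗ₜ AAlg.monoZ p q n 0 (k - m)) := by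
  have h := pow_self_apply (v := fun f m k => f ⊗ₜ AAlg.monoS p q (-1) m n k)
    (fun f m k hm => opp_monoS p q r (-1) f m n k hm) f m k
  simpa only [AAlg.monoS_neg_one] using h

theorem eps_pow_mul (hr0 : r ≠ 0) (n m : ℕ) :
    eps r 1 ^ n * eps r (-1) ^ m = Complex.I ^ (n + m) * r ^ ((n : ℤ) - m) := by
  rw [eps, eps, mul_pow, mul_pow, pow_add, zpow_sub₀ hr0]
  simp
  field_simp

theorem pairing_phi_mono [hr : SqrtData p q r] (n m k n' m' k' t s l : ℕ) (hn : n < p) (hm : m < p) (hn' : n' < p)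
    (hm' : m' < p) (f : Sm E11) :
    pairing p q r σ (UAlg.phi p q σ n m k t s l) (f ⊗ₜ AAlg.mono p q n' m' k')
      = if n = n' ∧ m = m' ∧ (k + n + m : ℕ) ≡ k' [MOD p]
        then dualConst q r σ n m t s l * Sm.jet t s l f else 0 := by
  have hr0 : r ≠ 0 := by
    rintro rfl
    exact root_ne_zero p q (by rw [← hr.sq]; simp)
  rw [pairing_apply, act_phi, AAlg.mono_eq]
  by_cases h : n = n' ∧ m = m'
  · obtain ⟨rfl, rfl⟩ := h
    rw [opp_one_pow_self, map_smul, opp_neg_one_pow_self, pow_zero, one_pow, smul_smul, map_smul,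
      map_smul, map_smul, map_smul, map_smul, opK_tmul, monoZ_zero_zero, AAlg.kapA_idem,
      opP_pow_tmul, opP_pow_tmul, opH_pow_idem, counit_idem]
    have hiff : ((k' : ℤ) - n - m - k ≡ 0 [ZMOD p]) ↔ (k + n + m : ℕ) ≡ k' [MOD p] := by
      rw [Int.modEq_zero_iff_dvd, ← Int.natCast_modEq_iff, Int.modEq_iff_dvd]
      push_cast
      rw [show (k' : ℤ) - n - m - k = k' - (k + n + m) by ring]
    have hv : ((-(sgn σ * Complex.I)) ^ l • (Sm.boost ^ l) (Complex.I ^ s • (Sm.dz (-1) ^ s)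
        (Complex.I ^ t • (Sm.dz 1 ^ t) f))).1 0
        = (-(sgn σ * Complex.I)) ^ l * (Complex.I ^ s * Complex.I ^ t) * Sm.jet t s l f := by
      rw [map_smul, map_smul, map_smul, smul_smul, smul_smul, Sm.jet_eq, mul_assoc]
      rfl
    rw [hv]
    by_cases hk : (k + n + m : ℕ) ≡ k' [MOD p]
    · rw [if_pos (hiff.2 hk), if_pos ⟨rfl, rfl, hk⟩, dualConst, zpow_neg, ← inv_zpow, zpow_mul,
        zpow_natCast, zpow_natCast, smul_eq_mul, ← pow_mul, mul_comm m n, pow_mul]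
      have he := eps_pow_mul r hr0 n m
      rw [neg_mul_eq_neg_mul, mul_pow, pow_add Complex.I (n + m + t + s), pow_add _ (n + m + t),
        pow_add _ (n + m)]
      linear_combination (q⁻¹ ^ n) ^ m * qFact q n * qFact q m * (-sgn σ) ^ l * Complex.I ^ l
        * Complex.I ^ s * Complex.I ^ t * Sm.jet t s l f * he
    · rw [if_neg (fun h => hk (hiff.1 h)), if_neg (fun h => hk h.2.2), smul_zero]
  · rw [if_neg fun h' => h ⟨h'.1, h'.2.1⟩]
    obtain ⟨a, g, i, hi, hi0, h1⟩ := opp_one_pow p q r f hn' hn m' k'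
    obtain ⟨b, g', j, hj, hj0, h2⟩ := opp_neg_one_pow p q r g hm' hm i (k' - n)
    obtain ⟨g'', h3⟩ := exists_opH_opP_opK_monoZ p q σ g' i j ((k' : ℤ) - n - m) k t s l
    simp only [h1, h2, map_smul, h3]
    rw [counit_monoZ, smul_zero, smul_zero]
    by_contra! hc
    exact h ⟨by by_contra h; exact absurd (hi0 h) (by omega),
      by by_contra h; exact absurd (hj0 h) (by omega)⟩

end Duality

end AFAlg

/-! ### Taylor coefficients of monomials -/

namespace Sm

theorem derivation_pow_mul_pow {D : Sm E11 →ₗ[ℂ] Sm E11}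
    (hD : ∀ f g, D (f * g) = f * D g + D f * g) {A B : Sm E11} (hA : D A = 0) (hB : D B = 1)
    (l n : ℕ) : (D ^ l) (A * B ^ n) = (n.descFactorial l : ℂ) • (A * B ^ (n - l)) := by
  have hpow : ∀ n : ℕ, D (A * B ^ n) = (n : ℂ) • (A * B ^ (n - 1)) := by
    intro n
    induction n with
    | zero => rw [pow_zero, mul_one, hA]; simp
    | succ n ih =>
      have h1 : (n : ℂ) • (A * B ^ (n - 1)) * B = (n : ℂ) • (A * B ^ n) := by
        rcases n with _ | n
        · simp
        · rw [Nat.add_sub_cancel, smul_mul_assoc, mul_assoc, ← pow_succ]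
      rw [pow_succ, ← mul_assoc, hD, ih, hB, mul_one, h1, Nat.add_sub_cancel]
      push_cast
      module
  induction l with
  | zero => simp
  | succ l ih =>
    rw [pow_succ', Module.End.mul_apply, ih, map_smul, hpow, smul_smul, Nat.descFactorial_succ,
      Nat.sub_sub]
    push_cast
    rw [mul_comm]

theorem derivation_pow_eq_zero {D : Sm E11 →ₗ[ℂ] Sm E11}
    (hD : ∀ f g, D (f * g) = f * D g + D f * g) {A : Sm E11} (hA : D A = 0) (n : ℕ) :
    D (A ^ n) = 0 := by
  induction n with
  | zero =>
    have h := hD 1 1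
    rw [mul_one, one_mul, mul_one] at h
    rw [pow_zero]
    exact left_eq_add.1 h
  | succ n ih => rw [pow_succ, hD, hA, ih, mul_zero, zero_mul, add_zero]

theorem descFactorial_mul_zero_pow (n l : ℕ) :
    (n.descFactorial l : ℂ) * 0 ^ (n - l) = if l = n then (l.factorial : ℂ) else 0 := by
  rcases lt_trichotomy n l with h | h | h
  · rw [Nat.descFactorial_of_lt h, if_neg h.ne']
    simp
  · subst h
    rw [Nat.descFactorial_self, if_pos rfl, Nat.sub_self, pow_zero, mul_one]
  · rw [zero_pow (by omega), mul_zero, if_neg h.ne]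

theorem jet_monomial (t s l t' s' l' : ℕ) :
    jet t s l (z 1 ^ t' * z (-1) ^ s' * lam ^ l')
      = if t = t' ∧ s = s' ∧ l = l'
        then (l.factorial : ℂ) * t.factorial * s.factorial else 0 := by
  have hz := fun u n => derivation_pow_eq_zero dlam_mul (dlam_z u) n
  have hA : dlam (z 1 ^ t' * z (-1) ^ s') = 0 := by
    rw [dlam_mul, hz, hz, mul_zero, zero_mul, add_zero]
  have h1 : dz (-1) (z 1) = 0 := by rw [dz_z, if_neg (by decide)]
  have h2 : dz 1 (z (-1)) = 0 := by rw [dz_z, if_neg (by decide)]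
  have h3 : ∀ u, dz u (z u) = 1 := fun u => by rw [dz_z, if_pos rfl]
  have hB : ∀ n, dz (-1) (z 1 ^ t' * lam ^ n) = 0 := fun n => by
    rw [dz_mul, derivation_pow_eq_zero (dz_mul (-1)) h1,
      derivation_pow_eq_zero (dz_mul (-1)) (dz_lam (-1)), mul_zero, zero_mul, add_zero]
  have hC : ∀ n m, dz 1 (z (-1) ^ n * lam ^ m) = 0 := fun n m => by
    rw [dz_mul, derivation_pow_eq_zero (dz_mul 1) h2,
      derivation_pow_eq_zero (dz_mul 1) (dz_lam 1), mul_zero, zero_mul, add_zero]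
  change evHom (0 : E11) ((dz 1 ^ t) ((dz (-1) ^ s) ((dlam ^ l) (z 1 ^ t' * z (-1) ^ s' * lam ^ l'))))
    = _
  rw [derivation_pow_mul_pow dlam_mul hA dlam_lam, map_smul,
    show z 1 ^ t' * z (-1) ^ s' * lam ^ (l' - l) = z 1 ^ t' * lam ^ (l' - l) * z (-1) ^ s' by ring,
    derivation_pow_mul_pow (dz_mul (-1)) (hB _) (h3 (-1)), map_smul, map_smul, map_smul,
    show z 1 ^ t' * lam ^ (l' - l) * z (-1) ^ (s' - s)
      = z (-1) ^ (s' - s) * lam ^ (l' - l) * z 1 ^ t' by ring,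
    derivation_pow_mul_pow (dz_mul 1) (hC _ _) (h3 1), map_smul, map_smul, map_mul, map_mul,
    map_pow, map_pow, map_pow]
  have e1 : ∀ u, evHom (0 : E11) (z u) = 0 := fun u => by
    change ((((0 : E11).1 u : ℝ)) : ℂ) = 0; simp
  have e2 : evHom (0 : E11) lam = 0 := by
    change ((((0 : E11).2 : ℝ)) : ℂ) = 0; simp
  have d := descFactorial_mul_zero_pow
  rw [e1, e1, e2]
  have : (if t = t' ∧ s = s' ∧ l = l' then (l.factorial : ℂ) * t.factorial * s.factorial else 0)
      = (if l = l' then (l.factorial : ℂ) else 0) * (if t = t' then (t.factorial : ℂ) else 0)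
        * (if s = s' then (s.factorial : ℂ) else 0) := by
    split_ifs <;> simp_all
  rw [this, ← d, ← d, ← d]
  simp only [smul_eq_mul]
  ring

end Sm

namespace AFAlg

section Basis

variable (p : ℕ) (q : ℂ)

/-- `a^{nmktsl} = η_+^n η_-^m ζ(k, δ) z_+^t z_-^s λ^l` -/
def a (n m k t s l : ℕ) : AFAlg p q :=
  aqHom p q (AAlg.eta p q 1) ^ n * aqHom p q (AAlg.eta p q (-1)) ^ m * aqHom p q (AAlg.zeta p q k)
    * fnHom p q (Sm.z 1) ^ t * fnHom p q (Sm.z (-1)) ^ s * fnHom p q Sm.lam ^ l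

theorem a_eq [hpq : RootData p q] (n m k t s l : ℕ) : a p q n m k t s l
    = (Sm.z 1 ^ t * Sm.z (-1) ^ s * Sm.lam ^ l) ⊗ₜ AAlg.mono p q n m k := by
  rw [a, ← map_pow, ← map_pow, ← map_mul, ← map_mul, ← AAlg.mono, ← map_pow, ← map_pow, ← map_pow,
    mul_assoc, mul_assoc, ← map_mul, ← map_mul, ← mul_assoc, ← fnHom_mul_aqHom]
  exact (fnHom_commute p q _ _).eq.symm

theorem pairing_phi_a (r : ℂ) (σ : ℤˣ) [hpq : RootData p q] [hr : SqrtData p q r]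
    (n m k n' m' k' : Fin p) (t s l t' s' l' : ℕ) :
    pairing p q r σ (UAlg.phi p q σ n m k t s l) (a p q n' m' k' t' s' l')
      = if n = n' ∧ m = m' ∧ t = t' ∧ s = s' ∧ l = l' ∧ (k + n + m : ℕ) ≡ k' [MOD p]
        then dualConst q r σ n m t s l
          * ((l.factorial : ℂ) * (t.factorial : ℂ) * (s.factorial : ℂ))
        else 0 := by
  rw [a_eq, pairing_phi_mono p q r σ n m k n' m' k' t s l n.2 m.2 n'.2 m'.2, Sm.jet_monomial]
  simp only [Fin.val_inj]
  by_cases h1 : n = n' ∧ m = m' ∧ (k + n + m : ℕ) ≡ k' [MOD p]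
  · by_cases h2 : t = t' ∧ s = s' ∧ l = l'
    · rw [if_pos h1, if_pos h2, if_pos ⟨h1.1, h1.2.1, h2.1, h2.2.1, h2.2.2, h1.2.2⟩]
    · rw [if_pos h1, if_neg h2, mul_zero, if_neg fun h => h2 ⟨h.2.2.1, h.2.2.2.1, h.2.2.2.2.1⟩]
  · rw [if_neg h1, if_neg fun h => h1 ⟨h.1, h.2.1, h.2.2.2.2.2⟩]

end Basis

end AFAlg

/-! ### Twisted derivations and the nilpotent part of the coproduct -/

section TwistedDerivation

variable {A : Type*} [Ring A] [Algebra ℂ A] {T L R : A →ₗ[ℂ] A}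

theorem twisted_pow_eq_zero (hT : ∀ x y, T (x * y) = L x * T y + T x * R y) (h1 : T 1 = 0) {a : A}
    (ha : T a = 0) (n : ℕ) : T (a ^ n) = 0 := by
  induction n with
  | zero => rw [pow_zero, h1]
  | succ n ih => rw [pow_succ, hT, ih, ha, mul_zero, zero_mul, add_zero]

theorem twisted_nil_eq_zero (p : ℕ) (q : ℂ) [hpq : RootData p q]
    (hT : ∀ x y, T (x * y) = L x * T y + T x * R y) (h1 : T 1 = 0) {a b : A}
    (ha : T a = 0) (hb : T b = 0) : T (nil p q a b) = 0 :=
  linearMap_nil p q T fun i j _ _ _ => by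
    rw [hT, twisted_pow_eq_zero hT h1 ha, twisted_pow_eq_zero hT h1 hb, mul_zero, zero_mul, add_zero]

theorem derivation_pow_of_eigen (hT : ∀ x y, T (x * y) = x * T y + T x * y) {a : A} {c : ℂ}
    (ha : T a = c • a) (n : ℕ) : T (a ^ n) = (n * c) • a ^ n := by
  induction n with
  | zero =>
    have h := hT 1 1
    rw [mul_one, one_mul, mul_one] at h
    simpa using h
  | succ n ih =>
    rw [pow_succ, hT, ih, ha, mul_smul_comm, smul_mul_assoc, ← add_smul]
    push_cast
    ring_nf

theorem derivation_nil_of_eigen (p : ℕ) (q : ℂ) (hT : ∀ x y, T (x * y) = x * T y + T x * y)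
    {a b : A} {c : ℂ} (ha : T a = c • a) (hb : T b = c • b) :
    T (nil p q a b) = (p * c) • nil p q a b := by
  rw [nil, map_smul, map_sum, smul_comm ((p : ℂ) * c)]
  congr 1
  rw [Finset.smul_sum]
  refine Finset.sum_congr rfl fun x hx => ?_
  have h := Finset.HasAntidiagonal.mem_antidiagonal.1 hx
  rw [map_smul, hT, derivation_pow_of_eigen hT ha, derivation_pow_of_eigen hT hb, mul_smul_comm,
    smul_mul_assoc, ← add_smul, smul_comm, ← h]
  push_cast
  ring_nf

theorem twisted_pow_of_eigen {q : ℂ} (hq : q ≠ 0)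
    (hT : ∀ x y, T (x * y) = L x * T y + T x * R y) (h1 : T 1 = 0)
    {a : A} {e : ℂ} (hL : ∀ n : ℕ, L (a ^ n) = q⁻¹ ^ n • a ^ n) (hR : R a = q • a)
    (ha : T a = (e * qNum q 1) • 1) (n : ℕ) : T (a ^ n) = (e * qNum q n) • a ^ (n - 1) := by
  induction n with
  | zero => rw [pow_zero, h1]; simp [qNum]
  | succ n ih =>
    have h := qNum_add hq 1 n
    have hn : (e * qNum q n * q) • (a ^ (n - 1) * a) = (e * qNum q n * q) • a ^ n := by
      rcases n with _ | n
      · simp [qNum]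
      · rw [Nat.add_sub_cancel, ← pow_succ]
    rw [pow_succ, hT, ih, ha, hL, hR, Nat.add_sub_cancel, smul_mul_smul_comm, smul_mul_smul_comm,
      mul_one, hn, ← add_smul]
    congr 1
    rw [add_comm n 1, ← h, pow_one]
    ring

theorem linearMap_nil_of_eigen (p : ℕ) (q : ℂ) [hpq : RootData p q] {a b : A} {e : ℂ}
    (hab : a * b = q ^ 2 • (b * a))
    (hT : ∀ i j, 0 < i → 0 < j → i + j = p →
      T (a ^ i * b ^ j) = (e * qNum q i * q ^ j) • (a ^ (i - 1) * b ^ j)) :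
    T (nil p q a b)
      = ((-1) ^ ((p + 1) / 2) * e / qFact q (p - 1)) • ((a + b) ^ (p - 1) - a ^ (p - 1)) := by
  have hq := root_ne_zero p q
  have h0 := root_pos p q
  have hF : qFact q (p - 1) ≠ 0 := qFact_ne_zero p q (by omega)
  have h1 : (a + b) ^ (p - 1) - a ^ (p - 1)
      = ∑ n ∈ Finset.Icc 1 (p - 1), qCoef q (p - 1 - n) n • (a ^ (p - 1 - n) * b ^ n) := by
    rw [add_pow_of_qcomm hq hab, Finset.Nat.sum_antidiagonal_eq_sum_range_succ
      (fun i j => qCoef q i j • (a ^ i * b ^ j)), ← Finset.sum_range_reflect,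
      Finset.sum_range_succ', sub_eq_iff_eq_add]
    congr 1
    · rw [show Finset.Icc 1 (p - 1) = Finset.Ico 1 (p - 1 + 1) by ext; simp,
        Finset.sum_Ico_eq_sum_range, Nat.add_sub_cancel]
      refine Finset.sum_congr rfl fun i hi => ?_
      have := Finset.mem_range.1 hi
      rw [show p - 1 + 1 - 1 - (i + 1) = p - 1 - (1 + i) by omega,
        show p - 1 - (p - 1 - (1 + i)) = 1 + i by omega]
    · simp [qCoef_zero_right]
  rw [nil_eq_sum_Icc, map_smul, map_sum, h1, div_eq_mul_inv, mul_assoc, mul_smul]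
  congr 1
  rw [Finset.smul_sum]
  refine Finset.sum_congr rfl fun n hn => ?_
  have hn' := Finset.mem_Icc.1 hn
  have hF1 : qFact q (p - 1 - n) ≠ 0 := qFact_ne_zero p q (by omega)
  have hF2 : qFact q n ≠ 0 := qFact_ne_zero p q (by omega)
  have hN : qNum q (p - n) ≠ 0 := qNum_ne_zero p q (by omega) (by omega)
  have hFs : qFact q (p - n) = qFact q (p - 1 - n) * qNum q (p - n) := by
    obtain ⟨j, hj⟩ : ∃ j, p - n = j + 1 := ⟨p - n - 1, by omega⟩
    rw [hj, qFact_succ, show p - 1 - n = j by omega]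
  have hpow : q⁻¹ ^ ((p - 1 - n) * n) = q ^ (n ^ 2) * q ^ n := by
    rw [← pow_add]
    refine root_inv_pow_eq p q ?_
    refine ⟨n, ?_⟩
    obtain ⟨j, rfl⟩ : ∃ j, p = j + 1 + n := ⟨p - 1 - n, by omega⟩
    rw [show j + 1 + n - 1 - n = j by omega]
    ring
  rw [map_smul, hT _ _ (by omega) (by omega) (by omega), smul_smul, smul_smul,
    show p - n - 1 = p - 1 - n by omega, qCoef_eq p q (by omega), show p - 1 - n + n = p - 1 by omega,
    hpow, hFs]
  congr 1
  field_simp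

theorem rTensor_twisted {C : Type*} [Ring C] [Algebra ℂ C]
    (hT : ∀ x y, T (x * y) = L x * T y + T x * R y) (u v : A ⊗[ℂ] C) :
    T.rTensor C (u * v) = L.rTensor C u * T.rTensor C v + T.rTensor C u * R.rTensor C v := by
  induction u using TensorProduct.induction_on with
  | zero => simp only [map_zero, zero_mul, add_zero]
  | add u₁ u₂ h₁ h₂ => simp only [map_add, add_mul, h₁, h₂]; abel
  | tmul a c =>
    induction v using TensorProduct.induction_on with
    | zero => simp only [map_zero, mul_zero, add_zero]
    | add v₁ v₂ h₁ h₂ => simp only [map_add, mul_add, h₁, h₂]; abel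
    | tmul b d =>
      simp only [Algebra.TensorProduct.tmul_mul_tmul, LinearMap.rTensor_tmul, hT,
        TensorProduct.add_tmul]

end TwistedDerivation

theorem tay_apply_sign {B : Type*} [Ring B] [Algebra ℂ B] (ρ : Sm E11 →ₗ[ℂ] B) {n : ℤˣ → B}
    (h : Commute (n 1) (n (-1))) (s : ℤˣ) (f : Sm E11) : tay ρ n f
      = ρ f + ρ (Sm.dz s f) * n s + ρ (Sm.dz (-s) f) * n (-s)
        + ρ (Sm.dz s (Sm.dz (-s) f)) * (n s * n (-s)) := by
  rcases Int.units_eq_one_or s with rfl | rfl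
  · exact tay_apply ρ n f
  · rw [tay_apply, neg_neg, Sm.dz_comm (-1) 1, h.eq]
    abel

namespace AFAlg

/-! ### Leibniz rules -/

section Leibniz

variable (p : ℕ) (q r : ℂ) (σ : ℤˣ) [hpq : RootData p q]

theorem bilinear_ext {M : Type*} [AddCommGroup M] [Module ℂ M]
    {Φ Ψ : AFAlg p q →ₗ[ℂ] AFAlg p q →ₗ[ℂ] M}
    (h : ∀ f a g b, Φ (f ⊗ₜ a) (g ⊗ₜ b) = Ψ (f ⊗ₜ a) (g ⊗ₜ b)) (x y : AFAlg p q) :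
    Φ x y = Ψ x y := by
  have : Φ = Ψ := TensorProduct.ext' fun f a => TensorProduct.ext' fun g b => h f a g b
  rw [this]

theorem twisted_of_tmul {T L R : Module.End ℂ (AFAlg p q)}
    (h : ∀ f a g b, T ((f * g) ⊗ₜ (a * b))
      = L (f ⊗ₜ a) * T (g ⊗ₜ b) + T (f ⊗ₜ a) * R (g ⊗ₜ b)) (x y : AFAlg p q) :
    T (x * y) = L x * T y + T x * R y := by
  have := bilinear_ext p q (Φ := (LinearMap.mul ℂ (AFAlg p q)).compr₂ T)
    (Ψ := (LinearMap.mul ℂ (AFAlg p q)).compl₁₂ L T + (LinearMap.mul ℂ (AFAlg p q)).compl₁₂ T R)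
    (fun f a g b => by
      simpa only [LinearMap.compr₂_apply, LinearMap.mul_apply', Algebra.TensorProduct.tmul_mul_tmul,
        LinearMap.add_apply, LinearMap.compl₁₂_apply] using h f a g b) x y
  simpa only [LinearMap.compr₂_apply, LinearMap.mul_apply',
    LinearMap.add_apply, LinearMap.compl₁₂_apply] using this

theorem opP_mul (s : ℤˣ) (x y : AFAlg p q) :
    opP p q s (x * y) = x * opP p q s y + opP p q s x * y := by
  refine twisted_of_tmul p q (L := LinearMap.id) (R := LinearMap.id) (fun f a g b => ?_) x y
  simp only [opP_tmul, LinearMap.id_apply, Algebra.TensorProduct.tmul_mul_tmul, Sm.dz_mul, smul_add,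
    TensorProduct.add_tmul, mul_smul_comm, smul_mul_assoc]

theorem opH_mul (x y : AFAlg p q) :
    opH p q σ (x * y) = x * opH p q σ y + opH p q σ x * y := by
  refine twisted_of_tmul p q (L := LinearMap.id) (R := LinearMap.id) (fun f a g b => ?_) x y
  simp only [opH_tmul, LinearMap.id_apply, mul_smul_comm, smul_mul_assoc, mul_add, add_mul,
    Algebra.TensorProduct.tmul_mul_tmul, Sm.boost_mul, AAlg.degA_mul, TensorProduct.add_tmul,
    TensorProduct.tmul_add]
  module

theorem opp_mul (s : ℤˣ) (x y : AFAlg p q) : opp p q r s (x * y)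
    = opK p q (-1) x * opp p q r s y + opp p q r s x * opK p q 1 y := by
  refine twisted_of_tmul p q (L := (opK p q (-1)).toLinearMap) (R := (opK p q 1).toLinearMap)
    (fun f a g b => ?_) x y
  have h1 : AAlg.thA p q s (a * b) = AAlg.kapA p q (-1) a * AAlg.thA p q s b := by
    rw [AAlg.thA_apply, AAlg.thA_apply, map_mul, mul_assoc]
  have h2 : AAlg.thA p q s (a * b) = AAlg.thA p q s a * AAlg.kapA p q 1 b := by
    rw [AAlg.thA_eq, AAlg.thA_eq, map_mul, mul_assoc]
  simp only [opp_tmul, AlgHom.toLinearMap_apply, opK_tmul, mul_smul_comm, smul_mul_assoc, mul_add,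
    add_mul, Algebra.TensorProduct.tmul_mul_tmul, Sm.dz_mul, AAlg.pA_mul, TensorProduct.add_tmul,
    TensorProduct.tmul_add, ← h1, ← h2]
  module

theorem opP_fn (s : ℤˣ) (f : Sm E11) : opP p q s (fnHom p q f) = Complex.I • fnHom p q (Sm.dz s f) :=
  rfl

theorem opP_aq (s : ℤˣ) (a : AAlg p q) : opP p q s (aqHom p q a) = 0 := by
  rw [aqHom_apply, opP_tmul, Sm.dz, Sm.dirDeriv_one, smul_zero, TensorProduct.zero_tmul]

theorem opH_fn (f : Sm E11) :
    opH p q σ (fnHom p q f) = (-(sgn σ * Complex.I)) • fnHom p q (Sm.boost f) := by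
  rw [fnHom_apply, opH_tmul, AAlg.degA_one, TensorProduct.tmul_zero, smul_zero, add_zero, fnHom_apply]

theorem boost_one : Sm.boost 1 = 0 := by
  have h := Sm.boost_mul 1 1
  rw [mul_one, one_mul, mul_one] at h
  exact left_eq_add.1 h

theorem opH_aq (a : AAlg p q) : opH p q σ (aqHom p q a)
    = (-(sgn σ * Complex.I) * (1 / p)) • aqHom p q (AAlg.degA p q a) := by
  rw [aqHom_apply, opH_tmul, boost_one, TensorProduct.zero_tmul, zero_add, smul_smul, aqHom_apply]

theorem opK_fn (k : ℤ) (f : Sm E11) : opK p q k (fnHom p q f) = fnHom p q f := by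
  rw [fnHom_apply, opK_tmul, map_one]

theorem opK_aq (k : ℤ) (a : AAlg p q) : opK p q k (aqHom p q a) = aqHom p q (AAlg.kapA p q k a) :=
  rfl

theorem opp_fn (s : ℤˣ) (f : Sm E11) : opp p q r s (fnHom p q f)
    = wrap p q r s • (fnHom p q (Sm.dz s f) * aqHom p q (AAlg.eta p q s) ^ (p - 1)) := by
  rw [fnHom_apply, opp_tmul, AAlg.pA_one, TensorProduct.tmul_zero, zero_add, AAlg.thA_apply,
    map_one, one_mul, ← map_pow, fnHom_mul_aqHom]

theorem opp_aq (s : ℤˣ) (a : AAlg p q) :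
    opp p q r s (aqHom p q a) = aqHom p q (AAlg.pA p q (eps r s) s a) := by
  rw [aqHom_apply, opp_tmul, Sm.dz, Sm.dirDeriv_one, TensorProduct.zero_tmul, smul_zero, add_zero,
    aqHom_apply]

end Leibniz

end AFAlg

namespace AFAlg

/-! ### The action commutes with the coproduct -/

section Equivariance

variable (p : ℕ) (q r : ℂ) (σ : ℤˣ) [hpq : RootData p q]

/-- The coproduct with the second group variable fixed. -/
def comulL (h : E11) : AFAlg p q →ₐ[ℂ] AFAlg p q ⊗[ℂ] AAlg p q := (sliceLHom h).comp (comul p q)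

theorem comulL_apply (h : E11) (x : AFAlg p q) : comulL p q h x = sliceLHom h (comul p q x) := rfl

/-- `f ↦ f(· h) ⊗ 1` -/
def rhoL (h : E11) : Sm E11 →ₗ[ℂ] AFAlg p q ⊗[ℂ] AAlg p q :=
  (sliceLHom h).toLinearMap ∘ₗ (comulRho p q).toLinearMap

theorem rhoL_apply (h : E11) (f : Sm E11) : rhoL p q h f = fnHom p q (Sm.rtrans h f) ⊗ₜ 1 :=
  sliceLHom_rho p q h f

/-- The slice of the nilpotent part of the coproduct of `z_±`. -/
def nL (h : E11) (s : ℤˣ) : AFAlg p q ⊗[ℂ] AAlg p q := sliceLHom h (cN p q s)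

theorem nL_eq (h : E11) (s : ℤˣ) : nL p q h s
    = nil p (q ^ (s : ℤ)) (sliceLHom h (cX p q s)) (sliceLHom h (cY p q s)) := by
  rw [nL, cN, map_nil]

theorem nL_commute (h : E11) : Commute (nL p q h 1) (nL p q h (-1)) :=
  (cN_commute p q).map (sliceLHom h)

theorem comulL_fn (h : E11) (f : Sm E11) :
    comulL p q h (fnHom p q f) = tay (rhoL p q h) (nL p q h) f := by
  rw [comulL_apply, comul_fn, tay_map]; rfl

theorem comulL_fn_sign (h : E11) (s : ℤˣ) (f : Sm E11) : comulL p q h (fnHom p q f)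
    = rhoL p q h f + rhoL p q h (Sm.dz s f) * nL p q h s + rhoL p q h (Sm.dz (-s) f) * nL p q h (-s)
      + rhoL p q h (Sm.dz s (Sm.dz (-s) f)) * (nL p q h s * nL p q h (-s)) := by
  rw [comulL_fn, tay_apply_sign _ (nL_commute p q h) s]

theorem comulL_eta (h : E11) (s : ℤˣ) : comulL p q h (aqHom p q (AAlg.eta p q s))
    = sliceLHom h (cX p q s) + sliceLHom h (cY p q s) := by
  rw [comulL_apply, comul_eta, map_add]

theorem comulL_del (h : E11) : comulL p q h (aqHom p q (AAlg.gen p q .del))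
    = aqHom p q (AAlg.delta p q 1) ⊗ₜ AAlg.delta p q 1 := by
  rw [comulL_apply, comul_del, sliceLHom_cD]

/-- The action of `κ^k` on the first factor. -/
def opKL (k : ℤ) : AFAlg p q ⊗[ℂ] AAlg p q →ₐ[ℂ] AFAlg p q ⊗[ℂ] AAlg p q :=
  Algebra.TensorProduct.map (opK p q k) (AlgHom.id ℂ _)

theorem opKL_eq (k : ℤ) (u : AFAlg p q ⊗[ℂ] AAlg p q) :
    (opK p q k).toLinearMap.rTensor (AAlg p q) u = opKL p q k u := rfl

theorem opKL_tmul (k : ℤ) (x : AFAlg p q) (b : AAlg p q) :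
    opKL p q k (x ⊗ₜ b) = opK p q k x ⊗ₜ b := rfl

theorem opKL_cX (k : ℤ) (h : E11) (s : ℤˣ) :
    opKL p q k (sliceLHom h (cX p q s)) = q ^ (k * s) • sliceLHom h (cX p q s) := by
  rw [sliceLHom_cX, opKL_tmul, opK_aq, AAlg.kapA_eta, map_smul, TensorProduct.smul_tmul']

theorem opKL_cY (k : ℤ) (h : E11) (s : ℤˣ) :
    opKL p q k (sliceLHom h (cY p q s)) = q ^ (k * s) • sliceLHom h (cY p q s) := by
  rw [sliceLHom_cY, opKL_tmul, map_mul, opK_fn, opK_aq, AAlg.kapA_delta, map_smul, mul_smul_comm,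
    TensorProduct.smul_tmul']

theorem opKL_nL (k : ℤ) (h : E11) (s : ℤˣ) : opKL p q k (nL p q h s) = nL p q h s := by
  rw [nL_eq, map_nil, opKL_cX, opKL_cY, nil_smul, AAlg.zpow_pow_root, one_smul]

theorem opKL_rhoL (k : ℤ) (h : E11) (f : Sm E11) : opKL p q k (rhoL p q h f) = rhoL p q h f := by
  rw [rhoL_apply, opKL_tmul, opK_fn]

theorem comulL_opK (k : ℤ) (h : E11) (x : AFAlg p q) :
    comulL p q h (opK p q k x) = opKL p q k (comulL p q h x) := by
  refine algHom_ext (Φ := (comulL p q h).comp (opK p q k)) (Ψ := (opKL p q k).comp (comulL p q h))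
    (fun f => ?_) (fun s => ?_) ?_ x
  · rw [AlgHom.comp_apply, AlgHom.comp_apply, opK_fn, comulL_fn_sign p q h 1]
    simp only [map_add, map_mul, opKL_rhoL, opKL_nL]
  · rw [AlgHom.comp_apply, AlgHom.comp_apply, opK_aq, AAlg.kapA_eta, map_smul, map_smul, comulL_eta,
      map_add, opKL_cX, opKL_cY, smul_add]
  · rw [AlgHom.comp_apply, AlgHom.comp_apply, opK_aq, AAlg.kapA_del, map_smul, map_smul, comulL_del,
      opKL_tmul, opK_aq, AAlg.kapA_delta, map_smul, mul_one, TensorProduct.smul_tmul']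

theorem opPL_mul (s : ℤˣ) (u v : AFAlg p q ⊗[ℂ] AAlg p q) :
    (opP p q s).rTensor (AAlg p q) (u * v)
      = u * (opP p q s).rTensor (AAlg p q) v + (opP p q s).rTensor (AAlg p q) u * v := by
  have := rTensor_twisted (L := LinearMap.id) (R := LinearMap.id) (T := opP p q s) (C := AAlg p q)
    (opP_mul p q s) u v
  rwa [LinearMap.rTensor_id, LinearMap.id_apply, LinearMap.id_apply] at this

theorem opHL_mul (u v : AFAlg p q ⊗[ℂ] AAlg p q) :
    (opH p q σ).rTensor (AAlg p q) (u * v)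
      = u * (opH p q σ).rTensor (AAlg p q) v + (opH p q σ).rTensor (AAlg p q) u * v := by
  have := rTensor_twisted (L := LinearMap.id) (R := LinearMap.id) (T := opH p q σ) (C := AAlg p q)
    (opH_mul p q σ) u v
  rwa [LinearMap.rTensor_id, LinearMap.id_apply, LinearMap.id_apply] at this

theorem oppL_mul (s : ℤˣ) (u v : AFAlg p q ⊗[ℂ] AAlg p q) :
    (opp p q r s).rTensor (AAlg p q) (u * v)
      = opKL p q (-1) u * (opp p q r s).rTensor (AAlg p q) v
        + (opp p q r s).rTensor (AAlg p q) u * opKL p q 1 v :=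
  rTensor_twisted (L := (opK p q (-1)).toLinearMap) (R := (opK p q 1).toLinearMap)
    (T := opp p q r s) (C := AAlg p q) (opp_mul p q r s) u v

theorem comulL_opP (s : ℤˣ) (h : E11) (x : AFAlg p q) :
    comulL p q h (opP p q s x) = (opP p q s).rTensor (AAlg p q) (comulL p q h x) := by
  set T := (opP p q s).rTensor (AAlg p q) with hT
  have hX : ∀ t, T (sliceLHom h (cX p q t)) = 0 := fun t => by
    rw [sliceLHom_cX, hT, LinearMap.rTensor_tmul, opP_aq, TensorProduct.zero_tmul]
  have hY : ∀ t, T (sliceLHom h (cY p q t)) = 0 := fun t => by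
    rw [sliceLHom_cY, hT, LinearMap.rTensor_tmul, opP_mul, opP_aq, opP_fn, Sm.dz_expLam]
    simp
  have h1 : T 1 = 0 := by
    rw [hT, Algebra.TensorProduct.one_def, LinearMap.rTensor_tmul, ← map_one (aqHom p q), opP_aq,
      TensorProduct.zero_tmul]
  have hN : ∀ t, T (nL p q h t) = 0 := fun t => by
    rw [nL_eq]
    exact twisted_nil_eq_zero p _ (L := LinearMap.id) (R := LinearMap.id) (opPL_mul p q s) h1
      (hX t) (hY t)
  have hρ : ∀ f, T (rhoL p q h f) = Complex.I • rhoL p q h (Sm.dz s f) := fun f => by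
    rw [rhoL_apply, hT, LinearMap.rTensor_tmul, opP_fn, Sm.dz_rtrans, rhoL_apply,
      TensorProduct.smul_tmul']
  induction x using AFAlg.induction with
  | hf f =>
    rw [opP_fn, map_smul, comulL_fn_sign p q h 1, comulL_fn_sign p q h 1]
    simp only [map_add, hT, opPL_mul]
    simp only [← hT, hN, hρ, mul_zero, zero_mul, zero_add, add_zero, smul_add, smul_mul_assoc,
      Sm.dz_comm s]
  | he t => rw [opP_aq, map_zero, comulL_eta, map_add, hX, hY, add_zero]
  | hd =>
    rw [opP_aq, map_zero, comulL_del, hT, LinearMap.rTensor_tmul, opP_aq, TensorProduct.zero_tmul]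
  | hmul x y hx hy => rw [opP_mul, map_add, map_mul, map_mul, hx, hy, map_mul, hT, opPL_mul]
  | hadd x y hx hy => simp only [map_add, hx, hy]

theorem comulL_opH (h : E11) (x : AFAlg p q) :
    comulL p q h (opH p q σ x) = (opH p q σ).rTensor (AAlg p q) (comulL p q h x) := by
  have h0 := root_pos p q
  have hp : (p : ℂ) ≠ 0 := by exact_mod_cast h0.ne'
  set T := (opH p q σ).rTensor (AAlg p q) with hT
  set c := -(sgn σ * Complex.I) with hc
  have hX : ∀ t, T (sliceLHom h (cX p q t)) = (c * (1 / p) * sgn t) • sliceLHom h (cX p q t) :=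
    fun t => by
    rw [sliceLHom_cX, hT, LinearMap.rTensor_tmul, opH_aq, AAlg.degA_eta, map_smul, smul_smul,
      TensorProduct.smul_tmul']
  have hY : ∀ t, T (sliceLHom h (cY p q t)) = (c * (1 / p) * sgn t) • sliceLHom h (cY p q t) :=
    fun t => by
    rw [sliceLHom_cY, hT, LinearMap.rTensor_tmul, opH_mul, opH_aq, opH_fn, Sm.boost_expLam,
      AAlg.degA_delta, map_zero, smul_zero, mul_zero, zero_add, map_smul, smul_smul, smul_mul_assoc,
      TensorProduct.smul_tmul', ← hc]
    congr 2
    have : sgn t = ((t : ℤ) : ℂ) := rfl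
    rw [this]
    push_cast
    ring
  have hN : ∀ t, T (nL p q h t) = (c * sgn t) • nL p q h t := fun t => by
    rw [nL_eq, derivation_nil_of_eigen p _ (opHL_mul p q σ) (hX t) (hY t)]
    congr 1
    field_simp
  have hρ : ∀ f, T (rhoL p q h f) = c • rhoL p q h (Sm.boost f) := fun f => by
    rw [rhoL_apply, hT, LinearMap.rTensor_tmul, opH_fn, Sm.boost_rtrans, rhoL_apply,
      TensorProduct.smul_tmul']
  induction x using AFAlg.induction with
  | hf f =>
    rw [opH_fn, map_smul, comulL_fn_sign p q h 1, comulL_fn_sign p q h 1]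
    simp only [map_add, hT, opHL_mul]
    simp only [← hT, hN, hρ, Sm.dz_boost, map_add, map_smul, add_mul, smul_add, smul_mul_assoc,
      mul_smul_comm, mul_add]
    module
  | he t =>
    rw [opH_aq, AAlg.degA_eta, map_smul, map_smul, map_smul, comulL_eta, map_add, hX, hY, smul_smul,
      smul_add]
  | hd =>
    rw [opH_aq, AAlg.degA_del, map_zero, smul_zero, map_zero, comulL_del, hT, LinearMap.rTensor_tmul,
      opH_aq, AAlg.degA_delta, map_zero, smul_zero, TensorProduct.zero_tmul]
  | hmul x y hx hy => rw [opH_mul, map_add, map_mul, map_mul, hx, hy, map_mul, hT, opHL_mul]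
  | hadd x y hx hy => simp only [map_add, hx, hy]

theorem comulL_opp (s : ℤˣ) (h : E11) (x : AFAlg p q) :
    comulL p q h (opp p q r s x) = (opp p q r s).rTensor (AAlg p q) (comulL p q h x) := by
  have h0 := root_pos p q
  set T := (opp p q r s).rTensor (AAlg p q) with hT
  set X := sliceLHom h (cX p q s) with hXd
  set Y := sliceLHom h (cY p q s) with hYd
  set N := nL p q h s with hNd
  set M := nL p q h (-s) with hMd
  have hXY : X * Y = (q ^ (s : ℤ)) ^ 2 • (Y * X) := by
    rw [hXd, hYd, ← map_mul, cX_mul_cY, map_smul, map_mul]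
  have hXp : X ^ p = 0 := by rw [hXd, ← map_pow, cX_pow, map_zero]
  have hYp : Y ^ p = 0 := by rw [hYd, ← map_pow, cY_pow, map_zero]
  have hTX : ∀ t, T (sliceLHom h (cX p q t))
      = (AAlg.pA p q (eps r s) s (AAlg.eta p q t) |> aqHom p q) ⊗ₜ 1 := fun t => by
    rw [sliceLHom_cX, hT, LinearMap.rTensor_tmul, opp_aq]
  have hTY : ∀ t, T (sliceLHom h (cY p q t)) = 0 := fun t => by
    rw [sliceLHom_cY, hT, LinearMap.rTensor_tmul, opp_mul, opp_aq, opp_fn, Sm.dz_expLam, AAlg.pA_delta]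
    simp
  have hTmul : ∀ u v, T (u * v) = opKL p q (-1) u * T v + T u * opKL p q 1 v := oppL_mul p q r s
  have hKY : opKL p q 1 Y = q ^ (s : ℤ) • Y := by rw [hYd, opKL_cY, one_mul]
  have hKN : ∀ k, opKL p q k N = N := fun k => opKL_nL p q k h s
  have hKM : ∀ k, opKL p q k M = M := fun k => opKL_nL p q k h (-s)
  have hfn : ∀ f, comulL p q h (fnHom p q f) = rhoL p q h f + rhoL p q h (Sm.dz s f) * N
      + rhoL p q h (Sm.dz (-s) f) * M + rhoL p q h (Sm.dz s (Sm.dz (-s) f)) * (N * M) :=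
    comulL_fn_sign p q h s
  have hTX1 : T X = (eps r s * qNum q 1) • 1 := by
    rw [hXd, hTX, AAlg.pA_eta, map_smul, map_one, ← TensorProduct.smul_tmul']
    rfl
  have hTX0 : T (sliceLHom h (cX p q (-s))) = 0 := by
    rw [hTX, AAlg.pA_eta_neg, map_zero, TensorProduct.zero_tmul]
  have h1 : T 1 = 0 := by
    rw [hT, Algebra.TensorProduct.one_def, LinearMap.rTensor_tmul, ← map_one (aqHom p q), opp_aq,
      AAlg.pA_one, map_zero, TensorProduct.zero_tmul]
  have hM : T M = 0 := by
    rw [hMd, nL_eq]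
    exact twisted_nil_eq_zero p _ (L := (opKL p q (-1)).toLinearMap) (R := (opKL p q 1).toLinearMap)
      (oppL_mul p q r s) h1 hTX0 (hTY _)
  have hQ := root_ne_zero p (q ^ (s : ℤ))
  have hTpow : ∀ n : ℕ, T (X ^ n) = (eps r s * qNum (q ^ (s : ℤ)) n) • X ^ (n - 1) := by
    refine twisted_pow_of_eigen (L := (opKL p q (-1)).toLinearMap) (R := (opKL p q 1).toLinearMap)
      hQ (oppL_mul p q r s) h1 (fun n => ?_) ?_ ?_
    · rw [AlgHom.toLinearMap_apply, map_pow, hXd, opKL_cX, smul_pow, neg_one_mul, zpow_neg]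
    · rw [AlgHom.toLinearMap_apply, hXd, opKL_cX, one_mul]
    · rw [hTX1, qNum_zpow]
  have hN : T N = wrap p q r s • ((X + Y) ^ (p - 1) - X ^ (p - 1)) := by
    rw [hNd, nL_eq, linearMap_nil_of_eigen p (q ^ (s : ℤ)) (e := eps r s) hXY, wrap, qFact_zpow]
    intro i j _ _ _
    rw [hTmul, hTpow, twisted_pow_eq_zero (L := (opKL p q (-1)).toLinearMap)
      (R := (opKL p q 1).toLinearMap) (oppL_mul p q r s) h1 (hTY s), mul_zero, zero_add, map_pow,
      hKY, smul_pow, smul_mul_smul_comm]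
  have hρ : ∀ f, T (rhoL p q h f) = wrap p q r s • (rhoL p q h (Sm.dz s f) * X ^ (p - 1)) := fun f => by
    rw [rhoL_apply, hT, LinearMap.rTensor_tmul, opp_fn, Sm.dz_rtrans, rhoL_apply, hXd, sliceLHom_cX,
      Algebra.TensorProduct.tmul_pow, one_pow, Algebra.TensorProduct.tmul_mul_tmul, one_mul,
      TensorProduct.smul_tmul']
  have hXN : X ^ (p - 1) * N = 0 := by
    have := pow_mul_nil p (q ^ (s : ℤ)) hXY hXp hYp (i := p - 1) (j := 0) (by omega)
    rwa [pow_zero, mul_one, ← nL_eq, ← hNd] at this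
  have hSN : (X + Y) ^ (p - 1) * N = 0 := by
    rw [add_pow_of_qcomm hQ hXY, Finset.sum_mul, hNd, nL_eq]
    refine Finset.sum_eq_zero fun x hx => ?_
    have := Finset.HasAntidiagonal.mem_antidiagonal.1 hx
    rw [smul_mul_assoc, pow_mul_nil p (q ^ (s : ℤ)) hXY hXp hYp (by omega), smul_zero]
  have hcN : Commute (X + Y) N := by
    have := (cXY_commute_cN p q s s).map (sliceLHom h)
    rwa [map_add] at this
  have hcM : Commute (X + Y) M := by
    have := (cXY_commute_cN p q (-s) s).map (sliceLHom h)
    rwa [map_add] at this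
  have hNS : N * (X + Y) ^ (p - 1) = 0 := by rw [← (hcN.pow_left (p - 1)).eq, hSN]
  induction x using AFAlg.induction with
  | hf f =>
    rw [opp_fn, map_smul, map_mul, map_pow, comulL_eta, hfn, hfn, ← hXd, ← hYd]
    simp only [map_add, hTmul, hM, hN, hρ, opKL_rhoL, hKN, hKM, map_mul, mul_zero, zero_add]
    have e1 : rhoL p q h (Sm.dz s (Sm.dz s f)) * N * (X + Y) ^ (p - 1) = 0 := by
      rw [mul_assoc, hNS, mul_zero]
    have e2 : ∀ g, rhoL p q h g * (N * M) * (X + Y) ^ (p - 1) = 0 := fun g => by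
      rw [mul_assoc, mul_assoc, ← (hcM.pow_left (p - 1)).eq, ← mul_assoc N, hNS, zero_mul, mul_zero]
    have e3 : ∀ g, rhoL p q h g * X ^ (p - 1) * N = 0 := fun g => by
      rw [mul_assoc, hXN, mul_zero]
    have e4 : ∀ g, rhoL p q h g * X ^ (p - 1) * (N * M) = 0 := fun g => by
      rw [← mul_assoc, e3, zero_mul]
    have e5 : ∀ g, rhoL p q h g * M * (X + Y) ^ (p - 1) = rhoL p q h g * ((X + Y) ^ (p - 1) * M) :=
      fun g => by rw [mul_assoc, ← (hcM.pow_left (p - 1)).eq]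
    simp only [add_mul, smul_mul_assoc, e1, e2, e3, e4, e5, smul_zero, add_zero, mul_smul_comm,
      mul_sub, sub_mul, mul_assoc, Sm.dz_comm (-s) s]
    module
  | he t =>
    rw [opp_aq, comulL_eta, map_add, hTX, hTY, add_zero]
    rcases eq_or_ne t s with rfl | ht
    · rw [AAlg.pA_eta, map_smul, map_one, map_smul, map_one, Algebra.TensorProduct.one_def,
        TensorProduct.smul_tmul']
    · rw [Int.units_ne_iff_eq_neg.1 ht, AAlg.pA_eta_neg, map_zero, map_zero, TensorProduct.zero_tmul]
  | hd =>
    rw [opp_aq, AAlg.pA_del, map_zero, map_zero, comulL_del, hT, LinearMap.rTensor_tmul, opp_aq,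
      AAlg.pA_delta, map_zero, TensorProduct.zero_tmul]
  | hmul x y hx hy =>
    rw [opp_mul, map_add, map_mul, map_mul, hx, hy, comulL_opK, comulL_opK, map_mul, hT, oppL_mul]
  | hadd x y hx hy => simp only [map_add, hx, hy]

variable [hr : SqrtData p q r]

theorem comulL_act (h : E11) (φ : UAlg p q σ) (x : AFAlg p q) :
    comulL p q h (act p q r σ φ x) = (act p q r σ φ).rTensor (AAlg p q) (comulL p q h x) := by
  induction φ using UAlg.induction generalizing x with
  | hc c =>
    have : act p q r σ (algebraMap ℂ _ c) = c • LinearMap.id :=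
      LinearMap.ext (act_algebraMap p q r σ c)
    rw [this, LinearMap.rTensor_smul, LinearMap.rTensor_id]
    simp
  | hg g =>
    cases g with
    | bigP s => rw [← UAlg.P, act_P, comulL_opP]
    | ham => rw [← UAlg.H, act_H, comulL_opH]
    | smallP s => rw [← UAlg.sp, act_sp, comulL_opp]
    | kap => rw [act_kap, AlgHom.toLinearMap_apply, comulL_opK, opKL_eq]
  | hmul φ ψ hφ hψ =>
    have : act p q r σ (φ * ψ) = act p q r σ ψ ∘ₗ act p q r σ φ :=
      LinearMap.ext (act_mul p q r σ φ ψ)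
    rw [this, LinearMap.comp_apply, hψ, hφ, LinearMap.rTensor_comp, LinearMap.comp_apply]
  | hadd φ ψ hφ hψ =>
    rw [act_add, LinearMap.add_apply, map_add, hφ, hψ, LinearMap.rTensor_add, LinearMap.add_apply]

theorem pairing_mul_left (φ : UAlg p q σ) (x : AFAlg p q) : ∃ y : AFAlg p q,
    (∀ h : E11, evalLin h y = TensorProduct.lid ℂ (AAlg p q)
      ((pairing p q r σ φ).rTensor (AAlg p q) (sliceL h (comul p q x)))) ∧
    ∀ ψ : UAlg p q σ, pairing p q r σ (φ * ψ) x = pairing p q r σ ψ y := by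
  refine ⟨act p q r σ φ x, fun h => ?_, fun ψ => pairing_mul p q r σ φ ψ x⟩
  have h1 : pairing p q r σ φ = (counit p q).toLinearMap ∘ₗ act p q r σ φ := rfl
  rw [← counit_left, sliceL_eq, sliceL_eq, ← comulL_apply, ← comulL_apply, comulL_act, h1,
    LinearMap.rTensor_comp, LinearMap.comp_apply]

/-! ### The action and products -/

/-- `u ⊗ v ↦ (act u x) (act v y)` -/
def actMul (x y : AFAlg p q) : UAlg p q σ ⊗[ℂ] UAlg p q σ →ₗ[ℂ] AFAlg p q :=
  TensorProduct.lift (LinearMap.mk₂ ℂ (fun u v => act p q r σ u x * act p q r σ v y)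
    (fun u u' v => by rw [act_add, LinearMap.add_apply, add_mul])
    (fun c u v => by rw [act_smul, LinearMap.smul_apply, smul_mul_assoc])
    (fun u v v' => by rw [act_add, LinearMap.add_apply, mul_add])
    (fun c u v => by rw [act_smul, LinearMap.smul_apply, mul_smul_comm]))

theorem actMul_tmul (x y : AFAlg p q) (u v : UAlg p q σ) :
    actMul p q r σ x y (u ⊗ₜ v) = act p q r σ u x * act p q r σ v y := rfl

theorem actMul_tmul_mul (x y : AFAlg p q) (u v : UAlg p q σ) (t : UAlg p q σ ⊗[ℂ] UAlg p q σ) :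
    actMul p q r σ x y ((u ⊗ₜ v) * t)
      = actMul p q r σ (act p q r σ u x) (act p q r σ v y) t := by
  induction t using TensorProduct.induction_on with
  | zero => rw [mul_zero, map_zero, map_zero]
  | add t t' h h' => rw [mul_add, map_add, map_add, h, h']
  | tmul a b =>
    rw [Algebra.TensorProduct.tmul_mul_tmul, actMul_tmul, actMul_tmul, act_mul, act_mul]

theorem act_mul_apply (φ : UAlg p q σ) (x y : AFAlg p q) :
    act p q r σ φ (x * y) = actMul p q r σ x y (UAlg.comulHom p q σ φ) := by
  induction φ using UAlg.induction generalizing x y with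
  | hc c =>
    rw [act_algebraMap, AlgHom.commutes, Algebra.algebraMap_eq_smul_one, map_smul,
      Algebra.TensorProduct.one_def, actMul_tmul, act_one]
    rfl
  | hg g =>
    cases g with
    | bigP s =>
      rw [← UAlg.P, UAlg.comulHom_P, map_add, actMul_tmul, actMul_tmul, act_P, act_one, opP_mul,
        add_comm]
      rfl
    | ham =>
      rw [← UAlg.H, UAlg.comulHom_H, map_add, actMul_tmul, actMul_tmul, act_H, act_one, opH_mul,
        add_comm]
      rfl
    | smallP s =>
      rw [← UAlg.sp, UAlg.comulHom_sp, map_add, actMul_tmul, actMul_tmul, act_sp, act_kappa,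
        act_kappa, opp_mul, add_comm]
    | kap =>
      rw [UAlg.comulHom_kap, actMul_tmul, act_kappa, act_kappa, act_kap, AlgHom.toLinearMap_apply,
        map_mul]
  | hmul φ ψ hφ hψ =>
    rw [act_mul, hφ, map_mul]
    generalize UAlg.comulHom p q σ φ = w
    induction w using TensorProduct.induction_on with
    | zero => rw [map_zero, map_zero, zero_mul, map_zero]
    | add t t' h h' => rw [map_add, map_add, add_mul, map_add, h, h']
    | tmul u v => rw [actMul_tmul, hψ, actMul_tmul_mul]
  | hadd φ ψ hφ hψ => rw [act_add, LinearMap.add_apply, hφ, hψ, map_add, map_add]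

theorem pairing_mul_right_hom (φ : UAlg p q σ) (x y : AFAlg p q) :
    pairing p q r σ φ (x * y) = LinearMap.mul' ℂ ℂ (TensorProduct.map ((pairing p q r σ).flip x)
      ((pairing p q r σ).flip y) (UAlg.comulHom p q σ φ)) := by
  rw [pairing_apply, act_mul_apply]
  generalize UAlg.comulHom p q σ φ = w
  induction w using TensorProduct.induction_on with
  | zero => simp only [map_zero]
  | add t t' h h' => simp only [map_add, h, h']
  | tmul u v =>
    rw [actMul_tmul, map_mul, TensorProduct.map_tmul, LinearMap.mul'_apply, LinearMap.flip_apply,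
      LinearMap.flip_apply, pairing_apply, pairing_apply]

theorem pairing_mul_right (φ : UAlg p q σ) (x y : AFAlg p q) :
    pairing p q r σ φ (x * y) = LinearMap.mul' ℂ ℂ (TensorProduct.map ((pairing p q r σ).flip x)
      ((pairing p q r σ).flip y) (Coalgebra.comul (R := ℂ) φ)) := by
  rw [UAlg.comul_def, pairing_mul_right_hom]

theorem pairing_one_left (x : AFAlg p q) : pairing p q r σ 1 x = counit p q x := by
  rw [pairing_apply, act_one, Module.End.one_apply]

theorem act_apply_one (φ : UAlg p q σ) :
    act p q r σ φ 1 = UAlg.counitHom p q σ φ • (1 : AFAlg p q) := by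
  induction φ using UAlg.induction with
  | hc c => rw [act_algebraMap, AlgHom.commutes]; rfl
  | hg g =>
    cases g with
    | bigP s => rw [← UAlg.P, act_P, UAlg.counitHom_P, zero_smul, ← map_one (aqHom p q), opP_aq]
    | ham =>
      rw [← UAlg.H, act_H, UAlg.counitHom_H, zero_smul, ← map_one (aqHom p q), opH_aq, AAlg.degA_one,
        map_zero, smul_zero]
    | smallP s =>
      rw [← UAlg.sp, act_sp, UAlg.counitHom_sp, zero_smul, ← map_one (aqHom p q), opp_aq,
        AAlg.pA_one, map_zero]
    | kap => rw [act_kap, UAlg.counitHom_kap, one_smul, AlgHom.toLinearMap_apply, map_one]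
  | hmul φ ψ hφ hψ => rw [act_mul, hφ, map_smul, hψ, smul_smul, map_mul]
  | hadd φ ψ hφ hψ => rw [act_add, LinearMap.add_apply, hφ, hψ, map_add, add_smul]

theorem pairing_one_right (φ : UAlg p q σ) :
    pairing p q r σ φ 1 = Coalgebra.counit (R := ℂ) φ := by
  rw [UAlg.counit_def, pairing_apply, act_apply_one, map_smul, map_one, smul_eq_mul, mul_one]

end Equivariance

end AFAlg

/-! ### Invariant vector fields at the unit element -/

namespace Sm

theorem eval_pow_eq {L R : Module.End ℂ (Sm E11)} (hc : Commute L R)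
    (h : ∀ f, (L f).1 0 = (R f).1 0) (n : ℕ) (f : Sm E11) : ((L ^ n) f).1 0 = ((R ^ n) f).1 0 := by
  induction n generalizing f with
  | zero => rfl
  | succ n ih =>
    rw [pow_succ', Module.End.mul_apply, h, ← Module.End.mul_apply, ← (hc.pow_left n).eq,
      Module.End.mul_apply, ih, ← Module.End.mul_apply, ← pow_succ]

theorem eval_ldz (s : ℤˣ) (f : Sm E11) : (ldz s f).1 0 = (dz s f).1 0 := by
  rw [ldz_eq]
  change evHom (0 : E11) (expLam ((s : ℤ) : ℝ) * dz s f) = evHom (0 : E11) (dz s f)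
  rw [map_mul]
  have : evHom (0 : E11) (expLam ((s : ℤ) : ℝ)) = 1 := by
    change ((Real.exp (((s : ℤ) : ℝ) * (0 : E11).2) : ℝ) : ℂ) = 1
    simp
  rw [this, one_mul]

theorem eval_left_eq_right (t s l : ℕ) (f : Sm E11) :
    ((dlam ^ l) ((ldz (-1) ^ s) ((ldz 1 ^ t) f))).1 0
      = ((dz 1 ^ t) ((dz (-1) ^ s) ((boost ^ l) f))).1 0 := by
  have c1 : ∀ u v, Commute (ldz u : Module.End ℂ (Sm E11)) (dz v) := fun u v =>
    LinearMap.ext fun f => (dz_ldz v u f).symm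
  have c2 : ∀ u, Commute (ldz u : Module.End ℂ (Sm E11)) boost := fun u =>
    LinearMap.ext fun f => (boost_ldz u f).symm
  have c3 : Commute (dlam : Module.End ℂ (Sm E11)) boost := LinearMap.ext dlam_boost
  have h1 : ∀ f, (dlam f).1 0 = (boost f).1 0 := fun f => (evalPt_boost f).symm
  have e : ∀ {L R : Module.End ℂ (Sm E11)} (_ : Commute L R) (m n : ℕ) (f : Sm E11),
      (R ^ n) ((L ^ m) f) = (L ^ m) ((R ^ n) f) := fun hc m n f => by
    rw [← Module.End.mul_apply, ← (hc.pow_pow m n).eq, Module.End.mul_apply]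
  rw [eval_pow_eq c3 h1, e (c2 (-1)), e (c2 1), eval_pow_eq (c1 (-1) (-1)) (eval_ldz (-1)),
    e (c1 1 (-1)), eval_pow_eq (c1 1 1) (eval_ldz 1)]

theorem dz_pow_invFun (s : ℤˣ) (n : ℕ) (f : Sm E11) :
    (dz s ^ n) (invFun f) = (-1 : ℂ) ^ n • invFun ((ldz s ^ n) f) := by
  induction n with
  | zero => simp
  | succ n ih =>
    rw [pow_succ', Module.End.mul_apply, ih, map_smul, dz_invFun, pow_succ' (ldz s),
      Module.End.mul_apply, pow_succ]
    module

theorem boost_pow_invFun (n : ℕ) (f : Sm E11) :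
    (boost ^ n) (invFun f) = (-1 : ℂ) ^ n • invFun ((dlam ^ n) f) := by
  induction n with
  | zero => simp
  | succ n ih =>
    rw [pow_succ', Module.End.mul_apply, ih, map_smul, boost_invFun, pow_succ' dlam,
      Module.End.mul_apply, pow_succ]
    module

end Sm

namespace AFAlg

/-! ### The pairing and the antipodes -/

section Antipode

variable (p : ℕ) (q r : ℂ) (σ : ℤˣ) [hpq : RootData p q]

theorem pairing_antipode_mul [hr : SqrtData p q r] {x y : AFAlg p q}
    (hx : ∀ φ, pairing p q r σ (UAlg.antipode p q σ φ) x = pairing p q r σ φ (antipode p q x))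
    (hy : ∀ φ, pairing p q r σ (UAlg.antipode p q σ φ) y = pairing p q r σ φ (antipode p q y))
    (φ : UAlg p q σ) : pairing p q r σ (UAlg.antipode p q σ φ) (x * y)
      = pairing p q r σ φ (antipode p q (x * y)) := by
  rw [antipode_mul, pairing_mul_right_hom, pairing_mul_right_hom, UAlg.comul_antipode]
  generalize UAlg.comulHom p q σ φ = w
  induction w using TensorProduct.induction_on with
  | zero => simp only [map_zero]
  | add t t' h h' => simp only [map_add, h, h']
  | tmul u v =>
    simp only [TensorProduct.map_tmul, TensorProduct.comm_tmul, LinearMap.mul'_apply,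
      LinearMap.flip_apply, hx, hy, mul_comm]

theorem act_antipode_delta [hr : SqrtData p q r] (φ : UAlg p q σ) : ∃ c : ℂ,
    act p q r σ φ (aqHom p q (AAlg.delta p q (-1))) = c • aqHom p q (AAlg.delta p q (-1)) ∧
    act p q r σ (UAlg.antipode p q σ φ) (aqHom p q (AAlg.delta p q 1))
      = c • aqHom p q (AAlg.delta p q 1) := by
  induction φ using UAlg.induction with
  | hc c =>
    exact ⟨c, act_algebraMap p q r σ c _, by rw [UAlg.antipode_algebraMap, act_algebraMap]⟩
  | hg g =>
    cases g with
    | bigP s =>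
      refine ⟨0, ?_⟩
      rw [← UAlg.P, UAlg.antipode_P, act_neg, LinearMap.neg_apply, act_P, opP_aq, opP_aq]
      simp
    | ham =>
      refine ⟨0, ?_⟩
      rw [← UAlg.H, UAlg.antipode_H, act_neg, LinearMap.neg_apply, act_H, opH_aq, opH_aq,
        AAlg.degA_delta, AAlg.degA_delta]
      simp
    | smallP s =>
      refine ⟨0, ?_⟩
      rw [← UAlg.sp, UAlg.antipode_sp, act_neg, LinearMap.neg_apply, act_smul, LinearMap.smul_apply,
        act_sp, opp_aq, opp_aq, AAlg.pA_delta, AAlg.pA_delta]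
      simp
    | kap =>
      refine ⟨q ^ (-1 : ℤ), ?_⟩
      rw [UAlg.antipode_kap, act_kap, act_kappa, AlgHom.toLinearMap_apply, opK_aq, opK_aq,
        AAlg.kapA_delta, AAlg.kapA_delta, map_smul, map_smul, one_mul, mul_one]
      exact ⟨rfl, rfl⟩
  | hmul φ ψ hφ hψ =>
    obtain ⟨a, h1, h2⟩ := hφ
    obtain ⟨b, h3, h4⟩ := hψ
    refine ⟨a * b, ?_, ?_⟩
    · rw [act_mul, h1, map_smul, h3, smul_smul]
    · rw [UAlg.antipode_mul, act_mul, h4, map_smul, h2, smul_smul, mul_comm]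
  | hadd φ ψ hφ hψ =>
    obtain ⟨a, h1, h2⟩ := hφ
    obtain ⟨b, h3, h4⟩ := hψ
    refine ⟨a + b, ?_, ?_⟩
    · rw [act_add, LinearMap.add_apply, h1, h3, add_smul]
    · rw [map_add, act_add, LinearMap.add_apply, h2, h4, add_smul]

/-- `e^{∓λ/p} δ^{∓1} a` -/
def twist (s : ℤˣ) (a : AAlg p q) : AFAlg p q :=
  Sm.expLam (-((s : ℤ) : ℝ) / p) ⊗ₜ (AAlg.delta p q (-(s : ℤ)) * a)

theorem twist_smul (s : ℤˣ) (c : ℂ) (a : AAlg p q) : twist p q s (c • a) = c • twist p q s a := by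
  rw [twist, mul_smul_comm, TensorProduct.tmul_smul, twist]

theorem opP_twist (t s : ℤˣ) (a : AAlg p q) : opP p q t (twist p q s a) = 0 := by
  rw [twist, opP_tmul, Sm.dz_expLam, smul_zero, TensorProduct.zero_tmul]

theorem opH_twist (s : ℤˣ) {a : AAlg p q} {c : ℂ} (ha : AAlg.degA p q a = c • a) :
    opH p q σ (twist p q s a)
      = (-(sgn σ * Complex.I) * ((c - sgn s) * (1 / p))) • twist p q s a := by
  rw [twist, opH_tmul, Sm.boost_expLam, AAlg.degA_mul, ha, AAlg.degA_delta, zero_mul, add_zero,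
    mul_smul_comm, TensorProduct.tmul_smul, ← TensorProduct.smul_tmul', smul_smul, ← add_smul,
    smul_smul]
  congr 2
  have : sgn s = ((s : ℤ) : ℂ) := rfl
  rw [this]
  push_cast
  ring

theorem opK_twist (k : ℤ) (s : ℤˣ) (a : AAlg p q) :
    opK p q k (twist p q s a) = q ^ (-(k * s)) • twist p q s (AAlg.kapA p q k a) := by
  rw [twist, opK_tmul, map_mul, AAlg.kapA_delta, smul_mul_assoc, TensorProduct.tmul_smul, twist,
    mul_neg]

theorem opp_twist (t s : ℤˣ) (a : AAlg p q) : opp p q r t (twist p q s a)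
    = q ^ (s : ℤ) • twist p q s (AAlg.pA p q (eps r t) t a) := by
  rw [twist, opp_tmul, Sm.dz_expLam, TensorProduct.zero_tmul, smul_zero, add_zero, AAlg.pA_mul,
    AAlg.pA_delta, zero_mul, add_zero, AAlg.kapA_delta, smul_mul_assoc, TensorProduct.tmul_smul,
    neg_one_mul, neg_neg, twist]

theorem sEta_eq_twist (s : ℤˣ) : sEta p q s = -twist p q s (AAlg.eta p q s) := by
  rw [sEta_eq, ← (fnHom_commute p q _ _).eq, mul_assoc, ← map_mul, fnHom_mul_aqHom, twist]

theorem act_antipode_eta [hr : SqrtData p q r] (s : ℤˣ) (φ : UAlg p q σ) : ∃ a b e : ℂ,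
    act p q r σ (UAlg.antipode p q σ φ) (aqHom p q (AAlg.eta p q s))
      = a • aqHom p q (AAlg.eta p q s) + b • 1 ∧
    act p q r σ (UAlg.antipode p q σ φ) 1 = e • 1 ∧
    act p q r σ φ (twist p q s 1) = a • twist p q s 1 ∧
    act p q r σ φ (twist p q s (AAlg.eta p q s))
      = e • twist p q s (AAlg.eta p q s) - b • twist p q s 1 := by
  have hq := root_ne_zero p q
  induction φ using UAlg.induction with
  | hc c =>
    refine ⟨c, 0, c, ?_⟩
    rw [UAlg.antipode_algebraMap]
    simp [act_algebraMap]
  | hg g =>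
    cases g with
    | bigP t =>
      refine ⟨0, 0, 0, ?_⟩
      rw [← UAlg.P, UAlg.antipode_P, act_neg, LinearMap.neg_apply, LinearMap.neg_apply, act_P,
        opP_twist, opP_twist, opP_aq, ← map_one (aqHom p q), opP_aq]
      simp
    | ham =>
      refine ⟨sgn σ * Complex.I * (1 / p) * sgn s, 0, 0, ?_⟩
      rw [← UAlg.H, UAlg.antipode_H, act_neg, LinearMap.neg_apply, LinearMap.neg_apply, act_H,
        opH_twist p q σ s (c := 0) (by rw [AAlg.degA_one, zero_smul]),
        opH_twist p q σ s (AAlg.degA_eta p q s), opH_aq, AAlg.degA_eta, ← map_one (aqHom p q), opH_aq,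
        AAlg.degA_one, map_smul]
      refine ⟨by module, by simp, ?_, by simp⟩
      congr 1
      ring
    | smallP t =>
      rw [← UAlg.sp, UAlg.antipode_sp, act_neg, LinearMap.neg_apply, LinearMap.neg_apply, act_smul,
        LinearMap.smul_apply, LinearMap.smul_apply, act_sp, opp_twist, opp_twist, opp_aq,
        ← map_one (aqHom p q), opp_aq, AAlg.pA_one]
      rcases eq_or_ne t s with rfl | ht
      · refine ⟨0, -(q ^ (t : ℤ) * (eps r t * qNum q 1)), 0, ?_⟩
        rw [AAlg.pA_eta, twist_smul, map_smul, map_one, map_zero, twist, mul_zero,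
          TensorProduct.tmul_zero]
        refine ⟨by module, by simp, by simp, by module⟩
      · have hs : s = -t := by rw [Int.units_ne_iff_eq_neg.1 ht, neg_neg]
        refine ⟨0, 0, 0, ?_⟩
        rw [hs, AAlg.pA_eta_neg, map_zero, twist, mul_zero, TensorProduct.tmul_zero]
        simp
    | kap =>
      refine ⟨q ^ (-(s : ℤ)), 0, 1, ?_⟩
      rw [UAlg.antipode_kap, act_kap, act_kappa, act_kappa, AlgHom.toLinearMap_apply,
        AlgHom.toLinearMap_apply, opK_aq, AAlg.kapA_eta, opK_twist, opK_twist, map_one, map_one,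
        AAlg.kapA_eta, twist_smul, smul_smul, ← zpow_add₀ hq, map_smul, neg_one_mul, one_mul,
        neg_add_cancel, zpow_zero]
      simp
  | hmul φ ψ hφ hψ =>
    obtain ⟨a, b, e, h1, h2, h3, h4⟩ := hφ
    obtain ⟨a', b', e', h1', h2', h3', h4'⟩ := hψ
    refine ⟨a' * a, a' * b + b' * e, e' * e, ?_, ?_, ?_, ?_⟩
    · rw [UAlg.antipode_mul, act_mul, h1', map_add, map_smul, map_smul, h1, h2]
      module
    · rw [UAlg.antipode_mul, act_mul, h2', map_smul, h2, smul_smul]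
    · rw [act_mul, h3, map_smul, h3', smul_smul, mul_comm]
    · rw [act_mul, h4, map_sub, map_smul, map_smul, h3', h4']
      module
  | hadd φ ψ hφ hψ =>
    obtain ⟨a, b, e, h1, h2, h3, h4⟩ := hφ
    obtain ⟨a', b', e', h1', h2', h3', h4'⟩ := hψ
    refine ⟨a + a', b + b', e + e', ?_, ?_, ?_, ?_⟩
    · rw [map_add, act_add, LinearMap.add_apply, h1, h1']
      module
    · rw [map_add, act_add, LinearMap.add_apply, h2, h2', add_smul]
    · rw [act_add, LinearMap.add_apply, h3, h3', add_smul]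
    · rw [act_add, LinearMap.add_apply, h4, h4']
      module

theorem counit_twist (s : ℤˣ) (a : AAlg p q) :
    counit p q (twist p q s a) = counit p q (aqHom p q a) := by
  rw [twist, ← fnHom_mul_aqHom, map_mul, map_mul, map_mul, counit_fn, counit_delta, one_mul]
  have : (Sm.expLam (-((s : ℤ) : ℝ) / p)).1 (0 : E11) = 1 := by
    change ((Real.exp (-((s : ℤ) : ℝ) / p * (0 : E11).2) : ℝ) : ℂ) = 1
    simp
  rw [this, one_mul]

theorem opP_pow_fn (c : ℂ) (s : ℤˣ) (n : ℕ) (f : Sm E11) :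
    ((c • opP p q s) ^ n) (fnHom p q f) = fnHom p q ((c * Complex.I) ^ n • (Sm.dz s ^ n) f) := by
  induction n with
  | zero => simp
  | succ n ih =>
    rw [pow_succ', Module.End.mul_apply, ih, LinearMap.smul_apply, opP_fn, map_smul, smul_smul,
      pow_succ' (Sm.dz s), Module.End.mul_apply, pow_succ' (c * Complex.I), ← map_smul, smul_smul]

theorem opH_pow_fn (c : ℂ) (n : ℕ) (f : Sm E11) : ((c • opH p q σ) ^ n) (fnHom p q f)
    = fnHom p q ((c * -(sgn σ * Complex.I)) ^ n • (Sm.boost ^ n) f) := by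
  induction n with
  | zero => simp
  | succ n ih =>
    rw [pow_succ', Module.End.mul_apply, ih, LinearMap.smul_apply, opH_fn, map_smul, smul_smul,
      pow_succ' Sm.boost, Module.End.mul_apply, pow_succ' (c * -(sgn σ * Complex.I)), ← map_smul,
      smul_smul]

theorem fnHom_eq_sum (f : Sm E11) :
    fnHom p q f = ∑ k ∈ Finset.range p, f ⊗ₜ AAlg.monoZ p q 0 0 k := by
  simp only [monoZ_zero_zero]
  rw [← TensorProduct.tmul_sum, AAlg.sum_idem, fnHom_apply]

theorem counit_opp_pow_fn {n m : ℕ} (hn : n < p) (hm : m < p) (h : n ≠ 0 ∨ m ≠ 0) (f : Sm E11) :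
    counit p q ((opp p q r 1 ^ n) ((opp p q r (-1) ^ m) (fnHom p q f))) = 0 := by
  have h0 := root_pos p q
  rw [fnHom_eq_sum, map_sum, map_sum, map_sum]
  refine Finset.sum_eq_zero fun k _ => ?_
  obtain ⟨b, g, j, hj, hj0, h2⟩ := opp_neg_one_pow p q r f h0 hm 0 k
  obtain ⟨a, g', i, hi, hi0, h1⟩ := opp_one_pow p q r g h0 hn j ((k : ℤ) - m)
  rw [h2, map_smul, h1, map_smul, map_smul, counit_monoZ, smul_zero, smul_zero]
  rcases h with h | h
  · exact Or.inl (hi0 h)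
  · exact Or.inr (hj0 h)

theorem act_antipode_phi [hr : SqrtData p q r] (n m k t s l : ℕ) (f : Sm E11) :
    ∃ c : ℂ, ((n = 0 ∧ m = 0) → c = 1) ∧
    act p q r σ (UAlg.antipode p q σ (UAlg.phi p q σ n m k t s l)) (fnHom p q f)
      = c • (opp p q r 1 ^ n) ((opp p q r (-1) ^ m) (fnHom p q
        ((((-Complex.I) ^ t * (-Complex.I) ^ s) * (sgn σ * Complex.I) ^ l) •
          (Sm.dz 1 ^ t) ((Sm.dz (-1) ^ s) ((Sm.boost ^ l) f))))) := by
  refine ⟨(-q ^ ((1 : ℤˣ) : ℤ)) ^ n * (-q ^ ((-1 : ℤˣ) : ℤ)) ^ m, ?_, ?_⟩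
  · rintro ⟨rfl, rfl⟩
    simp
  have hP : ∀ u, act p q r σ (-UAlg.P p q σ u) = (-1 : ℂ) • opP p q u := fun u =>
    LinearMap.ext fun x => by
      rw [act_neg, act_P, LinearMap.neg_apply, LinearMap.smul_apply, neg_one_smul]
  have hH : act p q r σ (-UAlg.H p q σ) = (-1 : ℂ) • opH p q σ :=
    LinearMap.ext fun x => by
      rw [act_neg, act_H, LinearMap.neg_apply, LinearMap.smul_apply, neg_one_smul]
  have hs : ∀ u : ℤˣ, act p q r σ (-(q ^ (u : ℤ) • UAlg.sp p q σ u)) = (-q ^ (u : ℤ)) • opp p q r u :=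
    fun u => LinearMap.ext fun x => by
      rw [act_neg, act_smul, act_sp, LinearMap.neg_apply, LinearMap.smul_apply, LinearMap.smul_apply,
        neg_smul]
  have hs' : ∀ (u : ℤˣ) (n : ℕ) (x : AFAlg p q), (((-q ^ (u : ℤ)) • opp p q r u) ^ n) x
      = (-q ^ (u : ℤ)) ^ n • (opp p q r u ^ n) x := fun u n x => by
    rw [smul_pow, LinearMap.smul_apply]
  simp only [UAlg.phi, UAlg.antipode_mul, UAlg.antipode_pow, UAlg.antipode_P, UAlg.antipode_H,
    UAlg.antipode_sp, UAlg.antipode_kappa, act_mul, act_pow, act_kappa, hP, hH, hs, hs', opH_pow_fn,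
    opP_pow_fn, opK_fn, map_smul, smul_smul]
  congr 1
  rw [neg_one_mul, neg_one_mul, neg_neg]
  ring

theorem pairing_antipode_fn [hr : SqrtData p q r] (φ : UAlg p q σ) (f : Sm E11) :
    pairing p q r σ (UAlg.antipode p q σ φ) (fnHom p q f)
      = pairing p q r σ φ (antipode p q (fnHom p q f)) := by
  rw [antipode_fn]
  have hφ : φ ∈ Submodule.span ℂ (Set.range (UAlg.phiFam p q σ)) := by
    rw [UAlg.span_phiFam]; trivial
  induction hφ using Submodule.span_induction with
  | zero => simp only [map_zero, LinearMap.zero_apply]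
  | add x y _ _ hx hy => simp only [map_add, LinearMap.add_apply, hx, hy]
  | smul c x _ hx => simp only [map_smul, LinearMap.smul_apply, hx]
  | mem x hx =>
    obtain ⟨⟨n, m, k, t, s, l⟩, rfl⟩ := hx
    rw [UAlg.phiFam]
    obtain ⟨c, hc, h⟩ := act_antipode_phi p q r σ n m k t s l f
    rw [pairing_apply, pairing_apply, h, map_smul]
    by_cases hnm : (n : ℕ) = 0 ∧ (m : ℕ) = 0
    · rw [hc hnm, act_phi, hnm.1, hnm.2, pow_zero, pow_zero, one_smul]
      simp only [Module.End.one_apply, opK_fn]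
      have e1 := opP_pow_fn p q 1 1 t (Sm.invFun f)
      have e2 := opP_pow_fn p q 1 (-1) s
      have e3 := opH_pow_fn p q σ 1 l
      simp only [one_smul, one_mul] at e1 e2 e3
      rw [e1, e2, e3, counit_fn, counit_fn]
      simp only [map_smul, smul_smul, Sm.dz_pow_invFun, Sm.boost_pow_invFun]
      have key := Sm.eval_left_eq_right t s l f
      rw [← evHom_apply, ← evHom_apply, map_smul, map_smul]
      have h0 : evHom (0 : E11) (Sm.invFun ((Sm.dlam ^ l) ((Sm.ldz (-1) ^ s) ((Sm.ldz 1 ^ t) f))))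
          = evHom (0 : E11) ((Sm.dz 1 ^ t) ((Sm.dz (-1) ^ s) ((Sm.boost ^ l) f))) := by
        rw [evHom_apply, evHom_apply, ← key, Sm.invFun_apply, Sm.inv_zero']
      rw [h0]
      congr 1
      rw [neg_pow Complex.I, neg_pow Complex.I, neg_pow (sgn σ * Complex.I)]
      have h1 : ((-1 : ℂ) ^ l) * (-1) ^ l = 1 := by rw [← mul_pow]; simp
      linear_combination (-((-1) ^ t * Complex.I ^ t * ((-1) ^ s * Complex.I ^ s)
        * (sgn σ * Complex.I) ^ l)) * h1
    · have hnm' : (n : ℕ) ≠ 0 ∨ (m : ℕ) ≠ 0 := by tauto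
      rw [counit_opp_pow_fn p q r n.2 m.2 hnm', smul_zero, ← pairing_apply, fnHom_eq_sum, map_sum]
      refine (Finset.sum_eq_zero fun j _ => ?_).symm
      have := pairing_phi_mono p q r σ n m k 0 0 j t s l n.2 m.2 (root_pos p q) (root_pos p q)
        (Sm.invFun f)
      rw [AAlg.mono_eq] at this
      rw [this, if_neg fun h => hnm ⟨h.1, h.2.1⟩]

theorem pairing_antipode [hr : SqrtData p q r] (φ : UAlg p q σ) (x : AFAlg p q) :
    pairing p q r σ (UAlg.antipode p q σ φ) x = pairing p q r σ φ (antipode p q x) := by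
  induction x using AFAlg.induction generalizing φ with
  | hf f => exact pairing_antipode_fn p q r σ φ f
  | he s =>
    obtain ⟨a, b, e, h1, -, -, h4⟩ := act_antipode_eta p q r σ s φ
    rw [antipode_eta, sEta_eq_twist, pairing_apply, pairing_apply, h1, map_neg, h4, map_add, map_neg,
      map_sub, map_smul, map_smul, map_smul, map_smul, counit_twist, counit_twist, counit_eta,
      map_one, map_one]
    simp
  | hd =>
    obtain ⟨c, h1, h2⟩ := act_antipode_delta p q r σ φ
    rw [antipode_del, ← AAlg.delta_one, pairing_apply, pairing_apply, h1, h2, map_smul, map_smul,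
      counit_delta, counit_delta]
  | hmul x y hx hy => exact pairing_antipode_mul p q r σ hx hy φ
  | hadd x y hx hy => simp only [map_add, hx, hy]

end Antipode

/-! ### The pairing and the involutions -/

section Star

variable (p : ℕ) (q r : ℂ) (σ : ℤˣ) [hpq : RootData p q]

theorem star_tmul_eq (f : Sm E11) (a : AAlg p q) :
    star (f ⊗ₜ[ℂ] a : AFAlg p q) = star f ⊗ₜ star a := rfl

theorem degA_star (a : AAlg p q) : AAlg.degA p q (star a) = star (AAlg.degA p q a) := by
  induction a using AAlg.induction with
  | hc c =>
    rw [Algebra.algebraMap_eq_smul_one, star_smul, star_one, map_smul, map_smul, AAlg.degA_one,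
      smul_zero, smul_zero, star_zero]
  | hg g =>
    cases g with
    | eta s => rw [← AAlg.eta, AAlg.star_eta, AAlg.degA_eta, star_smul, AAlg.star_eta, Sm.star_sgn]
    | del => rw [AAlg.star_gen, AAlg.degA_del, star_zero]
  | hmul x y hx hy =>
    rw [star_mul, AAlg.degA_mul, hx, hy, AAlg.degA_mul, star_add, star_mul, star_mul, add_comm]
  | hadd x y hx hy => rw [star_add, map_add, hx, hy, map_add, star_add]

theorem star_zpow_root (p : ℕ) {q : ℂ} [hpq : RootData p q] (k : ℤ) : star (q ^ k) = q ^ (-k) := by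
  rw [star_zpow₀, root_star p q, inv_zpow']

theorem kapA_star (k : ℤ) (a : AAlg p q) :
    AAlg.kapA p q k (star a) = star (AAlg.kapA p q (-k) a) := by
  induction a using AAlg.induction with
  | hc c =>
    rw [Algebra.algebraMap_eq_smul_one, star_smul, star_one, map_smul, map_smul, map_one, map_one,
      star_smul, star_one]
  | hg g =>
    cases g with
    | eta s =>
      rw [← AAlg.eta, AAlg.star_eta, AAlg.kapA_eta, AAlg.kapA_eta, star_smul, AAlg.star_eta,
        star_zpow_root p, neg_mul, neg_neg]
    | del =>
      rw [AAlg.star_gen, AAlg.kapA_del, AAlg.kapA_del, star_smul, AAlg.star_gen,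
        star_zpow_root p, neg_neg]
  | hmul x y hx hy => rw [star_mul, map_mul, hx, hy, map_mul, star_mul]
  | hadd x y hx hy => rw [star_add, map_add, hx, hy, map_add, star_add]

theorem opK_star (k : ℤ) (x : AFAlg p q) : opK p q k (star x) = star (opK p q (-k) x) := by
  induction x using TensorProduct.induction_on with
  | zero => rw [star_zero, map_zero, map_zero, star_zero]
  | tmul f a => rw [star_tmul_eq, opK_tmul, opK_tmul, star_tmul_eq, kapA_star]
  | add x y hx hy => rw [star_add, map_add, hx, hy, map_add, star_add]

theorem opP_star (s : ℤˣ) (x : AFAlg p q) : opP p q s (star x) = star (-opP p q s x) := by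
  induction x using TensorProduct.induction_on with
  | zero => simp only [star_zero, map_zero, neg_zero]
  | tmul f a =>
    rw [star_tmul_eq, opP_tmul, opP_tmul, Sm.dz_star, star_neg, star_tmul_eq, star_smul,
      ← TensorProduct.neg_tmul, ← neg_smul]
    simp
  | add x y hx hy => rw [star_add, map_add, hx, hy, map_add, neg_add, star_add]

theorem opH_star (x : AFAlg p q) : opH p q σ (star x) = star (-opH p q σ x) := by
  induction x using TensorProduct.induction_on with
  | zero => simp only [star_zero, map_zero, neg_zero]
  | tmul f a =>
    rw [star_tmul_eq, opH_tmul, opH_tmul, Sm.boost_star, degA_star, star_neg, star_smul, star_add,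
      star_smul, star_tmul_eq, star_tmul_eq, ← neg_smul, star_neg, star_mul, Sm.star_sgn]
    congr 1
    · simp [mul_comm]
    · simp
  | add x y hx hy => rw [star_add, map_add, hx, hy, map_add, neg_add, star_add]

theorem star_sqrt (p : ℕ) (q r : ℂ) [hpq : RootData p q] [hr : SqrtData p q r] : star r = r⁻¹ := by
  have h0 := root_pos p q
  have h1 : ‖r‖ = 1 := by
    have h : ‖r‖ ^ p = 1 := by rw [← norm_pow, hr.pow (q := q)]; simp
    exact (pow_eq_one_iff_of_nonneg (norm_nonneg r) h0.ne').1 h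
  rw [Complex.inv_def, Complex.normSq_eq_norm_sq, h1]
  simp

theorem star_eps (p : ℕ) (q r : ℂ) [hpq : RootData p q] [hr : SqrtData p q r] (s : ℤˣ) : star (eps r s) = -(q ^ (s : ℤ))⁻¹ * eps r s := by
  have hr0 : r ≠ 0 := by
    rintro rfl
    exact root_ne_zero p q (by rw [← hr.sq]; simp)
  have hs : (r ^ (s : ℤ)) ≠ 0 := zpow_ne_zero _ hr0
  rw [eps, star_mul, star_zpow₀, star_sqrt p q r, ← hr.sq, ← zpow_natCast r 2, zpow_comm,
    zpow_natCast, inv_zpow]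
  simp
  field_simp

variable [hr : SqrtData p q r]

theorem star_wrap (s : ℤˣ) : star (wrap p q r s) = -(q ^ (s : ℤ))⁻¹ * wrap p q r s := by
  rw [wrap, star_div₀, star_mul, star_eps p q r, star_qFact p q, star_pow, star_neg, star_one]
  ring

theorem opp_star (s : ℤˣ) (x : AFAlg p q) :
    opp p q r s (star x) = star (-((q ^ (s : ℤ))⁻¹ • opp p q r s x)) := by
  have hq : q ^ (s : ℤ) ≠ 0 := zpow_ne_zero _ (root_ne_zero p q)
  have hsq : star (q ^ (s : ℤ))⁻¹ = q ^ (s : ℤ) := by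
    rw [star_inv₀, star_zpow_root p, zpow_neg, inv_inv]
  induction x using AFAlg.induction with
  | hf f =>
    rw [star_fn, opp_fn, opp_fn, Sm.dz_star, star_neg, star_smul, star_smul, star_mul, star_pow,
      star_aq, AAlg.star_eta, star_fn, star_wrap, hsq, smul_smul, ← (fnHom_commute p q _ _).eq,
      ← neg_smul]
    congr 1
    field_simp
  | he t =>
    rw [star_aq, AAlg.star_eta, opp_aq]
    rcases eq_or_ne t s with rfl | ht
    · rw [AAlg.pA_eta, map_smul, map_one, star_neg, star_smul, star_smul, star_one, hsq, star_mul,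
        star_qNum p q, star_eps p q r, smul_smul, ← neg_smul]
      congr 1
      field_simp
    · rw [Int.units_ne_iff_eq_neg.1 ht, AAlg.pA_eta_neg, map_zero, smul_zero, neg_zero, star_zero]
  | hd => rw [star_aq, AAlg.star_gen, opp_aq, AAlg.pA_del, map_zero, smul_zero, neg_zero, star_zero]
  | hmul x y hx hy =>
    rw [star_mul, opp_mul, hx, hy, opK_star, opK_star, opp_mul, neg_neg, smul_add, neg_add, star_add]
    simp only [← star_mul]
    simp only [mul_neg, neg_mul, mul_smul_comm, smul_mul_assoc]
    rw [add_comm]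
  | hadd x y hx hy => rw [star_add, map_add, hx, hy, map_add, smul_add, neg_add, star_add]

theorem act_star (φ : UAlg p q σ) (x : AFAlg p q) :
    act p q r σ φ (star x) = star (act p q r σ (star (UAlg.antipode p q σ φ)) x) := by
  induction φ using UAlg.induction generalizing x with
  | hc c =>
    rw [UAlg.antipode_algebraMap, act_algebraMap, Algebra.algebraMap_eq_smul_one, star_smul, star_one,
      act_smul, act_one, LinearMap.smul_apply, star_smul, star_star, Module.End.one_apply]
  | hg g =>
    cases g with
    | bigP s =>
      rw [← UAlg.P, UAlg.antipode_P, star_neg, UAlg.P, UAlg.star_gen, ← UAlg.P, act_neg, act_P,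
        opP_star, LinearMap.neg_apply]
    | ham =>
      rw [← UAlg.H, UAlg.antipode_H, star_neg, UAlg.H, UAlg.star_gen, ← UAlg.H, act_neg, act_H,
        opH_star, LinearMap.neg_apply]
    | smallP s =>
      rw [← UAlg.sp, UAlg.antipode_sp, star_neg, star_smul, UAlg.sp, UAlg.star_gen, ← UAlg.sp,
        act_neg, act_smul, act_sp, opp_star, LinearMap.neg_apply, LinearMap.smul_apply,
        star_zpow_root p, zpow_neg]
    | kap =>
      rw [UAlg.antipode_kap, UAlg.star_kappa, act_kap, AlgHom.toLinearMap_apply, act_kappa, opK_star]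
  | hmul φ ψ hφ hψ => rw [act_mul, hφ, hψ, UAlg.antipode_mul, star_mul, act_mul]
  | hadd φ ψ hφ hψ =>
    rw [act_add, LinearMap.add_apply, hφ, hψ, map_add, star_add, act_add, LinearMap.add_apply,
      star_add]

theorem pairing_star (φ : UAlg p q σ) (x : AFAlg p q) :
    pairing p q r σ (star φ) x = star (pairing p q r σ φ (star (antipode p q x))) := by
  rw [pairing_apply p q r σ φ, act_star, counit_star, star_star, ← pairing_apply, ← pairing_antipode,
    UAlg.antipode_star_antipode]

end Star

end AFAlg

theorem dualConst_ne_zero (p : ℕ) (q r : ℂ) (σ : ℤˣ) [hpq : RootData p q] [hr : SqrtData p q r]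
    {n m : ℕ} (hn : n < p) (hm : m < p) (t s l : ℕ) : dualConst q r σ n m t s l ≠ 0 := by
  have hq := root_ne_zero p q
  have hr0 : r ≠ 0 := by
    rintro rfl
    exact hq (by rw [← hr.sq]; simp)
  have hσ : sgn σ ≠ 0 := by
    rcases Int.units_eq_one_or σ with rfl | rfl <;> simp [sgn]
  have h1 := qFact_ne_zero p q hn
  have h2 := qFact_ne_zero p q hm
  unfold dualConst
  refine mul_ne_zero (mul_ne_zero (mul_ne_zero ?_ ?_) (mul_ne_zero ?_ ?_)) (mul_ne_zero h1 h2)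
  · exact pow_ne_zero _ Complex.I_ne_zero
  · exact pow_ne_zero _ (neg_ne_zero.2 hσ)
  · exact zpow_ne_zero _ hr0
  · exact zpow_ne_zero _ hq

theorem dualConst_eq (q r : ℂ) (σ : ℤˣ) (n m t s l : ℕ) : dualConst q r σ n m t s l
    = Complex.I ^ (t + s + l) * (-sgn σ) ^ l * dualConst q r σ n m 0 0 0 := by
  unfold dualConst
  rw [show n + m + t + s + l = n + m + (t + s + l) by ring, pow_add]
  simp
  ring

/-- A family that is diagonal with respect to a family of functionals is linearly independent. -/
theorem linearIndependent_of_dual {ι V : Type*} [AddCommGroup V] [Module ℂ V] {v : ι → V}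
    (f : ι → V →ₗ[ℂ] ℂ) (h0 : ∀ i, f i (v i) ≠ 0) (h : ∀ i j, i ≠ j → f i (v j) = 0) :
    LinearIndependent ℂ v := by
  classical
  rw [linearIndependent_iff']
  intro s g hg i hi
  have h1 := congrArg (f i) hg
  rw [map_sum, map_zero, Finset.sum_eq_single i] at h1
  · rw [map_smul, smul_eq_mul] at h1
    exact (mul_eq_zero.1 h1).resolve_right (h0 i)
  · intro j _ hj
    rw [map_smul, h i j hj.symm, smul_zero]
  · exact fun h => absurd hi h

/-- A vector in the span of a family is zero when it is killed by functionals that are diagonal with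
respect to that family. -/
theorem eq_zero_of_dual {ι V : Type*} [AddCommGroup V] [Module ℂ V] {v : ι → V}
    (f : ι → V →ₗ[ℂ] ℂ) (h0 : ∀ i, f i (v i) ≠ 0) (h : ∀ i j, i ≠ j → f i (v j) = 0)
    (hs : Submodule.span ℂ (Set.range v) = ⊤) {x : V} (hx : ∀ i, f i x = 0) : x = 0 := by
  classical
  have hx' : x ∈ Submodule.span ℂ (Set.range v) := by rw [hs]; trivial
  obtain ⟨c, rfl⟩ := Finsupp.mem_span_range_iff_exists_finsupp.1 hx'
  refine Finset.sum_eq_zero fun i hi => ?_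
  have h1 := hx i
  rw [Finsupp.sum, map_sum, Finset.sum_eq_single i] at h1
  · rw [map_smul, smul_eq_mul] at h1
    have h2 := (mul_eq_zero.1 h1).resolve_right (h0 i)
    simp only [h2, zero_smul]
  · intro j _ hj
    rw [map_smul, h i j hj.symm, smul_zero]
  · exact fun h => absurd hi h

namespace AFAlg

section Bases

variable (p : ℕ) (q r : ℂ) (σ : ℤˣ)

/-- The index of the element of `A_F` dual to `φ^{nmktsl}`. -/
def shift {p : ℕ} (n m k : Fin p) : Fin p :=
  ⟨(k + n + m) % p, Nat.mod_lt _ (Nat.pos_of_ne_zero fun h => by subst h; exact k.elim0)⟩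

theorem shift_spec {p : ℕ} {n m k k' : Fin p} :
    (k' + n + m : ℕ) ≡ shift n m k [MOD p] ↔ k' = k := by
  rw [shift]
  constructor
  · intro h
    have h1 : (k' + n + m : ℕ) ≡ k + n + m [MOD p] := h.trans (Nat.mod_modEq _ _)
    have h2 : (k' : ℕ) ≡ k [MOD p] := Nat.ModEq.add_right_cancel' n (Nat.ModEq.add_right_cancel' m h1)
    exact Fin.ext (Nat.ModEq.eq_of_lt_of_lt h2 k'.2 k.2)
  · rintro rfl
    exact (Nat.mod_modEq _ _).symm

variable [hpq : RootData p q]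

/-- The Taylor coefficient `(∂_+^t ∂_-^s ∂_λ^l F)(e)`. -/
def taylor (t s l : ℕ) : AFAlg p q →ₗ[ℂ] AAlg p q :=
  (TensorProduct.lid ℂ (AAlg p q)).toLinearMap ∘ₗ (Sm.jet t s l).rTensor (AAlg p q)

theorem taylor_tmul (t s l : ℕ) (f : Sm E11) (b : AAlg p q) :
    taylor p q t s l (f ⊗ₜ b) = Sm.jet t s l f • b := rfl

theorem taylor_a (t s l : ℕ) (n m k t' s' l' : ℕ) : taylor p q t s l (a p q n m k t' s' l')
    = if t = t' ∧ s = s' ∧ l = l'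
      then ((l.factorial : ℂ) * t.factorial * s.factorial) • AAlg.mono p q n m k else 0 := by
  rw [a_eq, taylor_tmul, Sm.jet_monomial, ite_smul, zero_smul]

/-- The family `η_+^n η_-^m ζ(k, δ)`. -/
def monoFam (i : Fin p × Fin p × Fin p) : AAlg p q := AAlg.mono p q i.1 i.2.1 i.2.2

theorem span_monoFam : Submodule.span ℂ (Set.range (monoFam p q)) = ⊤ := by
  rw [← AAlg.span_monoZ p q]
  congr 2
  funext i
  exact AAlg.mono_eq p q i.1 i.2.1 i.2.2

variable [hr : SqrtData p q r]

/-- The functional on `A(E_q(1,1))` given by `p_+^n p_-^m κ^k`. -/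
def monoDual (i : Fin p × Fin p × Fin p) : AAlg p q →ₗ[ℂ] ℂ :=
  pairing p q r σ (UAlg.phi p q σ i.1 i.2.1 i.2.2 0 0 0) ∘ₗ (aqHom p q).toLinearMap

theorem monoDual_mono (n m k n' m' k' : Fin p) :
    monoDual p q r σ (n, m, k) (AAlg.mono p q n' m' k')
      = if n = n' ∧ m = m' ∧ (k + n + m : ℕ) ≡ k' [MOD p] then dualConst q r σ n m 0 0 0 else 0 := by
  have h := pairing_phi_mono p q r σ n m k n' m' k' 0 0 0 n.2 m.2 n'.2 m'.2 1
  have hj : Sm.jet 0 0 0 1 = 1 := by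
    rw [Sm.jet_eq]; rfl
  rw [hj, mul_one] at h
  simp only [Fin.val_inj] at h
  exact h

theorem pairing_phi_eq (n m k : Fin p) (t s l : ℕ) (x : AFAlg p q) :
    pairing p q r σ (UAlg.phi p q σ n m k t s l) x
      = (Complex.I ^ (t + s + l) * (-sgn σ) ^ l)
        * monoDual p q r σ (n, m, k) (taylor p q t s l x) := by
  induction x using TensorProduct.induction_on with
  | zero => simp only [map_zero, mul_zero]
  | add x y hx hy => rw [map_add, map_add, map_add, hx, hy, mul_add]
  | tmul f b =>
    have hb : b ∈ Submodule.span ℂ (Set.range (monoFam p q)) := by rw [span_monoFam]; trivial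
    induction hb using Submodule.span_induction with
    | zero => simp only [TensorProduct.tmul_zero, map_zero, mul_zero]
    | add x y _ _ hx hy => simp only [TensorProduct.tmul_add, map_add, mul_add, hx, hy]
    | smul c x _ hx =>
      simp only [TensorProduct.tmul_smul, map_smul, hx, smul_eq_mul]
      ring
    | mem x hx =>
      obtain ⟨⟨n', m', k'⟩, rfl⟩ := hx
      rw [monoFam, pairing_phi_mono p q r σ n m k n' m' k' t s l n.2 m.2 n'.2 m'.2, taylor_tmul,
        map_smul, monoDual_mono]
      simp only [Fin.val_inj]
      split_ifs
      · rw [dualConst_eq, smul_eq_mul]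
        ring
      · rw [smul_zero, mul_zero]

/-- The index of the functional dual to `η_+^n η_-^m ζ(k, δ)`. -/
def unshift {p : ℕ} (n m k : Fin p) : Fin p :=
  ⟨(k + (p - n) + (p - m)) % p,
    Nat.mod_lt _ (Nat.pos_of_ne_zero fun h => by subst h; exact k.elim0)⟩

theorem unshift_spec {p : ℕ} {n m k k' : Fin p} :
    (unshift n m k + n + m : ℕ) ≡ k' [MOD p] ↔ k = k' := by
  have h : (unshift n m k + n + m : ℕ) ≡ k [MOD p] := by
    have h1 : (unshift n m k : ℕ) ≡ k + (p - n) + (p - m) [MOD p] := Nat.mod_modEq _ _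
    have h2 := (h1.add_right n).add_right m
    have hn := n.2
    have hm := m.2
    rw [show (k : ℕ) + (p - n) + (p - m) + n + m = k + p + p by omega] at h2
    refine h2.trans ?_
    simp [Nat.ModEq]
  constructor
  · intro h'
    exact Fin.ext (Nat.ModEq.eq_of_lt_of_lt (h.symm.trans h') k.2 k'.2)
  · rintro rfl
    exact h

/-- The functionals dual, up to non-zero factors, to the family `η_+^n η_-^m ζ(k, δ)`. -/
def monoCoord (i : Fin p × Fin p × Fin p) : AAlg p q →ₗ[ℂ] ℂ :=
  monoDual p q r σ (i.1, i.2.1, unshift i.1 i.2.1 i.2.2)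

theorem monoCoord_apply (i j : Fin p × Fin p × Fin p) : monoCoord p q r σ i (monoFam p q j)
    = if i = j then dualConst q r σ i.1 i.2.1 0 0 0 else 0 := by
  obtain ⟨n, m, k⟩ := i
  obtain ⟨n', m', k'⟩ := j
  rw [monoCoord, monoFam, monoDual_mono]
  simp only [unshift_spec, Prod.mk.injEq]

theorem monoCoord_self (i : Fin p × Fin p × Fin p) : monoCoord p q r σ i (monoFam p q i) ≠ 0 := by
  rw [monoCoord_apply, if_pos rfl]
  exact dualConst_ne_zero p q r σ i.1.2 i.2.1.2 0 0 0

theorem monoCoord_ne (i j : Fin p × Fin p × Fin p) (h : i ≠ j) :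
    monoCoord p q r σ i (monoFam p q j) = 0 := by
  rw [monoCoord_apply, if_neg h]

/-- The functionals on `U_F` dual, up to non-zero factors, to the family `φ^{nmktsl}`. -/
def phiCoord (i : Idx p) : UAlg p q σ →ₗ[ℂ] ℂ := (pairing p q r σ).flip
  (a p q i.1 i.2.1 (shift i.1 i.2.1 i.2.2.1) i.2.2.2.1 i.2.2.2.2.1 i.2.2.2.2.2)

theorem phiCoord_self (i : Idx p) : phiCoord p q r σ i (UAlg.phiFam p q σ i) ≠ 0 := by
  obtain ⟨n, m, k, t, s, l⟩ := i
  rw [phiCoord, LinearMap.flip_apply, UAlg.phiFam, pairing_phi_a,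
    if_pos ⟨rfl, rfl, rfl, rfl, rfl, shift_spec.2 rfl⟩]
  refine mul_ne_zero (dualConst_ne_zero p q r σ n.2 m.2 t s l) ?_
  exact_mod_cast mul_ne_zero (mul_ne_zero l.factorial_ne_zero t.factorial_ne_zero)
    s.factorial_ne_zero

theorem phiCoord_ne (i j : Idx p) (h : i ≠ j) : phiCoord p q r σ i (UAlg.phiFam p q σ j) = 0 := by
  obtain ⟨n, m, k, t, s, l⟩ := i
  obtain ⟨n', m', k', t', s', l'⟩ := j
  rw [phiCoord, LinearMap.flip_apply, UAlg.phiFam, pairing_phi_a, if_neg]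
  rintro ⟨h1, h2, h3, h4, h5, h6⟩
  simp only at h1 h2 h3 h4 h5 h6
  subst h1 h2 h3 h4 h5
  rw [shift_spec] at h6
  exact h (by rw [h6])

theorem linearIndependent_phiFam (p : ℕ) (q r : ℂ) (σ : ℤˣ) [hpq : RootData p q]
    [hr : SqrtData p q r] : LinearIndependent ℂ (UAlg.phiFam p q σ) :=
  linearIndependent_of_dual (phiCoord p q r σ) (phiCoord_self p q r σ) (phiCoord_ne p q r σ)

theorem pairing_nondeg_left (φ : UAlg p q σ) (h : ∀ x, pairing p q r σ φ x = 0) : φ = 0 :=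
  eq_zero_of_dual (phiCoord p q r σ) (phiCoord_self p q r σ) (phiCoord_ne p q r σ)
    (UAlg.span_phiFam p q σ) fun _ => h _

theorem pairing_nondeg_right (x : AFAlg p q) :
    (∀ φ, pairing p q r σ φ x = 0) ↔ ∀ t s l, taylor p q t s l x = 0 := by
  constructor
  · intro h t s l
    refine eq_zero_of_dual (monoCoord p q r σ) (monoCoord_self p q r σ) (monoCoord_ne p q r σ)
      (span_monoFam p q) fun i => ?_
    have h1 := pairing_phi_eq p q r σ i.1 i.2.1 (unshift i.1 i.2.1 i.2.2) t s l x
    rw [h] at h1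
    have hσ : sgn σ ≠ 0 := by
      rcases Int.units_eq_one_or σ with rfl | rfl <;> simp [sgn]
    exact (mul_eq_zero.1 h1.symm).resolve_left
      (mul_ne_zero (pow_ne_zero _ Complex.I_ne_zero) (pow_ne_zero _ (neg_ne_zero.2 hσ)))
  · intro h φ
    have hφ : φ ∈ Submodule.span ℂ (Set.range (UAlg.phiFam p q σ)) := by
      rw [UAlg.span_phiFam]; trivial
    induction hφ using Submodule.span_induction with
    | zero => rw [map_zero, LinearMap.zero_apply]
    | add y z _ _ hy hz => rw [map_add, LinearMap.add_apply, hy, hz, add_zero]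
    | smul c y _ hy => rw [map_smul, LinearMap.smul_apply, hy, smul_zero]
    | mem y hy =>
      obtain ⟨⟨n, m, k, t, s, l⟩, rfl⟩ := hy
      rw [UAlg.phiFam, pairing_phi_eq, h, map_zero, mul_zero]

/-- The basis `η_+^n η_-^m ζ(k, δ)` of `A(E_q(1,1))`. -/
def monoBasis : Module.Basis (Fin p × Fin p × Fin p) ℂ (AAlg p q) :=
  Module.Basis.mk (linearIndependent_of_dual (monoCoord p q r 1) (monoCoord_self p q r 1)
    (monoCoord_ne p q r 1)) (span_monoFam p q).ge

theorem monoBasis_apply (i : Fin p × Fin p × Fin p) : monoBasis p q r i = monoFam p q i := by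
  rw [monoBasis, Module.Basis.mk_apply]

theorem taylor_sum_a (c : Idx p → ℂ) {N t s l : ℕ} (ht : t ≤ N) (hs : s ≤ N) (hl : l ≤ N) :
    taylor p q t s l (∑ n : Fin p, ∑ m : Fin p, ∑ k : Fin p,
      ∑ t' ∈ Finset.range (N + 1), ∑ s' ∈ Finset.range (N + 1), ∑ l' ∈ Finset.range (N + 1),
        c (n, m, k, t', s', l') • a p q n m k t' s' l')
      = ∑ i : Fin p × Fin p × Fin p, (c (i.1, i.2.1, i.2.2, t, s, l)
        * ((l.factorial : ℂ) * t.factorial * s.factorial)) • monoBasis p q r i := by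
  rw [Fintype.sum_prod_type, map_sum]
  refine Finset.sum_congr rfl fun n _ => ?_
  rw [Fintype.sum_prod_type, map_sum]
  refine Finset.sum_congr rfl fun m _ => ?_
  rw [map_sum]
  refine Finset.sum_congr rfl fun k _ => ?_
  simp only [map_sum, map_smul, taylor_a, monoBasis_apply]
  rw [Finset.sum_eq_single t, Finset.sum_eq_single s, Finset.sum_eq_single l]
  · rw [if_pos ⟨rfl, rfl, rfl⟩, smul_smul, monoFam]
  · intro l' _ h
    rw [if_neg fun h' => h h'.2.2.symm, smul_zero]
  · exact fun h => absurd (Finset.mem_range.2 (by omega)) h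
  · intro s' _ h
    refine Finset.sum_eq_zero fun l' _ => ?_
    rw [if_neg fun h' => h h'.2.1.symm, smul_zero]
  · exact fun h => absurd (Finset.mem_range.2 (by omega)) h
  · intro t' _ h
    refine Finset.sum_eq_zero fun s' _ => Finset.sum_eq_zero fun l' _ => ?_
    rw [if_neg fun h' => h h'.1.symm, smul_zero]
  · exact fun h => absurd (Finset.mem_range.2 (by omega)) h

theorem existsUnique_expansion (r : ℂ) [hr : SqrtData p q r] (F : AFAlg p q) :
    ∃! c : Idx p → ℂ, ∀ N t s l : ℕ, t ≤ N → s ≤ N → l ≤ N →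
      taylor p q t s l (F - ∑ n : Fin p, ∑ m : Fin p, ∑ k : Fin p,
        ∑ t' ∈ Finset.range (N + 1), ∑ s' ∈ Finset.range (N + 1), ∑ l' ∈ Finset.range (N + 1),
          c (n, m, k, t', s', l') • a p q n m k t' s' l') = 0 := by
  have hfac : ∀ t s l : ℕ, ((l.factorial : ℂ) * t.factorial * s.factorial) ≠ 0 := fun t s l => by
    exact_mod_cast mul_ne_zero (mul_ne_zero l.factorial_ne_zero t.factorial_ne_zero)
      s.factorial_ne_zero
  obtain ⟨c₀, hc₀⟩ : ∃ c₀ : Idx p → ℂ, ∀ (i : Fin p × Fin p × Fin p) (t s l : ℕ),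
      c₀ (i.1, i.2.1, i.2.2, t, s, l) * ((l.factorial : ℂ) * t.factorial * s.factorial)
        = (monoBasis p q r).repr (taylor p q t s l F) i :=
    ⟨fun i => (monoBasis p q r).repr (taylor p q i.2.2.2.1 i.2.2.2.2.1 i.2.2.2.2.2 F)
      (i.1, i.2.1, i.2.2.1) / ((i.2.2.2.2.2.factorial : ℂ) * i.2.2.2.1.factorial
        * i.2.2.2.2.1.factorial), fun i t s l => div_mul_cancel₀ _ (hfac t s l)⟩
  refine ⟨c₀, ?_, ?_⟩
  · intro N t s l ht hs hl
    rw [map_sub, taylor_sum_a p q r c₀ ht hs hl, sub_eq_zero]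
    simp only [hc₀]
    exact ((monoBasis p q r).sum_repr _).symm
  · intro c hc
    funext ⟨n, m, k, t, s, l⟩
    have h := hc (max t (max s l)) t s l (by omega) (by omega) (by omega)
    rw [map_sub, taylor_sum_a p q r c (by omega) (by omega) (by omega), sub_eq_zero] at h
    have h0 := hc₀ (n, m, k) t s l
    rw [h, Module.Basis.repr_sum_self] at h0
    exact (mul_right_cancel₀ (hfac t s l) h0).symm

end Bases

end AFAlg

/-! ### The structures on `U_F` and `A_F` -/

section Transfer

variable (p : ℕ) (q r : ℂ) (σ : ℤˣ) [hpq : RootData p q]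

@[reducible]
def ufStarRing : StarRing (UF p q σ) := inferInstanceAs (StarRing (UAlg p q σ))

theorem ufStarModule : @StarModule ℂ (UF p q σ) _ (ufStarRing p q σ).toStar _ :=
  inferInstanceAs (StarModule ℂ (UAlg p q σ))

@[reducible]
def ufCoalgebra : Coalgebra ℂ (UF p q σ) := inferInstanceAs (Coalgebra ℂ (UAlg p q σ))

def ufAntipode : UF p q σ →ₗ[ℂ] UF p q σ := UAlg.antipode p q σ

@[reducible]
def aqStarRing : StarRing (Aq p q) := inferInstanceAs (StarRing (AAlg p q))

theorem aqStarModule : @StarModule ℂ (Aq p q) _ (aqStarRing p q).toStar _ :=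
  inferInstanceAs (StarModule ℂ (AAlg p q))

def afComul : AF p q →ₐ[ℂ] AF2 p q := AFAlg.comul p q

def afCounit : AF p q →ₐ[ℂ] ℂ := AFAlg.counit p q

def afAntipode : AF p q →ₗ[ℂ] AF p q := AFAlg.antipode p q

def dualPairing [hr : SqrtData p q r] : UF p q σ →ₗ[ℂ] AF p q →ₗ[ℂ] ℂ := AFAlg.pairing p q r σ

theorem ufFormulas :
    @UFFormulas p q σ (ufStarRing p q σ) (ufCoalgebra p q σ) (ufAntipode p q σ) := by
  refine @UFFormulas.mk p q σ (ufStarRing p q σ) (ufCoalgebra p q σ) (ufAntipode p q σ)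
    ?star_P ?star_H ?star_sp ?star_kappa ?comul_P ?comul_H ?comul_sp ?comul_kappa ?counit_P ?counit_H
    ?counit_sp ?counit_kappa ?antipode_P ?antipode_H ?antipode_sp ?antipode_kappa
  case star_P => exact fun s => UAlg.star_gen p q σ (.bigP s)
  case star_H => exact UAlg.star_gen p q σ .ham
  case star_sp => exact fun s => UAlg.star_gen p q σ (.smallP s)
  case star_kappa => exact UAlg.star_kappa p q σ 1
  case comul_P => exact fun s => UAlg.comulHom_P p q σ s
  case comul_H => exact UAlg.comulHom_H p q σ
  case comul_sp => exact fun s => UAlg.comulHom_sp p q σ s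
  case comul_kappa => exact UAlg.comulHom_kappa p q σ 1
  case counit_P => exact fun s => UAlg.counitHom_P p q σ s
  case counit_H => exact UAlg.counitHom_H p q σ
  case counit_sp => exact fun s => UAlg.counitHom_sp p q σ s
  case counit_kappa => exact fun s => UAlg.counitHom_kappa p q σ s
  case antipode_P => exact fun s => UAlg.antipode_P p q σ s
  case antipode_H => exact UAlg.antipode_H p q σ
  case antipode_sp => exact fun s => UAlg.antipode_sp p q σ s
  case antipode_kappa => exact fun s => UAlg.antipode_kappa p q σ s

theorem uf_isHopfStar : @IsHopfStar (UF p q σ) _ _ (ufStarRing p q σ) (ufStarModule p q σ)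
    (ufCoalgebra p q σ) (ufAntipode p q σ) := UAlg.isHopfStar p q σ

theorem afFormulas : @AFFormulas p q (aqStarRing p q) (aqStarModule p q) (afComul p q)
    (afCounit p q) (afAntipode p q) := by
  refine @AFFormulas.mk p q (aqStarRing p q) (aqStarModule p q) (afComul p q) (afCounit p q)
    (afAntipode p q) ?star_eta ?star_delta ?star_z ?star_lam ?comul_eta ?comul_delta ?comul_lam
    ?comul_z ?comul_fn ?counit_eta ?counit_delta ?counit_lam ?counit_z ?counit_fn ?antipode_eta
    ?antipode_delta ?antipode_lam ?antipode_z ?antipode_fn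
  case star_eta => exact fun s => (AFAlg.star_aq p q _).trans (congrArg _ (AAlg.star_eta p q s))
  case star_delta => exact (AFAlg.star_aq p q _).trans (congrArg _ (AAlg.star_delta p q 1))
  case star_z => exact fun s => (AFAlg.star_fn p q _).trans (congrArg _ (Sm.star_z s))
  case star_lam => exact (AFAlg.star_fn p q _).trans (congrArg _ Sm.star_lam)
  case comul_eta =>
    intro s
    have := AFAlg.comul_eta p q s
    rw [AFAlg.cX_eq, AFAlg.cY_eq, ← map_add] at this
    exact this
  case comul_delta =>
    have := AFAlg.comul_del p q
    rw [AFAlg.cD_eq, ← AAlg.delta_one] at this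
    exact this
  case comul_lam => exact AFAlg.comul_lam p q
  case comul_z =>
    intro s
    have := AFAlg.comul_z p q s
    rw [AFAlg.cN_eq] at this
    exact this
  case comul_fn =>
    intro f
    have := AFAlg.comul_fn_eq_sum p q f
    rw [AFAlg.cN_eq, AFAlg.cN_eq] at this
    exact this
  case counit_eta => exact AFAlg.counit_eta p q
  case counit_delta => exact fun s => AFAlg.counit_delta p q s
  case counit_lam => exact AFAlg.counit_fn p q Sm.lam
  case counit_z => exact fun s => AFAlg.counit_fn p q (Sm.z s)
  case counit_fn => exact AFAlg.counit_fn p q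
  case antipode_eta => exact fun s => (AFAlg.antipode_eta p q s).trans (AFAlg.sEta_eq p q s)
  case antipode_delta => exact fun s => AFAlg.antipode_delta p q s
  case antipode_lam => exact AFAlg.antipode_lam p q
  case antipode_z => exact AFAlg.antipode_z p q
  case antipode_fn => exact AFAlg.antipode_fn p q

theorem af_isCompletedHopfStar : @IsCompletedHopfStar p q (aqStarRing p q) (aqStarModule p q)
    (afComul p q) (afCounit p q) (afAntipode p q) := by
  refine @IsCompletedHopfStar.mk p q (aqStarRing p q) (aqStarModule p q) (afComul p q)
    (afCounit p q) (afAntipode p q) ?coassoc ?counit_left ?counit_right ?antipode_left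
    ?antipode_right ?antipode_one ?antipode_mul ?comul_star ?counit_star
  case coassoc => exact AFAlg.coassoc p q
  case counit_left => exact AFAlg.counit_left p q
  case counit_right => exact AFAlg.counit_right p q
  case antipode_left =>
    intro x g
    have := AFAlg.antipode_left p q x g
    rw [← AFAlg.sliceL_eq] at this
    exact this
  case antipode_right =>
    intro x g
    have := AFAlg.antipode_right p q x g
    rw [← AFAlg.sliceR_eq] at this
    exact this
  case antipode_one => exact AFAlg.antipode_one p q
  case antipode_mul => exact AFAlg.antipode_mul p q
  case comul_star => exact AFAlg.comul_star p q
  case counit_star => exact AFAlg.counit_star p q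

theorem af_isLocalBasis [hr : SqrtData p q r] : IsLocalBasis p q := fun F =>
  AFAlg.existsUnique_expansion p q r F

variable [hr : SqrtData p q r]

theorem dualityRelations : DualityRelations p q r σ (dualPairing p q r σ) := by
  refine DualityRelations.mk ?basis ?smooth
  case basis => exact AFAlg.pairing_phi_a p q r σ
  case smooth =>
    intro n m k n' m' k' t s l f
    have := AFAlg.pairing_phi_mono p q r σ n m k n' m' k' t s l n.2 m.2 n'.2 m'.2 f
    simp only [Fin.val_inj] at this
    exact this

theorem isHopfPairing : @IsHopfPairing p q σ (ufStarRing p q σ) (ufCoalgebra p q σ)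
    (aqStarRing p q) (aqStarModule p q) (ufAntipode p q σ) (afComul p q) (afCounit p q)
    (afAntipode p q) (dualPairing p q r σ) := by
  refine @IsHopfPairing.mk p q σ (ufStarRing p q σ) (ufCoalgebra p q σ)
    (aqStarRing p q) (aqStarModule p q) (ufAntipode p q σ) (afComul p q) (afCounit p q)
    (afAntipode p q) (dualPairing p q r σ) ?mul_left ?mul_right ?one_left ?one_right ?antipode
    ?star_pairing ?nondeg_left ?nondeg_right
  case mul_left => exact AFAlg.pairing_mul_left p q r σ
  case mul_right => exact AFAlg.pairing_mul_right p q r σ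
  case one_left => exact AFAlg.pairing_one_left p q r σ
  case one_right => exact AFAlg.pairing_one_right p q r σ
  case antipode => exact AFAlg.pairing_antipode p q r σ
  case star_pairing => exact AFAlg.pairing_star p q r σ
  case nondeg_left => exact AFAlg.pairing_nondeg_left p q r σ
  case nondeg_right => exact AFAlg.pairing_nondeg_right p q r σ

end Transfer

end FracSusy

end

open FracSusy in
theorem mainTheorem1 (p : ℕ) (hp : Odd p) (q : ℂ) (hq : IsPrimitiveRoot q p)
    (r : ℂ) (hr : r ^ 2 = q) (hrp : r ^ p = -1) (σ : ℤˣ) :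
    ∃ (_ : StarRing (UF p q σ)) (_ : StarModule ℂ (UF p q σ)) (_ : Coalgebra ℂ (UF p q σ))
      (SU : UF p q σ →ₗ[ℂ] UF p q σ)
      (_ : StarRing (Aq p q)) (_ : StarModule ℂ (Aq p q))
      (Δ : AF p q →ₐ[ℂ] AF2 p q) (ε : AF p q →ₐ[ℂ] ℂ) (S : AF p q →ₗ[ℂ] AF p q)
      (B : UF p q σ →ₗ[ℂ] AF p q →ₗ[ℂ] ℂ),
      (LinearIndependent ℂ (phiFam p q σ) ∧ Submodule.span ℂ (Set.range (phiFam p q σ)) = ⊤) ∧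
      UFFormulas p q σ SU ∧
      IsHopfStar (UF p q σ) SU ∧
      AFFormulas p q Δ ε S ∧
      IsCompletedHopfStar p q Δ ε S ∧
      IsLocalBasis p q ∧
      DualityRelations p q r σ B ∧
      IsHopfPairing p q σ SU Δ ε S B := by
  have hpq : RootData p q := ⟨hp, hq⟩
  have hr' : SqrtData p q r := ⟨hr, hrp⟩
  exact ⟨ufStarRing p q σ, ufStarModule p q σ, ufCoalgebra p q σ, ufAntipode p q σ, aqStarRing p q,
    aqStarModule p q, afComul p q, afCounit p q, afAntipode p q, dualPairing p q r σ,
    ⟨AFAlg.linearIndependent_phiFam p q r σ, UAlg.span_phiFam p q σ⟩, ufFormulas p q σ,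
    uf_isHopfStar p q σ, afFormulas p q, af_isCompletedHopfStar p q, af_isLocalBasis p q r,
    dualityRelations p q r σ, isHopfPairing p q r σ⟩
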